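/- Let $(Q,\lambda,J)$ be a contact triad: $Q$ is a (Hausdorff, second countable) smooth manifold, $\lambda$ a contact form with Reeb field $R_\lambda$ and contact distribution $\xi=\ker\lambda$, $\pi:TQ\to\xi$ the projection along $R_\lambda$, and $J$ a smooth endomorphism of $TQ$ with $J^2=-\mathrm{id}$ on $\xi$, $J(R_\lambda)=0$ and $d\lambda(Y,JY)>0$ for $0\ne Y\in\xi$. On the symplectization $Q\times\mathbb R$, with $\mathbb R$-coordinate $s$, let $\widetilde J$ be the translation invariant almost complex structure with $\widetilde J|_\xi=J|_\xi$ and $\widetilde J\,\partial_s=R_\lambda$. Let $\dot\Sigma=\bigsqcup_{i=1}^k\dot\Sigma_i$, where each $\dot\Sigma_i$ is a closed connected Riemann surface minus a finite set of punctures, each of them declared positive or negative, and prescribe a closed Reeb orbit $\gamma_p$ of period $T_p>0$ at every puncture $p$. Let $\widetilde{\mathcal M}$ be the set of smooth $\widetilde J$-holomorphic maps $u=(u_i)_{i=1}^k$, $u_i=(w_i,f_i):\dot\Sigma_i\to Q\times\mathbb R$, of finite energy $\frac12\int|d^\pi w_i|^2+\sup_\varphi\int\varphi(f_i)\,df_i\circ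 j\wedge df_i$ (supremum over smooth compactly supported $\varphi\ge0$ with $\int\varphi=1$) such that at each positive (negative) puncture $p$, in cylindrical coordinates $(\tau,t)$ around $p$, $w_i(\tau,t)\to\gamma_p(T_p(t+t_p))$ in $C^\infty$ as $\tau\to+\infty$ ($\tau\to-\infty$), for some $t_p$. Let $\widetilde{\mathcal M}^{\rm exact}$ be the set of $w=(w_i)$, $w_i:\dot\Sigma_i\to Q$ smooth, with $\bar\partial^\pi w_i=\frac12(\pi\,dw_i+J\pi\,dw_i\circ j)=0$ and $w_i^*\lambda\circ j=df_i$ exact (exact contact instantons), of finite energy and with the same asymptotic conditions. Give both the $C^\infty_{loc}$ topology. Let $\mathrm{Aut}(\dot\Sigma)=\prod_i\mathrm{Aut}(\dot\Sigma_i)$, where $\mathrm{Aut}(\dot\Sigma_i)$ consists of the biholomorphisms of the closed surface that fix each puncture, and let $\mathcal M$ be the quotient of $\widetilde{\mathcal M}$ by the relation $(w_i,f_i)_i\sim(w_i\circ\varphi_i,\,f_i\circ\varphi_i-s_0)_i$ with $\varphi\in\mathrm{Aut}(\dot\Sigma)$ and one common $s_0\in\mathbb R$, and $\mathcal M^{\rm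 exact}=\widetilde{\mathcal M}^{\rm exact}/\mathrm{Aut}(\dot\Sigma)$, both with the quotient topology. Call the $i$-th component cylindrical if, for some biholomorphism $\dot\Sigma_i\cong\mathbb R\times S^1$ with coordinates $(\tau,t)$ and some closed Reeb orbit $\gamma$ of period $T>0$, $w_i(\tau,t)=\gamma(Tt)$. Let $N\subset\{1,\dots,k\}$ have $\ell\ge1$ elements, and let $\mathcal M_N$ and $\mathcal M_N^{\rm exact}$ be the parts of the moduli spaces that consist of the classes whose non-cylindrical components are exactly those with index in $N$. Then the forgetful map $\mathcal M_N\to\mathcal M_N^{\rm exact}$, $[(w_i,f_i)_i]\mapsto[(w_i)_i]$, is a principal $\mathbb R^{\ell-1}$-bundle: the group $\{(s_i)_{i\in N}\in\mathbb R^N:\sum_{i\in N} s_i=0\}$, which is of dimension $\ell-1$, acts continuously on $\mathcal M_N$ by the translations $[(w_i,f_i)_i]\mapsto[(w_i,f_i-s_i)_i]$ (with $s_i=0$ for $i\notin N$), preserving the fibres, and the map is locally trivial by equivariant local trivializations. In particular, the action is free and transitive on each fibre. -/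

import Mathlib

open scoped Manifold ContDiff Topology ENNReal UniformConvergence

noncomputable section

/-! ### Contact triads and symplectizations -/

section Contact

variable {E : Type*} [NormedAddCommGroup E] [NormedSpace ℝ E]
  {Q : Type*} [TopologicalSpace Q] [ChartedSpace E Q]

/-- The exterior derivative `dα(v, v')` of a one-form `α` at `q`, computed in the chart at `q`.
The tangent space at `q` is identified with `E` through that same chart. -/
def extDerivOneForm (α : ∀ q : Q, TangentSpace 𝓘(ℝ, E) q →L[ℝ] ℝ) (q : Q)
    (v v' : TangentSpace 𝓘(ℝ, E) q) : ℝ :=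
  let A : E → E →L[ℝ] ℝ := fun y =>
    (α ((extChartAt 𝓘(ℝ, E) q).symm y)).comp
      (mfderiv 𝓘(ℝ, E) 𝓘(ℝ, E) (extChartAt 𝓘(ℝ, E) q).symm y)
  fderiv ℝ A (extChartAt 𝓘(ℝ, E) q q) v v' - fderiv ℝ A (extChartAt 𝓘(ℝ, E) q q) v' v

variable (E Q) in
/-- A contact form on `Q`: a smooth nowhere vanishing one-form `λ` such that `dλ` is nondegenerate
on the hyperplane field `ξ = ker λ`. Smoothness of `λ` is smoothness as a function on `TQ`. -/
structure ContactForm [IsManifold 𝓘(ℝ, E) ∞ Q] where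
  form : ∀ q : Q, TangentSpace 𝓘(ℝ, E) q →L[ℝ] ℝ
  smooth : ContMDiff (𝓘(ℝ, E)).tangent 𝓘(ℝ, ℝ) ∞
    (fun p : TangentBundle 𝓘(ℝ, E) Q => form p.1 p.2)
  ne_zero : ∀ q, form q ≠ 0
  nondegenerate : ∀ q v, form q v = 0 →
    (∀ v', form q v' = 0 → extDerivOneForm form q v v' = 0) → v = 0

variable [IsManifold 𝓘(ℝ, E) ∞ Q]

/-- The Reeb vector field: the unique vector field with `λ(R) = 1` and `dλ(R, ·) = 0`. -/
def ContactForm.reeb (l : ContactForm E Q) (q : Q) : TangentSpace 𝓘(ℝ, E) q :=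
  Classical.epsilon fun v => l.form q v = 1 ∧ ∀ v', extDerivOneForm l.form q v v' = 0

/-- The projection `Π : TQ → TQ` onto `ξ` along the Reeb direction. -/
def ContactForm.proj (l : ContactForm E Q) (q : Q) (v : TangentSpace 𝓘(ℝ, E) q) :
    TangentSpace 𝓘(ℝ, E) q :=
  v - l.form q v • l.reeb q

variable (E Q) in
/-- A contact triad `(Q, λ, J)`: a contact form with a `λ`-adapted CR almost complex structure. -/
structure ContactTriad extends ContactForm E Q where
  J : ∀ q : Q, TangentSpace 𝓘(ℝ, E) q →L[ℝ] TangentSpace 𝓘(ℝ, E) q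
  J_smooth : ContMDiff (𝓘(ℝ, E)).tangent (𝓘(ℝ, E)).tangent ∞
    (fun p : TangentBundle 𝓘(ℝ, E) Q => (⟨p.1, J p.1 p.2⟩ : TangentBundle 𝓘(ℝ, E) Q))
  J_sq : ∀ q v, J q (J q v) = -toContactForm.proj q v
  J_reeb : ∀ q, J q (toContactForm.reeb q) = 0
  adapted : ∀ q v, form q v = 0 → v ≠ 0 → 0 < extDerivOneForm form q v (J q v)

variable (E Q) in
/-- A closed Reeb orbit `γ` of (not necessarily minimal) period `T = ∫ γ^* λ > 0`. -/
structure ReebOrbit (l : ContactForm E Q) where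
  curve : ℝ → Q
  period : ℝ
  period_pos : 0 < period
  isMIntegralCurve : IsMIntegralCurve (I := 𝓘(ℝ, E)) curve l.reeb
  periodic : ∀ t, curve (t + period) = curve t

/-- The translation invariant almost complex structure `J ⊕ J₀` on the symplectization `Q × ℝ`,
with `J₀ (∂/∂s) = R` and `J₀ R = -∂/∂s`; the pair `(v, a)` stands for `v + a ∂/∂s`. -/
def ContactTriad.tildeJ (t : ContactTriad E Q) (q : Q) (v : TangentSpace 𝓘(ℝ, E) q × ℝ) :
    TangentSpace 𝓘(ℝ, E) q × ℝ :=
  (t.J q v.1 + v.2 • t.reeb q, -t.form q v.1)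

end Contact

/-! ### The equations and the energies -/

section Equations

variable {E : Type*} [NormedAddCommGroup E] [NormedSpace ℝ E]
  {Q : Type*} [TopologicalSpace Q] [ChartedSpace E Q] [IsManifold 𝓘(ℝ, E) ∞ Q]
  {X : Type*} [TopologicalSpace X] [ChartedSpace ℂ X]

/-- The complex structure `j` of a Riemann surface, acting on real tangent vectors. -/
def surfaceJ (z : X) (v : TangentSpace 𝓘(ℝ, ℂ) z) : TangentSpace 𝓘(ℝ, ℂ) z :=
  (Complex.I * (show ℂ from v) : ℂ)

/-- `u = (w, f) : X → Q × ℝ` is pseudoholomorphic: `J̃ ∘ du = du ∘ j`. -/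
def IsPseudoholomorphic (t : ContactTriad E Q) (w : X → Q) (f : X → ℝ) : Prop :=
  ∀ (z : X) (v : TangentSpace 𝓘(ℝ, ℂ) z),
    t.tildeJ (w z) (mfderiv 𝓘(ℝ, ℂ) 𝓘(ℝ, E) w z v, mfderiv 𝓘(ℝ, ℂ) 𝓘(ℝ, ℝ) f z v) =
      (mfderiv 𝓘(ℝ, ℂ) 𝓘(ℝ, E) w z (surfaceJ z v),
        mfderiv 𝓘(ℝ, ℂ) 𝓘(ℝ, ℝ) f z (surfaceJ z v))

/-- `∂̄^π w = ½ (π dw + J π dw ∘ j) = 0`. -/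
def IsContactCauchyRiemann (t : ContactTriad E Q) (w : X → Q) : Prop :=
  ∀ (z : X) (v : TangentSpace 𝓘(ℝ, ℂ) z),
    (2⁻¹ : ℝ) • (t.proj (w z) (mfderiv 𝓘(ℝ, ℂ) 𝓘(ℝ, E) w z v) +
      t.J (w z) (t.proj (w z) (mfderiv 𝓘(ℝ, ℂ) 𝓘(ℝ, E) w z (surfaceJ z v)))) = 0

/-- `f` is a contact instanton potential of `w`: `w^*λ ∘ j = df`. -/
def IsPotential (t : ContactTriad E Q) (w : X → Q) (f : X → ℝ) : Prop :=
  ∀ (z : X) (v : TangentSpace 𝓘(ℝ, ℂ) z),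
    t.form (w z) (mfderiv 𝓘(ℝ, ℂ) 𝓘(ℝ, E) w z (surfaceJ z v)) = mfderiv 𝓘(ℝ, ℂ) 𝓘(ℝ, ℝ) f z v

/-- The integral over a Riemann surface of a nonnegative two-form, given in each holomorphic chart
`e` by `ρ e (x + iy) dx ∧ dy`: the supremum of the sums of the integrals over finitely many disjoint
measurable pieces, each lying in a holomorphic chart. -/
def surfaceLIntegral (ρ : OpenPartialHomeomorph X ℂ → ℂ → ℝ≥0∞) : ℝ≥0∞ :=
  ⨆ (n : ℕ) (e : Fin n → OpenPartialHomeomorph X ℂ) (A : Fin n → Set ℂ)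
    (_ : ∀ i, e i ∈ IsManifold.maximalAtlas 𝓘(ℂ, ℂ) ω X ∧ MeasurableSet (A i) ∧
      A i ⊆ (e i).target)
    (_ : ∀ i i', i ≠ i' → Disjoint ((e i).symm '' A i) ((e i').symm '' A i')),
    ∑ i, ∫⁻ y in A i, ρ (e i) y

/-- `|v^π|²` for the triad metric `dλ(·, J ·) + λ ⊗ λ`. -/
def ContactTriad.projNormSq (t : ContactTriad E Q) (q : Q) (v : TangentSpace 𝓘(ℝ, E) q) : ℝ :=
  extDerivOneForm t.form q (t.proj q v) (t.J q (t.proj q v))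

/-- The `π`-energy `½ ∫ |d^π w|² dA`. -/
def piEnergy (t : ContactTriad E Q) (w : X → Q) : ℝ≥0∞ :=
  surfaceLIntegral (X := X) fun e y =>
    let D := mfderiv 𝓘(ℝ, ℂ) 𝓘(ℝ, E) (w ∘ e.symm) y
    ENNReal.ofReal (2⁻¹ * (t.projNormSq _ (D (1 : ℂ)) + t.projNormSq _ (D Complex.I)))

/-- The test functions `φ : ℝ → [0, ∞)`, smooth with compact support and of integral one. -/
def energyTestFunctions : Set (ℝ → ℝ) :=
  {φ | ContDiff ℝ ∞ φ ∧ HasCompactSupport φ ∧ (∀ s, 0 ≤ φ s) ∧ ∫ s, φ s = 1}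

/-- The vertical energy `sup_φ ∫ φ(f) df ∘ j ∧ df = sup_φ ∫ φ(f) |df|² dA`. -/
def verticalEnergy (f : X → ℝ) : ℝ≥0∞ :=
  ⨆ φ ∈ energyTestFunctions, surfaceLIntegral (X := X) fun e y =>
    let D := fderiv ℝ (f ∘ e.symm) y
    ENNReal.ofReal (φ (f (e.symm y)) * ((D 1) ^ 2 + (D Complex.I) ^ 2))

/-- The total energy. -/
def totalEnergy (t : ContactTriad E Q) (w : X → Q) (f : X → ℝ) : ℝ≥0∞ :=
  piEnergy t w + verticalEnergy f

/-- `w` is the `Q`-component of a trivial cylinder over a closed Reeb orbit: up to a biholomorphism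
of the domain with `ℝ × S¹ = ℂ / iℤ`, with coordinates `τ + it`, one has `w(τ, t) = γ(T t)`. The
biholomorphism is given by its lift `ψ` to `ℂ`. -/
def IsTrivialCylinder (l : ContactForm E Q) (w : X → Q) : Prop :=
  ∃ ψ : ℂ → X, MDifferentiable 𝓘(ℂ, ℂ) 𝓘(ℂ, ℂ) ψ ∧ Function.Surjective ψ ∧
    (∀ z z', ψ z = ψ z' ↔ ∃ n : ℤ, z - z' = n * Complex.I) ∧
    ∃ γ : ReebOrbit E Q l, ∀ z, w (ψ z) = γ.curve (γ.period * z.im)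

lemma surfaceJ_surfaceJ (z : X) (v : TangentSpace 𝓘(ℝ, ℂ) z) :
    surfaceJ z (surfaceJ z v) = -v := by
  change (Complex.I * (Complex.I * (show ℂ from v)) : ℂ) = -(show ℂ from v)
  rw [← mul_assoc, Complex.I_mul_I, neg_one_mul]

lemma IsPseudoholomorphic.isContactCauchyRiemann {t : ContactTriad E Q} {w : X → Q} {f : X → ℝ}
    (h : IsPseudoholomorphic t w f) : IsContactCauchyRiemann t w := by
  intro z v
  have h1 : t.J (w z) (mfderiv 𝓘(ℝ, ℂ) 𝓘(ℝ, E) w z v) +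
      (show ℝ from mfderiv 𝓘(ℝ, ℂ) 𝓘(ℝ, ℝ) f z v) • t.reeb (w z) =
      mfderiv 𝓘(ℝ, ℂ) 𝓘(ℝ, E) w z (surfaceJ z v) := congrArg Prod.fst (h z v)
  have h2 : t.J (w z) (t.proj (w z) (mfderiv 𝓘(ℝ, ℂ) 𝓘(ℝ, E) w z (surfaceJ z v))) =
      -t.proj (w z) (mfderiv 𝓘(ℝ, ℂ) 𝓘(ℝ, E) w z v) := by
    rw [ContactForm.proj, map_sub, map_smul, t.J_reeb, smul_zero, sub_zero, ← h1, map_add,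
      map_smul, t.J_reeb, smul_zero, add_zero, t.J_sq]
  rw [h2, add_neg_cancel, smul_zero]

lemma IsPseudoholomorphic.isPotential {t : ContactTriad E Q} {w : X → Q} {f : X → ℝ}
    (h : IsPseudoholomorphic t w f) : IsPotential t w f := by
  intro z v
  have h1 : -t.form (w z) (mfderiv 𝓘(ℝ, ℂ) 𝓘(ℝ, E) w z (surfaceJ z v)) =
      mfderiv 𝓘(ℝ, ℂ) 𝓘(ℝ, ℝ) f z (surfaceJ z (surfaceJ z v)) :=
    congrArg Prod.snd (h z (surfaceJ z v))
  rw [surfaceJ_surfaceJ, map_neg] at h1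
  exact neg_injective h1

/-- Translation of a smooth function by a constant. -/
def translateFun (f : C^∞⟮𝓘(ℝ, ℂ), X; 𝓘(ℝ, ℝ), ℝ⟯) (s : ℝ) : C^∞⟮𝓘(ℝ, ℂ), X; 𝓘(ℝ, ℝ), ℝ⟯ :=
  ⟨fun z => f z - s, f.contMDiff.sub contMDiff_const⟩

lemma mfderiv_translate (f : C^∞⟮𝓘(ℝ, ℂ), X; 𝓘(ℝ, ℝ), ℝ⟯) (s : ℝ) (z : X) :
    mfderiv 𝓘(ℝ, ℂ) 𝓘(ℝ, ℝ) (translateFun f s) z = mfderiv 𝓘(ℝ, ℂ) 𝓘(ℝ, ℝ) f z := by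
  have h1 : HasMFDerivAt 𝓘(ℝ, ℂ) 𝓘(ℝ, ℝ) f z (mfderiv 𝓘(ℝ, ℂ) 𝓘(ℝ, ℝ) f z) :=
    ((f.contMDiff z).mdifferentiableAt (by simp)).hasMFDerivAt
  have h2 := h1.sub (hasMFDerivAt_const (I := 𝓘(ℝ, ℂ)) (I' := 𝓘(ℝ, ℝ)) s z)
  have h3 := h2.mfderiv
  rw [show (⇑(translateFun f s) : X → ℝ) = ⇑f - fun _ => s from rfl, h3]
  exact sub_zero _

lemma IsPseudoholomorphic.translate {t : ContactTriad E Q} {w : X → Q}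
    {f : C^∞⟮𝓘(ℝ, ℂ), X; 𝓘(ℝ, ℝ), ℝ⟯} (h : IsPseudoholomorphic t w f) (s : ℝ) :
    IsPseudoholomorphic t w (translateFun f s) := by
  intro z v
  have h1 := h z v
  rw [← mfderiv_translate f s z] at h1
  exact h1

lemma verticalEnergy_sub_le (f : X → ℝ) (s : ℝ) :
    verticalEnergy (fun z => f z - s) ≤ verticalEnergy f := by
  refine iSup₂_le fun φ hφ => ?_
  have hφ' : (fun x => φ (x - s)) ∈ energyTestFunctions := by
    refine ⟨hφ.1.comp (contDiff_id.sub contDiff_const), ?_, fun x => hφ.2.2.1 _, ?_⟩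
    · simpa [Function.comp_def, sub_eq_add_neg] using
        hφ.2.1.comp_homeomorph (Homeomorph.addRight (-s))
    · rw [MeasureTheory.integral_sub_right_eq_self φ s]; exact hφ.2.2.2
  refine le_trans (le_of_eq ?_) (le_iSup₂ (fun x => φ (x - s)) hφ')
  congr 1
  funext e y
  have : fderiv ℝ ((fun z => f z - s) ∘ e.symm) y = fderiv ℝ (f ∘ e.symm) y :=
    fderiv_sub_const (f := f ∘ e.symm) s
  simp only [this]

lemma verticalEnergy_translate (f : C^∞⟮𝓘(ℝ, ℂ), X; 𝓘(ℝ, ℝ), ℝ⟯) (s : ℝ) :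
    verticalEnergy (translateFun f s) = verticalEnergy f := by
  refine le_antisymm (verticalEnergy_sub_le f s) ?_
  simpa [translateFun] using verticalEnergy_sub_le (fun z => f z - s) (-s)

end Equations

/-! ### Punctured surfaces, asymptotics, reparametrizations -/

/-- Finite disjoint sets of positive and of negative punctures on a closed surface. -/
structure Punctures (S : Type*) where
  pos : Finset S
  neg : Finset S
  disjoint : Disjoint pos neg

/-- The punctured surface. -/
def Punctures.dot {S : Type*} [TopologicalSpace S] [T2Space S] (P : Punctures S) :
    TopologicalSpace.Opens S :=
  ⟨{z | z ∉ P.pos ∧ z ∉ P.neg},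
    (P.pos.finite_toSet.isClosed.isOpen_compl).inter (P.neg.finite_toSet.isClosed.isOpen_compl)⟩

section Asymptotics

variable {E : Type*} [NormedAddCommGroup E] [NormedSpace ℝ E]
  {Q : Type*} [TopologicalSpace Q] [ChartedSpace E Q] [IsManifold 𝓘(ℝ, E) ∞ Q]
  {S : Type*} [TopologicalSpace S] [T2Space S] [ChartedSpace ℂ S]

/-- `w(τ, t) → γ(T (t + t₀))` in `C^∞` as `σ τ → ∞`, for some `t₀`, in a holomorphic cylindrical
coordinate `τ + it ∈ ℂ / iℤ` with `e = exp (-2πσ (τ + it))` at the puncture `p`, where `e` is a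
holomorphic chart centred at `p`. Here `σ = 1` at positive and `σ = -1` at negative punctures.
Convergence in `C^∞` of maps to `Q` is tested on the smooth functions `g` on `Q`; the value `0` given
to `g ∘ w` at the punctures is never used. -/
def AsymptoticToOrbit {l : ContactForm E Q} (P : Punctures S) (w : P.dot → Q) (σ : ℝ) (p : S)
    (γ : ReebOrbit E Q l) : Prop :=
  ∃ e ∈ IsManifold.maximalAtlas 𝓘(ℂ, ℂ) ω S, p ∈ e.source ∧ e p = 0 ∧ ∃ t₀ : ℝ,
    ∀ (g : C^∞⟮𝓘(ℝ, E), Q; 𝓘(ℝ, ℝ), ℝ⟯) (r : ℕ) (ε : ℝ), 0 < ε →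
      ∃ R : ℝ, ∀ z : ℂ, R ≤ σ * z.re →
        ‖iteratedFDeriv ℝ r (fun z : ℂ =>
          Function.extend Subtype.val (fun x : P.dot => g (w x)) 0
              (e.symm (Complex.exp (-(2 * Real.pi * σ * z)))) -
            g (γ.curve (γ.period * (z.im + t₀)))) z‖ < ε

/-- A closed Reeb orbit for every puncture. -/
structure AsymptoticOrbits (l : ContactForm E Q) (P : Punctures S) where
  pos : P.pos → ReebOrbit E Q l
  neg : P.neg → ReebOrbit E Q l

/-- `w` is asymptotic to the prescribed Reeb orbits at all punctures. -/
def HasAsymptotics {l : ContactForm E Q} {P : Punctures S} (γ : AsymptoticOrbits l P)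
    (w : P.dot → Q) : Prop :=
  (∀ p : P.pos, AsymptoticToOrbit P w 1 p (γ.pos p)) ∧
    ∀ p : P.neg, AsymptoticToOrbit P w (-1) p (γ.neg p)

/-- Automorphisms of the punctured surface: biholomorphisms of the closed surface that fix every
puncture. -/
structure Punctures.Aut (P : Punctures S) where
  toDiffeomorph : S ≃ₘ^ω⟮𝓘(ℂ, ℂ), 𝓘(ℂ, ℂ)⟯ S
  fix_pos : ∀ p ∈ P.pos, toDiffeomorph p = p
  fix_neg : ∀ p ∈ P.neg, toDiffeomorph p = p

/-- The reparametrization of the punctured surface defined by an automorphism. -/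
def Punctures.Aut.restrict {P : Punctures S} (φ : P.Aut) (z : P.dot) : P.dot :=
  ⟨φ.toDiffeomorph z.1,
    fun h => z.2.1 (φ.toDiffeomorph.injective (φ.fix_pos _ h) ▸ h),
    fun h => z.2.2 (φ.toDiffeomorph.injective (φ.fix_neg _ h) ▸ h)⟩

/-- The identity. -/
def Punctures.Aut.refl (P : Punctures S) : P.Aut :=
  ⟨Diffeomorph.refl _ _ _, fun _ _ => rfl, fun _ _ => rfl⟩

/-- The inverse. -/
def Punctures.Aut.symm {P : Punctures S} (φ : P.Aut) : P.Aut :=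
  ⟨φ.toDiffeomorph.symm,
    fun p h => by conv_lhs => rw [← φ.fix_pos p h, Diffeomorph.symm_apply_apply],
    fun p h => by conv_lhs => rw [← φ.fix_neg p h, Diffeomorph.symm_apply_apply]⟩

/-- The composition: first `φ`, then `ψ`. -/
def Punctures.Aut.trans {P : Punctures S} (φ ψ : P.Aut) : P.Aut :=
  ⟨φ.toDiffeomorph.trans ψ.toDiffeomorph, fun p h => by simp [φ.fix_pos p h, ψ.fix_pos p h],
    fun p h => by simp [φ.fix_neg p h, ψ.fix_neg p h]⟩

lemma Punctures.Aut.restrict_symm {P : Punctures S} (φ : P.Aut) (z : P.dot) :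
    φ.restrict (φ.symm.restrict z) = z :=
  Subtype.ext (φ.toDiffeomorph.apply_symm_apply z.1)

end Asymptotics

/-! ### The weak `C^∞` topology -/

/-- The weak (`C^∞_loc`) topology on smooth maps from a surface to a manifold `Y`: the coarsest one
such that, for every smooth function `g` on `Y`, every chart of the surface and every order `r`, the
`r`-th derivative of `g ∘ w` in the chart depends continuously on `w`, for uniform convergence on
compact subsets of the chart. -/
instance weakSmoothTopology {F : Type*} [NormedAddCommGroup F] [NormedSpace ℝ F]
    {Y : Type*} [TopologicalSpace Y] [ChartedSpace F Y]
    {X : Type*} [TopologicalSpace X] [ChartedSpace ℂ X] :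
    TopologicalSpace C^∞⟮𝓘(ℝ, ℂ), X; 𝓘(ℝ, F), Y⟯ :=
  ⨅ (g : C^∞⟮𝓘(ℝ, F), Y; 𝓘(ℝ, ℝ), ℝ⟯) (x : X) (r : ℕ),
    TopologicalSpace.induced
      (fun w => UniformOnFun.ofFun {K : Set ℂ | IsCompact K ∧ K ⊆ (chartAt ℂ x).target}
        (iteratedFDeriv ℝ r fun y : ℂ => g (w ((chartAt ℂ x).symm y))))
      inferInstance

/-! ### The moduli spaces -/

section Moduli

variable {E : Type*} [NormedAddCommGroup E] [NormedSpace ℝ E]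
  {Q : Type*} [TopologicalSpace Q] [ChartedSpace E Q] [IsManifold 𝓘(ℝ, E) ∞ Q]
  {ι : Type*} {S : ι → Type*} [∀ i, TopologicalSpace (S i)] [∀ i, T2Space (S i)]
  [∀ i, ChartedSpace ℂ (S i)]
  (t : ContactTriad E Q) {P : ∀ i, Punctures (S i)}
  (γ : ∀ i, AsymptoticOrbits t.toContactForm (P i)) (N : Finset ι)

/-- Parametrized pseudoholomorphic curves `u = (u_i)`, `u_i = (w_i, f_i)`, of finite energy on the
disjoint union of the punctured surfaces, asymptotic to the prescribed Reeb orbits, whose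
non-cylindrical components are exactly those with index in `N`. -/
@[ext] structure CurveSpace where
  w : ∀ i, C^∞⟮𝓘(ℝ, ℂ), (P i).dot; 𝓘(ℝ, E), Q⟯
  f : ∀ i, C^∞⟮𝓘(ℝ, ℂ), (P i).dot; 𝓘(ℝ, ℝ), ℝ⟯
  isPseudoholomorphic : ∀ i, IsPseudoholomorphic t (w i) (f i)
  energy_lt_top : ∀ i, totalEnergy t (w i) (f i) < ⊤
  asymptotics : ∀ i, HasAsymptotics (γ i) (w i)
  mem_iff : ∀ i, i ∈ N ↔ ¬ IsTrivialCylinder t.toContactForm (w i)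

/-- Parametrized exact contact instantons `w = (w_i)` (that is, `∂̄^π w_i = 0` and `w_i^*λ ∘ j` is
exact, in particular closed) of finite energy on the disjoint union of the punctured surfaces,
asymptotic to the prescribed Reeb orbits, whose non-cylindrical components are exactly those with
index in `N`. -/
@[ext] structure InstantonSpace where
  w : ∀ i, C^∞⟮𝓘(ℝ, ℂ), (P i).dot; 𝓘(ℝ, E), Q⟯
  isContactCauchyRiemann : ∀ i, IsContactCauchyRiemann t (w i)
  exact_energy_lt_top : ∀ i, ∃ f : C^∞⟮𝓘(ℝ, ℂ), (P i).dot; 𝓘(ℝ, ℝ), ℝ⟯,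
    IsPotential t (w i) f ∧ totalEnergy t (w i) f < ⊤
  asymptotics : ∀ i, HasAsymptotics (γ i) (w i)
  mem_iff : ∀ i, i ∈ N ↔ ¬ IsTrivialCylinder t.toContactForm (w i)

instance : TopologicalSpace (CurveSpace t γ N) :=
  TopologicalSpace.induced (fun u => (u.w, u.f)) inferInstance

instance : TopologicalSpace (InstantonSpace t γ N) :=
  TopologicalSpace.induced (fun w => w.w) inferInstance

/-- The equivalence `(w, f) ∼ (w ∘ φ, f ∘ φ - s₀)` for `φ = (φ_i)` in the product of the automorphism
groups of the components and a common `s₀ ∈ ℝ`. -/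
def curveSetoid : Setoid (CurveSpace t γ N) where
  r u u' := ∃ (φ : ∀ i, (P i).Aut) (s₀ : ℝ), ∀ i z,
    u'.w i z = u.w i ((φ i).restrict z) ∧ u'.f i z = u.f i ((φ i).restrict z) - s₀
  iseqv :=
    { refl := fun u => ⟨fun i => .refl _, 0, fun i z => ⟨rfl, (sub_zero _).symm⟩⟩
      symm := by
        rintro u u' ⟨φ, s, h⟩
        refine ⟨fun i => (φ i).symm, -s, fun i z => ⟨?_, ?_⟩⟩
        · rw [(h i _).1, Punctures.Aut.restrict_symm]
        · rw [(h i _).2, Punctures.Aut.restrict_symm]; ring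
      trans := by
        rintro u u' u'' ⟨φ, s, h⟩ ⟨φ', s', h'⟩
        refine ⟨fun i => (φ' i).trans (φ i), s + s', fun i z => ⟨?_, ?_⟩⟩
        · rw [(h' i _).1, (h i _).1]; rfl
        · rw [(h' i _).2, (h i _).2, sub_sub]; rfl }

/-- The equivalence `w ∼ w ∘ φ` for `φ = (φ_i)` in the product of the automorphism groups of the
components. -/
def instantonSetoid : Setoid (InstantonSpace t γ N) where
  r w w' := ∃ φ : ∀ i, (P i).Aut, ∀ i z, w'.w i z = w.w i ((φ i).restrict z)
  iseqv :=
    { refl := fun w => ⟨fun i => .refl _, fun i z => rfl⟩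
      symm := by
        rintro w w' ⟨φ, h⟩
        exact ⟨fun i => (φ i).symm, fun i z => by rw [h, Punctures.Aut.restrict_symm]⟩
      trans := by
        rintro w w' w'' ⟨φ, h⟩ ⟨φ', h'⟩
        exact ⟨fun i => (φ' i).trans (φ i), fun i z => by rw [h', h]; rfl⟩ }

/-- The moduli space of pseudoholomorphic curves on the symplectization, with the quotient
topology. -/
def CurveModuli : Type _ := Quotient (curveSetoid t γ N)

/-- The moduli space of exact contact instantons, with the quotient topology. -/
def InstantonModuli : Type _ := Quotient (instantonSetoid t γ N)

instance : TopologicalSpace (CurveModuli t γ N) :=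
  inferInstanceAs (TopologicalSpace (Quotient (curveSetoid t γ N)))

instance : TopologicalSpace (InstantonModuli t γ N) :=
  inferInstanceAs (TopologicalSpace (Quotient (instantonSetoid t γ N)))

variable {t γ N}

/-- The map `(w, f) ↦ w` on parametrized curves. -/
def CurveSpace.forget (u : CurveSpace t γ N) : InstantonSpace t γ N where
  w := u.w
  isContactCauchyRiemann i := (u.isPseudoholomorphic i).isContactCauchyRiemann
  exact_energy_lt_top i := ⟨u.f i, (u.isPseudoholomorphic i).isPotential, u.energy_lt_top i⟩
  asymptotics := u.asymptotics
  mem_iff := u.mem_iff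

/-- The map `T_s : (w_i, f_i) ↦ (w_i, f_i - s_i)` on parametrized curves. -/
def CurveSpace.translate (s : ι → ℝ) (u : CurveSpace t γ N) : CurveSpace t γ N where
  w := u.w
  f i := translateFun (u.f i) (s i)
  isPseudoholomorphic i := (u.isPseudoholomorphic i).translate (s i)
  energy_lt_top i := by
    rw [totalEnergy, verticalEnergy_translate]
    exact u.energy_lt_top i
  asymptotics := u.asymptotics
  mem_iff := u.mem_iff

variable (t γ N) in
/-- The forgetful map `[(w, f)] ↦ [w]`. -/
def forgetCurve : CurveModuli t γ N → InstantonModuli t γ N :=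
  Quotient.map' (s₁ := curveSetoid t γ N) (s₂ := instantonSetoid t γ N) CurveSpace.forget
    fun _ _ ⟨φ, _, h⟩ => ⟨φ, fun i z => (h i z).1⟩

/-- The map induced by `T_s` on the moduli space. -/
def CurveModuli.translate (s : ι → ℝ) : CurveModuli t γ N → CurveModuli t γ N :=
  Quotient.map' (s₁ := curveSetoid t γ N) (s₂ := curveSetoid t γ N) (CurveSpace.translate s) <| by
    rintro u u' ⟨φ, s₀, h⟩
    refine ⟨φ, s₀, fun i z => ⟨(h i z).1, ?_⟩⟩
    change u'.f i z - s i = u.f i ((φ i).restrict z) - s i - s₀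
    rw [(h i z).2]; ring

/-- The vectors `(s_i)` supported on the index set `N` with `∑ s_i = 0`; a vector space of dimension
`|N| - 1` if `N` is nonempty. -/
def zeroSum {ι : Type*} (N : Finset ι) : Submodule ℝ (ι → ℝ) where
  carrier := {s | (∀ i, i ∉ N → s i = 0) ∧ ∑ i ∈ N, s i = 0}
  zero_mem' := by simp
  add_mem' := by
    rintro s s' ⟨h, h1⟩ ⟨h', h1'⟩
    refine ⟨fun i hi => by simp [h i hi, h' i hi], ?_⟩
    simp [Finset.sum_add_distrib, h1, h1']
  smul_mem' := by
    rintro c s ⟨h, h1⟩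
    refine ⟨fun i hi => by simp [h i hi], ?_⟩
    simp [← Finset.mul_sum, h1]

/-- The action by independent translations of the non-cylindrical components. -/
instance : AddAction (zeroSum N) (CurveModuli t γ N) where
  vadd s := CurveModuli.translate s.1
  zero_vadd m := by
    induction m using Quotient.inductionOn'
    refine congrArg (Quotient.mk (curveSetoid t γ N)) (CurveSpace.ext rfl ?_)
    funext i
    exact ContMDiffMap.ext fun z => sub_zero _
  add_vadd s s' m := by
    induction m using Quotient.inductionOn'
    refine congrArg (Quotient.mk (curveSetoid t γ N)) (CurveSpace.ext rfl ?_)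
    funext i
    exact ContMDiffMap.ext fun z => (sub_sub _ _ _).symm.trans (sub_right_comm _ _ _)

end Moduli

/-- `π : M → B` is a principal bundle for the action of the topological group `H` on `M`: the action
is continuous and around every point of `B` there is an `H`-equivariant local trivialization. In
particular the action is free and its orbits are the fibres of `π`. -/
structure IsPrincipalBundle (H : Type*) [AddGroup H] [TopologicalSpace H] {M B : Type*}
    [TopologicalSpace M] [TopologicalSpace B] [AddAction H M] (π : M → B) : Prop where
  continuous_vadd : Continuous fun p : H × M => p.1 +ᵥ p.2
  proj_vadd : ∀ (h : H) (m : M), π (h +ᵥ m) = π m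
  exists_trivialization : ∀ b : B, ∃ e : Bundle.Trivialization H π, b ∈ e.baseSet ∧
    ∀ m ∈ e.source, ∀ h : H, (e (h +ᵥ m)).2 = h + (e m).2

end

/-! The potential `f i` of an exact contact instanton is determined by `w i` up to an additive
constant, because the punctured surfaces are connected. A fibre of the forgetful map therefore
consists of these constants, modulo a common shift and the automorphisms. On a cylindrical component
the constant carries no information: the translations of `ℝ × S¹` along `ℝ` fix `w i` and shift `f
i` by any amount (`IsTrivialCylinder.exists_shift`). It remains to find, for every non-cylindrical
component, a continuous centre `c` with `c (f ∘ φ - s) = c f - s` for all automorphisms `φ` and all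
`s` (`exists_center`). Given such centres, the mean of the centres minus the individual centres
(`deviation`) is an equivariant map from the moduli space to the zero-sum vectors, potentials with
centre zero define a continuous section, and the bundle is even globally trivial
(`exists_equivariant_homeomorph`).

The centre comes from subharmonicity. Since `df = w^*λ ∘ j`, the form `Δf dx ∧ dy` is `w^*dλ`, and
by the Cauchy-Riemann equation its density is `|π ∂_x w|² ≥ 0`
(`laplacian_potential_eq_projNormSq`). The asymptotic conditions force `df` to tend to `± T dτ` in
cylindrical coordinates at a puncture (`AsymptoticToOrbit.hasSlope`). Hence the mass of `Δf` on an
end is the limiting flux minus the flux through a circle, and is finite (`integrableOn_strip`).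

Suppose first that no potential of the component is harmonic. Then the mass is positive, `b ↦ ∫
arctan (f - b) Δf` is strictly decreasing with limits of opposite signs, and its zero is the centre.
It is invariant under automorphisms because `Δf` is a conformally invariant two-form, so that the
integral does not depend on the decomposition of the surface into coordinate pieces
(`IsPartition.sum_integral_eq`). It is continuous although the topology controls only compact sets:
the slopes at the punctures are prescribed, so the flux through one circle controls the whole tail
and no mass escapes (`IsContFamily.continuous_setIntegral`).

Suppose next that some potential is harmonic. By the maximum principle every other potential differs
from it by a constant (`Subharm.sub_harm_const`), so evaluation at a point is a candidate for the
centre. Its equivariance says that no automorphism shifts the potential by a nonzero constant. Such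
a shift would be a multiplication in a coordinate at a puncture in which `f` is a multiple of a
logarithm; unwinding it identifies the surface with a cylinder on which `f` is linear
(`exists_cylinder_of_harm`), and then `w` is a trivial cylinder (`IsCylinder.isTrivialCylinder`).

The section is continuous because `λ` is locally a sum `∑ a dg` of globally defined smooth
functions. This expresses `df` through the functions on which the weak topology is tested; together
with the value at one point, `df` controls `f` (`continuous_potential`). -/

noncomputable section

set_option linter.unusedSectionVars false

/-! ### Planar calculus -/

section Planar

open Complex InnerProductSpace Laplacian MeasureTheory Set Filter

/-- Twice the Wirtinger derivative `∂F/∂z`. -/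
def wirt (F : ℂ → ℝ) (y : ℂ) : ℂ := fderiv ℝ F y 1 - I * fderiv ℝ F y I

lemma fderiv_eq_wirt (F : ℂ → ℝ) (y v : ℂ) : fderiv ℝ F y v = (wirt F y * v).re := by
  have h : v = v.re • (1 : ℂ) + v.im • I := by simp
  conv_lhs => rw [h, map_add, map_smul, map_smul]
  simp [wirt]; ring

lemma wirt_eq_of_fderiv {F : ℂ → ℝ} {y c : ℂ} (h : ∀ v, fderiv ℝ F y v = (c * v).re) :
    wirt F y = c := by
  rw [wirt, h, h]
  apply Complex.ext <;> simp

/-- The real covector `dF` is the real part of `wirt F dz`, and a holomorphic substitution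
multiplies `dz` by its complex derivative. All changes of coordinates below are reduced to this
rule. -/
lemma wirt_comp {F : ℂ → ℝ} {θ : ℂ → ℂ} {θ' y : ℂ} (hF : DifferentiableAt ℝ F (θ y))
    (hθ : HasDerivAt θ θ' y) : wirt (F ∘ θ) y = wirt F (θ y) * θ' := by
  refine wirt_eq_of_fderiv fun v => ?_
  rw [fderiv_comp y hF (hθ.differentiableAt.restrictScalars ℝ),
    (hθ.hasFDerivAt.restrictScalars ℝ).fderiv]
  simp only [ContinuousLinearMap.comp_apply]
  rw [fderiv_eq_wirt]
  simp
  ring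

lemma wirt_congr {F G : ℂ → ℝ} {y : ℂ} (h : F =ᶠ[𝓝 y] G) : wirt F y = wirt G y := by
  simp only [wirt, h.fderiv_eq]

lemma wirt_sub {F G : ℂ → ℝ} {y : ℂ} (hF : DifferentiableAt ℝ F y) (hG : DifferentiableAt ℝ G y) :
    wirt (fun z => F z - G z) y = wirt F y - wirt G y := by
  simp only [wirt, fderiv_fun_sub hF hG]
  simp; ring

lemma contDiffAt_wirt {F : ℂ → ℝ} {y : ℂ} {n m : WithTop ℕ∞} (hF : ContDiffAt ℝ n F y)
    (h : m + 1 ≤ n) : ContDiffAt ℝ m (wirt F) y := by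
  have h1 : ContDiffAt ℝ m (fderiv ℝ F) y := hF.fderiv_right h
  have : wirt F = fun z => ofRealCLM (fderiv ℝ F z 1) - I * ofRealCLM (fderiv ℝ F z I) := by
    funext z; simp [wirt]
  rw [this]
  fun_prop

lemma HasFDerivAt.eval_const {V W : Type*} [NormedAddCommGroup V] [NormedSpace ℝ V]
    [NormedAddCommGroup W] [NormedSpace ℝ W] {c : V → V →L[ℝ] W} {c' : V →L[ℝ] V →L[ℝ] W} {x : V}
    (h : HasFDerivAt c c' x) (u : V) : HasFDerivAt (fun z => c z u) (c'.flip u) x :=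
  (ContinuousLinearMap.apply ℝ W u).hasFDerivAt.comp x h

/-- The Laplacian is `∂̄` of the Wirtinger derivative. -/
lemma ofReal_laplacian {F : ℂ → ℝ} {y : ℂ} (hF : ContDiffAt ℝ 2 F y) :
    ((Δ F y : ℝ) : ℂ) = fderiv ℝ (wirt F) y 1 + I * fderiv ℝ (wirt F) y I := by
  have h1 : DifferentiableAt ℝ (fderiv ℝ F) y :=
    (hF.fderiv_right (m := 1) (by norm_num)).differentiableAt one_ne_zero
  have hs := hF.isSymmSndFDerivAt (by simp) 1 I
  have h2 : ∀ v, fderiv ℝ (wirt F) y v =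
      (fderiv ℝ (fderiv ℝ F) y v 1 : ℂ) - I * (fderiv ℝ (fderiv ℝ F) y v I : ℂ) := by
    intro v
    have e : ∀ u : ℂ, HasFDerivAt (fun z => ofRealCLM (fderiv ℝ F z u))
        (ofRealCLM.comp ((fderiv ℝ (fderiv ℝ F) y).flip u)) y := fun u =>
      ofRealCLM.hasFDerivAt.comp y (h1.hasFDerivAt.eval_const u)
    have := (e 1).sub ((e I).const_mul I)
    have h3 : wirt F = (fun z => ofRealCLM (fderiv ℝ F z 1)) -
        fun z => I * ofRealCLM (fderiv ℝ F z I) := by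
      funext z; simp [wirt]
    rw [h3, this.fderiv]
    simp
  rw [h2, h2, laplacian_eq_iteratedFDeriv_complexPlane]
  simp only [iteratedFDeriv_two_apply, Matrix.cons_val_zero, Matrix.cons_val_one, hs]
  apply Complex.ext <;> simp

/-- The combination `L 1 + I * L I` annihilates the complex linear part of `L` and is twice the
antilinear part, which is multiplied by the conjugate of `c` when the argument is multiplied by `c`.
-/
lemma conj_linear_add (L : ℂ →L[ℝ] ℂ) (c : ℂ) :
    L c + I * L (I * c) = (starRingEnd ℂ) c * (L 1 + I * L I) := by
  obtain ⟨a, b, rfl⟩ : ∃ a b : ℝ, c = a • (1 : ℂ) + b • I := ⟨c.re, c.im, by simp⟩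
  have h' : I * (a • (1 : ℂ) + b • I) = (-b) • (1 : ℂ) + a • I := by
    apply Complex.ext <;> simp
  rw [h', map_add, map_smul, map_smul, map_add, map_smul, map_smul]
  simp only [real_smul, ofReal_neg, map_add, map_mul, conj_ofReal, conj_I, map_one]
  linear_combination ((b : ℂ) * L I) * I_sq

/-- Conformal covariance of the Laplacian. -/
lemma laplacian_comp {F : ℂ → ℝ} {θ : ℂ → ℂ} {y : ℂ} (hF : ContDiffAt ℝ 2 F (θ y))
    (hθ : AnalyticAt ℂ θ y) : Δ (F ∘ θ) y = ‖deriv θ y‖ ^ 2 * Δ F (θ y) := by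
  have hθr : ContDiffAt ℝ 2 θ y := hθ.contDiffAt.restrict_scalars ℝ
  have h1 : wirt (F ∘ θ) =ᶠ[𝓝 y] fun z => wirt F (θ z) * deriv θ z := by
    have e1 := hθ.eventually_analyticAt
    have e2 := hθ.continuousAt.eventually (hF.eventually (by simp))
    filter_upwards [e1, e2] with z h1 h2
    exact wirt_comp (h2.differentiableAt two_ne_zero) h1.differentiableAt.hasDerivAt
  have hW : DifferentiableAt ℝ (wirt F) (θ y) :=
    (contDiffAt_wirt hF (m := 1) (by norm_num)).differentiableAt one_ne_zero
  have hd := hθ.differentiableAt.hasDerivAt.hasFDerivAt.restrictScalars ℝ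
  have hd2 := hθ.deriv.differentiableAt.hasDerivAt.hasFDerivAt.restrictScalars ℝ
  have h2 := (hW.hasFDerivAt.comp y hd).mul hd2
  have h3 : ((Δ (F ∘ θ) y : ℝ) : ℂ) = ((‖deriv θ y‖ ^ 2 * Δ F (θ y) : ℝ) : ℂ) := by
    rw [ofReal_laplacian (hF.comp y hθr), h1.fderiv_eq]
    have h4 : (fun z => wirt F (θ z) * deriv θ z) = (wirt F ∘ θ) * deriv θ := rfl
    rw [h4, h2.fderiv]
    have h5 := conj_linear_add (fderiv ℝ (wirt F) (θ y)) (deriv θ y)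
    rw [ofReal_mul, ofReal_laplacian hF]
    have h6 : ((‖deriv θ y‖ ^ 2 : ℝ) : ℂ) = (starRingEnd ℂ) (deriv θ y) * deriv θ y := by
      rw [mul_comm, mul_conj, normSq_eq_norm_sq]
    rw [h6]
    simp
    -- The derivative of the factor `deriv θ` enters through its `∂̄`, which vanishes because `θ` is
    -- holomorphic; this is the multiple of `I_sq`.
    linear_combination deriv θ y * h5 + wirt F (θ y) * deriv (deriv θ) y * I_sq
  exact_mod_cast h3

/-- The mean over the segment `ρ + [0, 1] i`. -/
def segMean (G : ℂ → ℝ) (ρ : ℝ) : ℝ := ∫ θ in (0 : ℝ)..1, G (ρ + θ * I)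

lemma isOpen_rightHalf (R : ℝ) : IsOpen {z : ℂ | R < z.re} :=
  isOpen_lt continuous_const continuous_re

lemma hasDerivAt_segMean {G : ℂ → ℝ} {R ρ : ℝ} (hG : ContDiffOn ℝ 1 G {z | R < z.re})
    (hρ : R < ρ) : HasDerivAt (segMean G) (segMean (fun z => fderiv ℝ G z 1) ρ) ρ := by
  have ho := isOpen_rightHalf R
  have hd : ∀ (x : ℝ), R < x → ∀ θ : ℝ,
      HasDerivAt (fun x : ℝ => G (x + θ * I)) (fderiv ℝ G (x + θ * I) 1) x := by
    intro x hx θ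
    have h1 : DifferentiableAt ℝ G (x + θ * I) :=
      (hG.contDiffAt (ho.mem_nhds (by simpa using hx))).differentiableAt one_ne_zero
    have h2 : HasDerivAt (fun x : ℝ => (x + θ * I : ℂ)) 1 x :=
      (hasDerivAt_id x).ofReal_comp.add_const (θ * I : ℂ)
    exact h1.hasFDerivAt.comp_hasDerivAt x h2
  have hc : ContinuousOn (fun z => fderiv ℝ G z 1) {z | R < z.re} :=
    (hG.continuousOn_fderiv_of_isOpen ho le_rfl).clm_apply continuousOn_const
  have hcont : ∀ {H : ℂ → ℝ}, ContinuousOn H {z | R < z.re} → ∀ x, R < x →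
      Continuous fun θ : ℝ => H (x + θ * I) := by
    intro H hH x hx
    refine hH.comp_continuous (by fun_prop) fun θ => by simpa using hx
  set δ := (ρ - R) / 2 with hδ
  have hδ0 : 0 < δ := by simp [hδ, hρ]
  let K : Set ℂ := (fun p : ℝ × ℝ => (p.1 + p.2 * I : ℂ)) '' (Icc (ρ - δ) (ρ + δ) ×ˢ Icc 0 1)
  have hK : IsCompact K := (isCompact_Icc.prod isCompact_Icc).image (by fun_prop)
  have hKs : K ⊆ {z | R < z.re} := by
    rintro _ ⟨⟨a, b⟩, ⟨ha, -⟩, rfl⟩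
    have : R < a := by have := ha.1; linarith
    simpa using this
  obtain ⟨M, hM⟩ := hK.exists_bound_of_continuousOn (hc.mono hKs)
  have hs : Ioo (ρ - δ) (ρ + δ) ∈ 𝓝 ρ := Ioo_mem_nhds (by linarith) (by linarith)
  refine (intervalIntegral.hasDerivAt_integral_of_dominated_loc_of_deriv_le (𝕜 := ℝ) (bound := fun _ => M)
    (F := fun x θ => G (x + θ * I)) (F' := fun x θ => fderiv ℝ G (x + θ * I) 1)
    hs ?_ ?_ ?_ ?_ ?_ ?_).2
  · filter_upwards [hs] with x hx
    exact (hcont hG.continuousOn x (by have := hx.1; linarith)).aestronglyMeasurable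
  · exact (hcont hG.continuousOn ρ hρ).intervalIntegrable _ _
  · exact (hcont hc ρ hρ).aestronglyMeasurable
  · refine .of_forall fun θ hθ x hx => hM _ ⟨(x, θ), ⟨⟨hx.1.le, hx.2.le⟩, ?_⟩, rfl⟩
    rw [uIoc_of_le zero_le_one] at hθ
    exact ⟨hθ.1.le, hθ.2⟩
  · exact intervalIntegrable_const
  · exact .of_forall fun θ _ x hx => hd x (by have := hx.1; linarith) θ

lemma fderiv_add_I {G : ℂ → ℝ} {R : ℝ} (hper : ∀ z, R < z.re → G (z + I) = G z) {z : ℂ}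
    (hz : R < z.re) : fderiv ℝ G (z + I) = fderiv ℝ G z := by
  have h : (fun y => G (y + I)) =ᶠ[𝓝 z] G := by
    filter_upwards [(isOpen_rightHalf R).mem_nhds hz] with y hy using hper y hy
  rw [← h.fderiv_eq, fderiv_comp_add_right]

/-- The second derivative of the mean of a periodic function is the mean of its Laplacian. -/
lemma hasDerivAt_segMean_fderiv {G : ℂ → ℝ} {R ρ : ℝ} (hG : ContDiffOn ℝ 2 G {z | R < z.re})
    (hper : ∀ z, R < z.re → G (z + I) = G z) (hρ : R < ρ) :
    HasDerivAt (segMean fun z => fderiv ℝ G z 1) (segMean (Δ G) ρ) ρ := by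
  have ho := isOpen_rightHalf R
  have h1 : ∀ v : ℂ, ContDiffOn ℝ 1 (fun z => fderiv ℝ G z v) {z | R < z.re} := fun v =>
    (hG.fderiv_of_isOpen ho (m := 1) (by norm_num)).clm_apply contDiffOn_const
  have h2 := hasDerivAt_segMean (h1 1) hρ
  convert h2 using 1
  have hline : ∀ θ : ℝ, (ρ + θ * I : ℂ) ∈ {z : ℂ | R < z.re} := fun θ => by simpa using hρ
  have hc : ∀ v : ℂ, Continuous fun θ : ℝ => fderiv ℝ (fun z => fderiv ℝ G z v) (ρ + θ * I) v := by
    intro v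
    exact ContinuousOn.comp_continuous (((h1 v).continuousOn_fderiv_of_isOpen ho le_rfl).clm_apply
      continuousOn_const) (by fun_prop) hline
  -- The second derivative in the direction of the period integrates to zero over a period, so only
  -- the one transverse to the circle survives in the mean.
  have h3 : ∫ θ in (0 : ℝ)..1, fderiv ℝ (fun z => fderiv ℝ G z I) (ρ + θ * I) I = 0 := by
    have hd : ∀ θ : ℝ, HasDerivAt (fun θ : ℝ => fderiv ℝ G (ρ + θ * I) I)
        (fderiv ℝ (fun z => fderiv ℝ G z I) (ρ + θ * I) I) θ := by
      intro θ
      have e1 : DifferentiableAt ℝ (fun z => fderiv ℝ G z I) (ρ + θ * I) :=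
        ((h1 I).contDiffAt (ho.mem_nhds (hline θ))).differentiableAt one_ne_zero
      have e2 : HasDerivAt (fun θ : ℝ => (ρ + θ * I : ℂ)) I θ := by
        simpa using ((hasDerivAt_id θ).ofReal_comp.mul_const I).const_add (ρ : ℂ)
      exact e1.hasFDerivAt.comp_hasDerivAt θ e2
    rw [intervalIntegral.integral_eq_sub_of_hasDerivAt (fun θ _ => hd θ)
      ((hc I).intervalIntegrable _ _)]
    have := fderiv_add_I hper (z := ρ) (by simpa using hρ)
    simp [this]
  have h4 : segMean (Δ G) ρ = ∫ θ in (0 : ℝ)..1,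
      (fderiv ℝ (fun z => fderiv ℝ G z 1) (ρ + θ * I) 1 +
        fderiv ℝ (fun z => fderiv ℝ G z I) (ρ + θ * I) I) := by
    refine intervalIntegral.integral_congr fun θ _ => ?_
    have e1 : DifferentiableAt ℝ (fderiv ℝ G) (ρ + θ * I) :=
      ((hG.fderiv_of_isOpen ho (m := 1) (by norm_num)).contDiffAt
        (ho.mem_nhds (hline θ))).differentiableAt one_ne_zero
    simp only [laplacian_eq_iteratedFDeriv_complexPlane, iteratedFDeriv_two_apply,
      Matrix.cons_val_zero, Matrix.cons_val_one]
    rw [(e1.hasFDerivAt.eval_const 1).fderiv, (e1.hasFDerivAt.eval_const I).fderiv]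
    rfl
  rw [h4, intervalIntegral.integral_add ((hc 1).intervalIntegrable _ _)
    ((hc I).intervalIntegrable _ _), h3, add_zero]
  rfl

end Planar

/-! ### Maximum principles -/

section MaxPrinciple

open Complex InnerProductSpace Laplacian MeasureTheory Set Filter

/-- A convex function on a half-line with a positive slope somewhere grows at least linearly, so it
is not bounded above. -/
lemma deriv_nonpos_of_bddAbove {m m' : ℝ → ℝ} {R B : ℝ}
    (hm : ∀ ρ, R < ρ → HasDerivAt m (m' ρ) ρ) (hmono : MonotoneOn m' (Ioi R))
    (hB : ∀ ρ, R < ρ → m ρ ≤ B) {ρ : ℝ} (hρ : R < ρ) : m' ρ ≤ 0 := by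
  by_contra! hpos
  -- Along an interval of this length, growth at the rate `m' ρ` exceeds the bound `B` by `m' ρ`.
  set L := (B - m ρ) / m' ρ + 1 with hL
  have hL0 : 0 < L := by
    have : 0 ≤ (B - m ρ) / m' ρ := div_nonneg (sub_nonneg.2 (hB ρ hρ)) hpos.le
    linarith
  obtain ⟨c, hc, hc'⟩ := exists_hasDerivAt_eq_slope m m' (show ρ < ρ + L by linarith)
    (fun x hx => (hm x (hρ.trans_le hx.1)).continuousAt.continuousWithinAt)
    fun x hx => hm x (hρ.trans hx.1)
  have h1 : m' ρ ≤ m' c := hmono hρ (hρ.trans hc.1) hc.1.le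
  have h2 : m (ρ + L) - m ρ = m' c * L := by
    rw [hc', add_sub_cancel_left, div_mul_cancel₀ _ hL0.ne']
  have h3 := hB (ρ + L) (by linarith)
  have h4 : m' ρ * L = B - m ρ + m' ρ := by
    rw [hL]; field_simp
  nlinarith [mul_le_mul_of_nonneg_right h1 hL0.le]

lemma continuous_segment {H : ℂ → ℝ} {R ρ : ℝ} (hH : ContinuousOn H {z | R < z.re}) (h : R < ρ) :
    Continuous fun θ : ℝ => H (ρ + θ * I) :=
  hH.comp_continuous (by fun_prop) fun θ => by simpa using h

/-- The second derivative of the circle mean is the mean of the Laplacian, so circle means of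
subharmonic functions are convex in the height of the cylinder. -/
lemma monotoneOn_segMean_fderiv {G : ℂ → ℝ} {R : ℝ} (hG : ContDiffOn ℝ 2 G {z | R < z.re})
    (hper : ∀ z, R < z.re → G (z + I) = G z) (hΔ : ∀ z, R < z.re → 0 ≤ Δ G z) :
    MonotoneOn (segMean fun z => fderiv ℝ G z 1) (Ioi R) := by
  have hd := fun ρ (h : R < ρ) => hasDerivAt_segMean_fderiv hG hper h
  refine monotoneOn_of_deriv_nonneg (convex_Ioi R)
    (fun x hx => (hd x hx).continuousAt.continuousWithinAt) (fun x hx => ?_) fun x hx => ?_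
  · rw [interior_Ioi] at hx
    exact (hd x hx).differentiableAt.differentiableWithinAt
  · rw [interior_Ioi] at hx
    rw [(hd x hx).deriv]
    exact intervalIntegral.integral_nonneg zero_le_one fun θ _ => hΔ _ (by simpa using hx)

lemma analyticAt_cexp_neg_mul (c ζ : ℂ) : AnalyticAt ℂ (fun ζ => c + cexp (-(2 * Real.pi * ζ))) ζ := by
  fun_prop

lemma norm_cexp_neg_two_pi (ζ : ℂ) :
    ‖cexp (-(2 * Real.pi * ζ))‖ = Real.exp (-(2 * Real.pi * ζ.re)) := by
  rw [norm_exp]; simp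

lemma cexp_neg_two_pi_add_I (ζ : ℂ) :
    cexp (-(2 * Real.pi * (ζ + I))) = cexp (-(2 * Real.pi * ζ)) := by
  rw [exp_eq_exp_iff_exists_int]
  exact ⟨-1, by push_cast; ring⟩

lemma exists_cexp_neg_two_pi {y : ℂ} (hy : y ≠ 0) : ∃ ρ θ : ℝ, θ ∈ Ico (0 : ℝ) 1 ∧
    cexp (-(2 * Real.pi * (ρ + θ * I))) = y ∧ ‖y‖ = Real.exp (-(2 * Real.pi * ρ)) := by
  set ζ := -(log y / (2 * Real.pi)) with hζ
  have hpi : (Real.pi : ℂ) ≠ 0 := by exact_mod_cast Real.pi_ne_zero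
  have h1 : cexp (-(2 * Real.pi * ζ)) = y := by
    rw [hζ, ← exp_log hy]
    congr 1
    rw [exp_log hy]; field_simp
  have h2 : cexp (-(2 * Real.pi * (ζ.re + (Int.fract ζ.im : ℝ) * I))) = y := by
    rw [← h1, exp_eq_exp_iff_exists_int]
    refine ⟨⌊ζ.im⌋, ?_⟩
    have h3 : (ζ.re + (Int.fract ζ.im : ℝ) * I : ℂ) = ζ - ⌊ζ.im⌋ * I := by
      have h4 : ((Int.fract ζ.im : ℝ) : ℂ) = ζ.im - ⌊ζ.im⌋ := by
        rw [Int.fract]; push_cast; rfl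
      rw [h4]
      linear_combination re_add_im ζ
    rw [h3]; ring
  refine ⟨ζ.re, Int.fract ζ.im, ⟨Int.fract_nonneg _, Int.fract_lt_one _⟩, h2, ?_⟩
  rw [← h1, norm_cexp_neg_two_pi]

/-- The strong maximum principle on a disc, for maxima at the centre. -/
lemma eq_of_isMax_center {F : ℂ → ℝ} {c : ℂ} {r : ℝ} (hF : ContDiffOn ℝ 2 F (Metric.ball c r))
    (hΔ : ∀ z ∈ Metric.ball c r, 0 ≤ Δ F z) (hmax : ∀ z ∈ Metric.ball c r, F z ≤ F c)
    {z : ℂ} (hz : z ∈ Metric.ball c r) : F z = F c := by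
  have hr : 0 < r := (dist_nonneg).trans_lt hz
  -- The map `ζ ↦ c + exp (-2πζ)` unrolls the punctured disc to the half-plane `R < Re ζ`, and means
  -- over circles around `c` become `segMean`.
  set R := -(Real.log r / (2 * Real.pi)) with hR
  set θ : ℂ → ℂ := fun ζ => c + cexp (-(2 * Real.pi * ζ)) with hθ
  have hnorm : ∀ ζ, dist (θ ζ) c = Real.exp (-(2 * Real.pi * ζ.re)) := by
    intro ζ; rw [hθ, dist_eq, add_sub_cancel_left, norm_cexp_neg_two_pi]
  have hpi := Real.pi_pos
  have hRr : Real.exp (-(2 * Real.pi * R)) = r := by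
    rw [hR, ← Real.exp_log hr]; congr 1; rw [Real.exp_log hr]; field_simp
  have hmem : ∀ ζ : ℂ, R < ζ.re → θ ζ ∈ Metric.ball c r := by
    intro ζ h
    rw [Metric.mem_ball, hnorm, ← hRr, Real.exp_lt_exp]
    nlinarith
  have hθan : ∀ ζ, AnalyticAt ℂ θ ζ := analyticAt_cexp_neg_mul c
  have hFat : ∀ z ∈ Metric.ball c r, ContDiffAt ℝ 2 F z := fun z hz =>
    hF.contDiffAt (Metric.isOpen_ball.mem_nhds hz)
  set G := F ∘ θ with hG
  have hGc : ContDiffOn ℝ 2 G {z | R < z.re} := fun ζ h =>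
    ((hFat _ (hmem ζ h)).comp ζ ((hθan ζ).contDiffAt.restrict_scalars ℝ)).contDiffWithinAt
  have hper : ∀ z, R < z.re → G (z + I) = G z := by
    intro z _
    simp only [hG, hθ, Function.comp_apply, cexp_neg_two_pi_add_I]
  have hGΔ : ∀ z, R < z.re → 0 ≤ Δ G z := by
    intro ζ h
    rw [laplacian_comp (hFat _ (hmem ζ h)) (hθan ζ)]
    exact mul_nonneg (by positivity) (hΔ _ (hmem ζ h))
  have hle : ∀ ρ, R < ρ → segMean G ρ ≤ F c := by
    intro ρ h
    have := intervalIntegral.integral_mono_on zero_le_one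
      ((continuous_segment hGc.continuousOn h).intervalIntegrable 0 1)
      (intervalIntegrable_const (μ := volume) (c := F c)) fun x _ => hmax _ (hmem (ρ + x * I) (by simpa using h))
    simpa [segMean] using this
  have hd := fun ρ (h : R < ρ) => hasDerivAt_segMean (hGc.of_le one_le_two) h
  have hmono := monotoneOn_segMean_fderiv hGc hper hGΔ
  -- The means are convex and bounded above by `F c`, hence decreasing as the circles shrink. They
  -- tend to `F c` by continuity, so they are all at least `F c`, and thus equal to it.
  have hanti : AntitoneOn (segMean G) (Ioi R) := by
    refine antitoneOn_of_deriv_nonpos (convex_Ioi R)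
      (fun x hx => (hd x hx).continuousAt.continuousWithinAt) (fun x hx => ?_) fun x hx => ?_
    · rw [interior_Ioi] at hx
      exact (hd x hx).differentiableAt.differentiableWithinAt
    · rw [interior_Ioi] at hx
      rw [(hd x hx).deriv]
      exact deriv_nonpos_of_bddAbove hd hmono hle hx
  have heq : ∀ ρ, R < ρ → segMean G ρ = F c := by
    intro ρ h
    refine le_antisymm (hle ρ h) (le_of_forall_pos_le_add fun ε hε => ?_)
    have hcF : ContinuousAt F c := (hFat c (Metric.mem_ball_self hr)).continuousAt
    obtain ⟨δ, hδ, hδ'⟩ := Metric.continuousAt_iff.1 hcF ε hε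
    obtain ⟨ρ', h1, h2⟩ : ∃ ρ', ρ ≤ ρ' ∧ Real.exp (-(2 * Real.pi * ρ')) < δ := by
      have : Tendsto (fun ρ' : ℝ => Real.exp (-(2 * Real.pi * ρ'))) atTop (𝓝 0) :=
        Real.tendsto_exp_neg_atTop_nhds_zero.comp
          (tendsto_id.const_mul_atTop (by positivity))
      obtain ⟨ρ', h⟩ := ((this.eventually_lt_const hδ).and (eventually_ge_atTop ρ)).exists
      exact ⟨ρ', h.2, h.1⟩
    have h3 : F c - ε ≤ segMean G ρ' := by
      have := intervalIntegral.integral_mono_on zero_le_one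
        (intervalIntegrable_const (μ := volume) (c := F c - ε))
        ((continuous_segment hGc.continuousOn (h.trans_le h1)).intervalIntegrable 0 1) fun x _ => ?_
      · simpa [segMean] using this
      · have h4 := hδ' (x := θ (ρ' + x * I)) (by rw [hnorm]; simpa using h2)
        rw [Real.dist_eq] at h4
        have := (abs_lt.1 h4).1
        simp only [hG, Function.comp_apply]; linarith
    have := hanti h (h.trans_le h1) h1
    linarith
  by_cases hzc : z = c
  · rw [hzc]
  obtain ⟨ρ, t, ht, h1, h2⟩ := exists_cexp_neg_two_pi (sub_ne_zero.2 hzc)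
  have hρ : R < ρ := by
    rw [← dist_eq] at h2
    have h3 : Real.exp (-(2 * Real.pi * ρ)) < Real.exp (-(2 * Real.pi * R)) := by
      rw [hRr, ← h2]; exact hz
    rw [Real.exp_lt_exp] at h3; nlinarith
  by_contra hne
  have hlt : F z < F c := lt_of_le_of_ne (hmax z hz) hne
  have hcont := continuous_segment hGc.continuousOn hρ
  -- On the circle through `z` the nonnegative continuous function `F c - F` would have mean zero
  -- and be positive at `z`.
  have h5 : 0 < ∫ x in (0 : ℝ)..1, (F c - G (ρ + x * I)) := by
    refine intervalIntegral.integral_pos zero_lt_one (continuous_const.sub hcont).continuousOn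
      (fun x _ => sub_nonneg.2 (hmax _ (hmem _ (by simpa using hρ)))) ⟨t, ⟨ht.1, ht.2.le⟩, ?_⟩
    have h6 : θ (ρ + t * I) = z := by simp only [hθ, h1]; ring
    simp only [hG, Function.comp_apply, h6]; linarith
  rw [intervalIntegral.integral_sub intervalIntegrable_const (hcont.intervalIntegrable 0 1)] at h5
  have h6 := heq ρ hρ
  rw [segMean] at h6
  simp [h6] at h5

/-- The strong maximum principle for subharmonic functions. -/
lemma eq_of_isMax_of_isPreconnected {F : ℂ → ℝ} {U : Set ℂ} (hU : IsOpen U) (hUc : IsPreconnected U)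
    (hF : ContDiffOn ℝ 2 F U) (hΔ : ∀ z ∈ U, 0 ≤ Δ F z) {c : ℂ} (hc : c ∈ U)
    (hmax : ∀ z ∈ U, F z ≤ F c) {z : ℂ} (hz : z ∈ U) : F z = F c := by
  have ho : IsOpen {z ∈ U | F z = F c} := by
    refine isOpen_iff_mem_nhds.2 fun x hx => ?_
    obtain ⟨r, hr, hrU⟩ := Metric.isOpen_iff.1 hU x hx.1
    filter_upwards [Metric.ball_mem_nhds x hr] with y hy
    refine ⟨hrU hy, ?_⟩
    rw [← hx.2]
    exact eq_of_isMax_center (hF.mono hrU) (fun z hz => hΔ z (hrU hz))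
      (fun z hz => by rw [hx.2]; exact hmax z (hrU hz)) hy
  refine (hUc.subset_of_closure_inter_subset ho ⟨c, hc, hc, rfl⟩ ?_ hz).2
  rintro x ⟨hx, hxU⟩
  refine ⟨hxU, ?_⟩
  have hca : ContinuousAt F x := hF.continuousOn.continuousAt (hU.mem_nhds hxU)
  by_contra hne
  obtain ⟨y, hy, hy'⟩ := mem_closure_iff_nhds.1 hx _ (hca.eventually_ne hne)
  exact hy hy'.2

/-- A periodic subharmonic function on a half-plane whose gradient tends to zero is bounded by its
boundary values. -/
lemma le_of_boundary_le {G : ℂ → ℝ} {R ρ₁ M : ℝ} (hG : ContDiffOn ℝ 2 G {z | R < z.re})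
    (hper : ∀ z, R < z.re → G (z + I) = G z) (hΔ : ∀ z, R < z.re → 0 ≤ Δ G z)
    (hgrad : ∀ ε > 0, ∃ R', ∀ z : ℂ, R' < z.re → ‖wirt G z‖ < ε) (hρ₁ : R < ρ₁)
    (hM : ∀ z : ℂ, z.re = ρ₁ → G z ≤ M) {z : ℂ} (hz : ρ₁ ≤ z.re) : G z ≤ M := by
  by_contra! hlt
  have hperInt : ∀ z : ℂ, R < z.re → G (z.re + Int.fract z.im * I) = G z := by
    have hn : ∀ (n : ℕ) (z : ℂ), R < z.re → G (z + n * I) = G z := by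
      intro n
      induction n with
      | zero => simp
      | succ n ih =>
        intro z hz
        rw [← ih z hz, ← hper (z + n * I) (by simpa using hz)]
        push_cast; ring_nf
    have hm : ∀ (n : ℤ) (z : ℂ), R < z.re → G (z + n * I) = G z := by
      intro n z hz
      obtain ⟨k, rfl | rfl⟩ := n.eq_nat_or_neg
      · exact_mod_cast hn k z hz
      · have := hn k (z + (-(k : ℤ) : ℤ) * I) (by simpa using hz)
        rw [← this]; push_cast; ring_nf
    intro z hz
    rw [← hm ⌊z.im⌋ _ (by simpa using hz)]
    congr 1
    have h4 : ((Int.fract z.im : ℝ) : ℂ) = z.im - ⌊z.im⌋ := by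
      rw [Int.fract]; push_cast; rfl
    rw [h4]
    conv_rhs => rw [← re_add_im z]
    ring
  have ho := isOpen_rightHalf R
  have hzρ : 0 < z.re - ρ₁ := by
    rcases hz.eq_or_lt with h | h
    · exact absurd (hM z h.symm) (not_le.2 hlt)
    · linarith
  -- Tilting by this slope removes exactly half of the excess of `G z` over `M`, while the values on
  -- the boundary line do not change.
  set ε := (G z - M) / (2 * (z.re - ρ₁)) with hε
  have hε0 : 0 < ε := div_pos (by linarith) (by linarith)
  have hεz : ε * (z.re - ρ₁) = (G z - M) / 2 := by rw [hε]; field_simp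
  -- Far out `G` grows at a rate of at most `ε / 2`, so the tilt by `ε` wins and the tilted function
  -- is eventually below `M`.
  obtain ⟨R', hR'⟩ := hgrad (ε / 2) (by linarith)
  set A := max (R' + 1) ρ₁ with hA
  have hA1 : R' < A := by have := le_max_left (R' + 1) ρ₁; linarith
  have hA2 : ρ₁ ≤ A := le_max_right _ _
  obtain ⟨C, hC⟩ := (isCompact_Icc (a := (0 : ℝ)) (b := 1)).bddAbove_image
    (continuous_segment hG.continuousOn (hρ₁.trans_le hA2)).continuousOn
  have hC' : ∀ θ ∈ Icc (0 : ℝ) 1, G (A + θ * I) ≤ C := fun θ hθ => hC ⟨θ, hθ, rfl⟩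
  have hgrow : ∀ ρ, A ≤ ρ → ∀ θ ∈ Icc (0 : ℝ) 1, G (ρ + θ * I) ≤ C + ε / 2 * (ρ - A) := by
    intro ρ hρ θ hθ
    rcases hρ.eq_or_lt with rfl | hρ
    · simpa using hC' θ hθ
    have hd : ∀ x : ℝ, A ≤ x →
        HasDerivAt (fun x : ℝ => G (x + θ * I)) (fderiv ℝ G (x + θ * I) 1) x := by
      intro x hx
      have h1 : DifferentiableAt ℝ G (x + θ * I) := (hG.contDiffAt (ho.mem_nhds
        (by simpa using (hρ₁.trans_le hA2).trans_le hx))).differentiableAt two_ne_zero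
      exact h1.hasFDerivAt.comp_hasDerivAt x
        ((hasDerivAt_id x).ofReal_comp.add_const (θ * I : ℂ))
    obtain ⟨x, hx, hx'⟩ := exists_hasDerivAt_eq_slope (fun x : ℝ => G (x + θ * I)) _ hρ
      (fun x hx => (hd x hx.1).continuousAt.continuousWithinAt) fun x hx => hd x hx.1.le
    have h2 : fderiv ℝ G (x + θ * I) 1 ≤ ε / 2 := by
      rw [fderiv_eq_wirt, mul_one]
      exact (re_le_norm _).trans (hR' _ (by simpa using hA1.trans hx.1)).le
    rw [hx', div_le_iff₀ (by linarith)] at h2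
    have := hC' θ hθ
    linarith
  set Gε : ℂ → ℝ := fun z => G z - ε * (z.re - ρ₁) with hGε
  -- beyond a large abscissa the perturbed function is small
  have hsmall : ∃ B, z.re ≤ B ∧ ∀ ρ, B ≤ ρ → ∀ θ ∈ Icc (0 : ℝ) 1, Gε (ρ + θ * I) < M := by
    set D := C - M - ε / 2 * A + ε * ρ₁ with hD
    refine ⟨max (max A z.re) (2 * D / ε + 1), (le_max_right _ _).trans (le_max_left _ _),
      fun ρ hρ θ hθ => ?_⟩
    have h1 := hgrow ρ ((le_max_left _ _).trans ((le_max_left _ _).trans hρ)) θ hθ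
    have h2 : 2 * D / ε + 1 ≤ ρ := (le_max_right _ _).trans hρ
    have h3 : 2 * D + ε ≤ ε * ρ := by
      calc 2 * D + ε = ε * (2 * D / ε + 1) := by field_simp
        _ ≤ ε * ρ := by gcongr
    simp only [hGε]
    have h4 : (ρ + θ * I : ℂ).re = ρ := by simp
    rw [h4]
    nlinarith
  obtain ⟨B', hzB, hB'⟩ := hsmall
  set K : Set ℂ := (fun p : ℝ × ℝ => (p.1 + p.2 * I : ℂ)) '' (Icc ρ₁ B' ×ˢ Icc 0 1) with hK
  have hKc : IsCompact K := (isCompact_Icc.prod isCompact_Icc).image (by fun_prop)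
  have hGεc : ContDiffOn ℝ 2 Gε {z | R < z.re} := by
    refine hG.sub (ContDiff.contDiffOn ?_)
    have : (fun z : ℂ => ε * (z.re - ρ₁)) = fun z => ε * (reCLM z - ρ₁) := rfl
    rw [this]; fun_prop
  have hKs : K ⊆ {z | R < z.re} := by
    rintro _ ⟨⟨a, b⟩, ⟨ha, -⟩, rfl⟩
    have : R < a := hρ₁.trans_le ha.1
    simpa using this
  have hfr : ∀ x : ℝ, Int.fract x ∈ Icc (0 : ℝ) 1 := fun x =>
    ⟨Int.fract_nonneg _, (Int.fract_lt_one _).le⟩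
  have hGεp : ∀ z : ℂ, R < z.re → Gε (z.re + Int.fract z.im * I) = Gε z := by
    intro z hz
    simp only [hGε, hperInt z hz]; simp
  have hz' : (z.re + Int.fract z.im * I : ℂ) ∈ K :=
    ⟨(z.re, Int.fract z.im), ⟨⟨hz, hzB⟩, hfr _⟩, rfl⟩
  have hRz : R < z.re := hρ₁.trans_le hz
  -- By periodicity and smallness far out, the maximum over this rectangle is a maximum over the
  -- half-plane. It exceeds `M`, so it is not attained on the boundary line.
  obtain ⟨c, hcK, hcmax⟩ := hKc.exists_isMaxOn ⟨_, hz'⟩ (hGεc.continuousOn.mono hKs)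
  have hcM : M < Gε c := by
    have h1 := hcmax hz'
    have h2 : Gε (z.re + Int.fract z.im * I) = Gε z := hGεp z hRz
    simp only [mem_ofPred_eq, h2] at h1
    refine lt_of_lt_of_le ?_ h1
    simp only [hGε]; linarith
  have hmaxall : ∀ y : ℂ, ρ₁ < y.re → Gε y ≤ Gε c := by
    intro y hy
    rw [← hGεp y (hρ₁.trans hy)]
    rcases le_total y.re B' with h | h
    · exact hcmax ⟨(y.re, Int.fract y.im), ⟨⟨hy.le, h⟩, hfr _⟩, rfl⟩
    · exact (hB' _ h _ (hfr _)).le.trans hcM.le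
  have hcρ : ρ₁ < c.re := by
    obtain ⟨⟨a, b⟩, ⟨ha, hb⟩, rfl⟩ := hcK
    rcases ha.1.eq_or_lt with h | h
    · obtain rfl : ρ₁ = a := h
      have := hM (ρ₁ + b * I) (by simp)
      simp [hGε] at hcM; linarith
    · simpa using h
  have hΔε : ∀ y ∈ {z : ℂ | ρ₁ < z.re}, 0 ≤ Δ Gε y := by
    intro y hy
    have hRy : R < y.re := hρ₁.trans hy
    have h1 : Gε = G - (fun z : ℂ => (ε * z.re - ε * ρ₁)) := by
      funext z; simp [hGε]; ring
    have h0 : (fun z : ℂ => (ε * z.re - ε * ρ₁)) = (fun z => (ε • reCLM) z - ε * ρ₁) := by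
      funext z; simp
    have h2 : Δ (fun z : ℂ => (ε * z.re - ε * ρ₁)) y = 0 := by
      rw [laplacian_eq_iteratedFDeriv_complexPlane]
      simp only [iteratedFDeriv_two_apply]
      have : fderiv ℝ (fun z : ℂ => (ε * z.re - ε * ρ₁)) = fun _ => ε • reCLM := by
        funext z
        rw [h0, fderiv_sub_const, ContinuousLinearMap.fderiv]
      rw [this]; simp
    rw [h1, ContDiffAt.laplacian_sub (hG.contDiffAt (ho.mem_nhds hRy)) (by rw [h0]; fun_prop), h2,
      sub_zero]
    exact hΔ y hRy
  have hcv : IsPreconnected {z : ℂ | ρ₁ < z.re} := (convex_halfSpace_re_gt ρ₁).isPreconnected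
  have hBρ : ρ₁ < B' := by linarith
  -- The tilted function would be constant beyond `ρ₁`, contrary to its smallness at the abscissa
  -- `B'`.
  have h5 := eq_of_isMax_of_isPreconnected (isOpen_rightHalf ρ₁) hcv
    (hGεc.mono fun y hy => hρ₁.trans hy) hΔε hcρ hmaxall
    (z := (B' + (0 : ℝ) * I)) (by simpa using hBρ)
  have h6 := hB' B' le_rfl 0 ⟨le_rfl, zero_le_one⟩
  rw [h5] at h6
  exact absurd h6 (not_lt.2 hcM.le)

end MaxPrinciple

/-! ### Contact forms in charts, the Reeb field -/

section ContactLocal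

open Set Filter

variable {E : Type*} [NormedAddCommGroup E] [NormedSpace ℝ E]
  {Q : Type*} [TopologicalSpace Q] [ChartedSpace E Q]

/-- The expression of a one-form in the chart at `q`. -/
def localForm (α : ∀ q : Q, TangentSpace 𝓘(ℝ, E) q →L[ℝ] ℝ) (q : Q) (y : E) : E →L[ℝ] ℝ :=
  (α ((extChartAt 𝓘(ℝ, E) q).symm y)).comp
    (mfderiv 𝓘(ℝ, E) 𝓘(ℝ, E) (extChartAt 𝓘(ℝ, E) q).symm y)

lemma extDerivOneForm_eq (α : ∀ q : Q, TangentSpace 𝓘(ℝ, E) q →L[ℝ] ℝ) (q : Q)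
    (v v' : TangentSpace 𝓘(ℝ, E) q) : extDerivOneForm α q v v' =
      fderiv ℝ (localForm α q) (extChartAt 𝓘(ℝ, E) q q) v v' -
        fderiv ℝ (localForm α q) (extChartAt 𝓘(ℝ, E) q q) v' v := rfl

/-- The exterior derivative as a bilinear map. -/
def extDerivBilin (α : ∀ q : Q, TangentSpace 𝓘(ℝ, E) q →L[ℝ] ℝ) (q : Q) :
    TangentSpace 𝓘(ℝ, E) q →L[ℝ] TangentSpace 𝓘(ℝ, E) q →L[ℝ] ℝ :=
  show E →L[ℝ] E →L[ℝ] ℝ from fderiv ℝ (localForm α q) (extChartAt 𝓘(ℝ, E) q q) -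
    (fderiv ℝ (localForm α q) (extChartAt 𝓘(ℝ, E) q q)).flip

lemma extDerivBilin_apply (α : ∀ q : Q, TangentSpace 𝓘(ℝ, E) q →L[ℝ] ℝ) (q : Q)
    (v v' : TangentSpace 𝓘(ℝ, E) q) : extDerivBilin α q v v' = extDerivOneForm α q v v' := rfl

lemma extDerivOneForm_self (α : ∀ q : Q, TangentSpace 𝓘(ℝ, E) q →L[ℝ] ℝ) (q : Q)
    (v : TangentSpace 𝓘(ℝ, E) q) : extDerivOneForm α q v v = 0 := sub_self _

lemma extDerivOneForm_swap (α : ∀ q : Q, TangentSpace 𝓘(ℝ, E) q →L[ℝ] ℝ) (q : Q)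
    (v v' : TangentSpace 𝓘(ℝ, E) q) : extDerivOneForm α q v v' = -extDerivOneForm α q v' v :=
  (neg_sub _ _).symm

/-- Nondegeneracy identifies the kernel of `l` with its dual through `B`. Subtracting from a vector
with `l = 1` the element of the kernel that represents its pairing gives a vector orthogonal to the
kernel. It is orthogonal to itself because `B` is alternating, hence to all of `V`. -/
lemma exists_reeb_vector {V : Type*} [AddCommGroup V] [Module ℝ V] [FiniteDimensional ℝ V]
    (B : V →ₗ[ℝ] V →ₗ[ℝ] ℝ) (hB : ∀ v, B v v = 0) (l : V →ₗ[ℝ] ℝ) (hl : l ≠ 0)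
    (hnd : ∀ v, l v = 0 → (∀ v', l v' = 0 → B v v' = 0) → v = 0) :
    ∃ v, l v = 1 ∧ ∀ v', B v v' = 0 := by
  obtain ⟨u, hu⟩ : ∃ u, l u ≠ 0 := by
    by_contra! h
    exact hl (LinearMap.ext h)
  set u' := (l u)⁻¹ • u with hu'
  have h1 : l u' = 1 := by simp [hu', hu]
  let K := LinearMap.ker l
  let b : K →ₗ[ℝ] Module.Dual ℝ K := (B.compl₁₂ K.subtype K.subtype)
  have hinj : Function.Injective b := by
    rw [injective_iff_map_eq_zero]
    intro x hx
    refine Subtype.ext (hnd x x.2 fun v' hv' => ?_)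
    exact LinearMap.congr_fun hx ⟨v', hv'⟩
  have hsurj : Function.Surjective b :=
    (LinearMap.injective_iff_surjective_of_finrank_eq_finrank
      (Subspace.dual_finrank_eq (K := ℝ) (V := K)).symm).1 hinj
  obtain ⟨η, hη⟩ := hsurj ((B u').comp K.subtype)
  have h2 : ∀ v', l v' = 0 → B (u' - η) v' = 0 := by
    intro v' hv'
    have : B η v' = B u' v' := LinearMap.congr_fun hη ⟨v', hv'⟩
    rw [map_sub, LinearMap.sub_apply, this, sub_self]
  have h3 : l (u' - η) = 1 := by rw [map_sub, h1, show l η = 0 from η.2, sub_zero]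
  refine ⟨u' - η, h3, fun v' => ?_⟩
  have h4 : l (v' - l v' • (u' - η)) = 0 := by rw [map_sub, map_smul, h3]; simp
  have h5 := h2 _ h4
  rw [map_sub, map_smul, hB, smul_zero, sub_zero] at h5
  exact h5

variable [IsManifold 𝓘(ℝ, E) ∞ Q]

lemma contMDiffOn_extChartAt_symm_tangent (q : Q) (v : E) :
    ContMDiffOn 𝓘(ℝ, E) (𝓘(ℝ, E)).tangent ∞ (fun y : E =>
      (⟨(extChartAt 𝓘(ℝ, E) q).symm y, mfderiv 𝓘(ℝ, E) 𝓘(ℝ, E) (extChartAt 𝓘(ℝ, E) q).symm y v⟩ :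
        TangentBundle 𝓘(ℝ, E) Q)) (extChartAt 𝓘(ℝ, E) q).target := by
  have ho := isOpen_extChartAt_target (I := 𝓘(ℝ, E)) q
  have h1 : ContMDiffOn 𝓘(ℝ, E) 𝓘(ℝ, E) ∞ (extChartAt 𝓘(ℝ, E) q).symm
    (extChartAt 𝓘(ℝ, E) q).target := contMDiffOn_extChartAt_symm q
  have h2 := h1.contMDiffOn_tangentMapWithin (m := ∞) (by simp) ho.uniqueMDiffOn
  have h3 : ContMDiff 𝓘(ℝ, E) (𝓘(ℝ, E)).tangent ∞
      (fun y : E => (⟨y, v⟩ : TangentBundle 𝓘(ℝ, E) E)) := by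
    exact contMDiff_vectorSpace_iff_contDiff.2 contDiff_const
  have h4 := h2.comp h3.contMDiffOn (s := (extChartAt 𝓘(ℝ, E) q).target) fun y hy => hy
  refine h4.congr fun y hy => ?_
  simp only [Function.comp_apply, tangentMapWithin, mfderivWithin_of_isOpen ho hy]

lemma contDiffOn_localForm [FiniteDimensional ℝ E] (l : ContactForm E Q) (q : Q) :
    ContDiffOn ℝ ∞ (localForm l.form q) (extChartAt 𝓘(ℝ, E) q).target := by
  rw [contDiffOn_clm_apply]
  intro v
  exact (l.smooth.comp_contMDiffOn (contMDiffOn_extChartAt_symm_tangent q v)).contDiffOn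

variable [FiniteDimensional ℝ E]

/-- The Reeb field is a choice by `Classical.epsilon`; it has its defining properties only once
existence is known from linear algebra in each tangent space. -/
lemma ContactForm.reeb_spec (l : ContactForm E Q) (q : Q) :
    l.form q (l.reeb q) = 1 ∧ ∀ v', extDerivOneForm l.form q (l.reeb q) v' = 0 := by
  have : FiniteDimensional ℝ (TangentSpace 𝓘(ℝ, E) q) := inferInstanceAs (FiniteDimensional ℝ E)
  have h : ∃ v : TangentSpace 𝓘(ℝ, E) q, l.form q v = 1 ∧ ∀ v', extDerivOneForm l.form q v v' = 0 :=
    exists_reeb_vector (V := TangentSpace 𝓘(ℝ, E) q)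
      (ContinuousLinearMap.coeLM ℝ ∘ₗ (extDerivBilin l.form q).toLinearMap)
      (extDerivOneForm_self l.form q) (l.form q).toLinearMap (fun h => l.ne_zero q (ContinuousLinearMap.ext (LinearMap.congr_fun h)))
      (l.nondegenerate q)
  exact Classical.epsilon_spec h

lemma ContactForm.form_proj (l : ContactForm E Q) (q : Q) (v : TangentSpace 𝓘(ℝ, E) q) :
    l.form q (l.proj q v) = 0 := by
  rw [ContactForm.proj, map_sub, map_smul, (l.reeb_spec q).1, smul_eq_mul, mul_one, sub_self]

lemma ContactForm.proj_proj (l : ContactForm E Q) (q : Q) (v : TangentSpace 𝓘(ℝ, E) q) :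
    l.proj q (l.proj q v) = l.proj q v := by
  conv_lhs => rw [ContactForm.proj, l.form_proj, zero_smul, sub_zero]

lemma ContactForm.extDeriv_proj (l : ContactForm E Q) (q : Q) (v v' : TangentSpace 𝓘(ℝ, E) q) :
    extDerivOneForm l.form q (l.proj q v) (l.proj q v') = extDerivOneForm l.form q v v' := by
  have h1 : ∀ a, extDerivBilin l.form q (l.reeb q) a = 0 := (l.reeb_spec q).2
  have h2 : ∀ a, extDerivBilin l.form q a (l.reeb q) = 0 := fun a => by
    rw [extDerivBilin_apply, extDerivOneForm_swap, (l.reeb_spec q).2, neg_zero]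
  simp only [← extDerivBilin_apply, ContactForm.proj, map_sub, map_smul, sub_apply,
    smul_apply, h1, h2, smul_zero, sub_zero]

variable {X : Type*} [TopologicalSpace X] [ChartedSpace ℂ X]

lemma IsContactCauchyRiemann.J_proj {t : ContactTriad E Q} {w : X → Q}
    (h : IsContactCauchyRiemann t w) (z : X) (v : TangentSpace 𝓘(ℝ, ℂ) z) :
    t.J (w z) (t.proj (w z) (mfderiv 𝓘(ℝ, ℂ) 𝓘(ℝ, E) w z v)) =
      t.proj (w z) (mfderiv 𝓘(ℝ, ℂ) 𝓘(ℝ, E) w z (surfaceJ z v)) := by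
  have h1 := (smul_eq_zero.1 (h z v)).resolve_left (by norm_num)
  have h2 := congrArg (t.J (w z)) h1
  rw [map_add, t.J_sq, t.proj_proj, map_zero] at h2
  exact sub_eq_zero.1 (by rw [sub_eq_add_neg]; exact h2)

/-- The component in `ξ` is the Cauchy-Riemann equation. The Reeb component is the potential
equation at `v`, and the component along `∂_s` is the potential equation at `j v`. -/
lemma isPseudoholomorphic_of_potential {t : ContactTriad E Q} {w : X → Q} {f : X → ℝ}
    (h : IsContactCauchyRiemann t w) (hf : IsPotential t w f) : IsPseudoholomorphic t w f := by
  intro z v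
  refine Prod.ext ?_ ?_
  · have h1 := h.J_proj z v
    have h2 : t.J (w z) (t.proj (w z) (mfderiv 𝓘(ℝ, ℂ) 𝓘(ℝ, E) w z v)) =
        t.J (w z) (mfderiv 𝓘(ℝ, ℂ) 𝓘(ℝ, E) w z v) := by
      rw [ContactForm.proj, map_sub, map_smul, t.J_reeb, smul_zero, sub_zero]
    rw [h2, ContactForm.proj, hf z v] at h1
    change t.J (w z) (mfderiv 𝓘(ℝ, ℂ) 𝓘(ℝ, E) w z v) +
      (show ℝ from mfderiv 𝓘(ℝ, ℂ) 𝓘(ℝ, ℝ) f z v) • t.reeb (w z) = _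
    rw [h1]
    exact sub_add_cancel _ _
  · have h1 := hf z (surfaceJ z v)
    rw [surfaceJ_surfaceJ, map_neg, map_neg] at h1
    exact h1

end ContactLocal

/-! ### Subharmonicity of contact instanton potentials -/

section Subharmonic

open Set Filter Laplacian

variable {E : Type*} [NormedAddCommGroup E] [NormedSpace ℝ E] [FiniteDimensional ℝ E]
  {Q : Type*} [TopologicalSpace Q] [ChartedSpace E Q] [IsManifold 𝓘(ℝ, E) ∞ Q]

omit [FiniteDimensional ℝ E] in
lemma form_mfderiv_eq_localForm (l : ContactForm E Q) (q : Q) {W : ℂ → Q} {y : ℂ}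
    (hW : MDifferentiableAt 𝓘(ℝ, ℂ) 𝓘(ℝ, E) W y) (hq : W y ∈ (extChartAt 𝓘(ℝ, E) q).source)
    (v : ℂ) : l.form (W y) (mfderiv 𝓘(ℝ, ℂ) 𝓘(ℝ, E) W y v) =
      localForm l.form q (extChartAt 𝓘(ℝ, E) q (W y))
        (fderiv ℝ (extChartAt 𝓘(ℝ, E) q ∘ W) y v) := by
  have h1 : W =ᶠ[𝓝 y] (extChartAt 𝓘(ℝ, E) q).symm ∘ (extChartAt 𝓘(ℝ, E) q ∘ W) := by
    filter_upwards [hW.continuousAt.eventually ((isOpen_extChartAt_source q).mem_nhds hq)] with z hz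
    simp only [Function.comp_apply]
    exact ((extChartAt 𝓘(ℝ, E) q).left_inv hz).symm
  have h2 : MDifferentiableAt 𝓘(ℝ, ℂ) 𝓘(ℝ, E) (extChartAt 𝓘(ℝ, E) q ∘ W) y :=
    (mdifferentiableAt_extChartAt (by rwa [← extChartAt_source 𝓘(ℝ, E)])).comp y hW
  have h3 : MDifferentiableAt 𝓘(ℝ, E) 𝓘(ℝ, E) (extChartAt 𝓘(ℝ, E) q).symm
      ((extChartAt 𝓘(ℝ, E) q ∘ W) y) := by
    exact mdifferentiableOn_extChartAt_symm.mdifferentiableAt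
      ((isOpen_extChartAt_target q).mem_nhds ((extChartAt 𝓘(ℝ, E) q).map_source hq))
  have h4 := mfderiv_comp y h3 h2
  rw [← h1.mfderiv_eq] at h4
  -- Every tangent space is the model space `E`, so after forgetting the dependence of the type the
  -- base point can be replaced by an equal one.
  have h5 : ∀ q₁ q₂ : Q, q₁ = q₂ → ∀ e : E,
      (show E →L[ℝ] ℝ from l.form q₁) e = (show E →L[ℝ] ℝ from l.form q₂) e := by
    rintro q _ rfl e; rfl
  rw [mfderiv_eq_fderiv] at h4
  rw [h4]
  exact h5 _ _ ((extChartAt 𝓘(ℝ, E) q).left_inv hq).symm _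

omit [FiniteDimensional ℝ E] [IsManifold 𝓘(ℝ, E) ∞ Q] in
lemma mfderiv_eq_fderiv_extChartAt {W : ℂ → Q} {y : ℂ}
    (hW : MDifferentiableAt 𝓘(ℝ, ℂ) 𝓘(ℝ, E) W y) :
    mfderiv 𝓘(ℝ, ℂ) 𝓘(ℝ, E) W y = fderiv ℝ (extChartAt 𝓘(ℝ, E) (W y) ∘ W) y := by
  have h := hW.hasMFDerivAt.2
  simp only [writtenInExtChartAt, extChartAt_model_space_eq_id, PartialEquiv.refl_coe,
    modelWithCornersSelf_coe, range_id, PartialEquiv.refl_symm, Function.comp_id,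
    id_eq] at h
  have h' : HasFDerivWithinAt (extChartAt 𝓘(ℝ, E) (W y) ∘ W)
    (show ℂ →L[ℝ] E from mfderiv 𝓘(ℝ, ℂ) 𝓘(ℝ, E) W y) univ y := h
  exact (hasFDerivWithinAt_univ.1 h').fderiv.symm

/-- From `df = w^*λ ∘ j` one gets `df ∘ j = -w^*λ`, and therefore `Δf dx ∧ dy = -d(df ∘ j) = w^*dλ`.
-/
lemma laplacian_potential (l : ContactForm E Q) {W : ℂ → Q} {F : ℂ → ℝ} {U : Set ℂ} {y : ℂ}
    (hU : IsOpen U) (hy : y ∈ U) (hW : ContMDiffOn 𝓘(ℝ, ℂ) 𝓘(ℝ, E) ∞ W U)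
    (hF : ∀ z ∈ U, ∀ v : ℂ,
      fderiv ℝ F z v = l.form (W z) (mfderiv 𝓘(ℝ, ℂ) 𝓘(ℝ, E) W z (Complex.I * v : ℂ))) :
    Δ F y = extDerivOneForm l.form (W y) (mfderiv 𝓘(ℝ, ℂ) 𝓘(ℝ, E) W y (1 : ℂ))
      (mfderiv 𝓘(ℝ, ℂ) 𝓘(ℝ, E) W y Complex.I) := by
  have hWd : ∀ z ∈ U, MDifferentiableAt 𝓘(ℝ, ℂ) 𝓘(ℝ, E) W z := fun z hz =>
    (hW.contMDiffAt (hU.mem_nhds hz)).mdifferentiableAt (by simp)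
  set φ := extChartAt 𝓘(ℝ, E) (W y) with hφ
  set A := localForm l.form (W y) with hA
  have hnear : ∀ᶠ z in 𝓝 y, z ∈ U ∧ W z ∈ φ.source := by
    refine (show ∀ᶠ z in 𝓝 y, z ∈ U from hU.mem_nhds hy).and ?_
    exact (hWd y hy).continuousAt.eventually (extChartAt_source_mem_nhds (W y))
  have hV : ContDiffAt ℝ 2 (φ ∘ W) y := by
    have h1 : ContMDiffAt 𝓘(ℝ, ℂ) 𝓘(ℝ, E) ∞ (φ ∘ W) y :=
      (contMDiffAt_extChartAt).comp y (hW.contMDiffAt (hU.mem_nhds hy))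
    exact h1.contDiffAt.of_le (WithTop.coe_le_coe.2 le_top)
  have hAd : DifferentiableAt ℝ A (φ (W y)) :=
    ((contDiffOn_localForm l (W y)).contDiffAt (extChartAt_target_mem_nhds (W y))).differentiableAt
      (by simp)
  have hfd : ∀ᶠ z in 𝓝 y, ∀ v : ℂ,
      fderiv ℝ F z v = A (φ (W z)) (fderiv ℝ (φ ∘ W) z (Complex.I * v)) := by
    filter_upwards [hnear] with z hz v
    rw [hF z hz.1, form_mfderiv_eq_localForm l (W y) (hWd z hz.1) hz.2]
  have hVd : HasFDerivAt (φ ∘ W) (fderiv ℝ (φ ∘ W) y) y :=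
    (hV.differentiableAt two_ne_zero).hasFDerivAt
  have hVd2 : HasFDerivAt (fderiv ℝ (φ ∘ W)) (fderiv ℝ (fderiv ℝ (φ ∘ W)) y) y :=
    ((hV.fderiv_right (m := 1) (by norm_num)).differentiableAt one_ne_zero).hasFDerivAt
  have hsym : ∀ u v, fderiv ℝ (fderiv ℝ (φ ∘ W)) y u v = fderiv ℝ (fderiv ℝ (φ ∘ W)) y v u :=
    fun u v => hV.isSymmSndFDerivAt (by simp) u v
  have hAW : HasFDerivAt (fun z => A (φ (W z)))
      ((fderiv ℝ A (φ (W y))).comp (fderiv ℝ (φ ∘ W) y)) y :=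
    HasFDerivAt.comp (g := A) (f := φ ∘ W) y hAd.hasFDerivAt hVd
  have hsecond : ∀ u v : ℂ, fderiv ℝ (fun z => fderiv ℝ F z v) y u =
      fderiv ℝ A (φ (W y)) (fderiv ℝ (φ ∘ W) y u) (fderiv ℝ (φ ∘ W) y (Complex.I * v)) +
        A (φ (W y)) (fderiv ℝ (fderiv ℝ (φ ∘ W)) y u (Complex.I * v)) := by
    intro u v
    have h1 : (fun z => fderiv ℝ F z v) =ᶠ[𝓝 y]
        fun z => A (φ (W z)) (fderiv ℝ (φ ∘ W) z (Complex.I * v)) := by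
      filter_upwards [hfd] with z hz using hz v
    rw [h1.fderiv_eq, (hAW.clm_apply (hVd2.eval_const (Complex.I * v))).fderiv]
    simp [add_comm]
  have hFd : DifferentiableAt ℝ (fderiv ℝ F) y := by
    have h1 : fderiv ℝ F =ᶠ[𝓝 y] fun z => ((A (φ (W z))).comp (fderiv ℝ (φ ∘ W) z)).comp
        (ContinuousLinearMap.mul ℝ ℂ Complex.I) := by
      filter_upwards [hfd] with z hz
      ext v
      simp [hz]
    refine DifferentiableAt.congr_of_eventuallyEq ?_ h1
    exact (hAW.differentiableAt.clm_comp hVd2.differentiableAt).clm_comp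
      (differentiableAt_const _)
  rw [InnerProductSpace.laplacian_eq_iteratedFDeriv_complexPlane]
  simp only [iteratedFDeriv_two_apply, Matrix.cons_val_zero, Matrix.cons_val_one]
  have e1 : ∀ u v, fderiv ℝ (fderiv ℝ F) y u v = fderiv ℝ (fun z => fderiv ℝ F z v) y u := by
    intro u v
    rw [(hFd.hasFDerivAt.eval_const v).fderiv]; rfl
  -- The two terms with second derivatives of the map are opposite by symmetry of mixed derivatives.
  -- The terms with the derivative of the coefficients form the antisymmetrization that defines the
  -- exterior derivative.
  rw [e1, e1, hsecond, hsecond, extDerivOneForm_eq, mul_one, Complex.I_mul_I, hsym 1 Complex.I]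
  rw [mfderiv_eq_fderiv_extChartAt (hWd y hy)]
  simp only [map_neg]
  exact (by intros; ring : ∀ a b c : ℝ, a + c + (-b + -c) = a - b) _ _ _

/-- The Laplacian of the potential of a contact instanton is the density of the `π`-energy. -/
lemma laplacian_potential_eq_projNormSq (t : ContactTriad E Q) {W : ℂ → Q} {F : ℂ → ℝ} {U : Set ℂ}
    {y : ℂ} (hU : IsOpen U) (hy : y ∈ U) (hW : ContMDiffOn 𝓘(ℝ, ℂ) 𝓘(ℝ, E) ∞ W U)
    (hF : ∀ z ∈ U, ∀ v : ℂ,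
      fderiv ℝ F z v = t.form (W z) (mfderiv 𝓘(ℝ, ℂ) 𝓘(ℝ, E) W z (Complex.I * v : ℂ)))
    (hCR : t.J (W y) (t.proj (W y) (mfderiv 𝓘(ℝ, ℂ) 𝓘(ℝ, E) W y (1 : ℂ))) =
      t.proj (W y) (mfderiv 𝓘(ℝ, ℂ) 𝓘(ℝ, E) W y Complex.I)) :
    Δ F y = t.projNormSq (W y) (mfderiv 𝓘(ℝ, ℂ) 𝓘(ℝ, E) W y (1 : ℂ)) := by
  rw [laplacian_potential t.toContactForm hU hy hW hF, ← ContactForm.extDeriv_proj,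
    ContactTriad.projNormSq, hCR]

lemma ContactTriad.projNormSq_nonneg (t : ContactTriad E Q) (q : Q) (v : TangentSpace 𝓘(ℝ, E) q) :
    0 ≤ t.projNormSq q v := by
  rw [ContactTriad.projNormSq]
  by_cases h : t.proj q v = 0
  · rw [h]
    exact (show extDerivBilin t.form q 0 _ = 0 by rw [map_zero]; rfl).ge
  · exact (t.adapted q _ (t.form_proj q v) h).le

lemma ContactTriad.proj_eq_zero_of_projNormSq (t : ContactTriad E Q) (q : Q)
    (v : TangentSpace 𝓘(ℝ, E) q) (h : t.projNormSq q v = 0) : t.proj q v = 0 := by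
  by_contra hne
  exact (t.adapted q _ (t.form_proj q v) hne).ne' h

end Subharmonic

/-! ### Holomorphic parametrizations of Riemann surfaces -/

section RiemannSurface

open Set Filter Laplacian

variable {X : Type*} [TopologicalSpace X] [ChartedSpace ℂ X]

/-- `κ` is a holomorphic map from a neighbourhood of `y` to the Riemann surface `X`. -/
def HoloAt (κ : ℂ → X) (y : ℂ) : Prop :=
  ∀ᶠ z in 𝓝 y, MDifferentiableAt 𝓘(ℂ, ℂ) 𝓘(ℂ, ℂ) κ z

lemma HoloAt.eventually {κ : ℂ → X} {y : ℂ} (h : HoloAt κ y) : ∀ᶠ z in 𝓝 y, HoloAt κ z :=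
  eventually_eventually_nhds.2 h

lemma HoloAt.mdifferentiableAt {κ : ℂ → X} {y : ℂ} (h : HoloAt κ y) :
    MDifferentiableAt 𝓘(ℂ, ℂ) 𝓘(ℂ, ℂ) κ y := h.self_of_nhds

lemma HoloAt.continuousAt {κ : ℂ → X} {y : ℂ} (h : HoloAt κ y) : ContinuousAt κ y :=
  h.mdifferentiableAt.continuousAt

lemma HoloAt.congr {κ κ' : ℂ → X} {y : ℂ} (h : HoloAt κ y) (he : κ =ᶠ[𝓝 y] κ') : HoloAt κ' y := by
  filter_upwards [h, he.eventually_nhds] with z hz hz'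
  exact hz.congr_of_eventuallyEq (EventuallyEq.symm hz')

lemma HoloAt.comp_analyticAt {κ : ℂ → X} {θ : ℂ → ℂ} {y : ℂ} (h : HoloAt κ (θ y))
    (hθ : AnalyticAt ℂ θ y) : HoloAt (κ ∘ θ) y := by
  filter_upwards [hθ.continuousAt.eventually h, hθ.eventually_analyticAt] with z h1 h2
  exact h1.comp z h2.differentiableAt.mdifferentiableAt

lemma HoloAt.comp_mdifferentiable {X' : Type*} [TopologicalSpace X'] [ChartedSpace ℂ X']
    {κ : ℂ → X} {φ : X → X'} {y : ℂ} (h : HoloAt κ y)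
    (hφ : MDifferentiable 𝓘(ℂ, ℂ) 𝓘(ℂ, ℂ) φ) : HoloAt (φ ∘ κ) y := by
  filter_upwards [h] with z h1 using (hφ _).comp z h1

/-- A complex differentiable map is real differentiable with complex linear derivative. -/
lemma MDifferentiableAt.real_of_complex {κ : ℂ → X} {y : ℂ}
    (h : MDifferentiableAt 𝓘(ℂ, ℂ) 𝓘(ℂ, ℂ) κ y) : MDifferentiableAt 𝓘(ℝ, ℂ) 𝓘(ℝ, ℂ) κ y ∧
      ∀ v : ℂ, mfderiv 𝓘(ℝ, ℂ) 𝓘(ℝ, ℂ) κ y (Complex.I * v : ℂ) =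
        surfaceJ (κ y) (mfderiv 𝓘(ℝ, ℂ) 𝓘(ℝ, ℂ) κ y v) := by
  obtain ⟨hc, hd⟩ := h.hasMFDerivAt
  have hd' : HasFDerivWithinAt (writtenInExtChartAt 𝓘(ℂ, ℂ) 𝓘(ℂ, ℂ) y κ)
    (show ℂ →L[ℂ] ℂ from mfderiv 𝓘(ℂ, ℂ) 𝓘(ℂ, ℂ) κ y) (range 𝓘(ℂ, ℂ)) (extChartAt 𝓘(ℂ, ℂ) y y) := hd
  have h1 : HasMFDerivAt 𝓘(ℝ, ℂ) 𝓘(ℝ, ℂ) κ y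
      ((show ℂ →L[ℂ] ℂ from mfderiv 𝓘(ℂ, ℂ) 𝓘(ℂ, ℂ) κ y).restrictScalars ℝ) :=
    ⟨hc, hd'.restrictScalars ℝ⟩
  refine ⟨h1.mdifferentiableAt, fun v => ?_⟩
  rw [h1.mfderiv]
  exact (show ℂ →L[ℂ] ℂ from mfderiv 𝓘(ℂ, ℂ) 𝓘(ℂ, ℂ) κ y).map_smul Complex.I v

variable [IsManifold 𝓘(ℂ, ℂ) ω X]

/-- The smooth structure underlying a complex structure. -/
lemma isManifold_real_of_complex : IsManifold 𝓘(ℝ, ℂ) ∞ X := by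
  refine isManifold_of_contDiffOn _ _ _ fun e e' he he' => ?_
  have h1 := (contDiffGroupoid ω 𝓘(ℂ, ℂ)).compatible he he'
  rw [contDiffGroupoid, mem_groupoid_of_pregroupoid] at h1
  have h2 : ContDiffOn ℂ ω (𝓘(ℂ, ℂ) ∘ (e.symm ≫ₕ e') ∘ 𝓘(ℂ, ℂ).symm)
    (𝓘(ℂ, ℂ).symm ⁻¹' (e.symm ≫ₕ e').source ∩ range 𝓘(ℂ, ℂ)) := h1.1
  exact (h2.restrict_scalars ℝ).of_le le_top

lemma holoAt_chartAt_symm (x : X) {y : ℂ} (hy : y ∈ (chartAt ℂ x).target) :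
    HoloAt (chartAt ℂ x).symm y := by
  have : IsManifold 𝓘(ℂ, ℂ) 1 X := IsManifold.of_le (n := ω) le_top
  filter_upwards [(chartAt ℂ x).open_target.mem_nhds hy] with z hz
  exact mdifferentiableAt_atlas_symm (chart_mem_atlas ℂ x) hz

lemma HoloAt.analyticAt_chart {κ : ℂ → X} {y : ℂ} (h : HoloAt κ y) (x : X)
    (hx : κ y ∈ (chartAt ℂ x).source) : AnalyticAt ℂ (chartAt ℂ x ∘ κ) y := by
  have : IsManifold 𝓘(ℂ, ℂ) 1 X := IsManifold.of_le (n := ω) le_top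
  rw [Complex.analyticAt_iff_eventually_differentiableAt]
  filter_upwards [h, h.continuousAt.eventually ((chartAt ℂ x).open_source.mem_nhds hx)] with z h1 h2
  exact ((mdifferentiableAt_atlas (chart_mem_atlas ℂ x) h2).comp z h1).differentiableAt

lemma HoloAt.contMDiffAt_real {κ : ℂ → X} {y : ℂ} (h : HoloAt κ y) :
    ContMDiffAt 𝓘(ℝ, ℂ) 𝓘(ℝ, ℂ) ∞ κ y := by
  rw [contMDiffAt_iff]
  refine ⟨h.continuousAt, ?_⟩
  have h1 : ContDiffAt ℝ ∞ (chartAt ℂ (κ y) ∘ κ) y :=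
    (h.analyticAt_chart _ (mem_chart_source ℂ _)).contDiffAt.restrict_scalars ℝ
  simpa using! h1.contDiffWithinAt

lemma contDiffAt_comp_holo {f : X → ℝ} (hf : ContMDiff 𝓘(ℝ, ℂ) 𝓘(ℝ, ℝ) ∞ f) {κ : ℂ → X} {y : ℂ}
    (h : HoloAt κ y) : ContDiffAt ℝ ∞ (f ∘ κ) y :=
  ((hf.contMDiffAt).comp y h.contMDiffAt_real).contDiffAt

variable {E : Type*} [NormedAddCommGroup E] [NormedSpace ℝ E]
  {Q : Type*} [TopologicalSpace Q] [ChartedSpace E Q] [IsManifold 𝓘(ℝ, E) ∞ Q]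

lemma mfderiv_comp_holo {w : X → Q} (hw : ContMDiff 𝓘(ℝ, ℂ) 𝓘(ℝ, E) ∞ w) {κ : ℂ → X} {y : ℂ}
    (h : HoloAt κ y) (v : ℂ) : mfderiv 𝓘(ℝ, ℂ) 𝓘(ℝ, E) (w ∘ κ) y v =
      mfderiv 𝓘(ℝ, ℂ) 𝓘(ℝ, E) w (κ y) (mfderiv 𝓘(ℝ, ℂ) 𝓘(ℝ, ℂ) κ y v) := by
  rw [mfderiv_comp y ((hw (κ y)).mdifferentiableAt (by simp))
    h.mdifferentiableAt.real_of_complex.1]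
  rfl

lemma IsPotential.fderiv_comp {t : ContactTriad E Q} {w : X → Q} {f : X → ℝ}
    (hwf : IsPotential t w f) (hw : ContMDiff 𝓘(ℝ, ℂ) 𝓘(ℝ, E) ∞ w)
    (hf : ContMDiff 𝓘(ℝ, ℂ) 𝓘(ℝ, ℝ) ∞ f) {κ : ℂ → X} {y : ℂ} (h : HoloAt κ y) (v : ℂ) :
    fderiv ℝ (f ∘ κ) y v =
      t.form ((w ∘ κ) y) (mfderiv 𝓘(ℝ, ℂ) 𝓘(ℝ, E) (w ∘ κ) y (Complex.I * v : ℂ)) := by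
  rw [mfderiv_comp_holo hw h, h.mdifferentiableAt.real_of_complex.2]
  have h1 := hwf (κ y) (mfderiv 𝓘(ℝ, ℂ) 𝓘(ℝ, ℂ) κ y v)
  rw [← mfderiv_comp_holo hf h, mfderiv_eq_fderiv] at h1
  exact h1.symm

lemma contMDiffOn_comp_holo {w : X → Q} (hw : ContMDiff 𝓘(ℝ, ℂ) 𝓘(ℝ, E) ∞ w) {κ : ℂ → X}
    {U : Set ℂ} (h : ∀ z ∈ U, HoloAt κ z) : ContMDiffOn 𝓘(ℝ, ℂ) 𝓘(ℝ, E) ∞ (w ∘ κ) U :=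
  fun z hz => ((hw.contMDiffAt).comp z (h z hz).contMDiffAt_real).contMDiffWithinAt

variable [FiniteDimensional ℝ E]

lemma IsContactCauchyRiemann.J_proj_comp {t : ContactTriad E Q} {w : X → Q}
    (hCR : IsContactCauchyRiemann t w) (hw : ContMDiff 𝓘(ℝ, ℂ) 𝓘(ℝ, E) ∞ w) {κ : ℂ → X} {y : ℂ}
    (h : HoloAt κ y) :
    t.J ((w ∘ κ) y) (t.proj ((w ∘ κ) y) (mfderiv 𝓘(ℝ, ℂ) 𝓘(ℝ, E) (w ∘ κ) y (1 : ℂ))) =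
      t.proj ((w ∘ κ) y) (mfderiv 𝓘(ℝ, ℂ) 𝓘(ℝ, E) (w ∘ κ) y Complex.I) := by
  have h1 := h.mdifferentiableAt.real_of_complex.2 1
  rw [mul_one] at h1
  rw [mfderiv_comp_holo hw h, mfderiv_comp_holo hw h, h1]
  exact hCR.J_proj _ _

lemma IsPotential.laplacian_comp_eq {t : ContactTriad E Q} {w : X → Q} {f : X → ℝ}
    (hwf : IsPotential t w f) (hCR : IsContactCauchyRiemann t w)
    (hw : ContMDiff 𝓘(ℝ, ℂ) 𝓘(ℝ, E) ∞ w)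
    (hf : ContMDiff 𝓘(ℝ, ℂ) 𝓘(ℝ, ℝ) ∞ f) {κ : ℂ → X} {y : ℂ} (h : HoloAt κ y) :
    Δ (f ∘ κ) y = t.projNormSq ((w ∘ κ) y) (mfderiv 𝓘(ℝ, ℂ) 𝓘(ℝ, E) (w ∘ κ) y (1 : ℂ)) := by
  obtain ⟨U, hU, hUo, hyU⟩ := mem_nhds_iff.1 h.eventually
  exact laplacian_potential_eq_projNormSq t hUo hyU (contMDiffOn_comp_holo hw hU)
    (fun z hz v => hwf.fderiv_comp hw hf (hU hz) v) (hCR.J_proj_comp hw h)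

lemma IsPotential.laplacian_comp_nonneg {t : ContactTriad E Q} {w : X → Q} {f : X → ℝ}
    (hwf : IsPotential t w f) (hCR : IsContactCauchyRiemann t w)
    (hw : ContMDiff 𝓘(ℝ, ℂ) 𝓘(ℝ, E) ∞ w)
    (hf : ContMDiff 𝓘(ℝ, ℂ) 𝓘(ℝ, ℝ) ∞ f) {κ : ℂ → X} {y : ℂ} (h : HoloAt κ y) :
    0 ≤ Δ (f ∘ κ) y := by
  rw [hwf.laplacian_comp_eq hCR hw hf h]
  exact t.projNormSq_nonneg _ _

end RiemannSurface

/-! ### Holomorphic maps into open subsets of a surface -/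

section Opens

open Set Filter

variable {S : Type*} [TopologicalSpace S] [ChartedSpace ℂ S] {U : TopologicalSpace.Opens S}

lemma mdifferentiableAt_opens_iff {κ : ℂ → U} {y : ℂ} :
    MDifferentiableAt 𝓘(ℂ, ℂ) 𝓘(ℂ, ℂ) κ y ↔
      MDifferentiableAt 𝓘(ℂ, ℂ) 𝓘(ℂ, ℂ) (fun z => (κ z : S)) y := by
  rw [mdifferentiableAt_iff, mdifferentiableAt_iff, Topology.IsInducing.subtypeVal.continuousAt_iff]
  rfl

lemma holoAt_opens_iff {κ : ℂ → U} {y : ℂ} : HoloAt κ y ↔ HoloAt (fun z => (κ z : S)) y :=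
  eventually_congr (.of_forall fun _ => mdifferentiableAt_opens_iff)

end Opens

/-! ### Contact forms in terms of globally defined smooth functions -/

section LocalExpression

open Set Filter

variable {E : Type*} [NormedAddCommGroup E] [NormedSpace ℝ E] [FiniteDimensional ℝ E]
  {Q : Type*} [TopologicalSpace Q] [T2Space Q] [ChartedSpace E Q] [IsManifold 𝓘(ℝ, E) ∞ Q]

lemma form_eq_localForm (l : ContactForm E Q) (q : Q) {q' : Q}
    (hq : q' ∈ (extChartAt 𝓘(ℝ, E) q).source) (v : TangentSpace 𝓘(ℝ, E) q') :
    l.form q' v = localForm l.form q (extChartAt 𝓘(ℝ, E) q q')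
      (mfderiv 𝓘(ℝ, E) 𝓘(ℝ, E) (extChartAt 𝓘(ℝ, E) q) q' v) := by
  have h1 : (id : Q → Q) =ᶠ[𝓝 q'] (extChartAt 𝓘(ℝ, E) q).symm ∘ extChartAt 𝓘(ℝ, E) q := by
    filter_upwards [(isOpen_extChartAt_source q).mem_nhds hq] with z hz
    exact ((extChartAt 𝓘(ℝ, E) q).left_inv hz).symm
  have h2 : MDifferentiableAt 𝓘(ℝ, E) 𝓘(ℝ, E) (extChartAt 𝓘(ℝ, E) q) q' :=
    mdifferentiableAt_extChartAt (by rwa [← extChartAt_source 𝓘(ℝ, E)])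
  have h3 : MDifferentiableAt 𝓘(ℝ, E) 𝓘(ℝ, E) (extChartAt 𝓘(ℝ, E) q).symm
      (extChartAt 𝓘(ℝ, E) q q') :=
    mdifferentiableOn_extChartAt_symm.mdifferentiableAt
      ((isOpen_extChartAt_target q).mem_nhds ((extChartAt 𝓘(ℝ, E) q).map_source hq))
  have h4 := mfderiv_comp q' h3 h2
  rw [← h1.mfderiv_eq, mfderiv_id] at h4
  have h5 : ∀ q₁ q₂ : Q, q₁ = q₂ → ∀ e : E,
      (show E →L[ℝ] ℝ from l.form q₁) e = (show E →L[ℝ] ℝ from l.form q₂) e := by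
    rintro q _ rfl e; rfl
  have h6 := congrArg (fun L : E →L[ℝ] E => L v) h4
  refine (congrArg (l.form q') h6).trans ?_
  exact h5 _ _ ((extChartAt 𝓘(ℝ, E) q).left_inv hq).symm _

/-- Near every point a contact form is a finite sum `∑ a_j dg_j` with global smooth functions. -/
lemma exists_local_expression (l : ContactForm E Q) (q : Q) :
    ∃ (d : ℕ) (a g : Fin d → C^∞⟮𝓘(ℝ, E), Q; 𝓘(ℝ, ℝ), ℝ⟯) (χ : C^∞⟮𝓘(ℝ, E), Q; 𝓘(ℝ, ℝ), ℝ⟯),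
      χ q = 1 ∧ ∀ q', 1 / 2 < χ q' → ∀ v : TangentSpace 𝓘(ℝ, E) q',
        l.form q' v = ∑ j, a j q' * (show ℝ from mfderiv 𝓘(ℝ, E) 𝓘(ℝ, ℝ) (g j) q' v) := by
  set φ := extChartAt 𝓘(ℝ, E) q with hφ
  let b := Module.finBasis ℝ E
  -- The bump function `χ₀` makes chart coordinates and coefficients global. A second one, `χ`, is
  -- supported where `χ₀ = 1`, so that validity of the formula is guaranteed by an inequality for a
  -- single global smooth function.
  obtain ⟨χ₀⟩ : Nonempty (SmoothBumpFunction 𝓘(ℝ, E) q) := inferInstance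
  have hφs : ContMDiffOn 𝓘(ℝ, E) 𝓘(ℝ, E) ∞ φ (chartAt E q).source := contMDiffOn_extChartAt
  have ha : ∀ j, ContMDiffOn 𝓘(ℝ, E) 𝓘(ℝ, ℝ) ∞ (fun q' => localForm l.form q (φ q') (b j))
      (chartAt E q).source := by
    intro j
    have h1 := ((contDiffOn_localForm l q).clm_apply
      (contDiffOn_const (c := b j))).contMDiffOn
    refine h1.comp hφs fun q' hq' => ?_
    exact φ.map_source (by rwa [hφ, extChartAt_source])
  have hg : ∀ j, ContMDiffOn 𝓘(ℝ, E) 𝓘(ℝ, ℝ) ∞ (fun q' => b.coord j (φ q'))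
      (chartAt E q).source := by
    intro j
    have h1 : ContDiff ℝ ∞ (b.coord j).toContinuousLinearMap :=
      ContinuousLinearMap.contDiff _
    exact h1.contMDiff.comp_contMDiffOn hφs
  have hU : interior {x | χ₀ x = 1} ∈ 𝓝 q := interior_mem_nhds.2 χ₀.eventuallyEq_one
  obtain ⟨χ, -, hχ⟩ := (SmoothBumpFunction.nhds_basis_tsupport (I := 𝓘(ℝ, E)) q).mem_iff.1 hU
  refine ⟨_, fun j => ⟨_, χ₀.contMDiff_smul (ha j)⟩, fun j => ⟨_, χ₀.contMDiff_smul (hg j)⟩,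
    ⟨χ, χ.contMDiff⟩, χ.eq_one, fun q' hq' v => ?_⟩
  have hq'U : q' ∈ interior {x | χ₀ x = 1} := by
    refine hχ (subset_tsupport _ ?_)
    have : (0 : ℝ) < χ q' := lt_trans (by norm_num) hq'
    exact this.ne'
  have h1 : χ₀ q' = 1 := (interior_subset (s := {x | χ₀ x = 1})) hq'U
  have hs : q' ∈ (chartAt E q).source := χ₀.support_subset_source (by simp [h1])
  have hs' : q' ∈ φ.source := by rwa [hφ, extChartAt_source]
  have hd : MDifferentiableAt 𝓘(ℝ, E) 𝓘(ℝ, E) φ q' := mdifferentiableAt_extChartAt hs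
  rw [form_eq_localForm l q hs']
  set u : E := mfderiv 𝓘(ℝ, E) 𝓘(ℝ, E) φ q' v with hu
  have h2 : ∀ j, (show ℝ from mfderiv 𝓘(ℝ, E) 𝓘(ℝ, ℝ)
      (fun x => χ₀ x • b.coord j (φ x)) q' v) = b.coord j u := by
    intro j
    have e1 : (fun x => χ₀ x • b.coord j (φ x)) =ᶠ[𝓝 q']
        (b.coord j).toContinuousLinearMap ∘ φ := by
      filter_upwards [isOpen_interior.mem_nhds hq'U] with x hx
      have : χ₀ x = 1 := (interior_subset (s := {x | χ₀ x = 1})) hx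
      simp [this]
    rw [e1.mfderiv_eq, mfderiv_comp q' (ContinuousLinearMap.mdifferentiableAt _) hd,
      ContinuousLinearMap.mfderiv_eq]
    rfl
  have h3 : u = ∑ j, b.coord j u • b j := (b.sum_repr u).symm
  conv_lhs => rw [h3, map_sum]
  refine Finset.sum_congr rfl fun j _ => ?_
  rw [map_smul, smul_eq_mul, mul_comm]
  change _ = (χ₀ q' • localForm l.form q (φ q') (b j)) * _
  rw [h1, one_smul]
  exact congrArg _ (h2 j).symm

/-- The Reeb field of a contact triad in terms of the almost complex structure. -/
lemma ContactTriad.form_smul_reeb (t : ContactTriad E Q) (q : Q) (v : TangentSpace 𝓘(ℝ, E) q) :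
    t.form q v • t.reeb q = v + t.J q (t.J q v) := by
  rw [t.J_sq, ContactForm.proj]; abel

/-- The Reeb field is chosen pointwise, so its continuity has to be recovered. For a field `v` with
`λ(v) ≠ 0` one has `R = (v + J J v) / λ(v)`, which involves only the smooth data `λ` and `J`. -/
lemma ContactTriad.continuousAt_mfderiv_reeb (t : ContactTriad E Q)
    (g : C^∞⟮𝓘(ℝ, E), Q; 𝓘(ℝ, ℝ), ℝ⟯) (q : Q) :
    ContinuousAt (fun q' => (show ℝ from mfderiv 𝓘(ℝ, E) 𝓘(ℝ, ℝ) g q' (t.reeb q'))) q := by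
  set φ := extChartAt 𝓘(ℝ, E) q with hφ
  obtain ⟨v, hv⟩ : ∃ v : E, localForm t.form q (φ q) v ≠ 0 := by
    by_contra! h
    have h1 := (t.reeb_spec q).1
    rw [form_eq_localForm t.toContactForm q (mem_extChartAt_source q)] at h1
    exact one_ne_zero (h1.symm.trans (h _))
  let V : Q → TangentBundle 𝓘(ℝ, E) Q := fun q' => ⟨φ.symm (φ q'),
    mfderiv 𝓘(ℝ, E) 𝓘(ℝ, E) φ.symm (φ q') v⟩
  have hV : ContinuousAt V q := by
    have h1 := (contMDiffOn_extChartAt_symm_tangent q v).continuousOn.continuousAt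
      (extChartAt_target_mem_nhds q)
    exact ContinuousAt.comp (g := fun y : E => (⟨φ.symm y,
      mfderiv 𝓘(ℝ, E) 𝓘(ℝ, E) φ.symm y v⟩ : TangentBundle 𝓘(ℝ, E) Q)) h1 (continuousAt_extChartAt q)
  have hdg : Continuous (fun p : TangentBundle 𝓘(ℝ, E) Q =>
      (show ℝ from mfderiv 𝓘(ℝ, E) 𝓘(ℝ, ℝ) g p.1 p.2)) := by
    have h1 : ContMDiff (𝓘(ℝ, E)).tangent (𝓘(ℝ, ℝ)).tangent ∞
      (tangentMap 𝓘(ℝ, E) 𝓘(ℝ, ℝ) g) := g.contMDiff.contMDiff_tangentMap (by simp)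
    exact (contMDiff_snd_tangentBundle_modelSpace ℝ 𝓘(ℝ, ℝ) (n := ∞)).continuous.comp h1.continuous
  have hform := t.smooth.continuous
  have hJ := t.J_smooth.continuous
  have h1 : ContinuousAt (fun q' =>
      ((show ℝ from mfderiv 𝓘(ℝ, E) 𝓘(ℝ, ℝ) g (V q').1 (V q').2) +
        (show ℝ from mfderiv 𝓘(ℝ, E) 𝓘(ℝ, ℝ) g (V q').1 (t.J _ (t.J _ (V q').2)))) /
      t.form (V q').1 (V q').2) q := by
    refine ((hdg.continuousAt.comp hV).add
      (hdg.continuousAt.comp (hJ.continuousAt.comp (hJ.continuousAt.comp hV)))).div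
      (hform.continuousAt.comp hV) ?_
    exact hv
  have hne : ∀ᶠ q' in 𝓝 q, t.form (V q').1 (V q').2 ≠ 0 :=
    (hform.continuousAt.comp hV).eventually_ne hv
  refine h1.congr ?_
  filter_upwards [hne, extChartAt_source_mem_nhds (I := 𝓘(ℝ, E)) q]
    with q' h2 h3
  have h4 : (V q').1 = q' := φ.left_inv h3
  have h5 : ∀ p : TangentBundle 𝓘(ℝ, E) Q, p.1 = q' → t.form p.1 p.2 ≠ 0 →
      ((show ℝ from mfderiv 𝓘(ℝ, E) 𝓘(ℝ, ℝ) g p.1 p.2) +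
        (show ℝ from mfderiv 𝓘(ℝ, E) 𝓘(ℝ, ℝ) g p.1 (t.J _ (t.J _ p.2)))) /
      t.form p.1 p.2 = (show ℝ from mfderiv 𝓘(ℝ, E) 𝓘(ℝ, ℝ) g q' (t.reeb q')) := by
    rintro ⟨_, x⟩ rfl hx
    have h6 := congrArg (mfderiv 𝓘(ℝ, E) 𝓘(ℝ, ℝ) g _) (t.form_smul_reeb _ x)
    rw [map_smul, map_add] at h6
    exact (div_eq_iff hx).2 (h6.symm.trans (mul_comm (t.form _ x)
      (show ℝ from mfderiv 𝓘(ℝ, E) 𝓘(ℝ, ℝ) g _ (t.reeb _))))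
  exact h5 (V q') h4 h2

end LocalExpression

/-! ### Punctures and cylindrical ends -/

section Ends

open Set Filter Complex

variable {S : Type*} [TopologicalSpace S] [T2Space S] [ChartedSpace ℂ S] {P : Punctures S}

lemma Punctures.isOpen_insert_dot (P : Punctures S) (p : S) :
    IsOpen (insert p (P.dot : Set S)) := by
  have h : insert p (P.dot : Set S) = (((P.pos : Set S) ∪ P.neg) \ {p})ᶜ := by
    ext z
    simp only [mem_insert_iff, mem_compl_iff, Set.mem_sdiff, mem_union,
      mem_singleton_iff, not_and, not_not, SetLike.mem_coe]
    change z = p ∨ (z ∉ P.pos ∧ z ∉ P.neg) ↔ _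
    tauto
  rw [h]
  exact (((P.pos.finite_toSet.union P.neg.finite_toSet).subset sdiff_subset).isClosed).isOpen_compl

/-- The extension by zero of a function over the punctures. -/
def fext (f : P.dot → ℝ) : S → ℝ := Function.extend Subtype.val f 0

lemma fext_coe (f : P.dot → ℝ) (x : P.dot) : fext f x = f x :=
  Subtype.val_injective.extend_apply _ _ _

open Classical in
/-- Restriction of the codomain to the punctured surface. -/
def dotLift (x₀ : P.dot) (κ : ℂ → S) (z : ℂ) : P.dot :=
  if h : κ z ∈ P.dot then ⟨κ z, h⟩ else x₀

lemma coe_dotLift (x₀ : P.dot) {κ : ℂ → S} {z : ℂ} (h : κ z ∈ P.dot) :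
    (dotLift x₀ κ z : S) = κ z := by
  rw [dotLift, dif_pos h]

lemma coe_dotLift_eventually (x₀ : P.dot) {κ : ℂ → S} {z : ℂ} (hκ : ContinuousAt κ z)
    (h : κ z ∈ P.dot) : ∀ᶠ y in 𝓝 z, (dotLift x₀ κ y : S) = κ y := by
  filter_upwards [hκ.eventually (P.dot.isOpen.mem_nhds h)] with y hy using coe_dotLift x₀ hy

lemma holoAt_dotLift (x₀ : P.dot) {κ : ℂ → S} {z : ℂ} (hκ : HoloAt κ z) (h : κ z ∈ P.dot) :
    HoloAt (dotLift x₀ κ) z := by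
  rw [holoAt_opens_iff]
  exact hκ.congr ((coe_dotLift_eventually x₀ hκ.continuousAt h).mono fun y hy => hy.symm)

lemma fext_comp_eventuallyEq (x₀ : P.dot) (f : P.dot → ℝ) {κ : ℂ → S} {z : ℂ}
    (hκ : ContinuousAt κ z) (h : κ z ∈ P.dot) : fext f ∘ κ =ᶠ[𝓝 z] f ∘ dotLift x₀ κ := by
  filter_upwards [coe_dotLift_eventually x₀ hκ h] with y hy
  rw [Function.comp_apply, Function.comp_apply, ← hy, fext_coe]

/-- The filter of points of a half-cylinder that tend to the end `σ τ → ∞`. -/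
def endFilter (σ : ℝ) : Filter ℂ := comap (fun z => σ * z.re) atTop

lemma mem_endFilter {σ : ℝ} {s : Set ℂ} : s ∈ endFilter σ ↔ ∃ R : ℝ, ∀ z : ℂ, R ≤ σ * z.re → z ∈ s := by
  rw [endFilter, (atTop_basis.comap _).mem_iff]
  simp only [true_and]
  rfl

lemma tendsto_cexp_endFilter {σ : ℝ} :
    Tendsto (fun z : ℂ => cexp (-(2 * Real.pi * σ * z))) (endFilter σ) (𝓝 0) := by
  rw [tendsto_zero_iff_norm_tendsto_zero]
  have h : ∀ z : ℂ, ‖cexp (-(2 * Real.pi * σ * z))‖ = Real.exp (-(2 * Real.pi * (σ * z.re))) := by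
    intro z
    rw [norm_exp]; congr 1
    have : -(2 * Real.pi * σ * z : ℂ) = ((-(2 * Real.pi * σ) : ℝ) : ℂ) * z := by push_cast; ring
    rw [this, re_ofReal_mul]; ring
  simp only [h]
  have h2 : Tendsto (fun x : ℝ => Real.exp (-(2 * Real.pi * x))) atTop (𝓝 0) :=
    Real.tendsto_exp_neg_atTop_nhds_zero.comp
      (tendsto_id.const_mul_atTop (by have := Real.pi_pos; positivity))
  exact h2.comp tendsto_comap

variable [IsManifold 𝓘(ℂ, ℂ) ω S]

lemma holoAt_symm_of_mem_maximalAtlas {e : OpenPartialHomeomorph S ℂ}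
    (he : e ∈ IsManifold.maximalAtlas 𝓘(ℂ, ℂ) ω S) {y : ℂ} (hy : y ∈ e.target) :
    HoloAt e.symm y := by
  filter_upwards [e.open_target.mem_nhds hy] with z hz
  exact ((contMDiffOn_symm_of_mem_maximalAtlas he).contMDiffAt
    (e.open_target.mem_nhds hz)).mdifferentiableAt (by simp)

lemma analyticAt_transition {e e' : OpenPartialHomeomorph S ℂ}
    (he : e ∈ IsManifold.maximalAtlas 𝓘(ℂ, ℂ) ω S) (he' : e' ∈ IsManifold.maximalAtlas 𝓘(ℂ, ℂ) ω S)
    {p : S} (hp : p ∈ e.source) (hp' : p ∈ e'.source) : AnalyticAt ℂ (e' ∘ e.symm) (e p) := by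
  have h1 := (contMDiffOn_symm_of_mem_maximalAtlas he).contMDiffAt
    (e.open_target.mem_nhds (e.map_source hp))
  have h2 : ContMDiffAt 𝓘(ℂ, ℂ) 𝓘(ℂ, ℂ) ω e' (e.symm (e p)) := by
    rw [e.left_inv hp]
    exact (contMDiffOn_of_mem_maximalAtlas he').contMDiffAt (e'.open_source.mem_nhds hp')
  exact ((h2.comp _ h1).contDiffAt).analyticAt

lemma deriv_transition_ne_zero {e e' : OpenPartialHomeomorph S ℂ}
    (he : e ∈ IsManifold.maximalAtlas 𝓘(ℂ, ℂ) ω S) (he' : e' ∈ IsManifold.maximalAtlas 𝓘(ℂ, ℂ) ω S)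
    {p : S} (hp : p ∈ e.source) (hp' : p ∈ e'.source) : deriv (e' ∘ e.symm) (e p) ≠ 0 := by
  have h1 := (analyticAt_transition he he' hp hp').differentiableAt
  have h2 := (analyticAt_transition he' he hp' hp).differentiableAt
  have h3 : (e' ∘ e.symm) (e p) = e' p := by simp [e.left_inv hp]
  rw [← h3] at h2
  have h4 := h2.hasDerivAt.comp (e p) h1.hasDerivAt
  have h5 : (e ∘ e'.symm) ∘ (e' ∘ e.symm) =ᶠ[𝓝 (e p)] id := by
    have hc : ContinuousAt e.symm (e p) := e.continuousAt_symm (e.map_source hp)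
    have e1 : ∀ᶠ y in 𝓝 (e p), e.symm y ∈ e'.source := by
      refine hc.eventually (e'.open_source.mem_nhds ?_)
      rwa [e.left_inv hp]
    filter_upwards [e1, e.open_target.mem_nhds (e.map_source hp)] with y hy hy'
    simp [e'.left_inv hy, e.right_inv hy']
  have h6 := h4.congr_of_eventuallyEq h5.symm
  have h7 := h6.unique (hasDerivAt_id _)
  intro h0
  rw [h0, mul_zero] at h7
  exact zero_ne_one h7

/-- The cylindrical coordinate `ζ = -log(z - c) / 2π` at `p`, for the preferred chart at `p`. -/
def endMap (p : S) (ζ : ℂ) : S :=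
  (chartAt ℂ p).symm (chartAt ℂ p p + cexp (-(2 * Real.pi * ζ)))

lemma endMap_add_I (p : S) (ζ : ℂ) : endMap p (ζ + I) = endMap p ζ := by
  rw [endMap, cexp_neg_two_pi_add_I, endMap]

variable (P) in
lemma exists_end (p : S) : ∃ R : ℝ, ∀ ζ : ℂ, R < ζ.re →
    chartAt ℂ p p + cexp (-(2 * Real.pi * ζ)) ∈ (chartAt ℂ p).target ∧ endMap p ζ ∈ P.dot := by
  have hc : ContinuousAt (chartAt ℂ p).symm (chartAt ℂ p p) :=
    (chartAt ℂ p).continuousAt_symm (mem_chart_target ℂ p)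
  have h1 : ∀ᶠ y in 𝓝 (chartAt ℂ p p), y ∈ (chartAt ℂ p).target ∧
      (chartAt ℂ p).symm y ∈ insert p (P.dot : Set S) := by
    refine (show ∀ᶠ y in 𝓝 (chartAt ℂ p p), y ∈ (chartAt ℂ p).target from
      (chartAt ℂ p).open_target.mem_nhds (mem_chart_target ℂ p)).and
      (hc.eventually ((P.isOpen_insert_dot p).mem_nhds ?_))
    rw [(chartAt ℂ p).left_inv (mem_chart_source ℂ p)]
    exact mem_insert _ _
  have h2 : Tendsto (fun ζ : ℂ => chartAt ℂ p p + cexp (-(2 * Real.pi * ζ))) (endFilter 1)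
      (𝓝 (chartAt ℂ p p)) := by
    have := (tendsto_cexp_endFilter (σ := 1)).const_add (chartAt ℂ p p)
    simpa using this
  obtain ⟨R, hR⟩ := mem_endFilter.1 (h2.eventually h1)
  refine ⟨R, fun ζ hζ => ?_⟩
  obtain ⟨h3, h4⟩ := hR ζ (by simpa using hζ.le)
  refine ⟨h3, h4.resolve_left fun h5 => ?_⟩
  have h6 := congrArg (chartAt ℂ p) h5
  rw [(chartAt ℂ p).right_inv h3] at h6
  exact exp_ne_zero _ (by linear_combination h6)

variable (P) in
/-- An abscissa beyond which the cylindrical coordinate is defined. -/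
def endR (p : S) : ℝ := (exists_end P p).choose

lemma endMap_mem_target {p : S} {ζ : ℂ} (h : endR P p < ζ.re) :
    chartAt ℂ p p + cexp (-(2 * Real.pi * ζ)) ∈ (chartAt ℂ p).target :=
  ((exists_end P p).choose_spec ζ h).1

lemma endMap_mem_dot {p : S} {ζ : ℂ} (h : endR P p < ζ.re) : endMap p ζ ∈ P.dot :=
  ((exists_end P p).choose_spec ζ h).2

lemma holoAt_endMap {p : S} {ζ : ℂ} (h : endR P p < ζ.re) : HoloAt (endMap p) ζ :=
  (holoAt_chartAt_symm p (endMap_mem_target h)).comp_analyticAt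
    (θ := fun ζ => chartAt ℂ p p + cexp (-(2 * Real.pi * ζ))) (analyticAt_cexp_neg_mul _ ζ)

lemma endMap_eq_iff {p : S} {ζ ζ' : ℂ} (h : endR P p < ζ.re) (h' : endR P p < ζ'.re) :
    endMap p ζ = endMap p ζ' ↔ ∃ n : ℤ, ζ - ζ' = n * I := by
  have hpi : (Real.pi : ℂ) ≠ 0 := by exact_mod_cast Real.pi_ne_zero
  have h1 : endMap p ζ = endMap p ζ' ↔
      cexp (-(2 * Real.pi * ζ)) = cexp (-(2 * Real.pi * ζ')) := by
    rw [endMap, endMap, (chartAt ℂ p).symm.injOn.eq_iff (endMap_mem_target h)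
      (endMap_mem_target h'), add_right_inj]
  rw [h1, exp_eq_exp_iff_exists_int]
  constructor
  · rintro ⟨n, hn⟩
    refine ⟨-n, ?_⟩
    have : (2 * Real.pi : ℂ) * (ζ - ζ' + n * I) = 0 := by linear_combination -hn
    have := (mul_eq_zero.1 this).resolve_left (by simp [hpi])
    push_cast; linear_combination this
  · rintro ⟨n, hn⟩
    refine ⟨-n, ?_⟩
    push_cast; linear_combination (-2 * Real.pi : ℂ) * hn

/-- Punctured neighbourhoods of `p` are half-cylinders. -/
lemma endMap_nhds (p : S) (R : ℝ) :
    ∀ᶠ x in 𝓝 p, x ≠ p → ∃ ζ : ℂ, R < ζ.re ∧ ζ.im ∈ Ico (0 : ℝ) 1 ∧ endMap p ζ = x := by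
  have hc : ContinuousAt (chartAt ℂ p) p :=
    (chartAt ℂ p).continuousAt (mem_chart_source ℂ p)
  have h1 : ∀ᶠ x in 𝓝 p, ‖chartAt ℂ p x - chartAt ℂ p p‖ < Real.exp (-(2 * Real.pi * R)) := by
    have := Metric.tendsto_nhds.1 hc _ (Real.exp_pos (-(2 * Real.pi * R)))
    simpa [dist_eq] using this
  filter_upwards [h1, (chartAt ℂ p).open_source.mem_nhds (mem_chart_source ℂ p)] with x hx hx' hne
  have h2 : chartAt ℂ p x - chartAt ℂ p p ≠ 0 := fun h =>
    hne ((chartAt ℂ p).injOn hx' (mem_chart_source ℂ p) (sub_eq_zero.1 h))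
  obtain ⟨ρ, θ, hθ, h3, h4⟩ := exists_cexp_neg_two_pi h2
  refine ⟨ρ + θ * I, ?_, by simpa using hθ, ?_⟩
  · rw [h4, Real.exp_lt_exp] at hx
    have := Real.pi_pos
    simp; nlinarith
  · rw [endMap, h3, add_sub_cancel, (chartAt ℂ p).left_inv hx']

lemma tendsto_endMap (p : S) : Tendsto (endMap p) (endFilter 1) (𝓝 p) := by
  have h2 : Tendsto (fun ζ : ℂ => chartAt ℂ p p + cexp (-(2 * Real.pi * ζ))) (endFilter 1)
      (𝓝 (chartAt ℂ p p)) := by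
    have := (tendsto_cexp_endFilter (σ := 1)).const_add (chartAt ℂ p p)
    simpa using this
  have hc := ((chartAt ℂ p).continuousAt_symm (mem_chart_target ℂ p)).tendsto
  rw [(chartAt ℂ p).left_inv (mem_chart_source ℂ p)] at hc
  exact hc.comp h2

/-- The function `f` has the asymptotic slope `a` at `p`: in cylindrical coordinates `τ + it` at `p`
its differential tends to `a dτ` as `τ → ∞`. -/
def HasSlope (f : P.dot → ℝ) (p : S) (a : ℝ) : Prop :=
  Tendsto (wirt (fext f ∘ endMap p)) (endFilter 1) (𝓝 (a : ℂ))

/-- Asymptotic slopes can be computed in any holomorphic chart. -/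
lemma hasSlope_of_chart {f : P.dot → ℝ} (hf : ContMDiff 𝓘(ℝ, ℂ) 𝓘(ℝ, ℝ) ∞ f) {p : S}
    {e : OpenPartialHomeomorph S ℂ} (he : e ∈ IsManifold.maximalAtlas 𝓘(ℂ, ℂ) ω S)
    (hp : p ∈ e.source) (hp0 : e p = 0) {σ a : ℝ} (hσ : σ = 1 ∨ σ = -1)
    (h : Tendsto (wirt (fext f ∘ fun z : ℂ => e.symm (cexp (-(2 * Real.pi * σ * z)))))
      (endFilter σ) (𝓝 (a : ℂ))) : HasSlope f p (σ * a) := by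
  set φ := chartAt ℂ p with hφ
  have hφm : φ ∈ IsManifold.maximalAtlas 𝓘(ℂ, ℂ) ω S := IsManifold.chart_mem_maximalAtlas p
  set θ := e ∘ φ.symm with hθ
  set c := φ p with hc
  have hθa : AnalyticAt ℂ θ c := analyticAt_transition hφm he (mem_chart_source ℂ p) hp
  have hθ0 : θ c = 0 := by rw [hθ, Function.comp_apply, φ.left_inv (mem_chart_source ℂ p), hp0]
  have hθ' : deriv θ c ≠ 0 := deriv_transition_ne_zero hφm he (mem_chart_source ℂ p) hp
  set E : ℂ → ℂ := fun ζ => c + cexp (-(2 * Real.pi * ζ)) with hE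
  have hEt : Tendsto E (endFilter 1) (𝓝[≠] c) := by
    refine tendsto_nhdsWithin_iff.2 ⟨?_, .of_forall fun ζ h0 => ?_⟩
    · have := (tendsto_cexp_endFilter (σ := 1)).const_add c
      simpa using this
    · have h0' : c + cexp (-(2 * Real.pi * ζ)) = c := h0
      exact exp_ne_zero _ (by linear_combination h0')
  -- Since `θ` has a simple zero at `c`, the quotient of its logarithmic differential by that of `y
  -- - c` tends to `1`. Hence two cylindrical coordinates at `p` agree to first order at infinity,
  -- up to the sign `σ`.
  have hratio : Tendsto (fun y => deriv θ y * (y - c) / θ y) (𝓝[≠] c) (𝓝 1) := by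
    have h1 : Tendsto (slope θ c) (𝓝[≠] c) (𝓝 (deriv θ c)) :=
      hasDerivAt_iff_tendsto_slope.1 hθa.differentiableAt.hasDerivAt
    have h2 : Tendsto (deriv θ) (𝓝[≠] c) (𝓝 (deriv θ c)) :=
      hθa.deriv.continuousAt.tendsto.mono_left nhdsWithin_le_nhds
    have h3 := h2.div h1 hθ'
    rw [div_self hθ'] at h3
    refine h3.congr' ?_
    filter_upwards [self_mem_nhdsWithin] with y hy
    have : y - c ≠ 0 := sub_ne_zero.2 hy
    simp only [Pi.div_apply, slope_def_field, hθ0, sub_zero, div_div_eq_mul_div]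
  set ψ : ℂ → S := fun z => e.symm (cexp (-(2 * Real.pi * σ * z))) with hψ
  have hσ2 : (σ : ℂ) * σ = 1 := by rcases hσ with rfl | rfl <;> simp
  have hσ2' : σ * σ = 1 := by rcases hσ with rfl | rfl <;> simp
  have hpi : (Real.pi : ℂ) ≠ 0 := by exact_mod_cast Real.pi_ne_zero
  have hσ0 : (σ : ℂ) ≠ 0 := fun h0 => by simp [h0] at hσ2
  -- pointwise comparison
  have key : ∀ᶠ ζ in endFilter 1, ∃ z₀ : ℂ,
      ‖θ (E ζ)‖ = Real.exp (-(2 * Real.pi * (σ * z₀.re))) ∧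
      wirt (fext f ∘ endMap p) ζ = wirt (fext f ∘ ψ) z₀ *
        (σ * (deriv θ (E ζ) * (E ζ - c) / θ (E ζ))) := by
    have hgood : ∀ᶠ y in 𝓝 c, AnalyticAt ℂ θ y ∧ y ∈ φ.target ∧ φ.symm y ∈ e.source := by
      refine hθa.eventually_analyticAt.and ((show ∀ᶠ y in 𝓝 c, y ∈ φ.target from
        φ.open_target.mem_nhds (mem_chart_target ℂ p)).and ?_)
      refine (φ.continuousAt_symm (mem_chart_target ℂ p)).eventually (e.open_source.mem_nhds ?_)
      rwa [φ.left_inv (mem_chart_source ℂ p)]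
    have hne : ∀ᶠ y in 𝓝[≠] c, θ y ≠ 0 := by
      have := hθa.differentiableAt.hasDerivAt.eventually_ne hθ' (c := 0)
      simpa using this
    have hR : ∀ᶠ ζ in endFilter 1, endR P p < ζ.re :=
      mem_endFilter.2 ⟨endR P p + 1, fun z hz => by
        simp only [one_mul] at hz
        change endR P p < z.re
        linarith⟩
    filter_upwards [hEt.eventually (hgood.filter_mono nhdsWithin_le_nhds), hEt.eventually hne, hR]
      with ζ ⟨g1, g2, g3⟩ hy' hζ
    set y' := θ (E ζ) with hy'def
    obtain ⟨ρ, τ, -, h3, h4⟩ := exists_cexp_neg_two_pi hy'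
    set z₀ : ℂ := σ * (ρ + τ * I) with hz₀
    have hz₀e : cexp (-(2 * Real.pi * σ * z₀)) = y' := by
      rw [← h3, hz₀]; congr 1; linear_combination (-(2 * Real.pi * (ρ + τ * I)) : ℂ) * hσ2
    have hz₀re : σ * z₀.re = ρ := by
      rw [hz₀, re_ofReal_mul, ← mul_assoc, hσ2']; simp
    refine ⟨z₀, by rw [hz₀re, h4], ?_⟩
    -- This is the local change between the two cylindrical coordinates. Dividing by `y'` inside the
    -- logarithm keeps its argument near `1`, and the branch is normalized by `Lf ζ = z₀`.
    let Lf : ℂ → ℂ := fun ζ₁ => z₀ - ((2 * Real.pi * σ : ℂ))⁻¹ * log (θ (E ζ₁) / y')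
    have hEa : HasDerivAt E (cexp (-(2 * Real.pi * ζ)) * (-(2 * Real.pi * 1))) ζ :=
      ((((hasDerivAt_id ζ).const_mul (2 * Real.pi : ℂ)).neg).cexp).const_add c
    have hθE : HasDerivAt (fun ζ₁ => θ (E ζ₁))
        (deriv θ (E ζ) * (cexp (-(2 * Real.pi * ζ)) * (-(2 * Real.pi * 1)))) ζ :=
      g1.differentiableAt.hasDerivAt.comp ζ hEa
    have hslit : θ (E ζ) / y' ∈ slitPlane := by
      rw [← hy'def, div_self hy']; exact one_mem_slitPlane
    have hLd := (((hθE.div_const y').clog hslit).const_mul ((2 * Real.pi * σ : ℂ)⁻¹)).const_sub z₀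
    have hLζ : Lf ζ = z₀ := by
      simp only [Lf]; rw [← hy'def, div_self hy']; simp
    have hev : fext f ∘ endMap p =ᶠ[𝓝 ζ] (fext f ∘ ψ) ∘ Lf := by
      have c1 : ∀ᶠ ζ₁ in 𝓝 ζ, θ (E ζ₁) ≠ 0 := hθE.continuousAt.eventually_ne hy'
      have c2 : ∀ᶠ ζ₁ in 𝓝 ζ, φ.symm (E ζ₁) ∈ e.source := by
        have : ContinuousAt (fun ζ₁ => φ.symm (E ζ₁)) ζ :=
          ContinuousAt.comp (g := φ.symm) (φ.continuousAt_symm g2) hEa.continuousAt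
        exact this.eventually (e.open_source.mem_nhds g3)
      filter_upwards [c1, c2] with ζ₁ h5 h6
      simp only [Function.comp_apply]
      congr 1
      simp only [hψ, Lf]
      have h7 : cexp (-(2 * Real.pi * σ * (z₀ - ((2 * Real.pi * σ : ℂ))⁻¹ * log (θ (E ζ₁) / y')))) =
          θ (E ζ₁) := by
        have h8 : -(2 * Real.pi * σ * (z₀ - ((2 * Real.pi * σ : ℂ))⁻¹ * log (θ (E ζ₁) / y')) : ℂ) =
            -(2 * Real.pi * σ * z₀) + log (θ (E ζ₁) / y') := by
          field_simp; ring
        rw [h8, exp_add, hz₀e, exp_log (div_ne_zero h5 hy'), mul_div_cancel₀ _ hy']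
      rw [h7]
      exact (e.left_inv h6).symm
    have hψdot : ψ z₀ ∈ P.dot := by
      have h5 : ψ z₀ = endMap p ζ := by
        simp only [hψ]
        rw [hz₀e, hy'def]
        exact e.left_inv g3
      rw [h5]
      exact endMap_mem_dot hζ
    have hψholo : HoloAt ψ z₀ := by
      have : HoloAt e.symm (cexp (-(2 * Real.pi * σ * z₀))) := by
        rw [hz₀e]
        exact holoAt_symm_of_mem_maximalAtlas he (e.map_source g3)
      exact this.comp_analyticAt (θ := fun z : ℂ => cexp (-(2 * Real.pi * σ * z))) (by fun_prop)
    have hdiff : DifferentiableAt ℝ (fext f ∘ ψ) (Lf ζ) := by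
      rw [hLζ]
      have h5 := fext_comp_eventuallyEq ⟨_, hψdot⟩ f hψholo.continuousAt hψdot
      exact ((contDiffAt_comp_holo hf (holoAt_dotLift _ hψholo hψdot)).differentiableAt
        (by simp)).congr_of_eventuallyEq h5
    have hLd' : HasDerivAt Lf _ ζ := hLd
    rw [wirt_congr hev, wirt_comp hdiff hLd', hLζ]
    congr 1
    have h9 : E ζ - c = cexp (-(2 * Real.pi * ζ)) := by simp [hE]
    rw [h9, ← hy'def]
    have hinv : (σ : ℂ)⁻¹ = σ := inv_eq_of_mul_eq_one_left hσ2
    rw [div_self hy', mul_inv, hinv]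
    field_simp
  have hLtend : Tendsto (fun ζ => (σ : ℂ) * (deriv θ (E ζ) * (E ζ - c) / θ (E ζ))) (endFilter 1)
      (𝓝 (σ * 1)) := (hratio.comp hEt).const_mul _
  choose! z₀ hz₀1 hz₀2 using fun ζ (hζ : ∃ z₀ : ℂ,
      ‖θ (E ζ)‖ = Real.exp (-(2 * Real.pi * (σ * z₀.re))) ∧
      wirt (fext f ∘ endMap p) ζ = wirt (fext f ∘ ψ) z₀ *
        (σ * (deriv θ (E ζ) * (E ζ - c) / θ (E ζ)))) => hζ
  have hz₀t : Tendsto z₀ (endFilter 1) (endFilter σ) := by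
    refine tendsto_comap_iff.2 (tendsto_atTop.2 fun B => ?_)
    have h1 : Tendsto (fun ζ => ‖θ (E ζ)‖) (endFilter 1) (𝓝 0) := by
      have h2 := (hθa.continuousAt.tendsto.mono_left nhdsWithin_le_nhds).comp hEt
      rw [hθ0] at h2
      simpa using h2.norm
    filter_upwards [h1.eventually_lt_const (Real.exp_pos (-(2 * Real.pi * B))), key] with ζ h2 h3
    rw [hz₀1 ζ h3, Real.exp_lt_exp] at h2
    have := Real.pi_pos
    simp only [Function.comp_apply]
    nlinarith
  have hfin := (h.comp hz₀t).mul hLtend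
  rw [HasSlope]
  refine (hfin.congr' ?_).trans (le_of_eq ?_)
  · filter_upwards [key] with ζ hζ using (hz₀2 ζ hζ).symm
  · push_cast; ring_nf

end Ends

/-! ### The slope of a potential at a puncture -/

section Slopes

open Set Filter Complex

variable {E : Type*} [NormedAddCommGroup E] [NormedSpace ℝ E] [FiniteDimensional ℝ E]
  {Q : Type*} [TopologicalSpace Q] [T2Space Q] [ChartedSpace E Q] [IsManifold 𝓘(ℝ, E) ∞ Q]
  {S : Type*} [TopologicalSpace S] [T2Space S] [ChartedSpace ℂ S] [IsManifold 𝓘(ℂ, ℂ) ω S]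
  {P : Punctures S}

/-- The derivative of a function along the Reeb vector field. -/
def ContactForm.reebDeriv (l : ContactForm E Q) (g : Q → ℝ) (q : Q) : ℝ :=
  mfderiv 𝓘(ℝ, E) 𝓘(ℝ, ℝ) g q (l.reeb q)

lemma ReebOrbit.hasFDerivAt_comp {l : ContactForm E Q} (γ : ReebOrbit E Q l)
    (g : C^∞⟮𝓘(ℝ, E), Q; 𝓘(ℝ, ℝ), ℝ⟯) (t₀ : ℝ) (z : ℂ) :
    HasFDerivAt (fun z : ℂ => g (γ.curve (γ.period * (z.im + t₀))))
      ((γ.period * l.reebDeriv g (γ.curve (γ.period * (z.im + t₀)))) • imCLM) z := by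
  set s := γ.period * (z.im + t₀) with hs
  have h1 := γ.isMIntegralCurve s
  have h2 : HasMFDerivAt 𝓘(ℝ, E) 𝓘(ℝ, ℝ) g (γ.curve s) (mfderiv 𝓘(ℝ, E) 𝓘(ℝ, ℝ) g (γ.curve s)) :=
    ((g.contMDiff _).mdifferentiableAt (by simp)).hasMFDerivAt
  have h3 : HasFDerivAt (g ∘ γ.curve) _ s := (h2.comp s h1).hasFDerivAt
  have h4 : HasFDerivAt (fun z : ℂ => γ.period * (z.im + t₀)) (γ.period • imCLM) z :=
    ((imCLM.hasFDerivAt).add_const t₀).const_mul γ.period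
  refine (HasFDerivAt.comp z h3 h4).congr_fderiv ?_
  ext v
  change (show E →L[ℝ] ℝ from mfderiv 𝓘(ℝ, E) 𝓘(ℝ, ℝ) g (γ.curve s))
    ((γ.period * v.im) • (show E from l.reeb (γ.curve s))) =
      (γ.period * (show E →L[ℝ] ℝ from mfderiv 𝓘(ℝ, E) 𝓘(ℝ, ℝ) g (γ.curve s))
        (show E from l.reeb (γ.curve s))) * v.im
  rw [map_smul, smul_eq_mul]; ring

lemma ReebOrbit.continuous {l : ContactForm E Q} (γ : ReebOrbit E Q l) : Continuous γ.curve :=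
  continuous_iff_continuousAt.2 fun s => (γ.isMIntegralCurve s).continuousAt

lemma exists_dotLift_end {e : OpenPartialHomeomorph S ℂ}
    {p : S} (hp : p ∈ e.source) (hp0 : e p = 0) (σ : ℝ) :
    ∀ᶠ z in endFilter σ, cexp (-(2 * Real.pi * σ * z)) ∈ e.target ∧
      e.symm (cexp (-(2 * Real.pi * σ * z))) ∈ P.dot := by
  have h0 : (0 : ℂ) ∈ e.target := hp0 ▸ e.map_source hp
  have hs0 : e.symm 0 = p := by rw [← hp0, e.left_inv hp]
  have h1 : ∀ᶠ y in 𝓝 (0 : ℂ), y ∈ e.target ∧ e.symm y ∈ insert p (P.dot : Set S) := by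
    refine (show ∀ᶠ y in 𝓝 (0 : ℂ), y ∈ e.target from e.open_target.mem_nhds h0).and
      ((e.continuousAt_symm h0).eventually ((P.isOpen_insert_dot p).mem_nhds ?_))
    rw [hs0]; exact mem_insert _ _
  filter_upwards [tendsto_cexp_endFilter.eventually h1] with z hz
  refine ⟨hz.1, hz.2.resolve_left fun h5 => ?_⟩
  have h6 := congrArg e h5
  rw [e.right_inv hz.1, hp0] at h6
  exact exp_ne_zero _ h6

lemma endFilter_neBot {σ : ℝ} (hσ : σ = 1 ∨ σ = -1) : (endFilter σ).NeBot := by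
  refine comap_neBot_iff_frequently.2 (Eventually.frequently (.of_forall fun x => ?_))
  exact ⟨((σ * x : ℝ) : ℂ), by rcases hσ with rfl | rfl <;> simp⟩

/-- The slope of a potential of a contact instanton is the (signed) period of its asymptotic
orbit. -/
lemma AsymptoticToOrbit.hasSlope {t : ContactTriad E Q} {w : P.dot → Q}
    (hw : ContMDiff 𝓘(ℝ, ℂ) 𝓘(ℝ, E) ∞ w) {f : P.dot → ℝ} (hf : ContMDiff 𝓘(ℝ, ℂ) 𝓘(ℝ, ℝ) ∞ f)
    (hwf : IsPotential t w f) {σ : ℝ} (hσ : σ = 1 ∨ σ = -1) {p : S}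
    {γ : ReebOrbit E Q t.toContactForm} (h : AsymptoticToOrbit P w σ p γ) :
    HasSlope f p (σ * γ.period) := by
  obtain ⟨e, he, hp, hp0, t₀, hasym⟩ := h
  refine hasSlope_of_chart hf he hp hp0 hσ ?_
  set T := γ.period with hT
  set ψ : ℂ → S := fun z => e.symm (cexp (-(2 * Real.pi * σ * z))) with hψ
  set H := fext f ∘ ψ with hH
  have := endFilter_neBot hσ
  have hend : ∀ᶠ z in endFilter σ, HoloAt ψ z ∧ ψ z ∈ P.dot := by
    filter_upwards [exists_dotLift_end (P := P) hp hp0 σ] with z hz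
    exact ⟨(holoAt_symm_of_mem_maximalAtlas he hz.1).comp_analyticAt
      (θ := fun z : ℂ => cexp (-(2 * Real.pi * σ * z))) (by fun_prop), hz.2⟩
  obtain ⟨zz, hzz⟩ := hend.exists
  set x₀ : P.dot := ⟨ψ zz, hzz.2⟩
  set κ := dotLift x₀ ψ with hκ
  set Γ : ℂ → Q := fun z => γ.curve (T * (z.im + t₀)) with hΓ
  have hΓc : Continuous Γ := γ.continuous.comp (by fun_prop)
  -- convergence of functions and differentials
  have hval : ∀ g : C^∞⟮𝓘(ℝ, E), Q; 𝓘(ℝ, ℝ), ℝ⟯,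
      Tendsto (fun z => g (w (κ z)) - g (Γ z)) (endFilter σ) (𝓝 0) := by
    intro g
    rw [Metric.tendsto_nhds]
    intro ε hε
    obtain ⟨R, hR⟩ := hasym g 0 ε hε
    filter_upwards [hend, mem_endFilter.2 ⟨R, fun z hz => hR z hz⟩] with z h1 h2
    have h3 := (fext_comp_eventuallyEq x₀ (fun x => g (w x)) h1.1.continuousAt h1.2).self_of_nhds
    rw [dist_zero_right]
    refine lt_of_eq_of_lt ?_ h2
    rw [norm_iteratedFDeriv_zero]
    exact congrArg (fun s : ℝ => ‖s - g (Γ z)‖) h3.symm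
  have hdiff : ∀ g : C^∞⟮𝓘(ℝ, E), Q; 𝓘(ℝ, ℝ), ℝ⟯, ∀ u : ℂ,
      Tendsto (fun z => fderiv ℝ (g ∘ w ∘ κ) z u - T * u.im *
        t.reebDeriv g (Γ z)) (endFilter σ) (𝓝 0) := by
    intro g u
    rw [Metric.tendsto_nhds]
    intro ε hε
    obtain ⟨R, hR⟩ := hasym g 1 (ε / (‖u‖ + 1)) (by positivity)
    filter_upwards [hend, mem_endFilter.2 ⟨R, fun z hz => hR z hz⟩] with z h1 h2
    have h3 := fext_comp_eventuallyEq x₀ (fun x => g (w x)) h1.1.continuousAt h1.2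
    have hd : DifferentiableAt ℝ (g ∘ w ∘ κ) z :=
      (contDiffAt_comp_holo (g.contMDiff.comp hw) (holoAt_dotLift x₀ h1.1 h1.2)).differentiableAt
        (by simp)
    have h4 : HasFDerivAt (fun z : ℂ => fext (fun x : P.dot => g (w x)) (ψ z) -
        g (γ.curve (γ.period * (z.im + t₀)))) _ z :=
      (hd.hasFDerivAt.congr_of_eventuallyEq h3).sub (γ.hasFDerivAt_comp g t₀ z)
    have h2' : ‖iteratedFDeriv ℝ 1 (fun z : ℂ => fext (fun x : P.dot => g (w x)) (ψ z) -
        g (γ.curve (γ.period * (z.im + t₀)))) z‖ < ε / (‖u‖ + 1) := h2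
    rw [norm_iteratedFDeriv_one, h4.fderiv] at h2'
    rw [dist_zero_right]
    have h5 := ContinuousLinearMap.le_opNorm (fderiv ℝ (g ∘ w ∘ κ) z -
      (T * t.reebDeriv g (Γ z)) • imCLM) u
    have h6 : (fderiv ℝ (g ∘ w ∘ κ) z -
      (T * t.reebDeriv g (Γ z)) • imCLM) u =
        fderiv ℝ (g ∘ w ∘ κ) z u - T * u.im *
        t.reebDeriv g (Γ z) := by
      simp only [sub_apply, smul_apply, imCLM_apply, smul_eq_mul]; ring
    rw [← h6]
    refine h5.trans_lt ?_
    calc _ ≤ ε / (‖u‖ + 1) * ‖u‖ := mul_le_mul_of_nonneg_right h2'.le (norm_nonneg _)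
      _ < ε / (‖u‖ + 1) * (‖u‖ + 1) := by
        apply mul_lt_mul_of_pos_left _ (by positivity); linarith
      _ = ε := div_mul_cancel₀ _ (by positivity)
  -- convergence near a point of the circle
  have hloc : ∀ s : ℝ, Tendsto (wirt H) (endFilter σ ⊓ comap im (𝓝 s)) (𝓝 (T : ℂ)) := by
    intro s
    set q := γ.curve (T * (s + t₀)) with hq
    -- The expression `λ = ∑ a dg` holds only near a point of the orbit. Convergence is therefore
    -- first shown along points of the end whose angle tends to `s`.
    obtain ⟨d, a, g, χ, hχ, hform⟩ := exists_local_expression t.toContactForm q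
    set F := endFilter σ ⊓ comap im (𝓝 s) with hF
    have hΓt : Tendsto Γ F (𝓝 q) := by
      have h1 : Tendsto im F (𝓝 s) := tendsto_comap.mono_left inf_le_right
      have h2 : Continuous fun x : ℝ => γ.curve (T * (x + t₀)) := γ.continuous.comp (by fun_prop)
      exact (h2.tendsto s).comp h1
    have hv : ∀ g : C^∞⟮𝓘(ℝ, E), Q; 𝓘(ℝ, ℝ), ℝ⟯, Tendsto (fun z => g (w (κ z))) F (𝓝 (g q)) := by
      intro g
      have h1 := ((hval g).mono_left (inf_le_left : F ≤ _)).add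
        ((g.contMDiff.continuous.tendsto q).comp hΓt)
      simpa using h1
    have hd : ∀ g : C^∞⟮𝓘(ℝ, E), Q; 𝓘(ℝ, ℝ), ℝ⟯, ∀ u : ℂ,
        Tendsto (fun z => fderiv ℝ (g ∘ w ∘ κ) z u) F
          (𝓝 (T * u.im * t.reebDeriv g q)) := by
      intro g u
      have h1 := ((hdiff g u).mono_left (inf_le_left : F ≤ _)).add
        (((show Tendsto (t.reebDeriv g) (𝓝 q) (𝓝 (t.reebDeriv g q)) from
          (t.continuousAt_mfderiv_reeb g q).tendsto).comp hΓt).const_mul (T * u.im))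
      simpa [Function.comp_def] using h1
    have hform1 : ∑ j, a j q * t.reebDeriv (g j) q = 1 := by
      rw [← (t.reeb_spec q).1]
      exact (hform q (by rw [hχ]; norm_num) (t.reeb q)).symm
    -- The differential of the potential is `∑ (a ∘ w) d(g ∘ w) ∘ j`. All factors converge to their
    -- values on the orbit, where the sum is `λ(R) = 1` times the period.
    have hlam : ∀ v : ℂ, Tendsto (fun z => fderiv ℝ H z v) F (𝓝 (T * v.re)) := by
      intro v
      have h1 : Tendsto (fun z => ∑ j, a j (w (κ z)) * fderiv ℝ (g j ∘ w ∘ κ) z (I * v)) F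
          (𝓝 (∑ j, a j q * (T * (I * v).im *
            t.reebDeriv (g j) q))) :=
        tendsto_finsetSum _ fun j _ => (hv (a j)).mul (hd (g j) (I * v))
      have h2 : ∑ j, a j q * (T * (I * v).im *
            t.reebDeriv (g j) q) = T * v.re := by
        have h3 : ∀ j, a j q * (T * (I * v).im *
            t.reebDeriv (g j) q) = T * v.re *
            (a j q * t.reebDeriv (g j) q) := by
          intro j; simp; ring
        rw [Finset.sum_congr rfl fun j _ => h3 j, ← Finset.mul_sum, hform1, mul_one]
      rw [h2] at h1
      refine h1.congr' ?_
      have hχ' : ∀ᶠ z in F, 1 / 2 < χ (w (κ z)) :=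
        (hv χ).eventually_const_lt (by rw [hχ]; norm_num)
      filter_upwards [hχ', mem_inf_of_left hend] with z h4 h5
      have h6 := holoAt_dotLift x₀ h5.1 h5.2
      rw [(fext_comp_eventuallyEq x₀ f h5.1.continuousAt h5.2).fderiv_eq,
        hwf.fderiv_comp hw hf h6 v]
      refine ((hform _ h4 _).trans (Finset.sum_congr rfl fun j _ => ?_)).symm
      congr 1
      have h7 : MDifferentiableAt 𝓘(ℝ, ℂ) 𝓘(ℝ, E) (w ∘ κ) z :=
        ((hw _).comp z h6.contMDiffAt_real).mdifferentiableAt (by simp)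
      have h8 : MDifferentiableAt 𝓘(ℝ, E) 𝓘(ℝ, ℝ) (g j) ((w ∘ κ) z) :=
        ((g j).contMDiff _).mdifferentiableAt (by simp)
      have h9 := mfderiv_comp z h8 h7
      rw [mfderiv_eq_fderiv] at h9
      rw [show (⇑(g j) ∘ w ∘ κ) = g j ∘ (w ∘ κ) from rfl]
      exact (congrArg (fun L : ℂ →L[ℝ] ℝ => L (I * v)) h9).symm
    have h1 := ((continuous_ofReal.tendsto _).comp (hlam 1)).sub
      (((continuous_ofReal.tendsto _).comp (hlam I)).const_mul I)
    simpa [wirt, Function.comp_def, funext_iff] using! h1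
  -- uniformity
  have hper : ∀ (n : ℤ) z, H (z + n * I) = H z := by
    intro n z
    simp only [hH, hψ, Function.comp_apply]
    congr 2
    rw [exp_eq_exp_iff_exists_int]
    rcases hσ with rfl | rfl
    · exact ⟨-n, by push_cast; ring⟩
    · exact ⟨n, by push_cast; ring⟩
  have hperw : ∀ (n : ℤ) z, wirt H (z + n * I) = wirt H z := by
    intro n z
    have h1 : (fun y => H (y + n * I)) = H := funext (hper n)
    simp only [wirt]
    rw [← fderiv_comp_add_right (𝕜 := ℝ) (f := H) (x := z) (n * I : ℂ), h1]
  rw [Metric.tendsto_nhds]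
  intro ε hε
  -- Finitely many angular neighbourhoods cover the compact interval of one period, and periodicity
  -- of `H` handles all other angles.
  have hK : ∀ᶠ z in endFilter σ, z.im ∈ Icc (0 : ℝ) 1 → dist (wirt H z) T < ε := by
    refine isCompact_Icc.induction_on
      (p := fun s => ∀ᶠ z in endFilter σ, z.im ∈ s → dist (wirt H z) T < ε) (by simp)
      (fun s s' hs h => h.mono fun z hz hz' => hz (hs hz'))
      (fun s s' h h' => by filter_upwards [h, h'] with z hz hz' h using h.elim hz hz') ?_
    intro s _
    obtain ⟨U, hU, V, hV, hUV⟩ := mem_inf_iff_superset.1 (Metric.tendsto_nhds.1 (hloc s) ε hε)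
    obtain ⟨V', hV', hVV⟩ := mem_comap.1 hV
    refine ⟨V', mem_nhdsWithin_of_mem_nhds hV', ?_⟩
    filter_upwards [hU] with z hz hz' using hUV ⟨hz, hVV hz'⟩
  obtain ⟨R, hR⟩ := mem_endFilter.1 hK
  refine mem_endFilter.2 ⟨R, fun z hz => ?_⟩
  have h1 := hR (z + (-⌊z.im⌋ : ℤ) * I) (by simpa using hz) (by
    have h2 := Int.floor_le z.im
    have h3 := (Int.lt_floor_add_one z.im).le
    simp only [add_im, mul_im, intCast_re, intCast_im, I_re, I_im, mul_one, mul_zero, add_zero]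
    push_cast
    constructor <;> linarith)
  rw [hperw] at h1
  exact h1

end Slopes

/-! ### Maximum principles on Riemann surfaces -/

section MaxPrinciple

open Set Filter Laplacian

variable {X : Type*} [TopologicalSpace X] [ChartedSpace ℂ X] [IsManifold 𝓘(ℂ, ℂ) ω X]

lemma two_le_infty : (2 : WithTop ℕ∞) ≤ (∞ : WithTop ℕ∞) := WithTop.coe_le_coe.2 le_top

/-- Subharmonic functions on a Riemann surface. -/
def Subharm (f : X → ℝ) : Prop := ∀ (κ : ℂ → X) (y : ℂ), HoloAt κ y → 0 ≤ Δ (f ∘ κ) y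

/-- Harmonic functions on a Riemann surface. -/
def Harm (f : X → ℝ) : Prop := ∀ (κ : ℂ → X) (y : ℂ), HoloAt κ y → Δ (f ∘ κ) y = 0

lemma Subharm.sub_harm {f g : X → ℝ} (hf : ContMDiff 𝓘(ℝ, ℂ) 𝓘(ℝ, ℝ) ∞ f)
    (hg : ContMDiff 𝓘(ℝ, ℂ) 𝓘(ℝ, ℝ) ∞ g) (h : Subharm f) (h' : Harm g) :
    Subharm (fun x => f x - g x) := by
  intro κ y hκ
  have h1 : ContDiffAt ℝ 2 (f ∘ κ) y := (contDiffAt_comp_holo hf hκ).of_le two_le_infty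
  have h2 : ContDiffAt ℝ 2 (g ∘ κ) y := (contDiffAt_comp_holo hg hκ).of_le two_le_infty
  have h3 : Δ ((fun x => f x - g x) ∘ κ) y = Δ (f ∘ κ) y - Δ (g ∘ κ) y := h1.laplacian_sub h2
  rw [h3, h' κ y hκ, sub_zero]
  exact h κ y hκ

/-- A neighbourhood of a point of a Riemann surface, as the image of a disc. -/
lemma exists_chart_ball (x : X) : ∃ r > 0, Metric.ball (chartAt ℂ x x) r ⊆ (chartAt ℂ x).target ∧
    ∀ᶠ x' in 𝓝 x, ∃ y ∈ Metric.ball (chartAt ℂ x x) r, (chartAt ℂ x).symm y = x' := by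
  obtain ⟨r, hr, h⟩ := Metric.isOpen_iff.1 (chartAt ℂ x).open_target _ (mem_chart_target ℂ x)
  refine ⟨r, hr, h, ?_⟩
  filter_upwards [(chartAt ℂ x).open_source.mem_nhds (mem_chart_source ℂ x),
    ((chartAt ℂ x).continuousAt (mem_chart_source ℂ x)).eventually (Metric.ball_mem_nhds _ hr)]
    with x' h1 h2 using ⟨_, h2, (chartAt ℂ x).left_inv h1⟩

lemma eq_of_fderiv_chart_eq_zero [PreconnectedSpace X] {g : X → ℝ}
    (hg : ContMDiff 𝓘(ℝ, ℂ) 𝓘(ℝ, ℝ) ∞ g)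
    (h : ∀ (κ : ℂ → X) (y : ℂ), HoloAt κ y → fderiv ℝ (g ∘ κ) y = 0) (x x' : X) : g x = g x' := by
  refine IsLocallyConstant.apply_eq_of_preconnectedSpace
    ((IsLocallyConstant.iff_eventually_eq g).2 fun x => ?_) x x'
  obtain ⟨r, hr, hsub, hev⟩ := exists_chart_ball x
  filter_upwards [hev] with x' ⟨y, hy, hy'⟩
  have h1 : ∀ y ∈ Metric.ball (chartAt ℂ x x) r, HoloAt (chartAt ℂ x).symm y := fun y hy =>
    holoAt_chartAt_symm x (hsub hy)
  have h2 := (convex_ball (chartAt ℂ x x) r).is_const_of_fderivWithin_eq_zero (𝕜 := ℝ)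
    (f := g ∘ (chartAt ℂ x).symm)
    (fun y hy => ((contDiffAt_comp_holo hg (h1 y hy)).differentiableAt
      (by simp)).differentiableWithinAt)
    (fun y hy => by rw [fderivWithin_of_isOpen Metric.isOpen_ball hy, h _ _ (h1 y hy)])
    hy (Metric.mem_ball_self hr)
  rw [← hy']
  simpa using h2

/-- The set of maximum points is closed by continuity and open by the statement for discs, applied
in a chart centred at such a point. -/
lemma Subharm.eq_of_isMax [PreconnectedSpace X] {g : X → ℝ} (hg : ContMDiff 𝓘(ℝ, ℂ) 𝓘(ℝ, ℝ) ∞ g)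
    (h : Subharm g) {x₀ : X} (hmax : ∀ x, g x ≤ g x₀) (x : X) : g x = g x₀ := by
  have hcl : IsClosed {x | g x = g x₀} := isClosed_eq hg.continuous continuous_const
  have ho : IsOpen {x | g x = g x₀} := by
    refine isOpen_iff_mem_nhds.2 fun x hx => ?_
    obtain ⟨r, hr, hsub, hev⟩ := exists_chart_ball x
    filter_upwards [hev] with x' ⟨y, hy, hy'⟩
    have h1 : ∀ y ∈ Metric.ball (chartAt ℂ x x) r, HoloAt (chartAt ℂ x).symm y := fun y hy =>
      holoAt_chartAt_symm x (hsub hy)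
    have hc : (g ∘ (chartAt ℂ x).symm) (chartAt ℂ x x) = g x₀ := by simpa using hx
    have h2 := eq_of_isMax_center (F := g ∘ (chartAt ℂ x).symm) (c := chartAt ℂ x x) (r := r)
      (fun y hy => ((contDiffAt_comp_holo hg (h1 y hy)).of_le
        two_le_infty).contDiffWithinAt)
      (fun y hy => h _ _ (h1 y hy)) (fun y _ => by rw [hc]; exact hmax _) hy
    rw [hc] at h2
    rw [← hy']
    exact h2
  have := IsClopen.eq_univ ⟨hcl, ho⟩ ⟨x₀, rfl⟩
  exact (this ▸ mem_univ x : x ∈ {x | g x = g x₀})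

end MaxPrinciple

/-! ### The punctured surface, its ends, and the comparison of functions with equal slopes -/

section Punctured

open Set Filter Laplacian Complex

variable {S : Type*} [TopologicalSpace S] [T2Space S] [ChartedSpace ℂ S] [IsManifold 𝓘(ℂ, ℂ) ω S]
  {P : Punctures S}

lemma eventually_endFilter_gt (R : ℝ) : ∀ᶠ ζ in endFilter 1, R < ζ.re :=
  mem_endFilter.2 ⟨R + 1, fun z hz => by
    simp only [one_mul] at hz
    change R < z.re
    linarith⟩

variable (P) in
lemma nonempty_dot [Nonempty S] : Nonempty P.dot := by
  obtain ⟨p⟩ := ‹Nonempty S›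
  exact ⟨⟨endMap p ((endR P p + 1 : ℝ) : ℂ), endMap_mem_dot (by simp)⟩⟩

/-- A punctured neighbourhood of a puncture contains the image of a half-plane that fills a smaller
one, so a continuous two-valued function is constant near the puncture. It thus has a locally
constant extension to the connected closed surface. -/
lemma preconnectedSpace_dot [PreconnectedSpace S] : PreconnectedSpace P.dot := by
  refine preconnectedSpace_of_forall_constant fun b hb x y => ?_
  let A : Bool → Set S := fun v => {p | ∀ᶠ z in 𝓝 p, ∀ h : z ∈ P.dot, b ⟨z, h⟩ = v}
  have hAo : ∀ v, IsOpen (A v) := fun v => isOpen_iff_mem_nhds.2 fun p hp =>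
    eventually_eventually_nhds.2 hp
  have hcov : ∀ p, ∃ v, p ∈ A v := by
    intro p
    by_cases hp : p ∈ P.dot
    · refine ⟨b ⟨p, hp⟩, ?_⟩
      have h1 : ∀ᶠ z in 𝓝 (⟨p, hp⟩ : P.dot), b z = b ⟨p, hp⟩ :=
        hb.continuousAt.eventually (p := fun v => v = b ⟨p, hp⟩) (by rw [nhds_discrete]; exact rfl)
      rw [nhds_subtype, eventually_comap] at h1
      filter_upwards [h1] with z hz h using hz _ rfl
    · set U : Set ℂ := {ζ : ℂ | endR P p < ζ.re}
      have hU : IsPreconnected U := (convex_halfSpace_re_gt _).isPreconnected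
      let m : U → P.dot := fun ζ => ⟨endMap p ζ, endMap_mem_dot ζ.2⟩
      have hm : Continuous m := by
        refine Continuous.subtype_mk (continuous_iff_continuousAt.2 fun ζ => ?_) _
        exact ContinuousAt.comp (g := endMap p) (holoAt_endMap (P := P) ζ.2).continuousAt
          continuousAt_subtype_val
      have : PreconnectedSpace U := isPreconnected_iff_preconnectedSpace.1 hU
      obtain ⟨v, hv⟩ : ∃ v, ∀ ζ, b (m ζ) = v := by
        have h0 : ((endR P p + 1 : ℝ) : ℂ) ∈ U := by simp [U]
        exact ⟨b (m ⟨_, h0⟩), fun ζ => PreconnectedSpace.constant ‹_› (hb.comp hm)⟩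
      refine ⟨v, ?_⟩
      filter_upwards [endMap_nhds p (endR P p)] with z hz h
      obtain ⟨ζ, h1, -, h2⟩ := hz fun h' => hp (h' ▸ h)
      rw [← hv ⟨ζ, h1⟩]
      exact congrArg b (Subtype.ext h2.symm)
  -- Points of the end accumulate at `p`, so the value near `p` is unambiguous also when `p` is a
  -- puncture.
  have hdisj : ∀ p, p ∈ A true → p ∈ A false → False := by
    intro p h1 h2
    have : (endFilter 1).NeBot := endFilter_neBot (.inl rfl)
    obtain ⟨ζ, ⟨h3, h4⟩, h5⟩ := (((tendsto_endMap p).eventually (h1.and h2)).and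
      (eventually_endFilter_gt (endR P p))).exists
    have h6 := endMap_mem_dot h5
    have := (h3 h6).symm.trans (h4 h6)
    contradiction
  have hcl : IsClopen (A true) := by
    refine ⟨⟨?_⟩, hAo _⟩
    convert hAo false
    ext p
    refine ⟨fun h => ?_, fun h h' => hdisj p h' h⟩
    obtain ⟨v, hv⟩ := hcov p
    cases v
    · exact hv
    · exact (h hv).elim
  have hval : ∀ v (x : P.dot), (x : S) ∈ A v → b x = v := fun v x hx => hx.self_of_nhds x.2
  rcases isClopen_iff.1 hcl with h | h
  · have h1 : ∀ p, p ∈ A false := fun p => by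
      obtain ⟨v, hv⟩ := hcov p
      cases v
      · exact hv
      · rw [h] at hv; exact hv.elim
    rw [hval _ x (h1 x), hval _ y (h1 y)]
  · have h1 : ∀ p, p ∈ A true := fun p => h ▸ mem_univ p
    rw [hval _ x (h1 x), hval _ y (h1 y)]

/-- The cylindrical coordinate at `p`, as a map to the punctured surface. -/
def endLift (x₀ : P.dot) (p : S) : ℂ → P.dot := dotLift x₀ (endMap p)

lemma coe_endLift (x₀ : P.dot) {p : S} {ζ : ℂ} (h : endR P p < ζ.re) :
    (endLift x₀ p ζ : S) = endMap p ζ := coe_dotLift x₀ (endMap_mem_dot h)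

lemma holoAt_endLift (x₀ : P.dot) {p : S} {ζ : ℂ} (h : endR P p < ζ.re) :
    HoloAt (endLift x₀ p) ζ := holoAt_dotLift x₀ (holoAt_endMap (P := P) h) (endMap_mem_dot h)

lemma fext_comp_endMap (x₀ : P.dot) (f : P.dot → ℝ) {p : S} {ζ : ℂ} (h : endR P p < ζ.re) :
    fext f ∘ endMap p =ᶠ[𝓝 ζ] f ∘ endLift x₀ p :=
  fext_comp_eventuallyEq x₀ f (holoAt_endMap (P := P) h).continuousAt (endMap_mem_dot h)

lemma endLift_add_I (x₀ : P.dot) {p : S} {ζ : ℂ} (h : endR P p < ζ.re) :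
    endLift x₀ p (ζ + I) = endLift x₀ p ζ :=
  Subtype.ext (by rw [coe_endLift x₀ (by simpa using h), coe_endLift x₀ h, endMap_add_I])

lemma contDiffOn_comp_endLift (x₀ : P.dot) {f : P.dot → ℝ} (hf : ContMDiff 𝓘(ℝ, ℂ) 𝓘(ℝ, ℝ) ∞ f)
    (p : S) : ContDiffOn ℝ ∞ (f ∘ endLift x₀ p) {z | endR P p < z.re} :=
  fun _ hζ => (contDiffAt_comp_holo hf (holoAt_endLift x₀ hζ)).contDiffWithinAt

lemma HasSlope.tendsto_endLift (x₀ : P.dot) {f : P.dot → ℝ} {p : S} {a : ℝ} (h : HasSlope f p a) :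
    Tendsto (wirt (f ∘ endLift x₀ p)) (endFilter 1) (𝓝 (a : ℂ)) := by
  refine Tendsto.congr' ?_ h
  filter_upwards [eventually_endFilter_gt (endR P p)] with ζ hζ
  exact wirt_congr (fext_comp_endMap x₀ f hζ)

/-- The punctured surface is the union of a compact set and of half-cylinders at the punctures. -/
lemma exists_compact_core [CompactSpace S] (P : Punctures S) (ρ : S → ℝ) :
    ∃ K : Set P.dot, IsCompact K ∧ ∀ x : P.dot, x ∈ K ∨
      ∃ p ∉ P.dot, ∃ ζ : ℂ, ρ p < ζ.re ∧ ζ.im ∈ Ico (0 : ℝ) 1 ∧ endMap p ζ = x := by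
  have h1 : ∀ p : S, ∃ U : Set S, IsOpen U ∧ p ∈ U ∧
      ∀ x ∈ U, x ≠ p → ∃ ζ : ℂ, ρ p < ζ.re ∧ ζ.im ∈ Ico (0 : ℝ) 1 ∧ endMap p ζ = x := by
    intro p
    obtain ⟨U, hU, hUo, hp⟩ := mem_nhds_iff.1 (endMap_nhds p (ρ p))
    exact ⟨U, hUo, hp, fun x hx => hU hx⟩
  choose U hUo hpU hU using h1
  have hK : IsCompact (⋃ p ∈ {p : S | p ∉ P.dot}, U p)ᶜ :=
    (isOpen_biUnion fun p _ => hUo p).isClosed_compl.isCompact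
  refine ⟨Subtype.val ⁻¹' (⋃ p ∈ {p : S | p ∉ P.dot}, U p)ᶜ, ?_, fun x => ?_⟩
  · refine Topology.IsInducing.subtypeVal.isCompact_preimage' hK fun x hx => ?_
    refine ⟨⟨x, ?_⟩, rfl⟩
    by_contra h
    exact hx (mem_biUnion (show x ∈ {p : S | p ∉ P.dot} from h) (hpU x))
  · by_cases hx : (x : S) ∈ ⋃ p ∈ {p : S | p ∉ P.dot}, U p
    · obtain ⟨p, hp, hxp⟩ := mem_iUnion₂.1 hx
      obtain ⟨ζ, h⟩ := hU p x hxp fun h => hp (h ▸ x.2)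
      exact .inr ⟨p, hp, ζ, h⟩
    · exact .inl hx

lemma finite_punctures (P : Punctures S) : {p : S | p ∉ P.dot}.Finite := by
  refine (P.pos.finite_toSet.union P.neg.finite_toSet).subset fun p hp => ?_
  by_contra h
  simp only [mem_union, not_or] at h
  exact hp ⟨h.1, h.2⟩

/-- A compact part of the half-cylinder at `p`. -/
lemma isCompact_endLift_image (x₀ : P.dot) (p : S) {a b : ℝ} (h : endR P p < a) :
    IsCompact (endLift x₀ p '' {ζ : ℂ | ζ.re ∈ Icc a b ∧ ζ.im ∈ Icc (0 : ℝ) 1}) := by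
  refine IsCompact.image_of_continuousOn ?_ fun ζ hζ => ?_
  · have := (isCompact_Icc (a := a) (b := b)).reProdIm (isCompact_Icc (a := (0 : ℝ)) (b := 1))
    exact this
  · exact (holoAt_endLift x₀ (h.trans_le hζ.1.1)).continuousAt.continuousWithinAt

/-- A subharmonic function and a harmonic function with the same slopes differ by a constant. -/
lemma Subharm.sub_harm_const [CompactSpace S] [ConnectedSpace S] {f g : P.dot → ℝ}
    (hf : ContMDiff 𝓘(ℝ, ℂ) 𝓘(ℝ, ℝ) ∞ f) (hg : ContMDiff 𝓘(ℝ, ℂ) 𝓘(ℝ, ℝ) ∞ g) (h : Subharm f)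
    (h' : Harm g) {a : S → ℝ} (hfa : ∀ p ∉ P.dot, HasSlope f p (a p))
    (hga : ∀ p ∉ P.dot, HasSlope g p (a p)) (x x' : P.dot) : f x - g x = f x' - g x' := by
  obtain ⟨x₀⟩ := nonempty_dot P
  have := preconnectedSpace_dot (P := P)
  set u : P.dot → ℝ := fun x => f x - g x with hu
  have huc : ContMDiff 𝓘(ℝ, ℂ) 𝓘(ℝ, ℝ) ∞ u := hf.sub hg
  have hus : Subharm u := h.sub_harm hf hg h'
  obtain ⟨K, hK, hcov⟩ := exists_compact_core P fun p => endR P p + 1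
  set C : S → Set P.dot := fun p => endLift x₀ p ''
    {ζ : ℂ | ζ.re ∈ Icc (endR P p + 1) (endR P p + 1) ∧ ζ.im ∈ Icc (0 : ℝ) 1} with hC
  -- The difference has slope zero at every puncture, so on each end it is bounded by its values on
  -- the bounding circle. The maximum over this compact set, made nonempty by `x₀`, is therefore
  -- global.
  set K' := insert x₀ (K ∪ ⋃ p ∈ {p : S | p ∉ P.dot}, C p) with hK'
  have hKc : IsCompact K' := (hK.union ((finite_punctures P).isCompact_biUnion fun p _ =>
    isCompact_endLift_image x₀ p (by linarith))).insert x₀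
  obtain ⟨x₁, hx₁, hmax⟩ := hKc.exists_isMaxOn ⟨x₀, mem_insert _ _⟩ huc.continuous.continuousOn
  have hle : ∀ x, u x ≤ u x₁ := by
    intro x
    rcases hcov x with hx | ⟨p, hp, ζ, hζ, -, hζx⟩
    · exact hmax (.inr (.inl hx))
    have hR : endR P p < endR P p + 1 := by linarith
    have h2 := contDiffOn_comp_endLift x₀ huc p
    have hζ' : endLift x₀ p ζ = x := Subtype.ext (by rw [coe_endLift x₀ (hR.trans hζ), hζx])
    have hper : ∀ z : ℂ, endR P p < z.re →
        (u ∘ endLift x₀ p) (z + I) = (u ∘ endLift x₀ p) z := fun z hz => by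
      simp only [Function.comp_apply, endLift_add_I x₀ hz]
    rw [← hζ']
    refine le_of_boundary_le (G := u ∘ endLift x₀ p) (ρ₁ := endR P p + 1)
      (h2.of_le two_le_infty) hper
      (fun z hz => hus _ _ (holoAt_endLift x₀ hz)) ?_ hR ?_ hζ.le
    · intro ε hε
      have h3 := ((hfa p hp).tendsto_endLift x₀).sub ((hga p hp).tendsto_endLift x₀)
      rw [sub_self] at h3
      obtain ⟨R, hR⟩ := mem_endFilter.1 ((Metric.tendsto_nhds.1 h3 ε hε).and
        (eventually_endFilter_gt (endR P p)))
      refine ⟨R, fun z hz => ?_⟩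
      obtain ⟨h4, h5⟩ := hR z (by simpa using hz.le)
      have h6 := holoAt_endLift x₀ h5
      have h7 := wirt_sub ((contDiffAt_comp_holo hf h6).differentiableAt (by simp))
        ((contDiffAt_comp_holo hg h6).differentiableAt (by simp))
      rw [dist_zero_right, ← h7] at h4
      exact h4
    · intro z hz
      have h8 : z + (-⌊z.im⌋ : ℤ) * I ∈
          {ζ : ℂ | ζ.re ∈ Icc (endR P p + 1) (endR P p + 1) ∧ ζ.im ∈ Icc (0 : ℝ) 1} := by
        have h2 := Int.floor_le z.im
        have h3 := (Int.lt_floor_add_one z.im).le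
        simp only [Set.mem_ofPred_eq, add_re, mul_re, add_im, mul_im, intCast_re, intCast_im, I_re,
          I_im, mul_one, mul_zero, add_zero, sub_zero, hz]
        push_cast
        exact ⟨⟨le_rfl, le_rfl⟩, by linarith, by linarith⟩
      have h9 : endLift x₀ p (z + (-⌊z.im⌋ : ℤ) * I) = endLift x₀ p z := by
        have hz1 : endR P p < z.re := by rw [hz]; linarith
        refine Subtype.ext ?_
        rw [coe_endLift x₀ (by simpa using hz1), coe_endLift x₀ hz1]
        exact (endMap_eq_iff (P := P) (by simpa using hz1) hz1).2 ⟨-⌊z.im⌋, by ring⟩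
      rw [Function.comp_apply, ← h9]
      exact hmax (.inr (.inr (mem_biUnion (show p ∈ {p : S | p ∉ P.dot} from hp) ⟨_, h8, rfl⟩)))
  rw [show f x - g x = u x from rfl, show f x' - g x' = u x' from rfl,
    hus.eq_of_isMax huc hle x, hus.eq_of_isMax huc hle x']

end Punctured

/-! ### Subharmonicity of contact instanton potentials on a surface -/

section Potentials

open Set Filter Laplacian Complex

variable {E : Type*} [NormedAddCommGroup E] [NormedSpace ℝ E]
  {Q : Type*} [TopologicalSpace Q] [ChartedSpace E Q] [IsManifold 𝓘(ℝ, E) ∞ Q]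
  {X : Type*} [TopologicalSpace X] [ChartedSpace ℂ X] [IsManifold 𝓘(ℂ, ℂ) ω X]

lemma IsPotential.subharm [FiniteDimensional ℝ E] {t : ContactTriad E Q} {w : X → Q} {f : X → ℝ}
    (h : IsPotential t w f) (hCR : IsContactCauchyRiemann t w)
    (hw : ContMDiff 𝓘(ℝ, ℂ) 𝓘(ℝ, E) ∞ w) (hf : ContMDiff 𝓘(ℝ, ℂ) 𝓘(ℝ, ℝ) ∞ f) : Subharm f :=
  fun _ _ hκ => h.laplacian_comp_nonneg hCR hw hf hκ

end Potentials

/-! ### Local inverses of injective holomorphic maps -/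

section LocalInverse

open Set Filter Complex

/-- At a critical point `g w - g z` is a constant times the power `p w ^ n` of a local coordinate
with `n ≥ 2`. Two small values of `p` that differ by an `n`-th root of unity then contradict
injectivity. -/
lemma deriv_ne_zero_of_injOn {g : ℂ → ℂ} {z : ℂ} (hg : AnalyticAt ℂ g z) {U : Set ℂ} (hU : U ∈ 𝓝 z)
    (hinj : InjOn g U) : deriv g z ≠ 0 := by
  intro h0
  have hG : AnalyticAt ℂ (fun w => g w - g z) z := hg.sub analyticAt_const
  have hnc : ¬ ∀ᶠ w in 𝓝 z, g w - g z = 0 := by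
    intro h
    obtain ⟨w, ⟨h1, h2⟩, h3⟩ := (((h.and hU).filter_mono nhdsWithin_le_nhds).and
      (self_mem_nhdsWithin : {z}ᶜ ∈ 𝓝[≠] z)).exists
    exact h3 (hinj h2 (mem_of_mem_nhds hU) (sub_eq_zero.1 h1))
  obtain ⟨n, u, hu, hu0, hn⟩ := hG.exists_eventuallyEq_pow_smul_nonzero_iff.2 hnc
  have hn0 : n ≠ 0 := by
    rintro rfl
    have := hn.self_of_nhds
    simp at this
    exact hu0 this.symm
  have hn1 : n ≠ 1 := by
    rintro rfl
    have h1 : HasDerivAt (fun w => (w - z) ^ 1 • u w) (u z) z := by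
      have := ((hasDerivAt_id z).sub_const z).mul hu.differentiableAt.hasDerivAt
      simpa using! this
    have h2 : HasDerivAt (fun w => g w - g z) (deriv g z) z :=
      hg.differentiableAt.hasDerivAt.sub_const _
    have h3 := (h1.congr_of_eventuallyEq hn).unique h2
    exact hu0 (h3.trans h0)
  -- The principal branch of an `n`-th root of `u / u z` is analytic near `z`, because the quotient
  -- is near `1` there.
  set v : ℂ → ℂ := fun w => cexp (log (u w / u z) / n) with hv
  have hslit : u z / u z ∈ slitPlane := by rw [div_self hu0]; exact one_mem_slitPlane
  have hva : AnalyticAt ℂ v z := by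
    have h1 : AnalyticAt ℂ (fun w => u w / u z) z := hu.div analyticAt_const hu0
    exact ((h1.clog hslit).div analyticAt_const (by exact_mod_cast hn0)).cexp
  have hvz : v z = 1 := by simp [hv, div_self hu0]
  have hvn : ∀ᶠ w in 𝓝 z, v w ^ n = u w / u z := by
    filter_upwards [hu.continuousAt.eventually_ne hu0] with w hw
    rw [hv, ← Complex.exp_nat_mul, mul_div_cancel₀ _ (by exact_mod_cast hn0),
      exp_log (div_ne_zero hw hu0)]
  set p : ℂ → ℂ := fun w => (w - z) * v w with hp
  have hpa : AnalyticAt ℂ p z := (analyticAt_id.sub analyticAt_const).mul hva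
  have hpd : HasStrictDerivAt p 1 z := by
    have h1 := ((hasDerivAt_id z).sub_const z).mul hva.differentiableAt.hasDerivAt
    have h2 : deriv p z = 1 := by
      have h3 : HasDerivAt p _ z := h1
      rw [h3.deriv]; simp [hvz]
    have := hpa.hasStrictDerivAt
    rwa [h2] at this
  have hpG : ∀ᶠ w in 𝓝 z, g w - g z = p w ^ n * u z := by
    filter_upwards [hn, hvn] with w h1 h2
    rw [h1, hp, mul_pow, h2, smul_eq_mul]; field_simp
  have hopen := hpd.map_nhds_eq one_ne_zero
  -- The coordinate `p` is open at `z`, so all small complex numbers are values of `p` at points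
  -- where `g` is injective and the factorization holds.
  have hV : p '' (U ∩ {w | g w - g z = p w ^ n * u z}) ∈ 𝓝 (0 : ℂ) := by
    have h1 := image_mem_map (m := p) (inter_mem hU hpG)
    rw [hopen] at h1
    simpa [hp] using h1
  obtain ⟨r, hr, hball⟩ := Metric.mem_nhds_iff.1 hV
  set ζ : ℂ := cexp (2 * Real.pi * I / n) with hζ
  have hprim := Complex.isPrimitiveRoot_exp n hn0
  have hζ1 : ζ ≠ 1 := hprim.ne_one (by omega)
  have hζn : ζ ^ n = 1 := hprim.pow_eq_one
  have hζnorm : ‖ζ‖ = 1 := norm_eq_one_of_pow_eq_one hζn hn0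
  have hη0 : ((r / 2 : ℝ) : ℂ) ≠ 0 := by exact_mod_cast (by positivity)
  have hηn : ‖((r / 2 : ℝ) : ℂ)‖ = r / 2 := by rw [norm_real, Real.norm_of_nonneg (by positivity)]
  obtain ⟨w₁, ⟨hw₁U, hw₁⟩, he₁⟩ := hball (show ((r / 2 : ℝ) : ℂ) ∈ Metric.ball 0 r by
    rw [mem_ball_zero_iff, hηn]; linarith)
  obtain ⟨w₂, ⟨hw₂U, hw₂⟩, he₂⟩ := hball (show ζ * ((r / 2 : ℝ) : ℂ) ∈ Metric.ball 0 r by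
    rw [mem_ball_zero_iff, norm_mul, hζnorm, hηn]; linarith)
  have h1 : g w₁ = g w₂ := by
    have h2 : g w₁ - g z = p w₁ ^ n * u z := hw₁
    have h3 : g w₂ - g z = p w₂ ^ n * u z := hw₂
    rw [he₁] at h2
    rw [he₂, mul_pow, hζn, one_mul, ← h2] at h3
    linear_combination -h3
  have h2 := hinj hw₁U hw₂U h1
  rw [h2, he₂] at he₁
  exact hζ1 (mul_right_cancel₀ hη0 (by rw [he₁, one_mul]))

variable {X : Type*} [TopologicalSpace X] [ChartedSpace ℂ X] [IsManifold 𝓘(ℂ, ℂ) ω X]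

/-- Locally injective holomorphic maps have local holomorphic sections. -/
lemma HoloAt.exists_local_section {ψ : ℂ → X} {z : ℂ} (hψ : HoloAt ψ z) {U : Set ℂ} (hU : U ∈ 𝓝 z)
    (hinj : InjOn ψ U) : ∃ s : X → ℂ, MDifferentiableAt 𝓘(ℂ, ℂ) 𝓘(ℂ, ℂ) s (ψ z) ∧ s (ψ z) = z ∧
      ∀ᶠ x in 𝓝 (ψ z), ψ (s x) = x := by
  have : IsManifold 𝓘(ℂ, ℂ) 1 X := IsManifold.of_le (n := ω) le_top
  set e := chartAt ℂ (ψ z) with he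
  have hz : ψ z ∈ e.source := mem_chart_source ℂ _
  have hg : AnalyticAt ℂ (e ∘ ψ) z := hψ.analyticAt_chart _ hz
  have hsrc : ∀ᶠ y in 𝓝 z, ψ y ∈ e.source := hψ.continuousAt.eventually (e.open_source.mem_nhds hz)
  have hd : deriv (e ∘ ψ) z ≠ 0 := by
    refine deriv_ne_zero_of_injOn hg (inter_mem hU hsrc) fun y hy y' hy' h => ?_
    exact hinj hy.1 hy'.1 (e.injOn hy.2 hy'.2 h)
  have hs := hg.hasStrictDerivAt
  set θ := hs.localInverse (e ∘ ψ) _ z hd with hθ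
  have hθd : HasStrictDerivAt θ _ ((e ∘ ψ) z) := hs.to_localInverse hd
  have hθz : θ ((e ∘ ψ) z) = z := by
    exact HasStrictFDerivAt.localInverse_apply_image _
  have hθr : ∀ᶠ y in 𝓝 ((e ∘ ψ) z), (e ∘ ψ) (θ y) = y :=
    HasStrictFDerivAt.eventually_right_inverse _
  have hec : ContinuousAt e (ψ z) := e.continuousAt hz
  refine ⟨θ ∘ e, ?_, hθz, ?_⟩
  · exact hθd.hasDerivAt.differentiableAt.mdifferentiableAt.comp (ψ z)
      (mdifferentiableAt_atlas (chart_mem_atlas ℂ _) hz)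
  · have h1 : ∀ᶠ y in 𝓝 ((e ∘ ψ) z), ψ (θ y) ∈ e.source := by
      have := hθd.hasDerivAt.continuousAt
      rw [ContinuousAt, hθz] at this
      exact this.eventually hsrc
    filter_upwards [hec.eventually hθr, hec.eventually h1, e.open_source.mem_nhds hz] with x h2 h3 h4
    exact e.injOn h3 h4 h2

lemma HoloAt.map_nhds {ψ : ℂ → X} {z : ℂ} (hψ : HoloAt ψ z) {U : Set ℂ} (hU : U ∈ 𝓝 z)
    (hinj : InjOn ψ U) : map ψ (𝓝 z) = 𝓝 (ψ z) := by
  refine le_antisymm hψ.continuousAt fun V hV => ?_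
  obtain ⟨s, hs, hsz, hev⟩ := hψ.exists_local_section hU hinj
  have hc := hs.continuousAt
  rw [ContinuousAt, hsz] at hc
  filter_upwards [hc hV, hev] with x h1 h2
  rw [← h2]
  exact h1

/-- Near `ψ z` the map is `(Φ ∘ ψ) ∘ s` for a local holomorphic section `s`. In this way maps
defined through a covering are seen to be holomorphic on the base. -/
lemma HoloAt.descend {X' : Type*} [TopologicalSpace X'] [ChartedSpace ℂ X'] {ψ : ℂ → X} {z : ℂ}
    (hψ : HoloAt ψ z) {U : Set ℂ} (hU : U ∈ 𝓝 z) (hinj : InjOn ψ U) {Φ : X → X'}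
    (hΦ : HoloAt (Φ ∘ ψ) z) : MDifferentiableAt 𝓘(ℂ, ℂ) 𝓘(ℂ, ℂ) Φ (ψ z) := by
  obtain ⟨s, hs, hsz, hev⟩ := hψ.exists_local_section hU hinj
  have h1 : MDifferentiableAt 𝓘(ℂ, ℂ) 𝓘(ℂ, ℂ) ((Φ ∘ ψ) ∘ s) (ψ z) := by
    refine MDifferentiableAt.comp (ψ z) ?_ hs
    rw [hsz]; exact hΦ.mdifferentiableAt
  refine h1.congr_of_eventuallyEq ?_
  filter_upwards [hev] with x hx
  simp only [Function.comp_apply, hx]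

/-- In charts, complex differentiability on an open set implies analyticity. -/
lemma contMDiff_of_mdifferentiable {X' : Type*} [TopologicalSpace X'] [ChartedSpace ℂ X']
    [IsManifold 𝓘(ℂ, ℂ) ω X'] {F : X → X'} (hF : MDifferentiable 𝓘(ℂ, ℂ) 𝓘(ℂ, ℂ) F) :
    ContMDiff 𝓘(ℂ, ℂ) 𝓘(ℂ, ℂ) ω F := by
  intro x
  rw [contMDiffAt_iff]
  refine ⟨(hF x).continuousAt, ?_⟩
  have h1 : HoloAt (F ∘ (chartAt ℂ x).symm) (chartAt ℂ x x) :=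
    (holoAt_chartAt_symm x (mem_chart_target ℂ x)).comp_mdifferentiable hF
  have h2 : AnalyticAt ℂ (chartAt ℂ (F x) ∘ (F ∘ (chartAt ℂ x).symm)) (chartAt ℂ x x) :=
    h1.analyticAt_chart (F x) (by simp)
  simpa using! h2.contDiffAt.contDiffWithinAt

/-- Removable singularities for maps between Riemann surfaces. -/
lemma mdifferentiableAt_of_punctured {X' : Type*} [TopologicalSpace X'] [ChartedSpace ℂ X']
    [IsManifold 𝓘(ℂ, ℂ) ω X'] {F : X → X'} {p : X} (hc : ContinuousAt F p)
    (hF : ∀ᶠ x in 𝓝[≠] p, MDifferentiableAt 𝓘(ℂ, ℂ) 𝓘(ℂ, ℂ) F x) :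
    MDifferentiableAt 𝓘(ℂ, ℂ) 𝓘(ℂ, ℂ) F p := by
  have : IsManifold 𝓘(ℂ, ℂ) 1 X := IsManifold.of_le (n := ω) le_top
  have : IsManifold 𝓘(ℂ, ℂ) 1 X' := IsManifold.of_le (n := ω) le_top
  set e := chartAt ℂ p with he
  set e' := chartAt ℂ (F p) with he'
  have hp : p ∈ e.source := mem_chart_source ℂ p
  have hsc : ContinuousAt e.symm (e p) := e.continuousAt_symm (e.map_source hp)
  have hsp : e.symm (e p) = p := e.left_inv hp
  have hc1 : ContinuousAt (F ∘ e.symm) (e p) := by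
    refine ContinuousAt.comp ?_ hsc
    rwa [hsp]
  have hc2 : ContinuousAt (e' ∘ F ∘ e.symm) (e p) := by
    refine ContinuousAt.comp ?_ hc1
    rw [Function.comp_apply, hsp]
    exact e'.continuousAt (mem_chart_source ℂ _)
  have ht : Tendsto e.symm (𝓝[≠] (e p)) (𝓝[≠] p) := by
    refine tendsto_nhdsWithin_iff.2 ⟨?_, ?_⟩
    · have := hsc.tendsto.mono_left (nhdsWithin_le_nhds (s := {e p}ᶜ))
      rwa [hsp] at this
    · filter_upwards [self_mem_nhdsWithin, nhdsWithin_le_nhds (e.open_target.mem_nhds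
        (e.map_source hp))] with y hy hy' h
      rw [mem_singleton_iff] at h
      exact hy (by rw [mem_singleton_iff, ← h, e.right_inv hy'])
  have hsrc : ∀ᶠ y in 𝓝 (e p), F (e.symm y) ∈ e'.source := by
    refine hc1.eventually (e'.open_source.mem_nhds ?_)
    rw [Function.comp_apply, hsp]; exact mem_chart_source ℂ _
  have hd : ∀ᶠ y in 𝓝[≠] (e p), DifferentiableAt ℂ (e' ∘ F ∘ e.symm) y := by
    filter_upwards [ht.eventually hF, nhdsWithin_le_nhds hsrc,
      nhdsWithin_le_nhds (e.open_target.mem_nhds (e.map_source hp))] with y h1 h2 h3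
    exact ((mdifferentiableAt_atlas (chart_mem_atlas ℂ _) h2).comp y
      (h1.comp y (mdifferentiableAt_atlas_symm (chart_mem_atlas ℂ _) h3))).differentiableAt
  have ha := Complex.analyticAt_of_differentiable_on_punctured_nhds_of_continuousAt hd hc2
  have h1 : MDifferentiableAt 𝓘(ℂ, ℂ) 𝓘(ℂ, ℂ) (e'.symm ∘ (e' ∘ F ∘ e.symm) ∘ e) p := by
    refine MDifferentiableAt.comp p ?_ (ha.differentiableAt.mdifferentiableAt.comp p
      (mdifferentiableAt_atlas (chart_mem_atlas ℂ _) hp))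
    refine mdifferentiableAt_atlas_symm (chart_mem_atlas ℂ _) ?_
    simp only [Function.comp_apply, hsp]
    exact e'.map_source (mem_chart_source ℂ _)
  refine h1.congr_of_eventuallyEq ?_
  filter_upwards [e.open_source.mem_nhds hp, hc.eventually (e'.open_source.mem_nhds
    (mem_chart_source ℂ _))] with x h2 h3
  simp only [Function.comp_apply, e.left_inv h2]
  exact (e'.left_inv h3).symm

end LocalInverse

/-! ### Translations of cylinders -/

section Cylinder

open Set Filter Complex

variable {S : Type*} [TopologicalSpace S] [T2Space S] [ChartedSpace ℂ S] [IsManifold 𝓘(ℂ, ℂ) ω S]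
  {P : Punctures S}

/-- A biholomorphism from the cylinder `ℂ / iℤ` to the punctured surface, lifted to `ℂ`. -/
structure IsCylinder (P : Punctures S) (ψ : ℂ → P.dot) : Prop where
  mdifferentiable : MDifferentiable 𝓘(ℂ, ℂ) 𝓘(ℂ, ℂ) ψ
  surjective : Function.Surjective ψ
  eq_iff : ∀ z z', ψ z = ψ z' ↔ ∃ n : ℤ, z - z' = n * I

namespace IsCylinder

variable {ψ : ℂ → P.dot}

lemma holoAt (h : IsCylinder P ψ) (z : ℂ) : HoloAt ψ z := .of_forall h.mdifferentiable

lemma continuous (h : IsCylinder P ψ) : Continuous ψ := h.mdifferentiable.continuous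

lemma injOn (h : IsCylinder P ψ) (z : ℂ) : InjOn ψ (Metric.ball z 2⁻¹) := by
  intro x hx y hy hxy
  obtain ⟨n, hn⟩ := (h.eq_iff x y).1 hxy
  have h1 : ‖x - y‖ < 1 := by
    rw [← dist_eq]
    linarith [dist_triangle_right x y z, Metric.mem_ball.1 hx, Metric.mem_ball.1 hy]
  rw [hn, norm_mul, norm_I, mul_one, norm_intCast] at h1
  have h2 : n = 0 := Int.abs_lt_one_iff.1 (by exact_mod_cast h1)
  rw [h2, Int.cast_zero, zero_mul] at hn
  exact sub_eq_zero.1 hn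

lemma isOpenMap (h : IsCylinder P ψ) : IsOpenMap ψ := by
  rw [isOpenMap_iff_nhds_le]
  intro z
  rw [(h.holoAt z).map_nhds (Metric.ball_mem_nhds z (by norm_num)) (h.injOn z)]

/-- Translation by `a` on the punctured surface. -/
def shiftDot (h : IsCylinder P ψ) (a : ℂ) (x : P.dot) : P.dot :=
  ψ (Function.surjInv h.surjective x + a)

lemma shiftDot_apply (h : IsCylinder P ψ) (a z : ℂ) : h.shiftDot a (ψ z) = ψ (z + a) := by
  obtain ⟨n, hn⟩ := (h.eq_iff _ _).1 (Function.surjInv_eq h.surjective (ψ z))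
  exact (h.eq_iff _ _).2 ⟨n, by rw [← hn]; ring⟩

open Classical in
/-- Translation by `a`, extended to the closed surface. -/
def shift (h : IsCylinder P ψ) (a : ℂ) (x : S) : S :=
  if hx : x ∈ P.dot then h.shiftDot a ⟨x, hx⟩ else x

lemma shift_coe (h : IsCylinder P ψ) (a : ℂ) (x : P.dot) : h.shift a x = h.shiftDot a x := by
  rw [shift, dif_pos x.2]

lemma shift_of_notMem (h : IsCylinder P ψ) (a : ℂ) {p : S} (hp : p ∉ P.dot) : h.shift a p = p := by
  rw [shift, dif_neg hp]

lemma shift_shift (h : IsCylinder P ψ) (a : ℂ) (x : S) : h.shift (-a) (h.shift a x) = x := by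
  by_cases hx : x ∈ P.dot
  · obtain ⟨z, hz⟩ := h.surjective ⟨x, hx⟩
    have h1 := h.shift_coe a ⟨x, hx⟩
    rw [← hz, shiftDot_apply] at h1
    have h2 : h.shift a x = ψ (z + a) := by rw [← h1, hz]
    rw [h2, shift_coe, shiftDot_apply, add_neg_cancel_right, hz]
  · rw [h.shift_of_notMem a hx, h.shift_of_notMem _ hx]

/-- A compact set of the cylinder has bounded height. -/
lemma exists_bound (h : IsCylinder P ψ) {K : Set P.dot} (hK : IsCompact K) :
    ∃ B : ℝ, ∀ z, ψ z ∈ K → |z.re| < B := by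
  obtain ⟨n, hn⟩ := hK.elim_directed_cover (fun n : ℕ => ψ '' Metric.ball 0 n)
    (fun n => h.isOpenMap _ Metric.isOpen_ball)
    (fun x _ => by
      obtain ⟨z, rfl⟩ := h.surjective x
      obtain ⟨n, hn⟩ := exists_nat_gt ‖z‖
      exact mem_iUnion.2 ⟨n, z, by simpa using hn, rfl⟩)
    (directed_of_isDirected_le fun n m hnm => image_mono (Metric.ball_subset_ball (by
      exact_mod_cast hnm)))
  refine ⟨n, fun z hz => ?_⟩
  obtain ⟨z', h1, h2⟩ := hn hz
  obtain ⟨k, hk⟩ := (h.eq_iff _ _).1 h2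
  have h3 : z.re = z'.re := by
    have := congrArg re hk
    simp at this
    linarith
  rw [h3]
  exact (abs_re_le_norm _).trans_lt (by simpa using h1)

/-- The point is that translation cannot move an end to another puncture. A small circle around `p`
is compact, so its parameters have real part of absolute value less than some `B`. A point close to
`p` has a parameter whose real part exceeds `B + ‖a‖` in absolute value, so the path from it to its
translate misses the circle and stays inside the disc. -/
lemma continuousAt_shift (h : IsCylinder P ψ) (a : ℂ) {p : S} (hp : p ∉ P.dot) :
    ContinuousAt (h.shift a) p := by
  set e := chartAt ℂ p with he
  have hpe : p ∈ e.source := mem_chart_source ℂ p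
  have hsc : ContinuousAt e.symm (e p) := e.continuousAt_symm (e.map_source hpe)
  have hsp : e.symm (e p) = p := e.left_inv hpe
  rw [ContinuousAt, h.shift_of_notMem a hp]
  intro W hW
  -- a closed disc around `p` inside `W`
  have hW' : ∀ᶠ y in 𝓝 (e p), y ∈ e.target ∧ e.symm y ∈ W ∩ insert p (P.dot : Set S) := by
    refine (show ∀ᶠ y in 𝓝 (e p), y ∈ e.target from e.open_target.mem_nhds
      (e.map_source hpe)).and (hsc.eventually (inter_mem ?_ ?_))
    · rwa [hsp]
    · rw [hsp]; exact (P.isOpen_insert_dot p).mem_nhds (mem_insert _ _)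
  obtain ⟨r, hr, hball⟩ := Metric.nhds_basis_closedBall.mem_iff.1 hW'
  set D : Set S := e.symm '' Metric.ball (e p) r with hD
  set D' : Set S := e.symm '' Metric.closedBall (e p) r with hD'
  have hbt : Metric.closedBall (e p) r ⊆ e.target := fun y hy => (hball hy).1
  have hDo : IsOpen D := e.symm.isOpen_image_of_subset_source Metric.isOpen_ball
    (Metric.ball_subset_closedBall.trans hbt)
  have hDc : IsClosed D' := ((isCompact_closedBall _ _).image_of_continuousOn
    (e.continuousOn_symm.mono hbt)).isClosed
  have hpD : p ∈ D := ⟨e p, Metric.mem_ball_self hr, hsp⟩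
  set C : Set S := e.symm '' Metric.sphere (e p) r with hC
  have hCc : IsCompact C := (isCompact_sphere _ _).image_of_continuousOn
    (e.continuousOn_symm.mono (Metric.sphere_subset_closedBall.trans hbt))
  have hCdot : C ⊆ P.dot := by
    rintro _ ⟨y, hy, rfl⟩
    have h1 := hball (Metric.sphere_subset_closedBall hy)
    refine h1.2.2.resolve_left fun h2 => ?_
    have h3 := congrArg e h2
    rw [e.right_inv h1.1] at h3
    rw [h3, Metric.mem_sphere, dist_self] at hy
    exact hr.ne hy
  have hDD' : D' ⊆ D ∪ C := by
    rintro _ ⟨y, hy, rfl⟩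
    rcases (Metric.mem_closedBall.1 hy).lt_or_eq with h1 | h1
    · exact .inl ⟨y, h1, rfl⟩
    · exact .inr ⟨y, h1, rfl⟩
  have hDsub : D ⊆ D' := image_mono Metric.ball_subset_closedBall
  obtain ⟨B, hB⟩ := h.exists_bound (K := Subtype.val ⁻¹' C)
    (Topology.IsInducing.subtypeVal.isCompact_preimage' hCc fun x hx => ⟨⟨x, hCdot hx⟩, rfl⟩)
  -- a compact part of the cylinder
  set L : Set S := Subtype.val '' (ψ '' (Icc (-(B + ‖a‖)) (B + ‖a‖) ×ℂ Icc 0 1)) with hL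
  have hLc : IsCompact L := (((isCompact_Icc.reProdIm isCompact_Icc).image h.continuous).image
    continuous_subtype_val)
  have hpL : p ∉ L := by rintro ⟨x, -, rfl⟩; exact hp x.2
  change ∀ᶠ x in 𝓝 p, h.shift a x ∈ W
  filter_upwards [hDo.mem_nhds hpD, hLc.isClosed.isOpen_compl.mem_nhds hpL] with x hxD hxL
  by_cases hx : x ∈ P.dot
  swap
  · rw [h.shift_of_notMem a hx]
    obtain ⟨y, hy, rfl⟩ := hxD
    exact (hball (Metric.ball_subset_closedBall hy)).2.1
  obtain ⟨z, hz⟩ := h.surjective ⟨x, hx⟩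
  have hzx : (ψ z : S) = x := by rw [hz]
  have hzre : B + ‖a‖ < |z.re| := by
    by_contra! hle
    refine hxL ⟨ψ (z + (-⌊z.im⌋ : ℤ) * I), ⟨_, ?_, rfl⟩, ?_⟩
    · rw [mem_reProdIm]
      have h2 := Int.floor_le z.im
      have h3 := (Int.lt_floor_add_one z.im).le
      simp only [add_re, mul_re, add_im, mul_im, intCast_re, intCast_im, I_re,
          I_im, mul_one, mul_zero, add_zero, sub_zero]
      push_cast
      exact ⟨abs_le.1 hle, by linarith, by linarith⟩
    · rw [(h.eq_iff (z + (-⌊z.im⌋ : ℤ) * I) z).2 ⟨-⌊z.im⌋, by ring⟩, hzx]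
  have hshift : h.shift a x = ψ (z + a) := by
    rw [← hzx, shift_coe, shiftDot_apply]
  rw [hshift]
  -- the path from `x` to its translate does not meet the circle
  have hpath : IsPreconnected ((fun s : ℝ => (ψ (z + s * a) : S)) '' Icc 0 1) :=
    isPreconnected_Icc.image _ (continuous_subtype_val.comp
      (h.continuous.comp (by fun_prop))).continuousOn
  have hsub : (fun s : ℝ => (ψ (z + s * a) : S)) '' Icc 0 1 ⊆ D ∪ D'ᶜ := by
    rintro _ ⟨s, hs, rfl⟩
    by_contra hnot
    simp only [mem_union, mem_compl_iff, not_or, not_not] at hnot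
    have h1 : (ψ (z + s * a) : S) ∈ C := (hDD' hnot.2).resolve_left hnot.1
    have h2 := hB _ h1
    have h3 : |z.re| ≤ |(z + s * a).re| + ‖a‖ := by
      have h4 : z.re = (z + s * a).re - s * a.re := by simp
      have h5 : |s * a.re| ≤ ‖a‖ := by
        rw [abs_mul, abs_of_nonneg hs.1]
        exact (mul_le_of_le_one_left (abs_nonneg _) hs.2).trans (abs_re_le_norm a)
      calc |z.re| = |(z + s * a).re - s * a.re| := by rw [← h4]
        _ ≤ |(z + s * a).re| + |s * a.re| := abs_sub _ _
        _ ≤ _ := by gcongr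
    linarith
  have h6 := hpath.subset_left_of_subset_union hDo hDc.isOpen_compl
    (disjoint_compl_right.mono_left hDsub) hsub ⟨x, ⟨0, by simp, by simp [hzx]⟩, hxD⟩
  obtain ⟨y, hy, hye⟩ := h6 ⟨1, by simp, rfl⟩
  simp only [ofReal_one, one_mul] at hye
  rw [← hye]
  exact (hball (Metric.ball_subset_closedBall hy)).2.1

/-- On the punctured surface the map descends from a translation of `ℂ`; at the punctures continuity
makes the singularity removable. -/
lemma mdifferentiable_shift (h : IsCylinder P ψ) (a : ℂ) :
    MDifferentiable 𝓘(ℂ, ℂ) 𝓘(ℂ, ℂ) (h.shift a) := by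
  have hdot : ∀ x ∈ P.dot, MDifferentiableAt 𝓘(ℂ, ℂ) 𝓘(ℂ, ℂ) (h.shift a) x := by
    intro x hx
    obtain ⟨z, hz⟩ := h.surjective ⟨x, hx⟩
    have hzx : (ψ z : S) = x := by rw [hz]
    rw [← hzx]
    have h1 : HoloAt (fun z => (ψ z : S)) z := holoAt_opens_iff.1 (h.holoAt z)
    refine HoloAt.descend (ψ := fun z => (ψ z : S)) h1
      (Metric.ball_mem_nhds z (show (0 : ℝ) < 2⁻¹ by norm_num))
      (fun x hx y hy hxy => h.injOn z hx hy (Subtype.ext hxy)) ?_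
    have h2 : HoloAt (ψ ∘ fun z => z + a) z :=
      (h.holoAt (z + a)).comp_analyticAt (θ := fun z => z + a) (by fun_prop)
    refine (holoAt_opens_iff.1 h2).congr (.of_forall fun y => ?_)
    simp only [Function.comp_apply]
    rw [shift_coe, shiftDot_apply]
  intro p
  by_cases hp : p ∈ P.dot
  · exact hdot p hp
  · refine mdifferentiableAt_of_punctured (h.continuousAt_shift a hp) ?_
    filter_upwards [self_mem_nhdsWithin, nhdsWithin_le_nhds
      ((P.isOpen_insert_dot p).mem_nhds (mem_insert _ _))] with x hx hx'
    exact hdot x (hx'.resolve_left hx)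

/-- Translation by `a`, as an automorphism of the punctured surface. -/
def shiftAut (h : IsCylinder P ψ) (a : ℂ) : P.Aut where
  toDiffeomorph :=
    { toFun := h.shift a
      invFun := h.shift (-a)
      left_inv := h.shift_shift a
      right_inv := fun x => by simpa using h.shift_shift (-a) x
      contMDiff_toFun := contMDiff_of_mdifferentiable (h.mdifferentiable_shift a)
      contMDiff_invFun := contMDiff_of_mdifferentiable (h.mdifferentiable_shift (-a)) }
  fix_pos := fun p hp => h.shift_of_notMem a fun h' => h'.1 hp
  fix_neg := fun p hp => h.shift_of_notMem a fun h' => h'.2 hp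

lemma shiftAut_restrict (h : IsCylinder P ψ) (a z : ℂ) :
    (h.shiftAut a).restrict (ψ z) = ψ (z + a) :=
  Subtype.ext ((h.shift_coe a (ψ z)).trans (congrArg _ (h.shiftDot_apply a z)))

end IsCylinder

variable {E : Type*} [NormedAddCommGroup E] [NormedSpace ℝ E] [FiniteDimensional ℝ E]
  {Q : Type*} [TopologicalSpace Q] [T2Space Q] [ChartedSpace E Q] [IsManifold 𝓘(ℝ, E) ∞ Q]

lemma isTrivialCylinder_iff {l : ContactForm E Q} {w : P.dot → Q} :
    IsTrivialCylinder l w ↔ ∃ ψ, IsCylinder P ψ ∧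
      ∃ γ : ReebOrbit E Q l, ∀ z, w (ψ z) = γ.curve (γ.period * z.im) :=
  ⟨fun ⟨ψ, h1, h2, h3, h4⟩ => ⟨ψ, ⟨h1, h2, h3⟩, h4⟩,
    fun ⟨ψ, ⟨h1, h2, h3⟩, h4⟩ => ⟨ψ, h1, h2, h3, h4⟩⟩

/-- On a trivial cylinder, translations of the potential are absorbed by automorphisms. -/
lemma IsTrivialCylinder.exists_shift {t : ContactTriad E Q} {w : P.dot → Q}
    (hw : ContMDiff 𝓘(ℝ, ℂ) 𝓘(ℝ, E) ∞ w) {f : P.dot → ℝ} (hf : ContMDiff 𝓘(ℝ, ℂ) 𝓘(ℝ, ℝ) ∞ f)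
    (hwf : IsPotential t w f) (h : IsTrivialCylinder t.toContactForm w) (s : ℝ) :
    ∃ φ : P.Aut, ∀ z, w (φ.restrict z) = w z ∧ f (φ.restrict z) = f z + s := by
  obtain ⟨ψ, hψ, γ, hγ⟩ := isTrivialCylinder_iff.1 h
  have hT := γ.period_pos
  -- On the trivial cylinder `w^*λ = T dt`, and composition with `j` turns this into `T dτ`. Hence
  -- `f` is `T τ` up to a constant.
  have hd : ∀ z, HasFDerivAt (fun z => f (ψ z) - γ.period * z.re) (0 : ℂ →L[ℝ] ℝ) z := by
    intro z
    have h1 : HasFDerivAt (f ∘ ψ) (fderiv ℝ (f ∘ ψ) z) z :=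
      ((contDiffAt_comp_holo hf (hψ.holoAt z)).differentiableAt (by simp)).hasFDerivAt
    have h2 : HasFDerivAt (fun z : ℂ => γ.period * z.re) (γ.period • reCLM) z :=
      reCLM.hasFDerivAt.const_mul γ.period
    refine (h1.sub h2).congr_fderiv ?_
    ext v
    rw [sub_apply, smul_apply, hwf.fderiv_comp hw hf (hψ.holoAt z)]
    have h3 : HasMFDerivAt 𝓘(ℝ, ℂ) 𝓘(ℝ, ℝ) (fun z : ℂ => γ.period * z.im) z
        (γ.period • imCLM) := (imCLM.hasFDerivAt.const_mul γ.period).hasMFDerivAt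
    have h4 := (γ.isMIntegralCurve (γ.period * z.im)).comp z h3
    have h5 : (w ∘ ψ) = (γ.curve ∘ fun z : ℂ => γ.period * z.im) := funext hγ
    rw [h5, h4.mfderiv]
    have h6 : t.form (γ.curve (γ.period * z.im))
        ((γ.period * (I * v).im) • t.reeb (γ.curve (γ.period * z.im))) =
          γ.period * (I * v).im := by
      rw [map_smul, (t.reeb_spec _).1, smul_eq_mul, mul_one]
    refine (congrArg (fun x : ℝ => x - γ.period • reCLM v) h6).trans ?_
    simp
  have hconst : ∀ z z' : ℂ, f (ψ z) - γ.period * z.re = f (ψ z') - γ.period * z'.re := fun z z' =>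
    is_const_of_fderiv_eq_zero (𝕜 := ℝ) (fun z => (hd z).differentiableAt)
      (fun z => (hd z).fderiv) z z'
  -- Translation by `s / T` in the `τ` direction leaves `γ(T t)` unchanged and adds `s` to `T τ`.
  refine ⟨hψ.shiftAut ((s / γ.period : ℝ) : ℂ), fun x => ?_⟩
  obtain ⟨z, rfl⟩ := hψ.surjective x
  rw [hψ.shiftAut_restrict]
  refine ⟨by rw [hγ, hγ]; simp, ?_⟩
  have h1 := hconst (z + ((s / γ.period : ℝ) : ℂ)) z
  rw [add_re, ofReal_re] at h1
  have h2 : γ.period * (s / γ.period) = s := mul_div_cancel₀ _ hT.ne'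
  linarith

end Cylinder

/-! ### Harmonic functions at a puncture -/

section NormalEnd

open Set Filter Complex Laplacian InnerProductSpace

variable {S : Type*} [TopologicalSpace S] [T2Space S] [ChartedSpace ℂ S] [IsManifold 𝓘(ℂ, ℂ) ω S]
  {P : Punctures S}

/-- The Laplacian is `∂̄` of the Wirtinger derivative, so for a harmonic function the latter is
holomorphic. -/
lemma Harm.differentiableAt_wirt {X : Type*} [TopologicalSpace X] [ChartedSpace ℂ X]
    [IsManifold 𝓘(ℂ, ℂ) ω X] {f : X → ℝ} (hf : ContMDiff 𝓘(ℝ, ℂ) 𝓘(ℝ, ℝ) ∞ f) (h : Harm f)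
    {κ : ℂ → X} {y : ℂ} (hκ : HoloAt κ y) : DifferentiableAt ℂ (wirt (f ∘ κ)) y := by
  have h1 : HarmonicAt (f ∘ κ) y := by
    refine ⟨(contDiffAt_comp_holo hf hκ).of_le two_le_infty, ?_⟩
    filter_upwards [hκ.eventually] with z hz using h κ z hz
  exact (HarmonicAt.analyticAt_complex_partial h1).differentiableAt

/-- A holomorphic function with nonvanishing derivative has a holomorphic local inverse. -/
lemma exists_holomorphic_inverse {g : ℂ → ℂ} {z : ℂ} (hg : AnalyticAt ℂ g z) (h : deriv g z ≠ 0) :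
    ∃ θ : ℂ → ℂ, θ (g z) = z ∧ ∀ᶠ y in 𝓝 (g z), AnalyticAt ℂ θ y ∧ g (θ y) = y := by
  have hs := hg.hasStrictDerivAt
  set θ := hs.localInverse g _ z h with hθ
  have hθl : ∀ᶠ x in 𝓝 z, θ (g x) = x := HasStrictFDerivAt.eventually_left_inverse _
  have hθr : ∀ᶠ y in 𝓝 (g z), g (θ y) = y := HasStrictFDerivAt.eventually_right_inverse _
  refine ⟨θ, hθl.self_of_nhds, ?_⟩
  obtain ⟨U, hU, hUo, hzU⟩ := mem_nhds_iff.1 hθl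
  have hinj : InjOn g U := fun x hx y hy hxy => by rw [← hU hx, hxy, hU hy]
  have h1 : ∀ᶠ x in 𝓝 z, DifferentiableAt ℂ θ (g x) := by
    filter_upwards [hg.eventually_analyticAt, hUo.mem_nhds hzU] with x hx hxU
    have h2 : HoloAt g x := by
      filter_upwards [hx.eventually_analyticAt] with x' h using h.differentiableAt.mdifferentiableAt
    refine (h2.descend (hUo.mem_nhds hxU) hinj (Φ := θ) ?_).differentiableAt
    have h3 : HoloAt (id : ℂ → ℂ) x := .of_forall fun _ => mdifferentiableAt_id
    refine h3.congr ?_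
    filter_upwards [hUo.mem_nhds hxU] with x' hx' using (hU hx').symm
  have h2 : ∀ᶠ y in 𝓝 (g z), DifferentiableAt ℂ θ y := by
    rw [← hs.map_nhds_eq h]; exact h1
  filter_upwards [h2.eventually_nhds, hθr] with y hy hy'
  exact ⟨analyticAt_iff_eventually_differentiableAt.2 hy, hy'⟩

/-- A coordinate at a puncture in which a harmonic function is a multiple of a logarithm. -/
lemma exists_normal_end {f : P.dot → ℝ} (hf : ContMDiff 𝓘(ℝ, ℂ) 𝓘(ℝ, ℝ) ∞ f) (hharm : Harm f)
    {p : S} {T : ℝ} (hT : T ≠ 0) (hslope : HasSlope f p T) :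
    ∃ (Φ : ℂ → S) (δ : ℝ), 0 < δ ∧ (∀ y ∈ Metric.ball 0 δ, HoloAt Φ y) ∧
      InjOn Φ (Metric.ball 0 δ) ∧ Φ 0 = p ∧ ∀ y ∈ Metric.ball 0 δ, y ≠ 0 →
        Φ y ∈ P.dot ∧ fext f (Φ y) = -(T / (2 * Real.pi) * Real.log ‖y‖) := by
  have hpi := Real.pi_pos
  have hpiC : (Real.pi : ℂ) ≠ 0 := by exact_mod_cast hpi.ne'
  have hTC : (T : ℂ) ≠ 0 := by exact_mod_cast hT
  set e := chartAt ℂ p with he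
  set c := e p with hc
  set R := endR P p with hR
  set κ : ℂ → S := fun y => e.symm (c + y) with hκ
  set F := fext f ∘ κ with hF
  set r₀ := Real.exp (-(2 * Real.pi * R)) with hr₀
  have hpolar : ∀ {y : ℂ} {R' : ℝ}, y ≠ 0 → ‖y‖ < Real.exp (-(2 * Real.pi * R')) →
      ∃ ζ : ℂ, R' < ζ.re ∧ cexp (-(2 * Real.pi * ζ)) = y := by
    intro y R' hy hlt
    obtain ⟨ρ, θ, -, h3, h4⟩ := exists_cexp_neg_two_pi hy
    refine ⟨ρ + θ * I, ?_, h3⟩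
    rw [h4, Real.exp_lt_exp] at hlt
    simp; nlinarith
  have hκh : ∀ y : ℂ, y ≠ 0 → ‖y‖ < r₀ → c + y ∈ e.target ∧ HoloAt κ y ∧ κ y ∈ P.dot := by
    intro y hy hlt
    obtain ⟨ζ, h1, rfl⟩ := hpolar hy hlt
    have h2 := endMap_mem_target (P := P) h1
    exact ⟨h2, (holoAt_chartAt_symm p h2).comp_analyticAt (θ := fun y => c + y) (by fun_prop),
      endMap_mem_dot h1⟩
  have hx₀ : ∃ x₀ : P.dot, True := by
    obtain ⟨-, -, h⟩ := hκh ((r₀ / 2 : ℝ) : ℂ) (by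
      have := Real.exp_pos (-(2 * Real.pi * R)); exact_mod_cast (by positivity)) (by
      have := Real.exp_pos (-(2 * Real.pi * R))
      rw [norm_real, Real.norm_of_nonneg (by positivity)]; simp only [hr₀]; linarith)
    exact ⟨⟨_, h⟩, trivial⟩
  obtain ⟨x₀, -⟩ := hx₀
  have hFeq : ∀ y : ℂ, y ≠ 0 → ‖y‖ < r₀ → F =ᶠ[𝓝 y] f ∘ dotLift x₀ κ ∧ HoloAt (dotLift x₀ κ) y := by
    intro y hy hlt
    obtain ⟨-, h2, h3⟩ := hκh y hy hlt
    exact ⟨fext_comp_eventuallyEq x₀ f h2.continuousAt h3, holoAt_dotLift x₀ h2 h3⟩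
  have hFd : ∀ y : ℂ, y ≠ 0 → ‖y‖ < r₀ → DifferentiableAt ℝ F y := by
    intro y hy hlt
    obtain ⟨h1, h2⟩ := hFeq y hy hlt
    exact ((contDiffAt_comp_holo hf h2).differentiableAt (by simp)).congr_of_eventuallyEq h1
  have hFw : ∀ y : ℂ, y ≠ 0 → ‖y‖ < r₀ → DifferentiableAt ℂ (wirt F) y := by
    intro y hy hlt
    obtain ⟨h1, h2⟩ := hFeq y hy hlt
    refine (hharm.differentiableAt_wirt hf h2).congr_of_eventuallyEq ?_
    filter_upwards [h1.eventually_nhds] with z hz using wirt_congr hz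
  set G := fext f ∘ endMap p with hG
  have hE : ∀ ζ : ℂ, HasDerivAt (fun ζ => cexp (-(2 * Real.pi * ζ)))
      (cexp (-(2 * Real.pi * ζ)) * (-(2 * Real.pi * 1))) ζ := fun ζ =>
    (((hasDerivAt_id ζ).const_mul (2 * Real.pi : ℂ)).neg).cexp
  have hEn : ∀ {ζ : ℂ} {R' : ℝ}, R' < ζ.re →
      ‖cexp (-(2 * Real.pi * ζ))‖ < Real.exp (-(2 * Real.pi * R')) := by
    intro ζ R' h
    rw [norm_cexp_neg_two_pi, Real.exp_lt_exp]
    nlinarith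
  have hGw : ∀ ζ : ℂ, R < ζ.re → wirt G ζ = wirt F (cexp (-(2 * Real.pi * ζ))) *
      (cexp (-(2 * Real.pi * ζ)) * (-(2 * Real.pi * 1))) := fun ζ hζ =>
    wirt_comp (F := F) (hFd _ (exp_ne_zero _) (hEn hζ)) (hE ζ)
  -- the residue
  set m : ℂ → ℂ := fun y => y * wirt F y with hm
  -- In the cylindrical coordinate `wirt G = -2π y wirt F`. A slope `T` thus means that `wirt F` has
  -- a simple pole with this residue.
  set a : ℂ := -(T / (2 * Real.pi)) with ha
  have hmt : Tendsto m (𝓝[≠] 0) (𝓝 a) := by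
    rw [Metric.tendsto_nhds]
    intro ε hε
    obtain ⟨R', hR'⟩ := mem_endFilter.1 (Metric.tendsto_nhds.1 hslope ε hε)
    have h1 : ∀ᶠ y in 𝓝 (0 : ℂ), ‖y‖ < Real.exp (-(2 * Real.pi * max R R')) := by
      have := Metric.ball_mem_nhds (0 : ℂ) (Real.exp_pos (-(2 * Real.pi * max R R')))
      filter_upwards [this] with y hy using by simpa using hy
    filter_upwards [self_mem_nhdsWithin, nhdsWithin_le_nhds h1] with y hy hlt
    obtain ⟨ζ, h2, rfl⟩ := hpolar hy hlt
    have h3 : dist (wirt G ζ) T < ε := hR' ζ (by simpa using ((le_max_right _ _).trans_lt h2).le)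
    rw [hGw ζ ((le_max_left _ _).trans_lt h2)] at h3
    set y := cexp (-(2 * Real.pi * ζ))
    have h4 : m y - a = -(2 * Real.pi : ℂ)⁻¹ * (wirt F y * (y * (-(2 * Real.pi * 1))) - T) := by
      simp only [hm, ha]; field_simp; ring
    rw [dist_eq, h4, norm_mul]
    rw [dist_eq] at h3
    have h5 : ‖-(2 * Real.pi : ℂ)⁻¹‖ ≤ 1 := by
      rw [norm_neg, norm_inv, norm_mul, norm_real, Real.norm_of_nonneg hpi.le]
      refine inv_le_one_of_one_le₀ ?_
      have := Real.pi_gt_three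
      norm_num; linarith
    exact (mul_le_of_le_one_left (norm_nonneg _) h5).trans_lt h3
  have hsmall : ∀ᶠ y in 𝓝[≠] (0 : ℂ), y ≠ 0 ∧ ‖y‖ < r₀ := by
    filter_upwards [self_mem_nhdsWithin, nhdsWithin_le_nhds (Metric.ball_mem_nhds (0 : ℂ)
      (Real.exp_pos (-(2 * Real.pi * R))))] with y h1 h2 using ⟨h1, by simpa using h2⟩
  -- The limit removes the singularity of `y * wirt F y` at the puncture.
  set m' := Function.update m 0 a with hm'
  have hm'0 : m' 0 = a := by simp [hm']
  have hm'y : ∀ y, y ≠ 0 → m' y = m y := fun y hy => by simp [hm', hy]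
  have hma : AnalyticAt ℂ m' 0 := by
    refine analyticAt_of_differentiable_on_punctured_nhds_of_continuousAt ?_
      (continuousAt_update_same.2 hmt)
    filter_upwards [hsmall] with y ⟨hy, hlt⟩
    have h1 : DifferentiableAt ℂ m y := differentiableAt_id.mul (hFw y hy hlt)
    refine h1.congr_of_eventuallyEq ?_
    filter_upwards [isOpen_ne.mem_nhds hy] with y' hy' using hm'y y' hy'
  -- This is the regular part: `wirt F y = a / y + k y` away from zero.
  set k := dslope m' 0 with hk
  have hka : AnalyticAt ℂ k 0 := by
    obtain ⟨q, hq⟩ := hma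
    exact ⟨_, hq.has_fpower_series_dslope_fslope⟩
  have hky : ∀ y, y ≠ 0 → y * k y = m y - a := by
    intro y hy
    have := sub_smul_dslope m' 0 y
    rwa [sub_zero, smul_eq_mul, hm'0, hm'y y hy] at this
  obtain ⟨r₁', hr₁', hball⟩ := Metric.eventually_nhds_iff_ball.1 hka.eventually_analyticAt
  set r₁ := min r₁' r₀ with hr₁
  have hr₁pos : 0 < r₁ := lt_min hr₁' (Real.exp_pos _)
  have hkd : DifferentiableOn ℂ k (Metric.ball 0 r₁) := fun y hy =>
    (hball y (Metric.ball_subset_ball (min_le_left _ _) hy)).differentiableAt.differentiableWithinAt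
  -- A primitive of the regular part exists on the disc. Integration of the differential then gives
  -- `F = -(T / 2π) log ‖y‖ + Re K + C`, first on the half-plane that covers the punctured disc.
  obtain ⟨K, hK⟩ := hkd.isExactOn_ball
  set R₁ := -(Real.log r₁ / (2 * Real.pi)) with hR₁
  have hexpR₁ : Real.exp (-(2 * Real.pi * R₁)) = r₁ := by
    rw [hR₁, mul_neg, neg_neg, mul_div_cancel₀ _ (by positivity), Real.exp_log hr₁pos]
  have hRR₁ : R ≤ R₁ := by
    have h1 : Real.exp (-(2 * Real.pi * R₁)) ≤ Real.exp (-(2 * Real.pi * R)) := by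
      rw [hexpR₁]; exact min_le_right _ _
    rw [Real.exp_le_exp] at h1
    nlinarith
  have hEball : ∀ {ζ : ℂ}, R₁ < ζ.re → cexp (-(2 * Real.pi * ζ)) ∈ Metric.ball (0 : ℂ) r₁ := by
    intro ζ hζ
    rw [mem_ball_zero_iff, ← hexpR₁]; exact hEn hζ
  -- the function is determined by its differential
  have hD : ∃ C : ℝ, ∀ ζ : ℂ, R₁ < ζ.re →
      G ζ = T * ζ.re + (K (cexp (-(2 * Real.pi * ζ)))).re + C := by
    have hd : ∀ ζ : ℂ, R₁ < ζ.re → HasFDerivAt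
        (fun ζ => G ζ - (T * ζ + K (cexp (-(2 * Real.pi * ζ))) : ℂ).re) (0 : ℂ →L[ℝ] ℝ) ζ := by
      intro ζ hζ
      have hζR := hRR₁.trans_lt hζ
      have h1 : DifferentiableAt ℝ G ζ :=
        DifferentiableAt.comp (g := F) ζ (hFd _ (exp_ne_zero _) (hEn hζR))
          ((hE ζ).differentiableAt.restrictScalars ℝ)
      have h2 := ((hasDerivAt_id ζ).const_mul (T : ℂ)).add
        ((hK _ (hEball hζ)).comp ζ (hE ζ))
      have h3 := reCLM.hasFDerivAt.comp ζ (h2.hasFDerivAt.restrictScalars ℝ)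
      refine (h1.hasFDerivAt.sub h3).congr_fderiv ?_
      ext v
      have h4 := hky _ (exp_ne_zero (-(2 * Real.pi * ζ)))
      have h5 : wirt G ζ = T * 1 + k (cexp (-(2 * Real.pi * ζ))) *
          (cexp (-(2 * Real.pi * ζ)) * (-(2 * Real.pi * 1))) := by
        rw [hGw ζ hζR]
        simp only [hm, ha] at h4
        have h6 : (T : ℂ) = 2 * Real.pi * (T / (2 * Real.pi)) := by field_simp
        rw [h6]
        linear_combination (-(2 * Real.pi) : ℂ) * (-h4)
      have h6 := fderiv_eq_wirt G ζ v
      rw [sub_apply, h6, h5]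
      refine sub_eq_zero.2 ?_
      refine congrArg re ?_
      change _ = v * (T * 1 + k (cexp (-(2 * Real.pi * ζ))) *
          (cexp (-(2 * Real.pi * ζ)) * (-(2 * Real.pi * 1))))
      ring
    have hconv : Convex ℝ {ζ : ℂ | R₁ < ζ.re} := convex_halfSpace_re_gt _
    have ho := isOpen_rightHalf R₁
    have h0 : ((R₁ + 1 : ℝ) : ℂ) ∈ {ζ : ℂ | R₁ < ζ.re} := by simp
    refine ⟨G ((R₁ + 1 : ℝ) : ℂ) - (T * ((R₁ + 1 : ℝ) : ℂ) +
      K (cexp (-(2 * Real.pi * ((R₁ + 1 : ℝ) : ℂ)))) : ℂ).re, fun ζ hζ => ?_⟩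
    have := hconv.is_const_of_fderivWithin_eq_zero (𝕜 := ℝ)
      (fun ζ hζ => (hd ζ hζ).differentiableAt.differentiableWithinAt)
      (fun ζ hζ => by rw [fderivWithin_of_isOpen ho hζ, (hd ζ hζ).fderiv]) hζ h0
    simp only [add_re, re_ofReal_mul] at this ⊢
    linarith
  obtain ⟨C, hC⟩ := hD
  -- The regular terms are absorbed into the coordinate, so that `log ‖g‖` is exactly `-(2π / T) f`.
  -- The exponential factor does not vanish, hence `g` has a simple zero and a local inverse.
  set g : ℂ → ℂ := fun y => y * cexp (-(2 * Real.pi / T * (K y + C))) with hg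
  have hgn : ∀ ζ : ℂ, R₁ < ζ.re →
      Real.log ‖g (cexp (-(2 * Real.pi * ζ)))‖ = -(2 * Real.pi / T * G ζ) := by
    intro ζ hζ
    simp only [hg]
    rw [← Complex.exp_add, norm_exp, Real.log_exp, hC ζ hζ]
    have h1 : (-(2 * Real.pi * ζ) + -(2 * Real.pi / T * (K (cexp (-(2 * Real.pi * ζ))) + C)) : ℂ) =
        ((-(2 * Real.pi) : ℝ) : ℂ) * ζ + ((-(2 * Real.pi / T) : ℝ) : ℂ) *
          (K (cexp (-(2 * Real.pi * ζ))) + (C : ℂ)) := by push_cast; ring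
    rw [h1, add_re, re_ofReal_mul, re_ofReal_mul, add_re, ofReal_re]
    field_simp
    ring
  have hKa : AnalyticAt ℂ K 0 := by
    rw [analyticAt_iff_eventually_differentiableAt]
    filter_upwards [Metric.ball_mem_nhds (0 : ℂ) hr₁pos] with y hy using (hK y hy).differentiableAt
  have hga : AnalyticAt ℂ g 0 := by
    refine analyticAt_id.mul (AnalyticAt.cexp ?_)
    exact (analyticAt_const.mul (hKa.add analyticAt_const)).neg
  have hg0 : g 0 = 0 := by simp [hg]
  have hgd : deriv g 0 ≠ 0 := by
    have h1 : AnalyticAt ℂ (fun y => cexp (-(2 * Real.pi / T * (K y + C)))) 0 :=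
      ((analyticAt_const.mul (hKa.add analyticAt_const)).neg).cexp
    have h2 : HasDerivAt g _ 0 := (hasDerivAt_id (0 : ℂ)).mul h1.differentiableAt.hasDerivAt
    rw [h2.deriv]
    simp
  obtain ⟨θ, hθ0, hθ⟩ := exists_holomorphic_inverse hga hgd
  rw [hg0] at hθ0 hθ
  have hθc : ContinuousAt θ 0 := hθ.self_of_nhds.1.continuousAt
  have hθs : ∀ᶠ y in 𝓝 (0 : ℂ), ‖θ y‖ < r₁ := by
    have := hθc.eventually (Metric.ball_mem_nhds (θ 0) hr₁pos)
    rw [hθ0] at this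
    filter_upwards [this] with y hy using by simpa using hy
  obtain ⟨δ, hδ, hδb⟩ := Metric.eventually_nhds_iff_ball.1 (hθ.and hθs)
  have hθne : ∀ y ∈ Metric.ball (0 : ℂ) δ, y ≠ 0 → θ y ≠ 0 := by
    intro y hy hy0 h
    have := (hδb y hy).1.2
    rw [h, hg0] at this
    exact hy0 this.symm
  have htar : ∀ y ∈ Metric.ball (0 : ℂ) δ, c + θ y ∈ e.target := by
    intro y hy
    by_cases h : θ y = 0
    · rw [h, add_zero]; exact mem_chart_target ℂ p
    · exact (hκh _ h ((hδb y hy).2.trans_le (min_le_right _ _))).1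
  refine ⟨fun y => e.symm (c + θ y), δ, hδ, fun y hy => ?_, fun y hy y' hy' h => ?_, ?_,
    fun y hy hy0 => ?_⟩
  · exact (holoAt_chartAt_symm p (htar y hy)).comp_analyticAt (θ := fun y => c + θ y)
      (analyticAt_const.add (hδb y hy).1.1)
  · have h1 := add_left_cancel (e.symm.injOn (htar y hy) (htar y' hy') h)
    rw [← (hδb y hy).1.2, h1, (hδb y' hy').1.2]
  · simp only [hθ0, add_zero]; exact e.left_inv (mem_chart_source ℂ p)
  · have h1 := hθne y hy hy0
    refine ⟨(hκh _ h1 ((hδb y hy).2.trans_le (min_le_right _ _))).2.2, ?_⟩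
    obtain ⟨ζ, h2, h3⟩ := hpolar (R' := R₁) h1 (by rw [hexpR₁]; exact (hδb y hy).2)
    have h4 := hgn ζ h2
    rw [h3, (hδb y hy).1.2] at h4
    have h5 : fext f (e.symm (c + θ y)) = G ζ := by rw [← h3]; rfl
    rw [h4, h5]
    field_simp

end NormalEnd

/-! ### Harmonic potentials with a translational symmetry -/

section Sections

open Set Filter Complex

variable {X : Type*} [TopologicalSpace X] [ChartedSpace ℂ X] [IsManifold 𝓘(ℂ, ℂ) ω X]

/-- A local section inverts `ψ` near `z` by injectivity. Applying `HoloAt.descend` at the nearby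
points upgrades differentiability at one point to a neighbourhood. -/
lemma HoloAt.exists_holo_section {ψ : ℂ → X} {z : ℂ} (hψ : HoloAt ψ z) {U : Set ℂ} (hU : U ∈ 𝓝 z)
    (hinj : InjOn ψ U) : ∃ s : X → ℂ, s (ψ z) = z ∧
      ∀ᶠ x in 𝓝 (ψ z), MDifferentiableAt 𝓘(ℂ, ℂ) 𝓘(ℂ, ℂ) s x ∧ ψ (s x) = x := by
  obtain ⟨s, hs, hsz, hev⟩ := hψ.exists_local_section hU hinj
  refine ⟨s, hsz, ?_⟩
  have hc : Tendsto (s ∘ ψ) (𝓝 z) (𝓝 z) := by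
    have := hs.continuousAt.tendsto.comp hψ.continuousAt.tendsto
    rwa [hsz] at this
  have hl : ∀ᶠ y in 𝓝 z, s (ψ y) = y := by
    filter_upwards [hc hU, hψ.continuousAt.eventually hev, hU] with y h1 h2 h3
    exact hinj h1 h3 h2
  have h1 : ∀ᶠ y in 𝓝 z, MDifferentiableAt 𝓘(ℂ, ℂ) 𝓘(ℂ, ℂ) s (ψ y) := by
    filter_upwards [hψ.eventually, hl.eventually_nhds, eventually_mem_nhds_iff.2 hU] with y h1 h2 h3
    refine h1.descend h3 hinj (Φ := s) ?_
    have h3 : HoloAt (id : ℂ → ℂ) y := .of_forall fun _ => mdifferentiableAt_id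
    exact h3.congr (h2.mono fun _ h => h.symm)
  rw [← hψ.map_nhds hU hinj] at hev ⊢
  exact (eventually_map.2 h1).and hev

lemma injOn_ball_of_eq_iff {ψ : ℂ → X} (h : ∀ z z', ψ z = ψ z' → ∃ n : ℤ, z - z' = n * I) (z : ℂ) :
    InjOn ψ (Metric.ball z 2⁻¹) := by
  intro x hx y hy hxy
  obtain ⟨n, hn⟩ := h x y hxy
  have h1 : ‖x - y‖ < 1 := by
    rw [← dist_eq]
    linarith [dist_triangle_right x y z, Metric.mem_ball.1 hx, Metric.mem_ball.1 hy]
  rw [hn, norm_mul, norm_I, mul_one, norm_intCast] at h1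
  have h2 : n = 0 := Int.abs_lt_one_iff.1 (by exact_mod_cast h1)
  rw [h2, Int.cast_zero, zero_mul] at hn
  exact sub_eq_zero.1 hn

lemma add_floor_mem (z : ℂ) : (z + (-⌊z.im⌋ : ℤ) * I).re = z.re ∧
    (z + (-⌊z.im⌋ : ℤ) * I).im ∈ Icc (0 : ℝ) 1 := by
  have h2 := Int.floor_le z.im
  have h3 := (Int.lt_floor_add_one z.im).le
  simp only [add_re, mul_re, add_im, mul_im, intCast_re, intCast_im, I_re,
    I_im, mul_one, mul_zero, add_zero, sub_zero]
  push_cast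
  exact ⟨trivial, by linarith, by linarith⟩

lemma cexp_neg_two_pi_eq_iff (z z' : ℂ) :
    cexp (-(2 * Real.pi * z)) = cexp (-(2 * Real.pi * z')) ↔ ∃ n : ℤ, z - z' = n * I := by
  have hpi : (Real.pi : ℂ) ≠ 0 := by exact_mod_cast Real.pi_ne_zero
  rw [exp_eq_exp_iff_exists_int]
  constructor
  · rintro ⟨n, hn⟩
    refine ⟨-n, ?_⟩
    have : (2 * Real.pi : ℂ) * (z - z' + n * I) = 0 := by linear_combination -hn
    have := (mul_eq_zero.1 this).resolve_left (by simp [hpi])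
    push_cast; linear_combination this
  · rintro ⟨n, hn⟩
    refine ⟨-n, ?_⟩
    push_cast; linear_combination (-2 * Real.pi : ℂ) * hn

end Sections

/-! ### Automorphisms of a punctured surface and holomorphic parametrizations -/

section Aut

open Set Filter Complex

variable {S : Type*} [TopologicalSpace S] [T2Space S] [ChartedSpace ℂ S] {P : Punctures S}

lemma Punctures.Aut.symm_restrict (φ : P.Aut) (z : P.dot) : φ.symm.restrict (φ.restrict z) = z :=
  Subtype.ext (φ.toDiffeomorph.symm_apply_apply z.1)

lemma Punctures.Aut.apply_of_notMem (φ : P.Aut) {p : S} (hp : p ∉ P.dot) :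
    φ.toDiffeomorph p = p := by
  by_cases h : p ∈ P.pos
  · exact φ.fix_pos p h
  · refine φ.fix_neg p (by_contra fun h' => hp ⟨h, h'⟩)

lemma HoloAt.restrict (φ : P.Aut) {κ : ℂ → P.dot} {y : ℂ} (h : HoloAt κ y) :
    HoloAt (φ.restrict ∘ κ) y := by
  rw [holoAt_opens_iff] at h ⊢
  exact h.comp_mdifferentiable (φ.toDiffeomorph.contMDiff_toFun.mdifferentiable (by simp))

lemma HoloAt.restrict_iterate (φ : P.Aut) {κ : ℂ → P.dot} {y : ℂ} (h : HoloAt κ y) (n : ℕ) :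
    HoloAt (φ.restrict^[n] ∘ κ) y := by
  induction n with
  | zero => exact h
  | succ n ih =>
    rw [Function.iterate_succ', Function.comp_assoc]
    exact ih.restrict φ

end Aut

/-! ### Automorphisms that shift a function with prescribed slopes -/

section Symmetry

open Set Filter Complex

variable {S : Type*} [TopologicalSpace S] [T2Space S] [ChartedSpace ℂ S] [IsManifold 𝓘(ℂ, ℂ) ω S]
  [CompactSpace S] [ConnectedSpace S] {P : Punctures S}

/-- A function that is unbounded above has a puncture of nonnegative slope. -/
lemma bddAbove_of_neg_slopes {f : P.dot → ℝ} (hf : ContMDiff 𝓘(ℝ, ℂ) 𝓘(ℝ, ℝ) ∞ f)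
    (h : ∀ p ∉ P.dot, ∃ a < 0, HasSlope f p a) : ∃ M, ∀ x, f x ≤ M := by
  obtain ⟨x₀⟩ := nonempty_dot P
  have h1 : ∀ p, ∃ ρ : ℝ, endR P p < ρ ∧ (p ∉ P.dot → ∀ ζ : ℂ, ρ ≤ ζ.re →
      (wirt (f ∘ endLift x₀ p) ζ).re < 0) := by
    intro p
    by_cases hp : p ∈ P.dot
    · exact ⟨endR P p + 1, by linarith, fun h => (h hp).elim⟩
    obtain ⟨a, ha, hs⟩ := h p hp
    have h2 : Tendsto (fun ζ => (wirt (f ∘ endLift x₀ p) ζ).re) (endFilter 1) (𝓝 a) := by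
      simpa [Function.comp_def] using (continuous_re.tendsto _).comp (hs.tendsto_endLift x₀)
    obtain ⟨R, hR⟩ := mem_endFilter.1 (h2.eventually_lt_const ha)
    refine ⟨max R (endR P p + 1), (lt_add_one _).trans_le (le_max_right _ _), fun _ ζ hζ => ?_⟩
    exact hR ζ (by simpa using (le_max_left _ _).trans hζ)
  choose ρ hρ hneg using h1
  obtain ⟨K, hK, hcov⟩ := exists_compact_core P ρ
  set C : S → Set P.dot := fun p => endLift x₀ p ''
    {ζ : ℂ | ζ.re ∈ Icc (ρ p) (ρ p) ∧ ζ.im ∈ Icc (0 : ℝ) 1} with hC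
  have hKc : IsCompact (K ∪ ⋃ p ∈ {p : S | p ∉ P.dot}, C p) :=
    hK.union ((finite_punctures P).isCompact_biUnion fun p _ => isCompact_endLift_image x₀ p (hρ p))
  obtain ⟨M, hM⟩ := hKc.bddAbove_image hf.continuous.continuousOn
  refine ⟨M, fun x => ?_⟩
  rcases hcov x with hx | ⟨p, hp, ζ, hζ, hζi, hζx⟩
  · exact hM ⟨x, .inl hx, rfl⟩
  have hζ' : endLift x₀ p ζ = x := Subtype.ext (by rw [coe_endLift x₀ ((hρ p).trans hζ), hζx])
  have hd : ∀ r : ℝ, ρ p ≤ r → HasDerivAt (fun r : ℝ => f (endLift x₀ p (r + ζ.im * I)))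
      (wirt (f ∘ endLift x₀ p) (r + ζ.im * I)).re r := by
    intro r hr
    have h2 : HasFDerivAt (f ∘ endLift x₀ p) (fderiv ℝ (f ∘ endLift x₀ p) (r + ζ.im * I))
        (r + ζ.im * I) := ((contDiffAt_comp_holo hf (holoAt_endLift x₀ (by
          simpa using (hρ p).trans_le hr))).differentiableAt (by simp)).hasFDerivAt
    have h3 : HasDerivAt (fun r : ℝ => (r : ℂ) + ζ.im * I) 1 r :=
      (ofRealCLM.hasDerivAt (x := r)).add_const _
    have h4 := h2.comp_hasDerivAt r h3
    rw [fderiv_eq_wirt, mul_one] at h4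
    exact h4
  -- Beyond the abscissa `ρ p` the radial derivative is negative, so a value on the end is at most
  -- the value on the bounding circle.
  have hanti : AntitoneOn (fun r : ℝ => f (endLift x₀ p (r + ζ.im * I))) (Ici (ρ p)) := by
    refine antitoneOn_of_deriv_nonpos (convex_Ici _)
      (fun r hr => (hd r hr).continuousAt.continuousWithinAt)
      (fun r hr => (hd r (interior_subset hr)).differentiableAt.differentiableWithinAt)
      fun r hr => ?_
    rw [(hd r (interior_subset hr)).deriv]
    exact (hneg p hp _ (by simpa using interior_subset hr)).le
  have h5 := hanti (mem_Ici.2 le_rfl) (mem_Ici.2 hζ.le) hζ.le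
  simp only [re_add_im, hζ'] at h5
  refine h5.trans (hM ⟨_, .inr (mem_biUnion (show p ∈ {p : S | p ∉ P.dot} from hp)
    ⟨_, ?_, rfl⟩), rfl⟩)
  simp only [Set.mem_ofPred_eq, add_re, ofReal_re, mul_re, I_re, mul_zero, ofReal_im, I_im, mul_one,
    sub_self, add_zero, add_im, mul_im, zero_add]
  exact ⟨⟨le_rfl, le_rfl⟩, hζi.1, hζi.2.le⟩

/-- A harmonic function with a translational symmetry lives on a cylinder. -/
lemma exists_cylinder_of_harm {f : P.dot → ℝ} (hf : ContMDiff 𝓘(ℝ, ℂ) 𝓘(ℝ, ℝ) ∞ f)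
    (hharm : Harm f) (hslope : ∀ p ∉ P.dot, ∃ a, a ≠ 0 ∧ HasSlope f p a) (φ : P.Aut) {s : ℝ}
    (hs : 0 < s) (hφ : ∀ z, f (φ.restrict z) = f z + s) :
    ∃ ψ, IsCylinder P ψ ∧ ∃ T > 0, ∀ z, f (ψ z) = T * z.re := by
  obtain ⟨x₀⟩ := nonempty_dot P
  have hpcon := preconnectedSpace_dot (P := P)
  have hpi := Real.pi_pos
  have hiter : ∀ n : ℕ, ∀ z, f (φ.restrict^[n] z) = f z + n * s := by
    intro n
    induction n with
    | zero => intro z; simp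
    | succ n ih => intro z; rw [Function.iterate_succ_apply', hφ, ih]; push_cast; ring
  -- Iterates of the symmetry make `f` arbitrarily large, so the slopes are not all negative.
  obtain ⟨p, hp, T, hT, hpT⟩ : ∃ p ∉ P.dot, ∃ T > 0, HasSlope f p T := by
    by_contra! hcon
    obtain ⟨M, hM⟩ := bddAbove_of_neg_slopes hf fun p hp => by
      obtain ⟨a, ha, hpa⟩ := hslope p hp
      refine ⟨a, lt_of_le_of_ne (le_of_not_gt fun h => hcon p hp a h hpa) ha, hpa⟩
    obtain ⟨n, hn⟩ := exists_nat_gt ((M - f x₀) / s)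
    rw [div_lt_iff₀ hs] at hn
    have := hM (φ.restrict^[n] x₀)
    rw [hiter] at this
    linarith
  obtain ⟨Φ, δ, hδ, hΦh, hΦi, hΦ0, hΦ⟩ := exists_normal_end hf hharm hT.ne' hpT
  set φ' : S → S := ⇑φ.toDiffeomorph with hφ'
  have hφ'm : MDifferentiable 𝓘(ℂ, ℂ) 𝓘(ℂ, ℂ) φ' :=
    φ.toDiffeomorph.contMDiff_toFun.mdifferentiable (by simp)
  have hφ'p : φ' p = p := φ.apply_of_notMem hp
  have hball := Metric.ball_mem_nhds (0 : ℂ) hδ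
  have hΦc : ContinuousAt Φ 0 := (hΦh 0 (Metric.mem_ball_self hδ)).continuousAt
  obtain ⟨σ, hσ0, hσ⟩ := (hΦh 0 (Metric.mem_ball_self hδ)).exists_holo_section hball hΦi
  rw [hΦ0] at hσ0 hσ
  -- the symmetry in the normal coordinate
  set g : ℂ → ℂ := fun y => σ (φ' (Φ y)) with hg
  have hg0 : g 0 = 0 := by simp only [hg, hΦ0, hφ'p, hσ0]
  have ht : Tendsto (fun y => φ' (Φ y)) (𝓝 0) (𝓝 p) := by
    have h1 := (hφ'm (Φ 0)).continuousAt.tendsto.comp hΦc.tendsto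
    rwa [hΦ0, hφ'p] at h1
  have hgd : ∀ᶠ y in 𝓝 (0 : ℂ), DifferentiableAt ℂ g y := by
    filter_upwards [ht.eventually hσ, hball] with y h1 h2
    exact ((h1.1.comp y ((hφ'm _).comp y (hΦh y h2).mdifferentiableAt))).differentiableAt
  have hga : AnalyticAt ℂ g 0 := analyticAt_iff_eventually_differentiableAt.2 hgd
  have hgδ : ∀ᶠ y in 𝓝 (0 : ℂ), g y ∈ Metric.ball (0 : ℂ) δ := by
    have h1 := hga.continuousAt
    rw [ContinuousAt, hg0] at h1
    exact h1 hball
  -- In the normal coordinate `f` is `-(T / 2π) log ‖y‖`, so adding `s` to `f` multiplies `‖y‖` by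
  -- this factor.
  set q := Real.exp (-(2 * Real.pi * s / T)) with hq
  have hq0 : 0 < q := Real.exp_pos _
  have hgn : ∀ᶠ y in 𝓝 (0 : ℂ), y ≠ 0 → ‖g y‖ = q * ‖y‖ := by
    filter_upwards [ht.eventually hσ, hball, hgδ] with y h1 h2 h3 hy
    have hΦg : Φ (g y) = φ' (Φ y) := h1.2
    obtain ⟨h4, h5⟩ := hΦ y h2 hy
    have hφdot : φ' (Φ y) = φ.restrict ⟨Φ y, h4⟩ := rfl
    have hgy : g y ≠ 0 := by
      intro h
      rw [h, hΦ0, hφdot] at hΦg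
      exact hp (hΦg ▸ (φ.restrict ⟨Φ y, h4⟩).2)
    have h6 := (hΦ (g y) h3 hgy).2
    have h7 := hφ ⟨Φ y, h4⟩
    rw [hΦg, hφdot, fext_coe, h7, ← fext_coe f ⟨Φ y, h4⟩, h5] at h6
    have h8 : Real.log ‖g y‖ = -(2 * Real.pi * s / T) + Real.log ‖y‖ := by
      field_simp at h6 ⊢
      linarith
    rw [← Real.exp_log (norm_pos_iff.2 hgy), h8, Real.exp_add, Real.exp_log (norm_pos_iff.2 hy)]
  set k := dslope g 0 with hk
  have hka : AnalyticAt ℂ k 0 := by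
    obtain ⟨Q, hQ⟩ := hga
    exact ⟨_, hQ.has_fpower_series_dslope_fslope⟩
  have hgk : ∀ y, y * k y = g y := fun y => by
    simpa [hg0] using sub_smul_dslope g 0 y
  have hkn : ∀ᶠ y in 𝓝 (0 : ℂ), y ≠ 0 → ‖k y‖ = q := by
    filter_upwards [hgn] with y hy hy0
    have h1 := hy hy0
    rw [← hgk, norm_mul, mul_comm] at h1
    exact mul_right_cancel₀ (norm_ne_zero_iff.2 hy0) h1
  have hk0 : ‖k 0‖ = q := by
    have h1 : Tendsto (fun y => ‖k y‖) (𝓝[≠] 0) (𝓝 ‖k 0‖) :=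
      hka.continuousAt.norm.tendsto.mono_left nhdsWithin_le_nhds
    refine tendsto_nhds_unique h1 (tendsto_const_nhds.congr' ?_)
    filter_upwards [self_mem_nhdsWithin, nhdsWithin_le_nhds hkn] with y h2 h3 using (h3 h2).symm
  -- The holomorphic function `g y / y` has constant modulus, hence is constant by the maximum
  -- modulus principle: near `p` the symmetry is multiplication by `α`.
  have hkc : ∀ᶠ y in 𝓝 (0 : ℂ), k y = k 0 := by
    refine eventually_eq_of_isLocalMax_norm
      (hka.eventually_analyticAt.mono fun y hy => hy.differentiableAt) ?_
    filter_upwards [hkn] with y hy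
    by_cases h : y = 0
    · rw [h]
    · simp only [Function.comp_apply, hy h, hk0]; exact le_rfl
  set α := k 0 with hα
  have hα0 : α ≠ 0 := norm_pos_iff.1 (hk0 ▸ hq0)
  obtain ⟨δ', hδ', hδ'b⟩ := Metric.eventually_nhds_iff_ball.1
    (((ht.eventually hσ).and hkc).and hball)
  have hΦα : ∀ y ∈ Metric.ball (0 : ℂ) δ', Φ (α * y) = φ' (Φ y) := by
    intro y hy
    obtain ⟨⟨h1, h2⟩, -⟩ := hδ'b y hy
    rw [← h1.2, ← h2, mul_comm, hgk]
  -- Multiplication by `α` is translation by `a` in the cylindrical coordinate; its real part `s /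
  -- T` is positive, so translation goes towards the puncture.
  set a : ℂ := -(log α / (2 * Real.pi)) with ha
  have hpiC : (Real.pi : ℂ) ≠ 0 := by exact_mod_cast hpi.ne'
  have haα : cexp (-(2 * Real.pi * a)) = α := by
    rw [ha, mul_neg, neg_neg, mul_div_cancel₀ _ (by simp [hpiC]), exp_log hα0]
  have hare : a.re = s / T := by
    have h1 := norm_cexp_neg_two_pi a
    rw [haα, hk0, hq, Real.exp_eq_exp] at h1
    field_simp at h1 ⊢
    linarith
  have hare0 : 0 < a.re := by rw [hare]; positivity
  set ρ₁ := -(Real.log δ' / (2 * Real.pi)) with hρ₁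
  have hexp : ∀ {z : ℂ}, ρ₁ < z.re → cexp (-(2 * Real.pi * z)) ∈ Metric.ball (0 : ℂ) δ' := by
    intro z hz
    rw [mem_ball_zero_iff, norm_cexp_neg_two_pi, ← Real.exp_log hδ', Real.exp_lt_exp]
    have h1 : Real.log δ' = -(2 * Real.pi * ρ₁) := by
      rw [hρ₁, mul_neg, neg_neg, mul_div_cancel₀ _ (by positivity)]
    rw [h1]; nlinarith
  -- the cylindrical coordinate near the puncture
  set ψ₀ : ℂ → S := fun z => Φ (cexp (-(2 * Real.pi * z))) with hψ₀
  have hψ₀dot : ∀ {z : ℂ}, ρ₁ < z.re → ψ₀ z ∈ P.dot ∧ fext f (ψ₀ z) = T * z.re := by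
    intro z hz
    obtain ⟨h1, h2⟩ := hΦ _ (hδ'b _ (hexp hz)).2 (exp_ne_zero _)
    refine ⟨h1, h2.trans ?_⟩
    rw [norm_cexp_neg_two_pi, Real.log_exp]
    field_simp
  set ψ₁ : ℂ → P.dot := dotLift x₀ ψ₀ with hψ₁
  have hψ₁c : ∀ {z : ℂ}, ρ₁ < z.re → (ψ₁ z : S) = ψ₀ z := fun hz => coe_dotLift x₀ (hψ₀dot hz).1
  have hψ₁h : ∀ {z : ℂ}, ρ₁ < z.re → HoloAt ψ₁ z := fun {z} hz =>
    holoAt_dotLift x₀ ((hΦh _ (hδ'b _ (hexp hz)).2).comp_analyticAt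
      (θ := fun z => cexp (-(2 * Real.pi * z))) (by fun_prop)) (hψ₀dot hz).1
  have hψ₁f : ∀ {z : ℂ}, ρ₁ < z.re → f (ψ₁ z) = T * z.re := fun hz => by
    rw [← fext_coe f, hψ₁c hz, (hψ₀dot hz).2]
  have hψ₁φ : ∀ {z : ℂ}, ρ₁ < z.re → ψ₁ (z + a) = φ.restrict (ψ₁ z) := by
    intro z hz
    have hz' : ρ₁ < (z + a).re := by rw [add_re]; linarith
    refine Subtype.ext ((hψ₁c hz').trans ?_)
    have h1 : cexp (-(2 * Real.pi * (z + a))) = α * cexp (-(2 * Real.pi * z)) := by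
      rw [← haα, ← Complex.exp_add]; congr 1; ring
    change Φ _ = φ' (ψ₁ z)
    rw [h1, hΦα _ (hexp hz), hψ₁c hz]
  set A : P.dot → P.dot := φ.symm.restrict with hA
  have hAφ : ∀ x, A (φ.restrict x) = x := φ.symm_restrict
  have hφA : ∀ x, φ.restrict (A x) = x := φ.restrict_symm
  have hAinj : ∀ n, Function.Injective (A^[n]) := fun n =>
    (Function.LeftInverse.injective hφA).iterate n
  have hAf : ∀ n : ℕ, ∀ x, f (A^[n] x) = f x - n * s := by
    intro n
    induction n with
    | zero => intro z; simp
    | succ n ih =>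
      intro z
      have h1 := hφ (A (A^[n] z))
      rw [hφA, ih] at h1
      rw [Function.iterate_succ_apply']; push_cast; linarith
  -- The coordinate of the end is continued to all of `ℂ`: translate by `n a` into the end and come
  -- back with the `n`-th power of the inverse symmetry. Once `z + n a` lies in the end, the result
  -- no longer depends on `n`.
  set ψn : ℕ → ℂ → P.dot := fun n z => A^[n] (ψ₁ (z + n * a)) with hψn
  have hnre : ∀ (n : ℕ) (z : ℂ), (z + n * a).re = z.re + n * a.re := fun n z => by simp
  have hstep : ∀ (z : ℂ) (n m : ℕ), n ≤ m → ρ₁ < (z + n * a).re → ψn m z = ψn n z := by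
    intro z n m hnm hz
    induction m, hnm using Nat.le_induction with
    | base => rfl
    | succ m hnm ih =>
      rw [← ih]
      have hz' : ρ₁ < (z + m * a).re := by
        rw [hnre] at hz ⊢
        have : (n : ℝ) * a.re ≤ m * a.re := by gcongr
        linarith
      simp only [hψn]
      rw [show z + ((m + 1 : ℕ) : ℂ) * a = z + m * a + a by push_cast; ring, hψ₁φ hz',
        Function.iterate_succ_apply, hAφ]
  have hN : ∀ z : ℂ, ∃ n : ℕ, ρ₁ < (z + n * a).re := by
    intro z
    obtain ⟨n, hn⟩ := exists_nat_gt ((ρ₁ - z.re) / a.re)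
    rw [div_lt_iff₀ hare0] at hn
    exact ⟨n, by rw [hnre]; linarith⟩
  choose N hN using hN
  set ψ : ℂ → P.dot := fun z => ψn (N z) z with hψ
  have hψeq : ∀ (n : ℕ) (z : ℂ), ρ₁ < (z + n * a).re → ψ z = ψn n z := fun n z hz => by
    change ψn (N z) z = _
    rw [← hstep z (N z) _ (le_max_left _ n) (hN z), hstep z n _ (le_max_right _ _) hz]
  have hψh : ∀ z, HoloAt ψ z := by
    intro z
    have h1 : HoloAt (ψn (N z)) z :=
      ((hψ₁h (hN z)).comp_analyticAt (θ := fun y => y + N z * a)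
        (analyticAt_id.add analyticAt_const) :
        HoloAt (ψ₁ ∘ fun y => y + N z * a) z).restrict_iterate φ.symm (N z)
    refine h1.congr ?_
    have h2 : ∀ᶠ y : ℂ in 𝓝 z, ρ₁ < (y + N z * a).re := by
      have : Continuous fun y : ℂ => (y + N z * a).re := by fun_prop
      exact this.continuousAt.eventually_const_lt (hN z)
    filter_upwards [h2] with y hy using (hψeq _ y hy).symm
  have hψf : ∀ z, f (ψ z) = T * z.re := by
    intro z
    change f (A^[N z] (ψ₁ (z + N z * a))) = _
    rw [hAf, hψ₁f (hN z), hnre, hare]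
    field_simp
    ring
  have heq : ∀ z z', ψ z = ψ z' ↔ ∃ n : ℤ, z - z' = n * I := by
    intro z z'
    have hz : ρ₁ < (z + (max (N z) (N z') : ℕ) * a).re := by
      have h1 := hN z
      rw [hnre] at h1 ⊢
      have : (N z : ℝ) * a.re ≤ (max (N z) (N z') : ℕ) * a.re := by
        gcongr; exact_mod_cast le_max_left _ _
      linarith
    have hz' : ρ₁ < (z' + (max (N z) (N z') : ℕ) * a).re := by
      have h1 := hN z'
      rw [hnre] at h1 ⊢
      have : (N z' : ℝ) * a.re ≤ (max (N z) (N z') : ℕ) * a.re := by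
        gcongr; exact_mod_cast le_max_right _ _
      linarith
    rw [hψeq _ z hz, hψeq _ z' hz']
    simp only [hψn]
    rw [(hAinj _).eq_iff, ← Subtype.coe_inj, hψ₁c hz, hψ₁c hz']
    simp only [hψ₀]
    rw [hΦi.eq_iff (hδ'b _ (hexp hz)).2 (hδ'b _ (hexp hz')).2, cexp_neg_two_pi_eq_iff]
    simp only [add_sub_add_right_eq_sub]
  have hψc : Continuous ψ := continuous_iff_continuousAt.2 fun z => (hψh z).continuousAt
  have ho : IsOpen (range ψ) := by
    refine IsOpenMap.isOpen_range ?_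
    rw [isOpenMap_iff_nhds_le]
    intro z
    rw [(hψh z).map_nhds (Metric.ball_mem_nhds z (by norm_num))
      (injOn_ball_of_eq_iff (fun z z' => (heq z z').1) z)]
  -- Near a limit point `x` the values of `f` are bounded, which confines the parameters modulo `I`
  -- to a compact set, whose image is closed. The range is then open and closed in a connected
  -- surface.
  have hcl : IsClosed (range ψ) := by
    refine isClosed_of_closure_subset fun x hx => ?_
    by_contra hxr
    set C := ψ '' (Icc (f x / T - 1) (f x / T + 1) ×ℂ Icc 0 1) with hC
    have hCc : IsCompact C := (isCompact_Icc.reProdIm isCompact_Icc).image hψc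
    have hV : {x' | |f x' - f x| < T} ∩ Cᶜ ∈ 𝓝 x := by
      refine inter_mem ((isOpen_lt (by have := hf.continuous; fun_prop)
        continuous_const).mem_nhds (by simpa using hT)) (hCc.isClosed.isOpen_compl.mem_nhds ?_)
      exact fun h => hxr (image_subset_range _ _ h)
    obtain ⟨_, ⟨h1, h2⟩, ⟨z, rfl⟩⟩ := mem_closure_iff_nhds.1 hx _ hV
    refine h2 ⟨z + (-⌊z.im⌋ : ℤ) * I, ?_, (heq _ _).2 ⟨-⌊z.im⌋, by ring⟩⟩
    rw [mem_reProdIm, (add_floor_mem z).1]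
    refine ⟨?_, (add_floor_mem z).2⟩
    have h3 : |f (ψ z) - f x| < T := h1
    rw [hψf, abs_lt] at h3
    have h4 : f x / T * T = f x := div_mul_cancel₀ _ hT.ne'
    constructor <;> nlinarith
  have hrange := IsClopen.eq_univ ⟨hcl, ho⟩ ⟨_, mem_range_self (0 : ℂ)⟩
  exact ⟨ψ, ⟨fun z => (hψh z).mdifferentiableAt, range_eq_univ.1 hrange, heq⟩, T, hT, hψf⟩

end Symmetry

/-! ### Contact instantons with harmonic potential -/

section HarmonicPotential

open Set Filter Complex

lemma eq_of_forall_smooth_eq {E : Type*} [NormedAddCommGroup E] [NormedSpace ℝ E]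
    [FiniteDimensional ℝ E] {Q : Type*} [TopologicalSpace Q] [T2Space Q] [ChartedSpace E Q]
    [IsManifold 𝓘(ℝ, E) ∞ Q] {q q' : Q}
    (h : ∀ g : C^∞⟮𝓘(ℝ, E), Q; 𝓘(ℝ, ℝ), ℝ⟯, g q = g q') : q = q' := by
  by_contra hne
  have hs : {q'}ᶜ ∈ 𝓝 q := isOpen_compl_singleton.mem_nhds hne
  obtain ⟨χ, -, hχ⟩ := (SmoothBumpFunction.nhds_basis_tsupport (I := 𝓘(ℝ, E)) q).mem_iff.1 hs
  have h1 := h ⟨χ, χ.contMDiff⟩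
  have h2 : χ q' = 0 := image_eq_zero_of_notMem_tsupport fun h => hχ h rfl
  have h3 : χ q = χ q' := h1
  rw [h2, χ.eq_one] at h3
  exact one_ne_zero h3

variable {E : Type*} [NormedAddCommGroup E] [NormedSpace ℝ E] [FiniteDimensional ℝ E]
  {Q : Type*} [TopologicalSpace Q] [T2Space Q] [ChartedSpace E Q] [IsManifold 𝓘(ℝ, E) ∞ Q]
  {S : Type*} [TopologicalSpace S] [T2Space S] [ChartedSpace ℂ S] [IsManifold 𝓘(ℂ, ℂ) ω S]
  {P : Punctures S}

/-- A contact instanton on the cylinder with linear potential is a trivial cylinder. -/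
lemma IsCylinder.isTrivialCylinder {t : ContactTriad E Q} {w : P.dot → Q} {f : P.dot → ℝ}
    (hw : ContMDiff 𝓘(ℝ, ℂ) 𝓘(ℝ, E) ∞ w) (hf : ContMDiff 𝓘(ℝ, ℂ) 𝓘(ℝ, ℝ) ∞ f)
    (hwf : IsPotential t w f) (hCR : IsContactCauchyRiemann t w) (hharm : Harm f)
    {ψ : ℂ → P.dot} (hψ : IsCylinder P ψ) {T : ℝ} (hT : 0 < T) (hψf : ∀ z, f (ψ z) = T * z.re) :
    IsTrivialCylinder t.toContactForm w := by
  set W : ℂ → Q := w ∘ ψ with hW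
  have hWd : ∀ z, MDifferentiableAt 𝓘(ℝ, ℂ) 𝓘(ℝ, E) W z := fun z =>
    ((hw _).comp z (hψ.holoAt z).contMDiffAt_real).mdifferentiableAt (by simp)
  have hform : ∀ z u : ℂ, t.form (W z) (mfderiv 𝓘(ℝ, ℂ) 𝓘(ℝ, E) W z (I * u : ℂ)) = T * u.re := by
    intro z u
    rw [← hwf.fderiv_comp hw hf (hψ.holoAt z) u]
    have h1 : HasFDerivAt (f ∘ ψ) (T • reCLM) z := by
      rw [show f ∘ ψ = fun z : ℂ => T * z.re from funext hψf]
      exact reCLM.hasFDerivAt.const_mul T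
    rw [h1.fderiv]; rfl
  -- The density of the `π`-energy is the Laplacian of the potential, which vanishes, so the
  -- derivative of `w` points in the Reeb direction.
  have hp1 : ∀ z, t.proj (W z) (mfderiv 𝓘(ℝ, ℂ) 𝓘(ℝ, E) W z (1 : ℂ)) = 0 := by
    intro z
    refine t.proj_eq_zero_of_projNormSq _ _ ?_
    rw [← hwf.laplacian_comp_eq hCR hw hf (hψ.holoAt z)]
    exact hharm ψ z (hψ.holoAt z)
  have hpI : ∀ z, t.proj (W z) (mfderiv 𝓘(ℝ, ℂ) 𝓘(ℝ, E) W z I) = 0 := by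
    intro z
    have h1 := hCR.J_proj_comp hw (hψ.holoAt z)
    rw [← h1]
    refine (congrArg (t.J (W z)) (hp1 z)).trans (map_zero _)
  have hd1 : ∀ z, mfderiv 𝓘(ℝ, ℂ) 𝓘(ℝ, E) W z (1 : ℂ) = 0 := by
    intro z
    have h1 := hp1 z
    have h2 := hform z (-I)
    rw [mul_neg, I_mul_I, neg_neg] at h2
    rw [ContactForm.proj, h2] at h1
    simpa using h1
  have hdI : ∀ z, mfderiv 𝓘(ℝ, ℂ) 𝓘(ℝ, E) W z I = T • t.reeb (W z) := by
    intro z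
    have h1 := hpI z
    have h2 := hform z 1
    rw [mul_one, one_re, mul_one] at h2
    rw [ContactForm.proj, h2, sub_eq_zero] at h1
    exact h1
  -- The derivative of the map in the real direction is zero. Independence of the real part is
  -- tested on smooth functions, which separate the points of `Q`.
  have hre : ∀ z, W z = W (z.im * I) := by
    intro z
    refine eq_of_forall_smooth_eq (E := E) fun g => ?_
    have h1 : ∀ r : ℝ, HasDerivAt (fun r : ℝ => g (W (r + z.im * I))) 0 r := by
      intro r
      have h2 : MDifferentiableAt 𝓘(ℝ, E) 𝓘(ℝ, ℝ) g (W (r + z.im * I)) :=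
        (g.contMDiff _).mdifferentiableAt (by simp)
      have h3 : HasFDerivAt (g ∘ W) _ ((r : ℂ) + z.im * I) :=
        (h2.hasMFDerivAt.comp _ (hWd _).hasMFDerivAt).hasFDerivAt
      have h4 : HasDerivAt (fun r : ℝ => (r : ℂ) + z.im * I) 1 r :=
        (ofRealCLM.hasDerivAt (x := r)).add_const _
      have h5 := h3.comp_hasDerivAt r h4
      refine h5.congr_deriv ?_
      exact (congrArg (mfderiv 𝓘(ℝ, E) 𝓘(ℝ, ℝ) g (W (r + z.im * I))) (hd1 _)).trans (map_zero _)
    have h2 := is_const_of_deriv_eq_zero (fun r => (h1 r).differentiableAt)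
      (fun r => (h1 r).deriv) z.re 0
    simpa using h2
  have hTC : (T : ℂ) ≠ 0 := by exact_mod_cast hT.ne'
  refine isTrivialCylinder_iff.2 ⟨ψ, hψ, ⟨fun s => W ((s / T : ℝ) * I), T, hT, fun s => ?_,
    fun s => ?_⟩, fun z => ?_⟩
  · have h1 : HasFDerivAt (fun s : ℝ => ((s / T : ℝ) : ℂ) * I)
        ((1 : ℝ →L[ℝ] ℝ).smulRight ((T⁻¹ : ℝ) * I : ℂ)) s := by
      have h2 : HasDerivAt (fun s : ℝ => ((s / T : ℝ) : ℂ) * I) ((T⁻¹ : ℝ) * I : ℂ) s := by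
        have h3 : HasDerivAt (fun s : ℝ => s / T) (1 / T) s := (hasDerivAt_id s).div_const T
        simpa using! (h3.ofReal_comp).mul_const I
      simpa using! h2.hasFDerivAt
    have h2 := (hWd ((s / T : ℝ) * I)).hasMFDerivAt.comp s h1.hasMFDerivAt
    refine h2.congr_mfderiv ?_
    ext
    have h3 : (show ℂ →L[ℝ] E from mfderiv 𝓘(ℝ, ℂ) 𝓘(ℝ, E) W ((s / T : ℝ) * I))
        ((1 : ℝ) • ((T⁻¹ : ℝ) * I : ℂ)) = (1 : ℝ) • (show E from t.reeb (W ((s / T : ℝ) * I))) := by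
      have h4 : ((T⁻¹ : ℝ) * I : ℂ) = T⁻¹ • I := by simp
      rw [one_smul, one_smul, h4, map_smul]
      refine (congrArg (fun x : E => T⁻¹ • x) (hdI _)).trans ?_
      exact inv_smul_smul₀ hT.ne' (show E from t.reeb (W ((s / T : ℝ) * I)))
    exact h3
  · simp only [hW, Function.comp_apply]
    congr 1
    refine (hψ.eq_iff _ _).2 ⟨1, ?_⟩
    push_cast; field_simp; ring
  · change W z = W ((T * z.im / T : ℝ) * I)
    rw [mul_div_cancel_left₀ _ hT.ne']
    exact hre z

/-- A symmetry of a harmonic potential of an instanton other than a trivial cylinder preserves the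
potential. -/
lemma eq_zero_of_harm_symmetry [CompactSpace S] [ConnectedSpace S] {t : ContactTriad E Q}
    {w : P.dot → Q} {f : P.dot → ℝ} (hw : ContMDiff 𝓘(ℝ, ℂ) 𝓘(ℝ, E) ∞ w)
    (hf : ContMDiff 𝓘(ℝ, ℂ) 𝓘(ℝ, ℝ) ∞ f) (hwf : IsPotential t w f)
    (hCR : IsContactCauchyRiemann t w) (hharm : Harm f)
    (hslope : ∀ p ∉ P.dot, ∃ a, a ≠ 0 ∧ HasSlope f p a)
    (hnt : ¬ IsTrivialCylinder t.toContactForm w) (φ : P.Aut) {s : ℝ}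
    (hφ : ∀ z, f (φ.restrict z) = f z + s) : s = 0 := by
  by_contra hs
  rcases lt_or_gt_of_ne hs with h | h
  · obtain ⟨ψ, hψ, T, hT, hψf⟩ := exists_cylinder_of_harm hf hharm hslope φ.symm
      (neg_pos.2 h) fun z => by
        have := hφ (φ.symm.restrict z)
        rw [φ.restrict_symm] at this
        linarith
    exact hnt (hψ.isTrivialCylinder hw hf hwf hCR hharm hT hψf)
  · obtain ⟨ψ, hψ, T, hT, hψf⟩ := exists_cylinder_of_harm hf hharm hslope φ h hφ
    exact hnt (hψ.isTrivialCylinder hw hf hwf hCR hharm hT hψf)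

end HarmonicPotential

/-! ### Integration against the Laplacian on a Riemann surface -/

section Pieces

open Set Filter Complex Laplacian MeasureTheory InnerProductSpace

/-- A parametrized piece `κ(s)` of a Riemann surface, with `κ` holomorphic and injective on an open
set that contains `s`. -/
structure Piece (X : Type*) [TopologicalSpace X] [ChartedSpace ℂ X] where
  κ : ℂ → X
  U : Set ℂ
  s : Set ℂ
  isOpen : IsOpen U
  holo : ∀ z ∈ U, HoloAt κ z
  inj : InjOn κ U
  sub : s ⊆ U
  meas : MeasurableSet s

variable {X : Type*} [TopologicalSpace X] [ChartedSpace ℂ X]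

namespace Piece

/-- The part of the surface that a piece covers. -/
def carrier (c : Piece X) : Set X := c.κ '' c.s

/-- The density of `F Δf` in the coordinate of a piece. -/
def dens (c : Piece X) (f F : X → ℝ) (y : ℂ) : ℝ := F (c.κ y) * Δ (f ∘ c.κ) y

lemma continuousOn (c : Piece X) : ContinuousOn c.κ c.s := fun z hz =>
  (c.holo z (c.sub hz)).continuousAt.continuousWithinAt

lemma measurableSet_carrier [T2Space X] [MeasurableSpace X] [BorelSpace X] (c : Piece X) :
    MeasurableSet c.carrier :=
  c.meas.image_of_continuousOn_injOn c.continuousOn (c.inj.mono c.sub)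

lemma measurableSet_inter [MeasurableSpace X] [BorelSpace X] (c : Piece X) {B : Set X}
    (hB : MeasurableSet B) : MeasurableSet (c.s ∩ c.κ ⁻¹' B) := by
  have h1 : MeasurableSet ((c.s.domRestrict c.κ) ⁻¹' B) :=
    (continuousOn_iff_continuous_domRestrict.1 c.continuousOn).measurable hB
  have h2 := c.meas.subtype_image h1
  convert h2 using 1
  ext z
  exact ⟨fun h => ⟨⟨z, h.1⟩, h.2, rfl⟩, fun ⟨⟨_, h1⟩, h2, h3⟩ => h3 ▸ ⟨h1, h2⟩⟩

/-- The piece on a smaller parameter set. -/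
def restrict (c : Piece X) (s : Set ℂ) (hs : MeasurableSet s) (h : s ⊆ c.s) : Piece X :=
  { c with s := s, sub := h.trans c.sub, meas := hs }

/-- The image of a piece under a biholomorphism. -/
def comp (c : Piece X) (φ : X → X) (hφ : ∀ (κ : ℂ → X) (y : ℂ), HoloAt κ y → HoloAt (φ ∘ κ) y)
    (hinj : Function.Injective φ) : Piece X where
  κ := φ ∘ c.κ
  U := c.U
  s := c.s
  isOpen := c.isOpen
  holo := fun z hz => hφ _ _ (c.holo z hz)
  inj := hinj.comp_injOn c.inj
  sub := c.sub
  meas := c.meas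

end Piece

/-- A decomposition of the surface into disjoint pieces. -/
structure IsPartition {J : Type*} (c : J → Piece X) : Prop where
  disjoint : Pairwise (Function.onFun Disjoint fun j => (c j).carrier)
  cover : ∀ x, ∃ j, x ∈ (c j).carrier

/-- Enumerate the finite cover and remove from each piece whatever the preceding pieces cover. -/
lemma exists_isPartition [T2Space X] {J : Type*} [Finite J] (d : J → Piece X)
    (hd : ∀ x, ∃ j, x ∈ (d j).carrier) : ∃ c : J → Piece X, IsPartition c ∧
      ∀ j, (c j).κ = (d j).κ ∧ (c j).U = (d j).U ∧ (c j).s ⊆ (d j).s := by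
  let _ : MeasurableSpace X := borel X
  have : BorelSpace X := ⟨rfl⟩
  obtain ⟨n, ⟨e⟩⟩ := Finite.exists_equiv_fin J
  let A : J → Set X := fun j => (d j).carrier \ ⋃ i ∈ {i | e i < e j}, (d i).carrier
  have hA : ∀ j, MeasurableSet (A j) := fun j => (d j).measurableSet_carrier.diff
    (MeasurableSet.biUnion (Set.toFinite _).countable fun i _ => (d i).measurableSet_carrier)
  let c : J → Piece X := fun j => (d j).restrict _ ((d j).measurableSet_inter (hA j))
    inter_subset_left
  have hc : ∀ j, (c j).carrier = A j := by
    intro j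
    change (d j).κ '' ((d j).s ∩ (d j).κ ⁻¹' A j) = A j
    rw [image_inter_preimage]
    exact inter_eq_right.2 sdiff_subset
  refine ⟨c, ⟨fun i j hij => ?_, fun x => ?_⟩, fun j => ⟨rfl, rfl, inter_subset_left⟩⟩
  · have key : ∀ i j, e i < e j → Disjoint (A i) (A j) := fun i j h =>
      disjoint_left.2 fun x hx hx' => hx'.2 (mem_biUnion (show i ∈ {i | e i < e j} from h) hx.1)
    simp only [Function.onFun, hc]
    rcases lt_or_gt_of_ne (e.injective.ne hij) with h | h
    · exact key i j h
    · exact (key j i h).symm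
  · have : ∃ k : Fin n, x ∈ (d (e.symm k)).carrier := by
      obtain ⟨j, hj⟩ := hd x
      exact ⟨e j, by simpa using hj⟩
    classical
    refine ⟨e.symm (Fin.find _ this), ?_⟩
    rw [hc]
    refine ⟨Fin.find_spec this, fun h => ?_⟩
    obtain ⟨i, hi, hxi⟩ := mem_iUnion₂.1 h
    have hi' : e i < Fin.find _ this := by simpa using hi
    exact Fin.find_min this hi' (by simpa using hxi)

lemma det_smul_restrictScalars (d : ℂ) :
    |((ContinuousLinearMap.toSpanSingleton ℂ d).restrictScalars ℝ : ℂ →L[ℝ] ℂ).det| = ‖d‖ ^ 2 := by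
  have h : ((ContinuousLinearMap.toSpanSingleton ℂ d).restrictScalars ℝ : ℂ →L[ℝ] ℂ).det =
      ‖d‖ ^ 2 := by
    have h1 : LinearMap.det (((ContinuousLinearMap.toSpanSingleton ℂ d).restrictScalars ℝ :
        ℂ →L[ℝ] ℂ) : ℂ →ₗ[ℝ] ℂ) = ‖d‖ ^ 2 := by
      rw [← LinearMap.det_toMatrix basisOneI, Matrix.det_fin_two, ← normSq_eq_norm_sq, normSq_apply]
      simp [LinearMap.toMatrix_apply]
    exact h1
  rw [h, abs_of_nonneg (by positivity)]

variable [T2Space X] [IsManifold 𝓘(ℂ, ℂ) ω X]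

/-- Invariance under changes of coordinates. -/
lemma Piece.setIntegral_transition {f : X → ℝ} (hf : ContMDiff 𝓘(ℝ, ℂ) 𝓘(ℝ, ℝ) ∞ f) (F : X → ℝ)
    (c c' : Piece X) : ∫ y in c.s ∩ c.κ ⁻¹' c'.carrier, c.dens f F y =
      ∫ y in c'.s ∩ c'.κ ⁻¹' c.carrier, c'.dens f F y := by
  let _ : MeasurableSpace X := borel X
  have : BorelSpace X := ⟨rfl⟩
  set T := c.s ∩ c.κ ⁻¹' c'.carrier with hT
  have hTm : MeasurableSet T := c.measurableSet_inter c'.measurableSet_carrier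
  have h1 : ∀ y ∈ T, ∃ y' ∈ c'.s, c'.κ y' = c.κ y := fun y hy => hy.2
  -- The transition map is chosen pointwise. By injectivity on the open patches it agrees, near each
  -- point of `T` and within `T`, with a holomorphic map built from a local section.
  choose! θ hθs hθ using h1
  have himg : θ '' T = c'.s ∩ c'.κ ⁻¹' c.carrier := by
    ext y'
    constructor
    · rintro ⟨y, hy, rfl⟩
      exact ⟨hθs y hy, y, hy.1, (hθ y hy).symm⟩
    · rintro ⟨hy', y, hy, hyy⟩
      have hyT : y ∈ T := ⟨hy, y', hy', hyy.symm⟩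
      refine ⟨y, hyT, c'.inj (c'.sub (hθs y hyT)) (c'.sub hy') ?_⟩
      rw [hθ y hyT, hyy]
  have hinj : InjOn θ T := by
    intro y hy y₁ hy₁ h
    refine c.inj (c.sub hy.1) (c.sub hy₁.1) ?_
    rw [← hθ y hy, h, hθ y₁ hy₁]
  have h2 : ∀ y ∈ T, ∃ d : ℂ, HasFDerivWithinAt θ
      ((ContinuousLinearMap.toSpanSingleton ℂ d).restrictScalars ℝ : ℂ →L[ℝ] ℂ) T y ∧
      Δ (f ∘ c.κ) y = ‖d‖ ^ 2 * Δ (f ∘ c'.κ) (θ y) := by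
    intro y hy
    have hU' := c'.isOpen.mem_nhds (c'.sub (hθs y hy))
    have hκ := c.holo y (c.sub hy.1)
    obtain ⟨σ, hσ0, hσ⟩ := (c'.holo _ (c'.sub (hθs y hy))).exists_holo_section hU' c'.inj
    rw [hθ y hy] at hσ0 hσ
    set τ : ℂ → ℂ := fun y₁ => σ (c.κ y₁) with hτ
    have hτy : τ y = θ y := hσ0
    have hτa : AnalyticAt ℂ τ y := by
      rw [analyticAt_iff_eventually_differentiableAt]
      filter_upwards [hκ, hκ.continuousAt.eventually hσ] with y₁ h3 h4
      exact (h4.1.comp y₁ h3).differentiableAt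
    have hev : ∀ᶠ y₁ in 𝓝 y, c'.κ (τ y₁) = c.κ y₁ := by
      filter_upwards [hκ.continuousAt.eventually hσ] with y₁ h4 using h4.2
    have hτU : ∀ᶠ y₁ in 𝓝 y, τ y₁ ∈ c'.U := by
      refine hτa.continuousAt.eventually ?_
      rw [hτy]; exact hU'
    refine ⟨deriv τ y, ?_, ?_⟩
    · have h3 : HasFDerivAt τ ((ContinuousLinearMap.toSpanSingleton ℂ (deriv τ y)).restrictScalars ℝ :
          ℂ →L[ℝ] ℂ) y := hτa.differentiableAt.hasDerivAt.hasFDerivAt.restrictScalars ℝ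
      refine h3.hasFDerivWithinAt.congr_of_eventuallyEq ?_ hτy.symm
      filter_upwards [self_mem_nhdsWithin, nhdsWithin_le_nhds hev, nhdsWithin_le_nhds hτU]
        with y₁ h4 h5 h6
      refine c'.inj (c'.sub (hθs y₁ h4)) h6 ?_
      rw [hθ y₁ h4, h5]
    · have h3 : f ∘ c.κ =ᶠ[𝓝 y] (f ∘ c'.κ) ∘ τ := by
        filter_upwards [hev] with y₁ h4
        simp only [Function.comp_apply, h4]
      rw [laplacian_congr_nhds h3 |>.self_of_nhds, ← hτy]
      refine laplacian_comp ?_ hτa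
      exact (contDiffAt_comp_holo hf (c'.holo _ (by
        rw [hτy]; exact c'.sub (hθs y hy)))).of_le two_le_infty
  choose! d hd hΔ using h2
  rw [← himg, integral_image_eq_integral_abs_det_fderiv_smul volume hTm hd hinj]
  refine setIntegral_congr_fun hTm fun y hy => ?_
  simp only [Piece.dens]
  -- The conformal factor of the Laplacian is exactly the real Jacobian of the transition map.
  rw [det_smul_restrictScalars, hΔ y hy, hθ y hy, smul_eq_mul]
  ring

lemma Piece.setIntegral_eq_sum {f : X → ℝ} {F : X → ℝ} {J : Type*} [Fintype J] {c : J → Piece X}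
    (hc : IsPartition c) (d : Piece X) (hd : IntegrableOn (d.dens f F) d.s) :
    ∫ y in d.s, d.dens f F y = ∑ j, ∫ y in d.s ∩ d.κ ⁻¹' (c j).carrier, d.dens f F y := by
  let _ : MeasurableSpace X := borel X
  have : BorelSpace X := ⟨rfl⟩
  rw [← integral_iUnion_fintype (fun j => d.measurableSet_inter (c j).measurableSet_carrier)
    (fun i j hij => ?_) (fun j => hd.mono_set inter_subset_left)]
  · congr 2
    rw [← inter_iUnion, left_eq_inter]
    intro y _
    obtain ⟨j, hj⟩ := hc.cover (d.κ y)
    exact mem_iUnion.2 ⟨j, hj⟩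
  · exact ((hc.disjoint hij).preimage d.κ).mono inter_subset_right inter_subset_right

/-- The integral of `F Δf` over the surface does not depend on the decomposition. -/
lemma IsPartition.sum_integral_eq {f : X → ℝ} (hf : ContMDiff 𝓘(ℝ, ℂ) 𝓘(ℝ, ℝ) ∞ f) {F : X → ℝ}
    {J J' : Type*} [Fintype J] [Fintype J'] {c : J → Piece X} {c' : J' → Piece X}
    (hc : IsPartition c) (hc' : IsPartition c')
    (hi : ∀ j, IntegrableOn ((c j).dens f F) (c j).s)
    (hi' : ∀ j, IntegrableOn ((c' j).dens f F) (c' j).s) :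
    ∑ j, ∫ y in (c j).s, (c j).dens f F y = ∑ j, ∫ y in (c' j).s, (c' j).dens f F y := by
  -- Both sides are expanded over the common refinement of the two decompositions.
  rw [Finset.sum_congr rfl fun j _ => Piece.setIntegral_eq_sum hc' (c j) (hi j),
    Finset.sum_congr rfl fun j _ => Piece.setIntegral_eq_sum hc (c' j) (hi' j), Finset.sum_comm]
  exact Finset.sum_congr rfl fun j' _ => Finset.sum_congr rfl fun j _ =>
    Piece.setIntegral_transition hf F _ _

end Pieces

/-! ### The mass of a half-cylinder -/

section Strips

open Set Filter Complex Laplacian MeasureTheory InnerProductSpace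

lemma ContDiffAt.continuousAt_laplacian {G : ℂ → ℝ} {y : ℂ} (h : ContDiffAt ℝ 2 G y) :
    ContinuousAt (Δ G) y := by
  have h1 : ContinuousAt (iteratedFDeriv ℝ 2 G) y :=
    (h.iteratedFDeriv_right (m := 0) (i := 2) (by norm_num)).continuousAt
  rw [show Δ G = fun z => iteratedFDeriv ℝ 2 G z ![1, 1] + iteratedFDeriv ℝ 2 G z ![I, I] from
    laplacian_eq_iteratedFDeriv_complexPlane G]
  have h2 : ∀ v : Fin 2 → ℂ, ContinuousAt (fun z => iteratedFDeriv ℝ 2 G z v) y := fun v =>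
    ((ContinuousMultilinearMap.apply ℝ (fun _ : Fin 2 => ℂ) ℝ v).continuous.continuousAt).comp h1
  exact (h2 _).add (h2 _)

/-- A fundamental domain of the half-cylinder `ρ < Re z`. -/
def strip (ρ : ℝ) : Set ℂ := {z | ρ < z.re ∧ z.im ∈ Ico (0 : ℝ) 1}

lemma measurableSet_strip (ρ : ℝ) : MeasurableSet (strip ρ) :=
  (measurable_re measurableSet_Ioi).inter (measurable_im measurableSet_Ico)

lemma ContDiffOn.continuousOn_fderiv_one {G : ℂ → ℝ} {R : ℝ}
    (hG : ContDiffOn ℝ 2 G {z | R < z.re}) :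
    ContinuousOn (fun z => fderiv ℝ G z 1) {z | R < z.re} :=
  (hG.continuousOn_fderiv_of_isOpen (isOpen_rightHalf R) one_le_two).clm_apply continuousOn_const

lemma tendsto_segMean_fderiv {G : ℂ → ℝ} {R a : ℝ} (hG : ContDiffOn ℝ 2 G {z | R < z.re})
    (h : Tendsto (wirt G) (endFilter 1) (𝓝 (a : ℂ))) :
    Tendsto (segMean fun z => fderiv ℝ G z 1) atTop (𝓝 a) := by
  rw [Metric.tendsto_atTop]
  intro ε hε
  obtain ⟨R', hR⟩ := mem_endFilter.1 (h (Metric.closedBall_mem_nhds (a : ℂ) (half_pos hε)))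
  refine ⟨max R' (R + 1), fun ρ hρ => ?_⟩
  have h1 : ∀ θ ∈ Icc (0 : ℝ) 1, |fderiv ℝ G (ρ + θ * I) 1 - a| ≤ ε / 2 := by
    intro θ _
    have h2 : ‖wirt G (ρ + θ * I) - a‖ ≤ ε / 2 := by
      rw [← dist_eq]
      exact hR (ρ + θ * I) (by simpa using (le_max_left _ _).trans hρ)
    have h3 : fderiv ℝ G (ρ + θ * I) 1 - a = (wirt G (ρ + θ * I) - a).re := by
      rw [fderiv_eq_wirt, mul_one, sub_re, ofReal_re]
    rw [h3]
    exact (abs_re_le_norm _).trans h2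
  have hi : IntervalIntegrable (fun θ : ℝ => fderiv ℝ G (ρ + θ * I) 1) volume 0 1 :=
    (continuous_segment hG.continuousOn_fderiv_one
      (by linarith [(le_max_right R' (R + 1)).trans hρ])).intervalIntegrable _ _
  have h4 : segMean (fun z => fderiv ℝ G z 1) ρ - a =
      ∫ θ : ℝ in (0 : ℝ)..1, (fderiv ℝ G (ρ + θ * I) 1 - a) := by
    rw [intervalIntegral.integral_sub hi intervalIntegrable_const]
    simp [segMean]
  rw [Real.dist_eq, h4, ← Real.norm_eq_abs]
  refine (intervalIntegral.norm_integral_le_of_norm_le_const (C := ε / 2) fun θ hθ => ?_).trans_lt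
    ?_
  · rw [uIoc_of_le zero_le_one] at hθ
    exact h1 θ ⟨hθ.1.le, hθ.2⟩
  · simpa using half_lt_self hε

/-- The flux through the circle at height `ρ` has derivative the mean of the Laplacian and tends to
the slope. The mass is the difference of the fluxes, and nonnegativity of the Laplacian turns the
existence of the limit into integrability. -/
lemma integrableOn_strip {G : ℂ → ℝ} {R ρ a : ℝ} (hG : ContDiffOn ℝ 2 G {z | R < z.re})
    (hper : ∀ z, R < z.re → G (z + I) = G z) (hΔ : ∀ z, R < z.re → 0 ≤ Δ G z)
    (h : Tendsto (wirt G) (endFilter 1) (𝓝 (a : ℂ))) (hρ : R < ρ) :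
    IntegrableOn (Δ G) (strip ρ) ∧
      ∫ z in strip ρ, Δ G z = a - segMean (fun z => fderiv ℝ G z 1) ρ := by
  have ho : IsOpen {z : ℂ | R < z.re} := isOpen_rightHalf R
  have hc : ContinuousOn (Δ G) {z | R < z.re} := fun z hz =>
    ((hG.contDiffAt (ho.mem_nhds hz)).continuousAt_laplacian).continuousWithinAt
  have hd : ∀ x ∈ Ici ρ, HasDerivAt (segMean fun z => fderiv ℝ G z 1) (segMean (Δ G) x) x :=
    fun x hx => hasDerivAt_segMean_fderiv hG hper (hρ.trans_le hx)
  have hseg : ∀ x ∈ Ioi ρ, ∫ θ in Ico (0 : ℝ) 1, Δ G (x + θ * I) = segMean (Δ G) x := by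
    intro x _
    rw [segMean, intervalIntegral.integral_of_le zero_le_one, integral_Ico_eq_integral_Ioc]
  have hnn : ∀ x ∈ Ioi ρ, ∀ θ : ℝ, 0 ≤ Δ G (x + θ * I) := fun x hx θ =>
    hΔ _ (by simpa using hρ.trans hx)
  have hpos : ∀ x ∈ Ioi ρ, 0 ≤ segMean (Δ G) x := fun x hx => by
    rw [← hseg x hx]
    exact setIntegral_nonneg measurableSet_Ico fun θ _ => hnn x hx θ
  have hlim := tendsto_segMean_fderiv hG h
  have hI := integrableOn_Ioi_deriv_of_nonneg' hd hpos hlim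
  have hV := integral_Ioi_of_hasDerivAt_of_nonneg' hd hpos hlim
  set F : ℝ × ℝ → ℝ := fun q => Δ G (q.1 + q.2 * I) with hF
  have hFc : ContinuousOn F (Ioi ρ ×ˢ Ico (0 : ℝ) 1) := by
    refine hc.comp (by fun_prop) fun q hq => ?_
    have := hq.1
    simp only [mem_Ioi] at this
    simpa using hρ.trans this
  have hm : MeasurableSet (Ioi ρ ×ˢ Ico (0 : ℝ) 1) := measurableSet_Ioi.prod measurableSet_Ico
  have hFm : AEStronglyMeasurable F ((volume.restrict (Ioi ρ)).prod
      (volume.restrict (Ico (0 : ℝ) 1))) := by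
    rw [Measure.prod_restrict]
    exact hFc.aestronglyMeasurable hm
  -- Integrability on the product follows from Tonelli's criterion: each slice is continuous on a
  -- compact interval, and the slice integrals are the integrable derivative of the flux.
  have hFi : Integrable F ((volume.restrict (Ioi ρ)).prod (volume.restrict (Ico (0 : ℝ) 1))) := by
    rw [integrable_prod_iff hFm]
    constructor
    · filter_upwards [ae_restrict_mem measurableSet_Ioi] with x hx
      have := (continuous_segment hc (hρ.trans hx)).integrableOn_Icc (a := 0) (b := 1)
        (μ := volume)
      exact this.mono_set Ico_subset_Icc_self
    · refine Integrable.congr hI ?_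
      filter_upwards [ae_restrict_mem measurableSet_Ioi] with x hx
      rw [← hseg x hx]
      refine setIntegral_congr_fun measurableSet_Ico fun θ _ => ?_
      exact (Real.norm_of_nonneg (hnn x hx θ)).symm
  have hS : strip ρ = measurableEquivRealProd ⁻¹' (Ioi ρ ×ˢ Ico (0 : ℝ) 1) := rfl
  have hGF : Δ G = F ∘ measurableEquivRealProd := by
    funext z
    simp [hF, measurableEquivRealProd_apply]
  have hFi' : IntegrableOn F (Ioi ρ ×ˢ Ico (0 : ℝ) 1) volume := by
    rw [IntegrableOn, Measure.volume_eq_prod, ← Measure.prod_restrict]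
    exact hFi
  constructor
  · rw [hS, hGF]
    exact (volume_preserving_equiv_real_prod.integrableOn_comp_preimage
      measurableEquivRealProd.measurableEmbedding).2 hFi'
  · have h1 : ∫ z in strip ρ, Δ G z = ∫ q in Ioi ρ ×ˢ Ico (0 : ℝ) 1, F q := by
      rw [hS, hGF]
      exact volume_preserving_equiv_real_prod.setIntegral_preimage_emb
        measurableEquivRealProd.measurableEmbedding F _
    rw [h1, ← hV, Measure.volume_eq_prod, ← Measure.prod_restrict, integral_prod F hFi]
    exact setIntegral_congr_fun measurableSet_Ioi fun x hx => hseg x hx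

end Strips

/-! ### Decompositions of a punctured surface into compact pieces and ends -/

section Decomposition

open Set Filter Complex Laplacian MeasureTheory InnerProductSpace

/-- Joint continuity over a compact set gives uniform convergence of the integrands, and the domain
of integration has finite measure. -/
lemma tendsto_setIntegral_of_compact {Z α : Type*} [TopologicalSpace Z] [TopologicalSpace α]
    [MeasurableSpace α] {μ : Measure α} {F : Z → α → ℝ} {s K : Set α} {z₀ : Z}
    (hK : IsCompact K) (hs : s ⊆ K) (hμ : μ s < ⊤) (hF : ∀ z, IntegrableOn (F z) s μ)
    (hc : ∀ y ∈ K, ContinuousAt (fun p : Z × α => F p.1 p.2) (z₀, y)) :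
    Tendsto (fun z => ∫ y in s, F z y ∂μ) (𝓝 z₀) (𝓝 (∫ y in s, F z₀ y ∂μ)) := by
  rw [Metric.tendsto_nhds]
  intro ε hε
  set δ : ℝ := ε / (μ.real s + 1) with hδ
  have hm : 0 ≤ μ.real s := measureReal_nonneg
  have hδ0 : 0 < δ := by positivity
  have h1 : ∀ y ∈ K, ∀ᶠ p : Z × α in 𝓝 (z₀, y), ‖F p.1 p.2 - F z₀ p.2‖ ≤ δ := by
    intro y hy
    have h2 : ContinuousAt (fun p : Z × α => F z₀ p.2) (z₀, y) :=
      (hc y hy).comp_of_eq (f := fun p : Z × α => (z₀, p.2)) (by fun_prop) rfl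
    have h3 := ((hc y hy).sub h2).norm
    have h4 : ‖F z₀ y - F z₀ y‖ < δ := by simpa using hδ0
    filter_upwards [h3.eventually (gt_mem_nhds h4)] with p hp using hp.le
  filter_upwards [hK.eventually_forall_of_forall_eventually
    (P := fun z y => ‖F z y - F z₀ y‖ ≤ δ) h1] with z hz
  rw [dist_eq_norm, ← integral_sub (hF z) (hF z₀)]
  refine (norm_setIntegral_le_of_norm_le_const hμ fun y hy => hz y (hs hy)).trans_lt ?_
  rw [hδ, div_mul_eq_mul_div, div_lt_iff₀ (by positivity)]
  nlinarith

variable {S : Type*} [TopologicalSpace S] [T2Space S] [ChartedSpace ℂ S] [IsManifold 𝓘(ℂ, ℂ) ω S]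
  {P : Punctures S}

/-- A piece with compact closure in its coordinate patch. -/
def Piece.IsRelCompact {X : Type*} [TopologicalSpace X] [ChartedSpace ℂ X] (c : Piece X) : Prop :=
  ∃ K, IsCompact K ∧ K ⊆ c.U ∧ c.s ⊆ K

/-- A piece of the end at a puncture. -/
def Piece.IsEnd (x₀ : P.dot) (c : Piece P.dot) : Prop :=
  ∃ p ∉ P.dot, ∃ ρ, endR P p < ρ ∧ c.κ = endLift x₀ p ∧ c.s ⊆ strip ρ

lemma endLift_injOn (x₀ : P.dot) (p : S) (a : ℝ) :
    InjOn (endLift x₀ p) {z | endR P p < z.re ∧ z.im ∈ Ioo a (a + 1)} := by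
  intro z hz z' hz' h
  have h1 : endMap p z = endMap p z' := by
    rw [← coe_endLift x₀ hz.1, ← coe_endLift x₀ hz'.1, h]
  obtain ⟨n, hn⟩ := (endMap_eq_iff hz.1 hz'.1).1 h1
  have him : z.im - z'.im = n := by
    have := congrArg im hn
    simpa using this
  have h2 : |(n : ℝ)| < 1 := by
    rw [← him, abs_lt]
    constructor <;> linarith [hz.2.1, hz.2.2, hz'.2.1, hz'.2.2]
  have h3 : n = 0 := by
    rw [← Int.abs_lt_one_iff]
    exact_mod_cast h2
  rw [h3, Int.cast_zero, zero_mul, sub_eq_zero] at hn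
  exact hn

/-- A half of the half-cylinder at `p`. -/
def endPiece (x₀ : P.dot) (p : S) (b : ℝ) : Piece P.dot where
  κ := endLift x₀ p
  -- The parametrization of an end is not injective on a neighbourhood of a whole fundamental
  -- domain, so the end is cut into two halves of height `1/2`. A margin of `1/4` on each side
  -- leaves an open strip of height one.
  U := {z | endR P p < z.re ∧ z.im ∈ Ioo (b - 1 / 4) (b - 1 / 4 + 1)}
  s := {z | endR P p + 1 < z.re ∧ z.im ∈ Ico b (b + 1 / 2)}
  isOpen := (isOpen_rightHalf _).inter (isOpen_Ioo.preimage continuous_im)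
  holo := fun _ hz => holoAt_endLift x₀ hz.1
  inj := endLift_injOn x₀ p _
  sub := fun z hz => ⟨by linarith [hz.1], by linarith [hz.2.1], by linarith [hz.2.2]⟩
  meas := (measurable_re measurableSet_Ioi).inter (measurable_im measurableSet_Ico)

lemma isEnd_endPiece (x₀ : P.dot) {p : S} (hp : p ∉ P.dot) {b : ℝ} (h0 : 0 ≤ b) (h1 : b ≤ 1 / 2) :
    (endPiece x₀ p b).IsEnd x₀ :=
  ⟨p, hp, endR P p + 1, by linarith, rfl, fun _ hz =>
    ⟨hz.1, h0.trans hz.2.1, by linarith [hz.2.2]⟩⟩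

/-- A closed coordinate disc. -/
def ballPiece {X : Type*} [TopologicalSpace X] [ChartedSpace ℂ X] [IsManifold 𝓘(ℂ, ℂ) ω X] (x : X)
    (y : ℂ) (r : ℝ) (h : Metric.closedBall y r ⊆ (chartAt ℂ x).target) : Piece X where
  κ := (chartAt ℂ x).symm
  U := (chartAt ℂ x).target
  s := Metric.closedBall y r
  isOpen := (chartAt ℂ x).open_target
  holo := fun _ hz => holoAt_chartAt_symm x hz
  inj := (chartAt ℂ x).symm.injOn
  sub := h
  meas := Metric.isClosed_closedBall.measurableSet

lemma isRelCompact_ballPiece {X : Type*} [TopologicalSpace X] [ChartedSpace ℂ X]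
    [IsManifold 𝓘(ℂ, ℂ) ω X] (x : X) (y : ℂ) (r : ℝ)
    (h : Metric.closedBall y r ⊆ (chartAt ℂ x).target) : (ballPiece x y r h).IsRelCompact :=
  ⟨Metric.closedBall y r, isCompact_closedBall y r, h, Subset.rfl⟩

lemma Piece.mono_cases {x₀ : P.dot} {c d : Piece P.dot} (hκ : c.κ = d.κ) (hU : c.U = d.U)
    (hs : c.s ⊆ d.s) (h : d.IsRelCompact ∨ d.IsEnd x₀) : c.IsRelCompact ∨ c.IsEnd x₀ := by
  rcases h with ⟨K, h1, h2, h3⟩ | ⟨p, hp, ρ, h1, h2, h3⟩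
  · exact Or.inl ⟨K, h1, hU ▸ h2, hs.trans h3⟩
  · exact Or.inr ⟨p, hp, ρ, h1, hκ.trans h2, hs.trans h3⟩

/-- Finitely many closed coordinate discs cover the compact core, two half-ends cover the
neighbourhood of each puncture, and overlaps are then removed. -/
lemma exists_decomposition [CompactSpace S] (P : Punctures S) (x₀ : P.dot) :
    ∃ (n : ℕ) (c : Fin n → Piece P.dot), IsPartition c ∧
      ∀ j, (c j).IsRelCompact ∨ (c j).IsEnd x₀ := by
  obtain ⟨K, hK, hcov⟩ := exists_compact_core P fun p => endR P p + 1
  have h1 : ∀ x : P.dot, ∃ r > 0, Metric.closedBall (chartAt ℂ x x) r ⊆ (chartAt ℂ x).target := by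
    intro x
    exact Metric.nhds_basis_closedBall.mem_iff.1
      ((chartAt ℂ x).open_target.mem_nhds (mem_chart_target ℂ x))
  choose r hr hsub using h1
  let B : P.dot → Piece P.dot := fun x => ballPiece x _ (r x) (hsub x)
  have h2 : ∀ x, (B x).carrier ∈ 𝓝 x := by
    intro x
    filter_upwards [(chartAt ℂ x).open_source.mem_nhds (mem_chart_source ℂ x),
      ((chartAt ℂ x).continuousAt (mem_chart_source ℂ x)).eventually
        (Metric.closedBall_mem_nhds _ (hr x))] with x' h1 h2 using ⟨_, h2, (chartAt ℂ x).left_inv h1⟩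
  obtain ⟨T, -, hT⟩ := hK.elim_nhds_subcover (fun x => (B x).carrier) fun x _ => h2 x
  have := (finite_punctures P).to_subtype
  let d : T ⊕ ({p : S | p ∉ P.dot} × Bool) → Piece P.dot := Sum.elim (fun x => B x)
    fun q => endPiece x₀ q.1 (if q.2 then 1 / 2 else 0)
  have hd : ∀ x, ∃ j, x ∈ (d j).carrier := by
    intro x
    rcases hcov x with hx | ⟨p, hp, ζ, h3, h4, h5⟩
    · obtain ⟨y, hy, hxy⟩ := mem_iUnion₂.1 (hT hx)
      exact ⟨.inl ⟨y, hy⟩, hxy⟩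
    · have hx : endLift x₀ p ζ = x := Subtype.ext (by rw [coe_endLift x₀ (by linarith), h5])
      by_cases h : ζ.im < 1 / 2
      · exact ⟨.inr (⟨p, hp⟩, false), ζ, ⟨h3, by simpa using h4.1, by simpa using h⟩, hx⟩
      · refine ⟨.inr (⟨p, hp⟩, true), ζ, ⟨h3, ?_, ?_⟩, hx⟩
        · simpa using h
        · have := h4.2
          simp only [if_true]
          linarith
  have hd' : ∀ j, (d j).IsRelCompact ∨ (d j).IsEnd x₀ := by
    rintro (x | ⟨p, b⟩)
    · exact Or.inl (isRelCompact_ballPiece _ _ _ _)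
    · refine Or.inr (isEnd_endPiece x₀ p.2 ?_ ?_) <;> split_ifs <;> norm_num
  obtain ⟨n, ⟨e⟩⟩ := Finite.exists_equiv_fin (T ⊕ ({p : S | p ∉ P.dot} × Bool))
  obtain ⟨c, hc, hcd⟩ := exists_isPartition (d ∘ e.symm) fun x => by
    obtain ⟨j, hj⟩ := hd x
    exact ⟨e j, by simpa using hj⟩
  exact ⟨n, c, hc, fun j => Piece.mono_cases (hcd j).1 (hcd j).2.1 (hcd j).2.2 (hd' _)⟩

end Decomposition

/-! ### The center of a subharmonic function -/

section Center

open Set Filter Complex Laplacian MeasureTheory InnerProductSpace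

variable {S : Type*} [TopologicalSpace S] [T2Space S] [ChartedSpace ℂ S] [IsManifold 𝓘(ℂ, ℂ) ω S]
  {P : Punctures S}

/-- Smooth subharmonic functions with slopes `a` at the punctures. -/
structure IsSloped (a : S → ℝ) (f : P.dot → ℝ) : Prop where
  contMDiff : ContMDiff 𝓘(ℝ, ℂ) 𝓘(ℝ, ℝ) ∞ f
  subharm : Subharm f
  hasSlope : ∀ p ∉ P.dot, HasSlope f p (a p)

lemma contDiffAt_two_comp {f : P.dot → ℝ} (hf : ContMDiff 𝓘(ℝ, ℂ) 𝓘(ℝ, ℝ) ∞ f) {κ : ℂ → P.dot}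
    {y : ℂ} (hκ : HoloAt κ y) : ContDiffAt ℝ 2 (f ∘ κ) y :=
  (contDiffAt_comp_holo hf hκ).of_le two_le_infty

lemma laplacian_sub_const (f : P.dot → ℝ) (b : ℝ) (κ : ℂ → P.dot) (y : ℂ) :
    Δ ((fun x => f x - b) ∘ κ) y = Δ (f ∘ κ) y := by
  have h : iteratedFDeriv ℝ 2 ((fun x => f x - b) ∘ κ) y = iteratedFDeriv ℝ 2 (f ∘ κ) y := by
    rw [show ((fun x => f x - b) ∘ κ) = fun y => (f ∘ κ) y - b from rfl]
    ext v
    rw [iteratedFDeriv_two_apply, iteratedFDeriv_two_apply]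
    have : fderiv ℝ (fun y => (f ∘ κ) y - b) = fderiv ℝ (f ∘ κ) := by
      funext y
      exact fderiv_sub_const b
    rw [this]
  rw [laplacian_eq_iteratedFDeriv_complexPlane, laplacian_eq_iteratedFDeriv_complexPlane]
  simp only [h]

lemma IsSloped.sub_const {a : S → ℝ} {f : P.dot → ℝ} (h : IsSloped a f) (b : ℝ) :
    IsSloped a (fun x => f x - b) where
  contMDiff := h.contMDiff.sub contMDiff_const
  subharm := fun κ y hκ => by
    rw [laplacian_sub_const]
    exact h.subharm κ y hκ
  hasSlope := fun p hp => by
    obtain ⟨x₀⟩ : Nonempty P.dot :=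
      ⟨⟨endMap p ((endR P p + 1 : ℝ) : ℂ), endMap_mem_dot (by simp)⟩⟩
    refine Tendsto.congr' ?_ (h.hasSlope p hp)
    filter_upwards [eventually_endFilter_gt (endR P p)] with ζ hζ
    rw [wirt_congr (fext_comp_endMap x₀ f hζ), wirt_congr (fext_comp_endMap x₀ _ hζ)]
    have : fderiv ℝ ((fun x => f x - b) ∘ endLift x₀ p) ζ = fderiv ℝ (f ∘ endLift x₀ p) ζ :=
      fderiv_sub_const (f := f ∘ endLift x₀ p) b
    simp only [wirt, this]

/-- The mass of an end. -/
lemma IsSloped.integrableOn_strip {a : S → ℝ} {f : P.dot → ℝ} (h : IsSloped a f) (x₀ : P.dot)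
    {p : S} (hp : p ∉ P.dot) {ρ : ℝ} (hρ : endR P p < ρ) :
    IntegrableOn (Δ (f ∘ endLift x₀ p)) (strip ρ) ∧ ∫ z in strip ρ, Δ (f ∘ endLift x₀ p) z =
      a p - segMean (fun z => fderiv ℝ (f ∘ endLift x₀ p) z 1) ρ :=
  _root_.integrableOn_strip ((contDiffOn_comp_endLift x₀ h.contMDiff p).of_le two_le_infty)
    (fun _ hz => congrArg f (endLift_add_I x₀ hz))
    (fun _ hz => h.subharm _ _ (holoAt_endLift x₀ hz)) ((h.hasSlope p hp).tendsto_endLift x₀) hρ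

lemma IsSloped.continuousOn_laplacian {a : S → ℝ} {f : P.dot → ℝ} (h : IsSloped a f)
    (c : Piece P.dot) : ContinuousOn (Δ (f ∘ c.κ)) c.U := fun _ hy =>
  ((contDiffAt_two_comp h.contMDiff (c.holo _ hy)).continuousAt_laplacian).continuousWithinAt

lemma IsSloped.integrableOn_laplacian {a : S → ℝ} {f : P.dot → ℝ} (h : IsSloped a f) {x₀ : P.dot}
    {c : Piece P.dot} (hc : c.IsRelCompact ∨ c.IsEnd x₀) : IntegrableOn (Δ (f ∘ c.κ)) c.s := by
  rcases hc with ⟨K, h1, h2, h3⟩ | ⟨p, hp, ρ, h1, h2, h3⟩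
  · exact (((h.continuousOn_laplacian c).mono h2).integrableOn_compact h1).mono_set h3
  · rw [h2]
    exact (h.integrableOn_strip x₀ hp h1).1.mono_set h3

lemma IsSloped.integrableOn_dens {a : S → ℝ} {f : P.dot → ℝ} (h : IsSloped a f) {x₀ : P.dot}
    {c : Piece P.dot} (hc : c.IsRelCompact ∨ c.IsEnd x₀) {F : P.dot → ℝ} (hF : Continuous F) {C : ℝ}
    (hFC : ∀ x, |F x| ≤ C) : IntegrableOn (c.dens f F) c.s :=
  (h.integrableOn_laplacian hc).bdd_mul (c := C)
    ((hF.comp_continuousOn c.continuousOn).aestronglyMeasurable c.meas)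
    (Eventually.of_forall fun y => hFC (c.κ y))

lemma continuous_arctan_sub {f : P.dot → ℝ} (hf : Continuous f) (b : ℝ) :
    Continuous fun x => Real.arctan (f x - b) :=
  Real.continuous_arctan.comp (hf.sub continuous_const)

lemma abs_arctan_le (x : ℝ) : |Real.arctan x| ≤ Real.pi / 2 :=
  abs_le.2 ⟨(Real.neg_pi_div_two_lt_arctan x).le, (Real.arctan_lt_pi_div_two x).le⟩

lemma IsSloped.integrableOn_arctan {a : S → ℝ} {f : P.dot → ℝ} (h : IsSloped a f) {x₀ : P.dot}
    {c : Piece P.dot} (hc : c.IsRelCompact ∨ c.IsEnd x₀) (b : ℝ) :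
    IntegrableOn (c.dens f fun x => Real.arctan (f x - b)) c.s :=
  h.integrableOn_dens hc (continuous_arctan_sub h.contMDiff.continuous b) fun x =>
    abs_arctan_le (f x - b)

variable {n : ℕ} {c : Fin n → Piece P.dot} {x₀ : P.dot}

/-- The total mass `∫ Δf`. -/
def mass (c : Fin n → Piece P.dot) (f : P.dot → ℝ) : ℝ := ∑ j, ∫ y in (c j).s, Δ (f ∘ (c j).κ) y

/-- `∫ arctan (f - b) Δf`. -/
def moment (c : Fin n → Piece P.dot) (f : P.dot → ℝ) (b : ℝ) : ℝ :=
  ∑ j, ∫ y in (c j).s, (c j).dens f (fun x => Real.arctan (f x - b)) y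

lemma IsSloped.laplacian_nonneg {a : S → ℝ} {f : P.dot → ℝ} (h : IsSloped a f) (c : Piece P.dot)
    {y : ℂ} (hy : y ∈ c.s) : 0 ≤ Δ (f ∘ c.κ) y := h.subharm _ _ (c.holo y (c.sub hy))

lemma mass_nonneg {a : S → ℝ} {f : P.dot → ℝ} (h : IsSloped a f) : 0 ≤ mass c f :=
  Finset.sum_nonneg fun j _ => setIntegral_nonneg (c j).meas fun _ hy => h.laplacian_nonneg _ hy

/-- Any holomorphic parametrization factors through a chart, and the Laplacian only acquires the
conformal factor. -/
lemma harm_of_charts {f : P.dot → ℝ} (hf : ContMDiff 𝓘(ℝ, ℂ) 𝓘(ℝ, ℝ) ∞ f)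
    (h : ∀ x : P.dot, ∀ y ∈ (chartAt ℂ x).target, Δ (f ∘ (chartAt ℂ x).symm) y = 0) : Harm f := by
  intro κ y hκ
  have hx := mem_chart_source ℂ (κ y)
  have h2 : f ∘ κ =ᶠ[𝓝 y] (f ∘ (chartAt ℂ (κ y)).symm) ∘ (chartAt ℂ (κ y) ∘ κ) := by
    filter_upwards [hκ.continuousAt.eventually ((chartAt ℂ (κ y)).open_source.mem_nhds hx)] with z hz
    simp only [Function.comp_apply, (chartAt ℂ (κ y)).left_inv hz]
  have ht : (chartAt ℂ (κ y) ∘ κ) y ∈ (chartAt ℂ (κ y)).target := (chartAt ℂ (κ y)).map_source hx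
  rw [(laplacian_congr_nhds h2).self_of_nhds, laplacian_comp
    (contDiffAt_two_comp hf (holoAt_chartAt_symm _ ht)) (hκ.analyticAt_chart _ hx), h _ _ ht, mul_zero]

/-- A point with positive Laplacian has a small coordinate disc of positive mass. The mass of the
disc is distributed over the pieces of the decomposition, so it vanishes if all pieces have mass
zero. -/
lemma mass_pos {a : S → ℝ} {f : P.dot → ℝ} (h : IsSloped a f) (hc : IsPartition c)
    (hce : ∀ j, (c j).IsRelCompact ∨ (c j).IsEnd x₀) (hf : ¬ Harm f) : 0 < mass c f := by
  refine lt_of_le_of_ne (mass_nonneg h) fun h0 => hf (harm_of_charts h.contMDiff fun x y hy => ?_)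
  by_contra hne
  have hcs : ∀ y ∈ (chartAt ℂ x).target, HoloAt (chartAt ℂ x).symm y := fun y hy =>
    holoAt_chartAt_symm x hy
  have hpos : 0 < Δ (f ∘ (chartAt ℂ x).symm) y := lt_of_le_of_ne (h.subharm _ _ (hcs y hy))
    (Ne.symm hne)
  have hcont := (contDiffAt_two_comp h.contMDiff (hcs y hy)).continuousAt_laplacian
  obtain ⟨r, hr, hrs⟩ := Metric.nhds_basis_closedBall.mem_iff.1
    (((chartAt ℂ x).open_target.eventually_mem hy).and (hcont.eventually (lt_mem_nhds hpos)))
  let d : Piece P.dot := ballPiece x y r fun z hz => (hrs hz).1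
  have hde : d.IsRelCompact ∨ d.IsEnd x₀ := Or.inl (isRelCompact_ballPiece x y r _)
  have hone : ∀ e : Piece P.dot, e.dens f (fun _ => 1) = Δ (f ∘ e.κ) := fun e => by
    funext z
    exact one_mul _
  have hj : ∀ j, ∫ z in (c j).s, Δ (f ∘ (c j).κ) z = 0 := fun j =>
    (Finset.sum_eq_zero_iff_of_nonneg (fun j _ => setIntegral_nonneg (c j).meas fun _ hy =>
      h.laplacian_nonneg _ hy)).1 h0.symm j (Finset.mem_univ j)
  have hd0 : ∫ z in d.s, Δ (f ∘ d.κ) z = 0 := by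
    have h1 := Piece.setIntegral_eq_sum (F := fun _ => 1) (f := f) hc d
      (by rw [hone]; exact h.integrableOn_laplacian hde)
    rw [hone] at h1
    rw [h1]
    refine Finset.sum_eq_zero fun j _ => ?_
    have h2 := Piece.setIntegral_transition h.contMDiff (fun _ => 1) d (c j)
    rw [hone, hone] at h2
    rw [h2]
    refine le_antisymm ?_ ?_
    · rw [← hj j]
      refine setIntegral_mono_set (h.integrableOn_laplacian (hce j)) ?_ inter_subset_left.eventuallyLE
      filter_upwards [ae_restrict_mem (c j).meas] with z hz using h.laplacian_nonneg _ hz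
    · let _ : MeasurableSpace P.dot := borel P.dot
      have : BorelSpace P.dot := ⟨rfl⟩
      exact setIntegral_nonneg ((c j).measurableSet_inter d.measurableSet_carrier) fun _ hz =>
        h.laplacian_nonneg _ hz.1
  have hd1 : 0 < ∫ z in d.s, Δ (f ∘ d.κ) z := by
    rw [setIntegral_pos_iff_support_of_nonneg_ae]
    · refine lt_of_lt_of_le (Metric.measure_ball_pos volume y hr) (measure_mono fun z hz => ?_)
      have := hrs (Metric.ball_subset_closedBall hz)
      exact ⟨this.2.ne', Metric.ball_subset_closedBall hz⟩
    · filter_upwards [ae_restrict_mem d.meas] with z hz using h.laplacian_nonneg _ hz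
    · exact h.integrableOn_laplacian hde
  exact hd1.ne' hd0

/-- The function `arctan` is strictly increasing, and equality of the integrals would force the
Laplacian to vanish almost everywhere on every piece, contrary to positive mass. -/
lemma moment_lt {a : S → ℝ} {f : P.dot → ℝ} (h : IsSloped a f) (hc : IsPartition c)
    (hce : ∀ j, (c j).IsRelCompact ∨ (c j).IsEnd x₀) (hf : ¬ Harm f) {b b' : ℝ} (hb : b < b') :
    moment c f b' < moment c f b := by
  have hlt : ∀ x, Real.arctan (f x - b') < Real.arctan (f x - b) := fun x =>
    Real.arctan_strictMono (by linarith)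
  have hle : ∀ j, ∀ y ∈ (c j).s, (c j).dens f (fun x => Real.arctan (f x - b')) y ≤
      (c j).dens f (fun x => Real.arctan (f x - b)) y := fun j y hy =>
    mul_le_mul_of_nonneg_right (hlt _).le (h.laplacian_nonneg _ hy)
  have hle' : ∀ j, ∫ y in (c j).s, (c j).dens f (fun x => Real.arctan (f x - b')) y ≤
      ∫ y in (c j).s, (c j).dens f (fun x => Real.arctan (f x - b)) y := fun j =>
    setIntegral_mono_on (h.integrableOn_arctan (hce j) b') (h.integrableOn_arctan (hce j) b)
      (c j).meas (hle j)
  refine lt_of_le_of_ne (Finset.sum_le_sum fun j _ => hle' j) fun heq => ?_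
  have hj := (Finset.sum_eq_sum_iff_of_le fun j _ => hle' j).1 heq
  refine (mass_pos h hc hce hf).ne' (Finset.sum_eq_zero fun j hju => ?_)
  have h1 : ∫ y in (c j).s, ((c j).dens f (fun x => Real.arctan (f x - b)) y -
      (c j).dens f (fun x => Real.arctan (f x - b')) y) = 0 := by
    rw [integral_sub (h.integrableOn_arctan (hce j) b) (h.integrableOn_arctan (hce j) b'),
      hj j hju, sub_self]
  rw [integral_eq_zero_iff_of_nonneg_ae] at h1
  · rw [integral_eq_zero_of_ae]
    filter_upwards [h1] with y hy
    have h2 : (Real.arctan (f ((c j).κ y) - b) - Real.arctan (f ((c j).κ y) - b')) *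
        Δ (f ∘ (c j).κ) y = 0 := by
      rw [sub_mul]
      exact hy
    rcases mul_eq_zero.1 h2 with h3 | h3
    · linarith [hlt ((c j).κ y)]
    · exact h3
  · filter_upwards [ae_restrict_mem (c j).meas] with y hy using sub_nonneg.2 (hle j y hy)
  · exact (h.integrableOn_arctan (hce j) b).sub (h.integrableOn_arctan (hce j) b')

/-- Dominated convergence with majorant `π / 2` times the Laplacian. It serves both for continuity
in `b` and for the limits at infinity. -/
lemma tendsto_moment {a : S → ℝ} {f : P.dot → ℝ} (h : IsSloped a f)
    (hce : ∀ j, (c j).IsRelCompact ∨ (c j).IsEnd x₀) {l : Filter ℝ} [l.IsCountablyGenerated]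
    {v : P.dot → ℝ} (hl : ∀ x, Tendsto (fun b => Real.arctan (f x - b)) l (𝓝 (v x))) :
    Tendsto (moment c f) l (𝓝 (∑ j, ∫ y in (c j).s, (c j).dens f v y)) := by
  refine tendsto_finsetSum _ fun j _ => ?_
  refine tendsto_integral_filter_of_dominated_convergence
    (fun y => Real.pi / 2 * Δ (f ∘ (c j).κ) y)
    (Eventually.of_forall fun b => (h.integrableOn_arctan (hce j) b).aestronglyMeasurable)
    (Eventually.of_forall fun b => ?_) ((h.integrableOn_laplacian (hce j)).const_mul _)
    (Eventually.of_forall fun y => (hl _).mul_const _)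
  filter_upwards [ae_restrict_mem (c j).meas] with y hy
  rw [Piece.dens, norm_mul, Real.norm_of_nonneg (h.laplacian_nonneg _ hy)]
  exact mul_le_mul_of_nonneg_right (abs_arctan_le _) (h.laplacian_nonneg _ hy)

/-- The moment is continuous in `b` and tends to `∓ π / 2` times the positive mass, so the
intermediate value theorem applies. -/
lemma exists_moment_eq_zero {a : S → ℝ} {f : P.dot → ℝ} (h : IsSloped a f) (hc : IsPartition c)
    (hce : ∀ j, (c j).IsRelCompact ∨ (c j).IsEnd x₀) (hf : ¬ Harm f) : ∃ b, moment c f b = 0 := by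
  have hm := mass_pos h hc hce hf
  have hpi := Real.pi_pos
  have hcont : Continuous (moment c f) := continuous_iff_continuousAt.2 fun b =>
    tendsto_moment h hce fun x =>
      (Real.continuous_arctan.comp (continuous_const.sub continuous_id)).continuousAt
  have hconst : ∀ v : ℝ, ∑ j, ∫ y in (c j).s, (c j).dens f (fun _ => v) y = v * mass c f := by
    intro v
    rw [mass, Finset.mul_sum]
    exact Finset.sum_congr rfl fun j _ => integral_const_mul _ _
  have h1 : Tendsto (moment c f) atTop (𝓝 (-(Real.pi / 2) * mass c f)) := by
    rw [← hconst]
    refine tendsto_moment h hce fun x => ?_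
    refine (Real.tendsto_arctan_atBot.mono_right nhdsWithin_le_nhds).comp ?_
    exact tendsto_atBot_add_const_left _ _ tendsto_neg_atTop_atBot
  have h2 : Tendsto (moment c f) atBot (𝓝 (Real.pi / 2 * mass c f)) := by
    rw [← hconst]
    refine tendsto_moment h hce fun x => ?_
    refine (Real.tendsto_arctan_atTop.mono_right nhdsWithin_le_nhds).comp ?_
    exact tendsto_atTop_add_const_left _ _ tendsto_neg_atBot_atTop
  have h3 : -(Real.pi / 2) * mass c f < 0 := by nlinarith
  have h4 : 0 < Real.pi / 2 * mass c f := by positivity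
  obtain ⟨b₁, hb₁⟩ := (h1.eventually (gt_mem_nhds h3)).exists
  obtain ⟨b₂, hb₂⟩ := (h2.eventually (lt_mem_nhds h4)).exists
  exact mem_range_of_exists_le_of_exists_ge hcont ⟨b₁, hb₁.le⟩ ⟨b₂, hb₂.le⟩

/-- An automorphism carries the decomposition to another one with the same densities, and the
integral does not depend on the decomposition. -/
lemma moment_comp_restrict {a : S → ℝ} {f f' : P.dot → ℝ} (h : IsSloped a f) (h' : IsSloped a f')
    (hc : IsPartition c) (hce : ∀ j, (c j).IsRelCompact ∨ (c j).IsEnd x₀) (φ : P.Aut)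
    (hφ : ∀ z, f' z = f (φ.restrict z)) (b : ℝ) : moment c f' b = moment c f b := by
  have hinj : Function.Injective φ.restrict := Function.LeftInverse.injective φ.symm_restrict
  have hsurj : Function.Surjective φ.restrict := Function.RightInverse.surjective φ.restrict_symm
  let d : Fin n → Piece P.dot := fun j => (c j).comp φ.restrict (fun _ _ hκ => hκ.restrict φ) hinj
  have hcar : ∀ j, (d j).carrier = φ.restrict '' (c j).carrier := fun j =>
    image_comp φ.restrict (c j).κ (c j).s
  have hd : IsPartition d := by
    constructor
    · intro i j hij
      simp only [Function.onFun, hcar]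
      exact (disjoint_image_iff hinj).2 (hc.disjoint hij)
    · intro x
      obtain ⟨z, rfl⟩ := hsurj x
      obtain ⟨j, hj⟩ := hc.cover z
      exact ⟨j, by rw [hcar]; exact mem_image_of_mem _ hj⟩
  have hff : f' = f ∘ φ.restrict := funext hφ
  have hdens : ∀ j, (c j).dens f' (fun x => Real.arctan (f' x - b)) =
      (d j).dens f (fun x => Real.arctan (f x - b)) := fun j => by
    rw [hff]
    rfl
  rw [moment, moment]
  simp only [hdens]
  refine IsPartition.sum_integral_eq h.contMDiff hd hc (fun j => ?_) fun j =>
    h.integrableOn_arctan (hce j) b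
  rw [← hdens]
  exact h'.integrableOn_arctan (hce j) b

end Center

/-! ### Continuous dependence of the center -/

section CenterContinuity

open Set Filter Complex Laplacian MeasureTheory InnerProductSpace

variable {S : Type*} [TopologicalSpace S] [T2Space S] [ChartedSpace ℂ S] [IsManifold 𝓘(ℂ, ℂ) ω S]
  {P : Punctures S}

/-- A family of functions that depends continuously on the parameter in `C²_loc`. -/
structure IsContFamily {Z X : Type*} [TopologicalSpace Z] [TopologicalSpace X] [ChartedSpace ℂ X]
    (f : Z → X → ℝ) : Prop where
  val : ∀ κ y, HoloAt κ y → ∀ z, ContinuousAt (fun q : Z × ℂ => f q.1 (κ q.2)) (z, y)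
  deriv : ∀ κ y, HoloAt κ y → ∀ z, ContinuousAt (fun q : Z × ℂ => fderiv ℝ (f q.1 ∘ κ) q.2) (z, y)
  lap : ∀ κ y, HoloAt κ y → ∀ z, ContinuousAt (fun q : Z × ℂ => Δ (f q.1 ∘ κ) q.2) (z, y)

variable {n : ℕ} {c : Fin n → Piece P.dot} {x₀ : P.dot} {Z : Type*} [TopologicalSpace Z]
  {f : Z → P.dot → ℝ} {a : S → ℝ}

lemma IsContFamily.continuousAt_dens (hf : IsContFamily f) (c : Piece P.dot) (b : ℝ) {y : ℂ}
    (hy : HoloAt c.κ y) (z : Z) :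
    ContinuousAt (fun q : Z × ℂ => c.dens (f q.1) (fun x => Real.arctan (f q.1 x - b)) q.2) (z, y) :=
  (Real.continuous_arctan.continuousAt.comp ((hf.val _ _ hy z).sub continuousAt_const)).mul
    (hf.lap _ _ hy z)

lemma IsContFamily.continuous_segMean (hf : IsContFamily f) (hs : ∀ z, IsSloped a (f z)) {p : S}
    {ρ : ℝ} (hρ : endR P p < ρ) :
    Continuous fun z => segMean (fun y => fderiv ℝ (f z ∘ endLift x₀ p) y 1) ρ := by
  refine continuous_iff_continuousAt.2 fun z => ?_
  simp only [segMean, intervalIntegral.integral_of_le zero_le_one]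
  have hh : ∀ θ : ℝ, endR P p < ((ρ : ℂ) + θ * I).re := fun θ => by simpa using hρ
  refine tendsto_setIntegral_of_compact (isCompact_Icc (a := (0 : ℝ)) (b := 1))
    Ioc_subset_Icc_self (by simp) (fun z' => ?_) fun θ _ => ?_
  · have h1 := continuous_segment (((contDiffOn_comp_endLift x₀ (hs z').contMDiff p).of_le
      two_le_infty).continuousOn_fderiv_one) hρ
    exact h1.integrableOn_Icc.mono_set Ioc_subset_Icc_self
  · have h1 := hf.deriv _ _ (holoAt_endLift x₀ (hh θ)) z
    have h2 : ContinuousAt (fun q : Z × ℝ => fderiv ℝ (f q.1 ∘ endLift x₀ p) (ρ + q.2 * I)) (z, θ) :=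
      h1.comp_of_eq (f := fun q : Z × ℝ => (q.1, (ρ : ℂ) + q.2 * I)) (by fun_prop) rfl
    exact h2.clm_apply continuousAt_const

/-- The bound involves the function only through the flux across one circle, a quantity that depends
continuously on parameters for convergence on compact sets. -/
lemma IsSloped.norm_tail_le {f : P.dot → ℝ} (h : IsSloped a f) {p : S} (hp : p ∉ P.dot) {ρ : ℝ}
    (hρ : endR P p < ρ) {s : Set ℂ} (hs : s ⊆ strip ρ) (hsm : MeasurableSet s) (b : ℝ) :
    ‖∫ y in s, Real.arctan (f (endLift x₀ p y) - b) * Δ (f ∘ endLift x₀ p) y‖ ≤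
      Real.pi / 2 * (a p - segMean (fun z => fderiv ℝ (f ∘ endLift x₀ p) z 1) ρ) := by
  obtain ⟨h1, h2⟩ := h.integrableOn_strip x₀ hp hρ
  have hnn : ∀ y ∈ strip ρ, 0 ≤ Δ (f ∘ endLift x₀ p) y := fun y hy =>
    h.subharm _ _ (holoAt_endLift x₀ (hρ.trans hy.1))
  rw [← h2, ← integral_const_mul]
  refine (norm_integral_le_of_norm_le ((h1.mono_set hs).const_mul (Real.pi / 2)) ?_).trans ?_
  · filter_upwards [ae_restrict_mem hsm] with y hy
    rw [norm_mul, Real.norm_of_nonneg (hnn y (hs hy))]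
    exact mul_le_mul_of_nonneg_right (abs_arctan_le _) (hnn y (hs hy))
  · refine setIntegral_mono_set (h1.const_mul _) ?_ hs.eventuallyLE
    filter_upwards [ae_restrict_mem (measurableSet_strip ρ)] with y hy
    exact mul_nonneg (by positivity) (hnn y hy)

/-- On a relatively compact piece this is uniform convergence. On an end, local convergence says
nothing about infinity, but the slope is common to all members of the family, so the mass beyond a
circle is controlled by the flux through it: a tail that is small at `z₀` stays small nearby. -/
lemma IsContFamily.continuous_setIntegral (hf : IsContFamily f) (hs : ∀ z, IsSloped a (f z))
    {c : Piece P.dot} (hc : c.IsRelCompact ∨ c.IsEnd x₀) (b : ℝ) :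
    Continuous fun z => ∫ y in c.s, c.dens (f z) (fun x => Real.arctan (f z x - b)) y := by
  refine continuous_iff_continuousAt.2 fun z₀ => ?_
  have hint := fun z => (hs z).integrableOn_arctan hc b
  rcases hc with ⟨K, h1, h2, h3⟩ | ⟨p, hp, ρ, h1, h2, h3⟩
  · exact tendsto_setIntegral_of_compact h1 h3 ((measure_mono h3).trans_lt h1.measure_lt_top) hint
      fun y hy => hf.continuousAt_dens c b (c.holo y (h2 hy)) z₀
  rw [ContinuousAt, Metric.tendsto_nhds]
  intro ε hε
  set m : Z → ℝ → ℝ := fun z r => segMean (fun y => fderiv ℝ (f z ∘ endLift x₀ p) y 1) r with hm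
  have hpi := Real.pi_pos
  have hlim : Tendsto (fun r => Real.pi / 2 * (a p - m z₀ r)) atTop (𝓝 0) := by
    have := tendsto_segMean_fderiv ((contDiffOn_comp_endLift x₀ (hs z₀).contMDiff p).of_le
      two_le_infty) (((hs z₀).hasSlope p hp).tendsto_endLift x₀)
    have h4 := (this.const_sub (a p)).const_mul (Real.pi / 2)
    rwa [sub_self, mul_zero] at h4
  -- The abscissa `r` is chosen for the parameter `z₀` alone; continuity of the flux at `r` extends
  -- the estimate to nearby parameters. The two tails and the compact part take `ε / 3` each.
  obtain ⟨r, hr, hρr⟩ := ((hlim.eventually (gt_mem_nhds (show (0 : ℝ) < ε / 3 by positivity))).and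
    (eventually_ge_atTop ρ)).exists
  have hr' : endR P p < r := h1.trans_le hρr
  have hev : ∀ᶠ z in 𝓝 z₀, Real.pi / 2 * (a p - m z r) < ε / 3 :=
    ((continuous_const.mul (continuous_const.sub
      (hf.continuous_segMean (x₀ := x₀) hs hr'))).tendsto z₀).eventually (gt_mem_nhds hr)
  have hre : MeasurableSet {y : ℂ | y.re ≤ r} := measurable_re measurableSet_Iic
  have hsplit : ∀ z, ∫ y in c.s, c.dens (f z) (fun x => Real.arctan (f z x - b)) y =
      (∫ y in c.s ∩ {y | y.re ≤ r}, c.dens (f z) (fun x => Real.arctan (f z x - b)) y) +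
      ∫ y in c.s \ {y | y.re ≤ r}, c.dens (f z) (fun x => Real.arctan (f z x - b)) y := fun z =>
    (integral_inter_add_sdiff hre (hint z)).symm
  have htail : ∀ z, ‖∫ y in c.s \ {y | y.re ≤ r},
      c.dens (f z) (fun x => Real.arctan (f z x - b)) y‖ ≤ Real.pi / 2 * (a p - m z r) := by
    intro z
    have := (hs z).norm_tail_le (x₀ := x₀) hp hr' (s := c.s \ {y | y.re ≤ r})
      (fun y hy => ⟨not_le.1 hy.2, (h3 hy.1).2⟩) (c.meas.diff hre) b
    simpa only [Piece.dens, h2] using this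
  have hK : IsCompact (Icc ρ r ×ℂ Icc (0 : ℝ) 1) := isCompact_Icc.reProdIm isCompact_Icc
  have hsub : c.s ∩ {y | y.re ≤ r} ⊆ Icc ρ r ×ℂ Icc (0 : ℝ) 1 := fun y hy =>
    ⟨⟨(h3 hy.1).1.le, hy.2⟩, (h3 hy.1).2.1, (h3 hy.1).2.2.le⟩
  have hcomp := tendsto_setIntegral_of_compact (μ := volume) hK hsub
    ((measure_mono hsub).trans_lt hK.measure_lt_top)
    (fun z => (hint z).mono_set inter_subset_left) fun y hy =>
      hf.continuousAt_dens c b (by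
        rw [h2]
        exact holoAt_endLift x₀ (h1.trans_le hy.1.1)) z₀
  filter_upwards [hev, Metric.tendsto_nhds.1 hcomp (ε / 3) (by positivity)] with z h4 h5
  rw [hsplit z, hsplit z₀]
  rw [Real.dist_eq] at h5 ⊢
  have h6 := htail z
  have h7 := htail z₀
  rw [Real.norm_eq_abs] at h6 h7
  rw [abs_lt] at h5 ⊢
  rw [abs_le] at h6 h7
  constructor <;> linarith [h5.1, h5.2, h6.1, h6.2, h7.1, h7.2]

/-- The zero of the moment. -/
def momentCenter (c : Fin n → Piece P.dot) (f : P.dot → ℝ) : ℝ :=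
  Classical.epsilon fun b => moment c f b = 0

lemma moment_center {f : P.dot → ℝ} (h : IsSloped a f) (hc : IsPartition c)
    (hce : ∀ j, (c j).IsRelCompact ∨ (c j).IsEnd x₀) (hf : ¬ Harm f) :
    moment c f (momentCenter c f) = 0 :=
  Classical.epsilon_spec (p := fun b => moment c f b = 0) (exists_moment_eq_zero h hc hce hf)

lemma moment_eq_zero_iff {f : P.dot → ℝ} (h : IsSloped a f) (hc : IsPartition c)
    (hce : ∀ j, (c j).IsRelCompact ∨ (c j).IsEnd x₀) (hf : ¬ Harm f) {b : ℝ} :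
    moment c f b = 0 ↔ b = momentCenter c f := by
  have h0 := moment_center h hc hce hf
  constructor
  · intro hb
    rcases lt_trichotomy b (momentCenter c f) with h1 | h1 | h1
    · have := moment_lt h hc hce hf h1
      linarith
    · exact h1
    · have := moment_lt h hc hce hf h1
      linarith
  · rintro rfl
    exact h0

lemma Harm.of_sub_const {f : P.dot → ℝ} {b : ℝ} (h : Harm fun x => f x - b) : Harm f :=
  fun κ y hκ => by
    rw [← laplacian_sub_const f b]
    exact h κ y hκ

lemma moment_sub_const (f : P.dot → ℝ) (s b : ℝ) :
    moment c (fun x => f x - s) b = moment c f (b + s) := by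
  simp only [moment, Piece.dens, laplacian_sub_const, sub_sub, add_comm s b]

lemma center_sub_const {f : P.dot → ℝ} (h : IsSloped a f) (hc : IsPartition c)
    (hce : ∀ j, (c j).IsRelCompact ∨ (c j).IsEnd x₀) (hf : ¬ Harm f) (s : ℝ) :
    momentCenter c (fun x => f x - s) = momentCenter c f - s := by
  symm
  rw [← moment_eq_zero_iff (h.sub_const s) hc hce fun h => hf h.of_sub_const, moment_sub_const,
    sub_add_cancel]
  exact moment_center h hc hce hf

lemma center_comp_restrict {f f' : P.dot → ℝ} (h : IsSloped a f) (h' : IsSloped a f')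
    (hc : IsPartition c) (hce : ∀ j, (c j).IsRelCompact ∨ (c j).IsEnd x₀) (φ : P.Aut)
    (hφ : ∀ z, f' z = f (φ.restrict z)) : momentCenter c f' = momentCenter c f := by
  simp only [momentCenter, moment_comp_restrict h h' hc hce φ hφ]

/-- By strict monotonicity the centre lies above `b` exactly when the moment at `b` is positive, and
below it exactly when the moment is negative. Both conditions are open in the parameter, since the
moment at fixed `b` is continuous. -/
lemma IsContFamily.continuous_center (hf : IsContFamily f) (hs : ∀ z, IsSloped a (f z))
    (hc : IsPartition c) (hce : ∀ j, (c j).IsRelCompact ∨ (c j).IsEnd x₀)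
    (hh : ∀ z, ¬ Harm (f z)) : Continuous fun z => momentCenter c (f z) := by
  have hcont : ∀ b, Continuous fun z => moment c (f z) b := fun b =>
    continuous_finsetSum _ fun j _ => hf.continuous_setIntegral hs (hce j) b
  have hlt : ∀ z b, b < momentCenter c (f z) ↔ 0 < moment c (f z) b := by
    intro z b
    have h0 := moment_center (hs z) hc hce (hh z)
    constructor
    · intro h
      rw [← h0]
      exact moment_lt (hs z) hc hce (hh z) h
    · intro h
      by_contra! h1
      rcases h1.eq_or_lt with h2 | h2
      · rw [← h2, h0] at h
        exact h.false
      · have := moment_lt (hs z) hc hce (hh z) h2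
        linarith
  have hgt : ∀ z b, momentCenter c (f z) < b ↔ moment c (f z) b < 0 := by
    intro z b
    rw [← not_le, ← not_le, not_iff_not, le_iff_lt_or_eq, le_iff_lt_or_eq, hlt,
      ← moment_eq_zero_iff (hs z) hc hce (hh z), eq_comm (a := (0 : ℝ))]
  refine continuous_iff_continuousAt.2 fun z₀ => tendsto_order.2 ⟨fun b hb => ?_, fun b hb => ?_⟩
  · filter_upwards [((hcont b).tendsto z₀).eventually (lt_mem_nhds ((hlt z₀ b).1 hb))] with z hz
    exact (hlt z b).2 hz
  · filter_upwards [((hcont b).tendsto z₀).eventually (gt_mem_nhds ((hgt z₀ b).1 hb))] with z hz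
    exact (hgt z b).2 hz

end CenterContinuity

/-! ### Families of smooth functions -/

section Families

open Set Filter

variable {Z : Type*} [TopologicalSpace Z] {V : Type*} [NormedAddCommGroup V] [NormedSpace ℝ V]
  {F : Type*} [NormedAddCommGroup F] [NormedSpace ℝ F]
  {G : Type*} [NormedAddCommGroup G] [NormedSpace ℝ G]

/-- Near the parameter `q.1` and the point `q.2`, all derivatives of `H z` are jointly continuous. -/
structure SmoothFamilyAt (H : Z → V → F) (q : Z × V) : Prop where
  contDiffAt : ∀ᶠ q' in 𝓝 q, ContDiffAt ℝ ∞ (H q'.1) q'.2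
  continuousAt : ∀ r : ℕ, ContinuousAt (fun q' : Z × V => iteratedFDeriv ℝ r (H q'.1) q'.2) q

namespace SmoothFamilyAt

lemma eventually_section {p : Z × V → Prop} {q : Z × V} (h : ∀ᶠ q' in 𝓝 q, p q') :
    ∀ᶠ q' in 𝓝 q, ∀ᶠ y in 𝓝 q'.2, p (q'.1, y) := by
  filter_upwards [eventually_eventually_nhds.2 h] with q' hq'
  exact (show ContinuousAt (fun y => (q'.1, y)) q'.2 by fun_prop).eventually hq'

lemma congr {H H' : Z → V → F} {q : Z × V} (h : SmoothFamilyAt H q)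
    (heq : ∀ᶠ q' in 𝓝 q, H q'.1 q'.2 = H' q'.1 q'.2) : SmoothFamilyAt H' q := by
  have h1 : ∀ᶠ q' in 𝓝 q, H q'.1 =ᶠ[𝓝 q'.2] H' q'.1 := eventually_section heq
  constructor
  · filter_upwards [h1, h.contDiffAt] with q' h2 h3 using h3.congr_of_eventuallyEq h2.symm
  · intro r
    refine (h.continuousAt r).congr ?_
    filter_upwards [h1] with q' h2 using (h2.iteratedFDeriv ℝ r).self_of_nhds

lemma val {H : Z → V → F} {q : Z × V} (h : SmoothFamilyAt H q) :
    ContinuousAt (fun q' : Z × V => H q'.1 q'.2) q := by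
  have h1 := (continuousMultilinearCurryFin0 ℝ V F).continuous.continuousAt.comp (h.continuousAt 0)
  refine h1.congr (Eventually.of_forall fun q' => ?_)
  simp

lemma fderiv {H : Z → V → F} {q : Z × V} (h : SmoothFamilyAt H q) :
    SmoothFamilyAt (fun z => fderiv ℝ (H z)) q := by
  constructor
  · filter_upwards [h.contDiffAt] with q' h1 using h1.fderiv_right (by simp)
  · intro r
    have h1 := (continuousMultilinearCurryRightEquiv' ℝ r V F).continuous.continuousAt.comp
      (h.continuousAt (r + 1))
    refine h1.congr (Eventually.of_forall fun q' => ?_)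
    simp [iteratedFDeriv_succ_eq_comp_right]

/-- A derivative of positive order is a derivative of the differential, so apart from smoothness
only the values need separate control. This is used for potentials, whose differentials are
explicit. -/
lemma of_fderiv {H : Z → V → F} {q : Z × V}
    (hd : ∀ᶠ q' in 𝓝 q, ContDiffAt ℝ ∞ (H q'.1) q'.2)
    (hv : ContinuousAt (fun q' : Z × V => H q'.1 q'.2) q)
    (h : SmoothFamilyAt (fun z => _root_.fderiv ℝ (H z)) q) : SmoothFamilyAt H q := by
  refine ⟨hd, fun r => ?_⟩
  cases r with
  | zero =>
    refine ((continuousMultilinearCurryFin0 ℝ V F).symm.continuous.continuousAt.comp hv).congr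
      (Eventually.of_forall fun q' => ?_)
    exact congrFun (iteratedFDeriv_zero_eq_comp (𝕜 := ℝ) (f := H q'.1)).symm q'.2
  | succ r =>
    refine ((continuousMultilinearCurryRightEquiv' ℝ r V F).symm.continuous.continuousAt.comp
      (h.continuousAt r)).congr (Eventually.of_forall fun q' => ?_)
    exact (iteratedFDeriv_succ_eq_comp_right (𝕜 := ℝ) (f := H q'.1) (x := q'.2)).symm

/-- By the Faà di Bruno formula the derivatives of the composition are fixed continuous expressions
in the derivatives of `g` along `H` and those of `H`. -/
lemma comp {H : Z → V → F} {q : Z × V} (h : SmoothFamilyAt H q) {g : F → G} (hg : ContDiff ℝ ∞ g) :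
    SmoothFamilyAt (fun z y => g (H z y)) q := by
  constructor
  · filter_upwards [h.contDiffAt] with q' h1 using hg.contDiffAt.comp q'.2 h1
  · intro r
    have h1 : ∀ᶠ q' in 𝓝 q, (ftaylorSeries ℝ g (H q'.1 q'.2)).taylorComp
        (ftaylorSeries ℝ (H q'.1) q'.2) r = iteratedFDeriv ℝ r (fun y => g (H q'.1 y)) q'.2 := by
      filter_upwards [h.contDiffAt] with q' h2
      exact (iteratedFDeriv_comp (n := ∞) hg.contDiffAt h2 (by exact_mod_cast le_top)).symm
    refine ContinuousAt.congr ?_ h1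
    refine tendsto_finsetSum _ fun c _ => ?_
    have h2 : Continuous fun p : (F [×c.length]→L[ℝ] G) × ∀ i, V [×c.partSize i]→L[ℝ] F =>
        c.compAlongOrderedFinpartitionL ℝ V F G p.1 p.2 := by
      have := (c.compAlongOrderedFinpartitionL ℝ V F G).analyticOnNhd_uncurry_of_multilinear
        (s := univ)
      exact continuousOn_univ.1 this.continuousOn
    refine (h2.continuousAt (x := (iteratedFDeriv ℝ c.length g (H q.1 q.2),
      fun i => iteratedFDeriv ℝ (c.partSize i) (H q.1) q.2))).tendsto.comp
        (Tendsto.prodMk_nhds ?_ (tendsto_pi_nhds.2 fun i => h.continuousAt (c.partSize i)))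
    exact ((hg.continuous_iteratedFDeriv (by exact_mod_cast le_top)).continuousAt
      (x := H q.1 q.2)).tendsto.comp h.val

lemma prodMk {H : Z → V → F} {H' : Z → V → G} {q : Z × V} (h : SmoothFamilyAt H q)
    (h' : SmoothFamilyAt H' q) : SmoothFamilyAt (fun z y => (H z y, H' z y)) q := by
  constructor
  · filter_upwards [h.contDiffAt, h'.contDiffAt] with q' h1 h2 using h1.prodMk h2
  · intro r
    have h1 : ∀ᶠ q' in 𝓝 q, (iteratedFDeriv ℝ r (H q'.1) q'.2).prod
        (iteratedFDeriv ℝ r (H' q'.1) q'.2) =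
        iteratedFDeriv ℝ r (fun y => (H q'.1 y, H' q'.1 y)) q'.2 := by
      filter_upwards [h.contDiffAt, h'.contDiffAt] with q' h1 h2
      exact (iteratedFDeriv_prodMk h1 h2 (by exact_mod_cast le_top)).symm
    refine ContinuousAt.congr ?_ h1
    exact (ContinuousMultilinearMap.prodL ℝ _ F G).continuous.continuousAt.comp
      ((h.continuousAt r).prodMk (h'.continuousAt r))

lemma const_right (s : Z → F) {q : Z × V} (hs : ContinuousAt s q.1) :
    SmoothFamilyAt (fun z _ => s z) q := by
  refine of_fderiv (Eventually.of_forall fun q' => contDiffAt_const) (hs.comp continuousAt_fst) ?_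
  have h0 : (fun z => _root_.fderiv ℝ (fun _ : V => s z)) = fun _ _ => 0 := by
    funext z y
    simp
  rw [h0]
  refine ⟨Eventually.of_forall fun q' => contDiffAt_const, fun r => ?_⟩
  have : (fun q' : Z × V => iteratedFDeriv ℝ r (fun _ : V => (0 : V →L[ℝ] F)) q'.2) =
      fun _ => 0 := by
    funext q'
    simp
  simp only [this]
  exact continuousAt_const

lemma add {H H' : Z → V → F} {q : Z × V} (h : SmoothFamilyAt H q) (h' : SmoothFamilyAt H' q) :
    SmoothFamilyAt (fun z y => H z y + H' z y) q :=
  (h.prodMk h').comp (g := fun p : F × F => p.1 + p.2) (by fun_prop)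

lemma sub {H H' : Z → V → F} {q : Z × V} (h : SmoothFamilyAt H q) (h' : SmoothFamilyAt H' q) :
    SmoothFamilyAt (fun z y => H z y - H' z y) q :=
  (h.prodMk h').comp (g := fun p : F × F => p.1 - p.2) (by fun_prop)

lemma smul {H : Z → V → ℝ} {H' : Z → V → F} {q : Z × V} (h : SmoothFamilyAt H q)
    (h' : SmoothFamilyAt H' q) : SmoothFamilyAt (fun z y => H z y • H' z y) q :=
  (h.prodMk h').comp (g := fun p : ℝ × F => p.1 • p.2) (by fun_prop)

lemma sum {J : Type*} (T : Finset J) {H : J → Z → V → F} {q : Z × V}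
    (h : ∀ j ∈ T, SmoothFamilyAt (H j) q) : SmoothFamilyAt (fun z y => ∑ j ∈ T, H j z y) q := by
  classical
  induction T using Finset.induction_on with
  | empty => simpa using const_right (fun _ => (0 : F)) continuousAt_const
  | insert j T hj ih =>
    simp only [Finset.sum_insert hj]
    exact (h j (Finset.mem_insert_self j T)).add
      (ih fun i hi => h i (Finset.mem_insert_of_mem hi))

/-- Uniform closeness on compact sets. -/
lemma eventually_forall_norm_sub_lt {H : Z → V → F} {z₀ : Z} {K : Set V} (hK : IsCompact K)
    (h : ∀ y ∈ K, ContinuousAt (fun q : Z × V => H q.1 q.2) (z₀, y)) {ε : ℝ} (hε : 0 < ε) :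
    ∀ᶠ z in 𝓝 z₀, ∀ y ∈ K, ‖H z y - H z₀ y‖ < ε := by
  refine hK.eventually_forall_of_forall_eventually (P := fun z y => ‖H z y - H z₀ y‖ < ε)
    fun y hy => ?_
  have h2 : ContinuousAt (fun p : Z × V => H z₀ p.2) (z₀, y) :=
    (h y hy).comp_of_eq (f := fun p : Z × V => (z₀, p.2)) (by fun_prop) rfl
  have h3 := ((h y hy).sub h2).norm
  have h4 : ‖H z₀ y - H z₀ y‖ < ε := by simpa using hε
  exact h3.eventually (gt_mem_nhds h4)

end SmoothFamilyAt

end Families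

/-! ### The weak topology and joint continuity -/

section WeakTopology

open Set Filter

variable {Z : Type*} [TopologicalSpace Z] {F : Type*} [NormedAddCommGroup F] [NormedSpace ℝ F]
  {Y : Type*} [TopologicalSpace Y] [ChartedSpace F Y]
  {X : Type*} [TopologicalSpace X] [ChartedSpace ℂ X] [IsManifold 𝓘(ℂ, ℂ) ω X]

lemma contDiffAt_comp_chart (w : C^∞⟮𝓘(ℝ, ℂ), X; 𝓘(ℝ, F), Y⟯) (g : C^∞⟮𝓘(ℝ, F), Y; 𝓘(ℝ, ℝ), ℝ⟯)
    (x : X) {y : ℂ} (hy : y ∈ (chartAt ℂ x).target) :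
    ContDiffAt ℝ ∞ (fun y => g (w ((chartAt ℂ x).symm y))) y :=
  contDiffAt_comp_holo (g.contMDiff.comp w.contMDiff) (holoAt_chartAt_symm x hy)

/-- A family of smooth maps is continuous for the weak topology if and only if its derivatives are
jointly continuous. -/
lemma continuous_weak_iff {w : Z → C^∞⟮𝓘(ℝ, ℂ), X; 𝓘(ℝ, F), Y⟯} : Continuous w ↔
    ∀ (g : C^∞⟮𝓘(ℝ, F), Y; 𝓘(ℝ, ℝ), ℝ⟯) (x : X) (z : Z), ∀ y ∈ (chartAt ℂ x).target,
      SmoothFamilyAt (fun z y => g (w z ((chartAt ℂ x).symm y))) (z, y) := by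
  have hev : ∀ (x : X) (z : Z), ∀ y ∈ (chartAt ℂ x).target,
      ∀ᶠ q : Z × ℂ in 𝓝 (z, y), q.2 ∈ (chartAt ℂ x).target := fun x z y hy =>
    continuousAt_snd.eventually ((chartAt ℂ x).open_target.mem_nhds hy)
  have hsm : ∀ (g : C^∞⟮𝓘(ℝ, F), Y; 𝓘(ℝ, ℝ), ℝ⟯) (x : X) (r : ℕ) (z : Z), ∀ y ∈ (chartAt ℂ x).target,
      ContinuousAt (iteratedFDeriv ℝ r fun y => g (w z ((chartAt ℂ x).symm y))) y :=
    fun g x r z y hy => ((contDiffAt_comp_chart (w z) g x hy).iteratedFDeriv_right (m := 0)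
      (by exact_mod_cast le_top)).continuousAt
  rw [continuous_iInf_rng]
  constructor
  · intro h g x z y hy
    refine ⟨(hev x z y hy).mono fun q hq => contDiffAt_comp_chart (w q.1) g x hq, fun r => ?_⟩
    have h1 := continuous_iInf_rng.1 (continuous_iInf_rng.1 (h g) x) r
    rw [continuous_induced_rng] at h1
    have h2 := UniformOnFun.tendsto_iff_tendstoUniformlyOn.1 (h1.tendsto z)
    -- Uniform convergence on a compact neighbourhood of `y`, combined with continuity of the single
    -- function at `z`, gives joint continuity.
    obtain ⟨K, hKn, hKs, hK⟩ := local_compact_nhds ((chartAt ℂ x).open_target.mem_nhds hy)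
    have h3 := Metric.tendstoUniformlyOn_iff.1 (h2 K ⟨hK, hKs⟩)
    rw [ContinuousAt, Metric.tendsto_nhds]
    intro ε hε
    have h4 : ∀ᶠ q : Z × ℂ in 𝓝 (z, y), dist
        (iteratedFDeriv ℝ r (fun y => g (w z ((chartAt ℂ x).symm y))) q.2)
        (iteratedFDeriv ℝ r (fun y => g (w z ((chartAt ℂ x).symm y))) y) < ε / 2 :=
      (continuousAt_snd (p := (z, y))).eventually
        (Metric.tendsto_nhds.1 (hsm g x r z y hy) _ (half_pos hε))
    have h5 := (continuousAt_fst (p := (z, y))).eventually (h3 _ (half_pos hε))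
    filter_upwards [h4, h5, (continuousAt_snd (p := (z, y))).eventually hKn] with q h6 h7 h8
    refine (dist_triangle _ _ _).trans_lt (add_lt_add ?_ h6 |>.trans_eq (add_halves ε))
    rw [dist_comm]
    exact h7 q.2 h8
  · intro h g
    refine continuous_iInf_rng.2 fun x => continuous_iInf_rng.2 fun r => ?_
    rw [continuous_induced_rng]
    refine continuous_iff_continuousAt.2 fun z => ?_
    refine UniformOnFun.tendsto_iff_tendstoUniformlyOn.2 fun K hK => ?_
    refine Metric.tendstoUniformlyOn_iff.2 fun ε hε => ?_
    have := SmoothFamilyAt.eventually_forall_norm_sub_lt (z₀ := z)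
      (H := fun z => iteratedFDeriv ℝ r fun y => g (w z ((chartAt ℂ x).symm y))) hK.1
      (fun y hy => (h g x z y (hK.2 hy)).continuousAt r) hε
    filter_upwards [this] with z' hz' y hy
    rw [dist_comm, dist_eq_norm]
    exact hz' y hy

/-- Families of real valued functions. -/
lemma continuous_weak_real_iff {f : Z → C^∞⟮𝓘(ℝ, ℂ), X; 𝓘(ℝ, ℝ), ℝ⟯} : Continuous f ↔
    ∀ (x : X) (z : Z), ∀ y ∈ (chartAt ℂ x).target,
      SmoothFamilyAt (fun z y => f z ((chartAt ℂ x).symm y)) (z, y) := by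
  rw [continuous_weak_iff]
  constructor
  · exact fun h => h ⟨id, contMDiff_id⟩
  · exact fun h g x z y hy => (h x z y hy).comp g.contMDiff.contDiff

end WeakTopology

/-! ### Continuous dependence of the potential -/

section PotentialFamily

open Set Filter Laplacian InnerProductSpace

variable {Z : Type*} [TopologicalSpace Z]
  {X : Type*} [TopologicalSpace X] [ChartedSpace ℂ X] [IsManifold 𝓘(ℂ, ℂ) ω X]

/-- The weak topology gives control in the preferred charts. A general holomorphic parametrization
factors through such a chart, and the chain rule and the conformal covariance of the Laplacian
transport the continuity. -/
lemma isContFamily_of_continuous {f : Z → C^∞⟮𝓘(ℝ, ℂ), X; 𝓘(ℝ, ℝ), ℝ⟯} (hf : Continuous f) :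
    IsContFamily fun z => ⇑(f z) := by
  have key : ∀ (κ : ℂ → X) (y : ℂ), HoloAt κ y → ∀ z, ∃ (e : OpenPartialHomeomorph X ℂ) (θ : ℂ → ℂ),
      AnalyticAt ℂ θ y ∧ SmoothFamilyAt (fun z y' => f z (e.symm y')) (z, θ y) ∧
      (∀ᶠ y' in 𝓝 y, ∀ z, f z (κ y') = f z (e.symm (θ y'))) := by
    intro κ y hκ z
    have hx := mem_chart_source ℂ (κ y)
    refine ⟨chartAt ℂ (κ y), chartAt ℂ (κ y) ∘ κ, hκ.analyticAt_chart _ hx,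
      continuous_weak_real_iff.1 hf _ z _ ((chartAt ℂ (κ y)).map_source hx), ?_⟩
    filter_upwards [hκ.continuousAt.eventually ((chartAt ℂ (κ y)).open_source.mem_nhds hx)]
      with y' hy' z
    rw [Function.comp_apply, (chartAt ℂ (κ y)).left_inv hy']
  constructor
  · intro κ y hκ z
    obtain ⟨e, θ, hθ, hS, hev⟩ := key κ y hκ z
    have h0 : ContinuousAt (fun q : Z × ℂ => f q.1 (e.symm q.2)) (z, θ y) := hS.val
    have h1 := h0.comp_of_eq (f := fun q : Z × ℂ => (q.1, θ q.2)) (x := (z, y))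
      (continuousAt_fst.prodMk (hθ.continuousAt.comp continuousAt_snd)) rfl
    refine h1.congr ?_
    filter_upwards [(continuousAt_snd (p := (z, y))).eventually hev] with q hq using (hq q.1).symm
  · intro κ y hκ z
    obtain ⟨e, θ, hθ, hS, hev⟩ := key κ y hκ z
    have hθr : ContDiffAt ℝ 1 θ y := hθ.contDiffAt.restrict_scalars ℝ
    have hp : ContinuousAt (fun q : Z × ℂ => (q.1, θ q.2)) (z, y) :=
      continuousAt_fst.prodMk (hθ.continuousAt.comp continuousAt_snd)
    have h0 : ContinuousAt (fun q : Z × ℂ => fderiv ℝ (fun y' => f q.1 (e.symm y')) q.2)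
      (z, θ y) := hS.fderiv.val
    have h1 := h0.comp_of_eq (f := fun q : Z × ℂ => (q.1, θ q.2)) (x := (z, y)) hp rfl
    have h2 : ContinuousAt (fun q : Z × ℂ => fderiv ℝ θ q.2) (z, y) :=
      ContinuousAt.comp (g := fderiv ℝ θ) (f := Prod.snd)
        (hθr.fderiv_right (m := 0) (by simp)).continuousAt continuousAt_snd
    refine (h1.clm_comp h2).congr ?_
    have h3 : ∀ᶠ q : Z × ℂ in 𝓝 (z, y), ContDiffAt ℝ ∞
        (fun y' => f q.1 (e.symm y')) (θ q.2) := Tendsto.eventually hp hS.contDiffAt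
    have h4 := hθ.eventually_analyticAt
    filter_upwards [(continuousAt_snd (p := (z, y))).eventually hev.eventually_nhds, h3,
      (continuousAt_snd (p := (z, y))).eventually h4] with q hq h5 h6
    have h7 : f q.1 ∘ κ =ᶠ[𝓝 q.2] (fun y' => f q.1 (e.symm y')) ∘ θ := by
      filter_upwards [hq] with y' hy' using hy' q.1
    rw [h7.fderiv_eq, fderiv_comp q.2 (h5.differentiableAt (by simp))
      (h6.differentiableAt.restrictScalars ℝ)]
    rfl
  · intro κ y hκ z
    obtain ⟨e, θ, hθ, hS, hev⟩ := key κ y hκ z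
    have hp : ContinuousAt (fun q : Z × ℂ => (q.1, θ q.2)) (z, y) :=
      continuousAt_fst.prodMk (hθ.continuousAt.comp continuousAt_snd)
    have h0 : ContinuousAt (fun q : Z × ℂ =>
        Δ (fun y' => f q.1 (e.symm y')) q.2) (z, θ y) := by
      have h2 : ∀ v : Fin 2 → ℂ, ContinuousAt (fun q : Z × ℂ => iteratedFDeriv ℝ 2
          (fun y' => f q.1 (e.symm y')) q.2 v) (z, θ y) := fun v =>
        ContinuousAt.comp (g := ContinuousMultilinearMap.apply ℝ (fun _ : Fin 2 => ℂ) ℝ v)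
          (f := fun q : Z × ℂ => iteratedFDeriv ℝ 2 (fun y' => f q.1 (e.symm y')) q.2)
          (ContinuousMultilinearMap.apply ℝ (fun _ : Fin 2 => ℂ) ℝ v).continuous.continuousAt
          (hS.continuousAt 2)
      simp only [laplacian_eq_iteratedFDeriv_complexPlane]
      exact (h2 _).add (h2 _)
    have h1 := h0.comp_of_eq (f := fun q : Z × ℂ => (q.1, θ q.2)) (x := (z, y)) hp rfl
    have h2 : ContinuousAt (fun q : Z × ℂ => ‖deriv θ q.2‖ ^ 2) (z, y) :=
      ((hθ.deriv.continuousAt.comp (continuousAt_snd (p := (z, y)))).norm).pow 2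
    refine (h2.mul h1).congr ?_
    have h3 : ∀ᶠ q : Z × ℂ in 𝓝 (z, y), ContDiffAt ℝ ∞
        (fun y' => f q.1 (e.symm y')) (θ q.2) := Tendsto.eventually hp hS.contDiffAt
    filter_upwards [(continuousAt_snd (p := (z, y))).eventually hev.eventually_nhds, h3,
      (continuousAt_snd (p := (z, y))).eventually hθ.eventually_analyticAt] with q hq h5 h6
    have h7 : f q.1 ∘ κ =ᶠ[𝓝 q.2] (fun y' => f q.1 (e.symm y')) ∘ θ := by
      filter_upwards [hq] with y' hy' using hy' q.1
    rw [(laplacian_congr_nhds h7).self_of_nhds, laplacian_comp (h5.of_le two_le_infty) h6]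
    rfl

/-- On a disc the oscillation of `f z' - f z` is bounded by the difference of the differentials, so
continuity in the parameter spreads from `x₀` over the connected surface, locally uniformly. -/
lemma continuous_eval_of_fderiv [PreconnectedSpace X] {f : Z → C^∞⟮𝓘(ℝ, ℂ), X; 𝓘(ℝ, ℝ), ℝ⟯}
    (hd : ∀ (x : X) (z : Z), ∀ y ∈ (chartAt ℂ x).target,
      SmoothFamilyAt (fun z => fderiv ℝ fun y => f z ((chartAt ℂ x).symm y)) (z, y))
    (x₀ : X) (h0 : Continuous fun z => f z x₀) (x : X) (z : Z) : ∀ y ∈ (chartAt ℂ x).target,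
      ContinuousAt (fun q : Z × ℂ => f q.1 ((chartAt ℂ x).symm q.2)) (z, y) := by
  have hsm : ∀ (x : X) (z : Z), ∀ y ∈ (chartAt ℂ x).target,
      ContDiffAt ℝ ∞ (fun y => f z ((chartAt ℂ x).symm y)) y := fun x z y hy =>
    contDiffAt_comp_holo (f z).contMDiff (holoAt_chartAt_symm x hy)
  have hosc : ∀ (x : X) (z : Z), ∀ y ∈ (chartAt ℂ x).target, ∃ r > 0,
      Metric.closedBall y r ⊆ (chartAt ℂ x).target ∧ ∀ ε > 0, ∀ᶠ z' in 𝓝 z,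
        ∀ y₁ ∈ Metric.closedBall y r, ∀ y₂ ∈ Metric.closedBall y r,
        |(f z' ((chartAt ℂ x).symm y₁) - f z ((chartAt ℂ x).symm y₁)) -
          (f z' ((chartAt ℂ x).symm y₂) - f z ((chartAt ℂ x).symm y₂))| ≤ ε := by
    intro x z y hy
    obtain ⟨r, hr, hsub⟩ := Metric.nhds_basis_closedBall.mem_iff.1
      ((chartAt ℂ x).open_target.mem_nhds hy)
    refine ⟨r, hr, hsub, fun ε hε => ?_⟩
    filter_upwards [SmoothFamilyAt.eventually_forall_norm_sub_lt (z₀ := z)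
      (H := fun z => fderiv ℝ fun y => f z ((chartAt ℂ x).symm y)) (isCompact_closedBall y r) (fun y' hy' => (hd x z y' (hsub hy')).val)
      (show 0 < ε / (2 * r) by positivity)] with z' hz' y₁ hy₁ y₂ hy₂
    have h1 := (convex_closedBall y r).norm_image_sub_le_of_norm_fderiv_le (𝕜 := ℝ)
      (f := fun y => f z' ((chartAt ℂ x).symm y) - f z ((chartAt ℂ x).symm y))
      (C := ε / (2 * r)) (x := y₂) (y := y₁)
      (fun y' hy' => ((hsm x z' y' (hsub hy')).differentiableAt (by simp)).sub
        ((hsm x z y' (hsub hy')).differentiableAt (by simp)))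
      (fun y' hy' => by
        rw [fderiv_fun_sub ((hsm x z' y' (hsub hy')).differentiableAt (by simp))
          ((hsm x z y' (hsub hy')).differentiableAt (by simp))]
        exact (hz' y' hy').le) hy₂ hy₁
    have h2 : ‖y₁ - y₂‖ ≤ 2 * r := by
      rw [← dist_eq_norm]
      linarith [dist_triangle_right y₁ y₂ y, Metric.mem_closedBall.1 hy₁, Metric.mem_closedBall.1 hy₂]
    rw [← Real.norm_eq_abs]
    refine h1.trans ((mul_le_mul_of_nonneg_left h2 (by positivity)).trans_eq ?_)
    field_simp
  have htr : ∀ (x : X) (z : Z) (y y' : ℂ) (r : ℝ),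
      y ∈ Metric.closedBall y' r → (∀ ε > 0, ∀ᶠ z' in 𝓝 z,
        ∀ y₁ ∈ Metric.closedBall y' r, ∀ y₂ ∈ Metric.closedBall y' r,
        |(f z' ((chartAt ℂ x).symm y₁) - f z ((chartAt ℂ x).symm y₁)) -
          (f z' ((chartAt ℂ x).symm y₂) - f z ((chartAt ℂ x).symm y₂))| ≤ ε) →
      ∀ y₂ ∈ Metric.closedBall y' r, ContinuousAt (fun z' => f z' ((chartAt ℂ x).symm y₂)) z →
        ContinuousAt (fun z' => f z' ((chartAt ℂ x).symm y)) z := by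
    intro x z y y' r hy h y₂ hy₂ hc
    rw [ContinuousAt, Metric.tendsto_nhds] at hc ⊢
    intro ε hε
    filter_upwards [h (ε / 2) (half_pos hε), hc (ε / 2) (half_pos hε)] with z' h1 h2
    have h3 := h1 y hy y₂ hy₂
    rw [Real.dist_eq, abs_lt] at h2 ⊢
    rw [abs_le] at h3
    constructor <;> linarith [h2.1, h2.2, h3.1, h3.2]
  have hval : ∀ (x : X) (z : Z), ContinuousAt (fun z' => f z' x) z := by
    intro x z
    -- Continuity in the parameter at `z`, viewed as a proposition depending on the point of the
    -- surface, is locally constant by the oscillation estimate.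
    have hlc : IsLocallyConstant fun x => ContinuousAt (fun z' => f z' x) z := by
      refine (IsLocallyConstant.iff_eventually_eq _).2 fun x => ?_
      obtain ⟨r, hr, hsub, h⟩ := hosc x z _ (mem_chart_target ℂ x)
      filter_upwards [(chartAt ℂ x).open_source.mem_nhds (mem_chart_source ℂ x),
        ((chartAt ℂ x).continuousAt (mem_chart_source ℂ x)).eventually
          (Metric.closedBall_mem_nhds _ hr)] with x' h1 h2
      have h3 := htr x z (chartAt ℂ x x') _ r h2 h (chartAt ℂ x x) (Metric.mem_closedBall_self hr.le)
      have h4 := htr x z (chartAt ℂ x x) _ r (Metric.mem_closedBall_self hr.le) h (chartAt ℂ x x') h2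
      rw [(chartAt ℂ x).left_inv h1, (chartAt ℂ x).left_inv (mem_chart_source ℂ x)] at h3 h4
      exact propext ⟨h4, h3⟩
    exact (hlc.apply_eq_of_preconnectedSpace x₀ x).mp h0.continuousAt
  intro y hy
  obtain ⟨r, hr, hsub, h⟩ := hosc x z y hy
  rw [ContinuousAt, Metric.tendsto_nhds]
  intro ε hε
  have h1 := Metric.tendsto_nhds.1 (hval ((chartAt ℂ x).symm y) z) (ε / 3) (by positivity)
  have h2 := Metric.tendsto_nhds.1 (hsm x z y hy).continuousAt (ε / 3) (by positivity)
  filter_upwards [(continuousAt_fst (p := (z, y))).eventually h1,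
    (continuousAt_snd (p := (z, y))).eventually h2,
    (continuousAt_fst (p := (z, y))).eventually (h (ε / 3) (by positivity)),
    (continuousAt_snd (p := (z, y))).eventually (Metric.closedBall_mem_nhds y hr)] with q h3 h4 h5 h6
  have h7 := h5 q.2 h6 y (Metric.mem_closedBall_self hr.le)
  rw [Real.dist_eq, abs_lt] at h3 h4 ⊢
  rw [abs_le] at h7
  constructor <;> linarith [h3.1, h3.2, h4.1, h4.2, h7.1, h7.2]

variable {E : Type*} [NormedAddCommGroup E] [NormedSpace ℝ E] [FiniteDimensional ℝ E]
  {Q : Type*} [TopologicalSpace Q] [T2Space Q] [ChartedSpace E Q] [IsManifold 𝓘(ℝ, E) ∞ Q]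

/-- The differential of the potential is expressed through compositions of `w` with global smooth
functions, which are the quantities that the weak topology controls. -/
lemma IsPotential.fderiv_comp_eq_sum {t : ContactTriad E Q} {w : X → Q} {f : X → ℝ}
    (hwf : IsPotential t w f) (hw : ContMDiff 𝓘(ℝ, ℂ) 𝓘(ℝ, E) ∞ w)
    (hf : ContMDiff 𝓘(ℝ, ℂ) 𝓘(ℝ, ℝ) ∞ f) {κ : ℂ → X} {y : ℂ} (h : HoloAt κ y) {d : ℕ}
    {a g : Fin d → C^∞⟮𝓘(ℝ, E), Q; 𝓘(ℝ, ℝ), ℝ⟯}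
    (hag : ∀ v : TangentSpace 𝓘(ℝ, E) (w (κ y)), t.form (w (κ y)) v =
      ∑ j, a j (w (κ y)) * (show ℝ from mfderiv 𝓘(ℝ, E) 𝓘(ℝ, ℝ) (g j) (w (κ y)) v)) :
    fderiv ℝ (f ∘ κ) y = ∑ j, a j (w (κ y)) •
      (fderiv ℝ (fun y => g j (w (κ y))) y).comp (Complex.I • ContinuousLinearMap.id ℝ ℂ) := by
  ext v
  rw [hwf.fderiv_comp hw hf h v]
  refine (hag _).trans ?_
  rw [sum_apply]
  refine Finset.sum_congr rfl fun j _ => ?_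
  refine congrArg (a j (w (κ y)) * ·) ?_
  have h1 : fderiv ℝ (fun y => g j (w (κ y))) y = mfderiv 𝓘(ℝ, ℂ) 𝓘(ℝ, ℝ) (g j ∘ (w ∘ κ)) y :=
    mfderiv_eq_fderiv.symm
  have h2 : MDifferentiableAt 𝓘(ℝ, ℂ) 𝓘(ℝ, E) (w ∘ κ) y :=
    ((hw _).comp y h.contMDiffAt_real).mdifferentiableAt (by simp)
  have h3 : MDifferentiableAt 𝓘(ℝ, E) 𝓘(ℝ, ℝ) (g j) ((w ∘ κ) y) :=
    (g j).contMDiff.contMDiffAt.mdifferentiableAt (by simp)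
  rw [h1, mfderiv_comp y h3 h2]
  rfl

/-- Normalized potentials depend continuously on the map. -/
lemma continuous_potential [PreconnectedSpace X] {t : ContactTriad E Q}
    {w : Z → C^∞⟮𝓘(ℝ, ℂ), X; 𝓘(ℝ, E), Q⟯} (hw : Continuous w)
    {f : Z → C^∞⟮𝓘(ℝ, ℂ), X; 𝓘(ℝ, ℝ), ℝ⟯} (hf : ∀ z, IsPotential t (w z) (f z)) (x₀ : X)
    (h0 : Continuous fun z => f z x₀) : Continuous f := by
  have hd : ∀ (x : X) (z : Z), ∀ y ∈ (chartAt ℂ x).target,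
      SmoothFamilyAt (fun z => fderiv ℝ fun y => f z ((chartAt ℂ x).symm y)) (z, y) := by
    intro x z y hy
    have hS := fun g => continuous_weak_iff.1 hw g x z y hy
    obtain ⟨d, a, g, χ, hχ, hag⟩ := exists_local_expression t.toContactForm
      (w z ((chartAt ℂ x).symm y))
    have h1 : SmoothFamilyAt (fun z y => ∑ j, a j (w z ((chartAt ℂ x).symm y)) •
        (fderiv ℝ (fun y => g j (w z ((chartAt ℂ x).symm y))) y).comp
          (Complex.I • ContinuousLinearMap.id ℝ ℂ)) (z, y) :=
      SmoothFamilyAt.sum _ fun j _ => (hS (a j)).smul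
        ((hS (g j)).fderiv.comp (g := fun L : ℂ →L[ℝ] ℝ =>
          L.comp (Complex.I • ContinuousLinearMap.id ℝ ℂ)) (contDiff_id.clm_comp contDiff_const))
    refine h1.congr ?_
    -- The local expression at the point `w z` persists for nearby parameters and points, because
    -- its validity is detected by the smooth function `χ`.
    have h2 : ∀ᶠ q : Z × ℂ in 𝓝 (z, y), 1 / 2 < χ (w q.1 ((chartAt ℂ x).symm q.2)) :=
      (hS χ).val.eventually (lt_mem_nhds (show 1 / 2 < χ (w z ((chartAt ℂ x).symm y)) by
        rw [hχ]; norm_num))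
    filter_upwards [h2, (continuousAt_snd (p := (z, y))).eventually
      ((chartAt ℂ x).open_target.mem_nhds hy)] with q h3 h4
    exact ((hf q.1).fderiv_comp_eq_sum (w q.1).contMDiff (f q.1).contMDiff
      (holoAt_chartAt_symm x h4) (hag _ h3)).symm
  refine continuous_weak_real_iff.2 fun x z y hy => ?_
  refine SmoothFamilyAt.of_fderiv ?_ (continuous_eval_of_fderiv hd x₀ h0 x z y hy) (hd x z y hy)
  filter_upwards [(continuousAt_snd (p := (z, y))).eventually
    ((chartAt ℂ x).open_target.mem_nhds hy)] with q hq
  exact contDiffAt_comp_holo (f q.1).contMDiff (holoAt_chartAt_symm x hq)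

/-- Translation is jointly continuous. -/
lemma continuous_translateFun {f : Z → C^∞⟮𝓘(ℝ, ℂ), X; 𝓘(ℝ, ℝ), ℝ⟯} (hf : Continuous f) {s : Z → ℝ}
    (hs : Continuous s) : Continuous fun z => translateFun (f z) (s z) :=
  continuous_weak_real_iff.2 fun x z y hy => (continuous_weak_real_iff.1 hf x z y hy).sub
    (SmoothFamilyAt.const_right s hs.continuousAt)

lemma continuous_eval {f : Z → C^∞⟮𝓘(ℝ, ℂ), X; 𝓘(ℝ, ℝ), ℝ⟯} (hf : Continuous f) (x : X) :
    Continuous fun z => f z x := by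
  refine continuous_iff_continuousAt.2 fun z => ?_
  have h := (continuous_weak_real_iff.1 hf x z _ (mem_chart_target ℂ x)).val.comp_of_eq
    (f := fun z' => (z', chartAt ℂ x x)) (x := z) (by fun_prop) rfl
  refine h.congr (Eventually.of_forall fun z' => ?_)
  simp [(chartAt ℂ x).left_inv (mem_chart_source ℂ x)]

end PotentialFamily

/-! ### The centers of the components of a curve -/

section Components

open Set Filter

variable {E : Type*} [NormedAddCommGroup E] [NormedSpace ℝ E] [FiniteDimensional ℝ E]
  {Q : Type*} [TopologicalSpace Q] [T2Space Q] [ChartedSpace E Q] [IsManifold 𝓘(ℝ, E) ∞ Q]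
  {S : Type*} [TopologicalSpace S] [T2Space S] [ChartedSpace ℂ S] [IsManifold 𝓘(ℂ, ℂ) ω S]
  {P : Punctures S}

lemma contMDiff_restrict (φ : P.Aut) : ContMDiff 𝓘(ℝ, ℂ) 𝓘(ℝ, ℂ) ∞ φ.restrict := by
  intro z
  have hz := mem_chart_source ℂ z
  have h1 : ContMDiffAt 𝓘(ℝ, ℂ) 𝓘(ℝ, ℂ) ∞ (φ.restrict ∘ (chartAt ℂ z).symm) (chartAt ℂ z z) :=
    ((holoAt_chartAt_symm z ((chartAt ℂ z).map_source hz)).restrict φ).contMDiffAt_real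
  have : IsManifold 𝓘(ℝ, ℂ) ∞ P.dot := isManifold_real_of_complex
  have h2 : ContMDiffAt 𝓘(ℝ, ℂ) 𝓘(ℝ, ℂ) ∞ (chartAt ℂ z) z :=
    (contMDiffOn_chart (I := 𝓘(ℝ, ℂ)) (n := ∞)).contMDiffAt ((chartAt ℂ z).open_source.mem_nhds hz)
  refine (ContMDiffAt.comp z h1 h2).congr_of_eventuallyEq ?_
  filter_upwards [(chartAt ℂ z).open_source.mem_nhds hz] with z' hz'
  simp only [Function.comp_apply, (chartAt ℂ z).left_inv hz']

/-- Potentials of reparametrized maps are reparametrized potentials, up to constants. -/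
lemma IsPotential.sub_comp_restrict [ConnectedSpace S] {t : ContactTriad E Q} {w w' : P.dot → Q}
    {f f' : P.dot → ℝ} (hw : ContMDiff 𝓘(ℝ, ℂ) 𝓘(ℝ, E) ∞ w) (hf : ContMDiff 𝓘(ℝ, ℂ) 𝓘(ℝ, ℝ) ∞ f)
    (hw' : ContMDiff 𝓘(ℝ, ℂ) 𝓘(ℝ, E) ∞ w') (hf' : ContMDiff 𝓘(ℝ, ℂ) 𝓘(ℝ, ℝ) ∞ f')
    (h : IsPotential t w f) (h' : IsPotential t w' f') (φ : P.Aut)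
    (hφ : ∀ z, w' z = w (φ.restrict z)) : ∃ k, ∀ z, f' z = f (φ.restrict z) - k := by
  have := preconnectedSpace_dot (P := P)
  obtain ⟨x₀⟩ := nonempty_dot P
  have hfφ : ContMDiff 𝓘(ℝ, ℂ) 𝓘(ℝ, ℝ) ∞ (f ∘ φ.restrict) := hf.comp (contMDiff_restrict φ)
  have key := eq_of_fderiv_chart_eq_zero (g := fun z => f (φ.restrict z) - f' z) (hfφ.sub hf')
    (fun κ y hκ => by
      have h1 : fderiv ℝ ((fun z => f (φ.restrict z) - f' z) ∘ κ) y =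
          fderiv ℝ (f ∘ (φ.restrict ∘ κ)) y - fderiv ℝ (f' ∘ κ) y :=
        fderiv_sub ((contDiffAt_comp_holo hf (hκ.restrict φ)).differentiableAt (by simp))
          ((contDiffAt_comp_holo hf' hκ).differentiableAt (by simp))
      have h2 : w' = w ∘ φ.restrict := funext hφ
      rw [h1, sub_eq_zero]
      ext v
      rw [h.fderiv_comp hw hf (hκ.restrict φ), h'.fderiv_comp hw' hf' hκ, h2]
      rfl)
  refine ⟨f (φ.restrict x₀) - f' x₀, fun z => ?_⟩
  linarith [key z x₀]

open Classical in
/-- The slopes at the punctures that are prescribed by the asymptotic orbits. -/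
def AsymptoticOrbits.slope {l : ContactForm E Q} (γ : AsymptoticOrbits l P) (p : S) : ℝ :=
  if h : p ∈ P.pos then (γ.pos ⟨p, h⟩).period else
    if h : p ∈ P.neg then -(γ.neg ⟨p, h⟩).period else 0

lemma AsymptoticOrbits.slope_ne_zero {l : ContactForm E Q} (γ : AsymptoticOrbits l P) {p : S}
    (hp : p ∉ P.dot) : γ.slope p ≠ 0 := by
  rw [slope]
  split_ifs with h1 h2
  · exact (γ.pos _).period_pos.ne'
  · exact neg_ne_zero.2 (γ.neg _).period_pos.ne'
  · exact (hp ⟨h1, h2⟩).elim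

lemma HasAsymptotics.hasSlope {t : ContactTriad E Q} {γ : AsymptoticOrbits t.toContactForm P}
    {w : P.dot → Q} (hw : ContMDiff 𝓘(ℝ, ℂ) 𝓘(ℝ, E) ∞ w) {f : P.dot → ℝ}
    (hf : ContMDiff 𝓘(ℝ, ℂ) 𝓘(ℝ, ℝ) ∞ f) (hwf : IsPotential t w f) (h : HasAsymptotics γ w) {p : S}
    (hp : p ∉ P.dot) : HasSlope f p (γ.slope p) := by
  rw [AsymptoticOrbits.slope]
  split_ifs with h1 h2
  · have := AsymptoticToOrbit.hasSlope hw hf hwf (Or.inl rfl) (h.1 ⟨p, h1⟩)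
    rwa [one_mul] at this
  · have := AsymptoticToOrbit.hasSlope hw hf hwf (Or.inr rfl) (h.2 ⟨p, h2⟩)
    rwa [neg_one_mul] at this
  · exact (hp ⟨h1, h2⟩).elim

end Components

/-! ### Centres and continuous choices of potentials -/

section Centers

open Set Filter

variable {E : Type*} [NormedAddCommGroup E] [NormedSpace ℝ E] [FiniteDimensional ℝ E]
  {Q : Type*} [TopologicalSpace Q] [T2Space Q] [ChartedSpace E Q] [IsManifold 𝓘(ℝ, E) ∞ Q]
  {ι : Type*} {S : ι → Type*} [∀ i, TopologicalSpace (S i)] [∀ i, T2Space (S i)]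
  [∀ i, CompactSpace (S i)] [∀ i, ConnectedSpace (S i)]
  [∀ i, ChartedSpace ℂ (S i)] [∀ i, IsManifold 𝓘(ℂ, ℂ) ω (S i)]
  {t : ContactTriad E Q} {P : ∀ i, Punctures (S i)}
  {γ : ∀ i, AsymptoticOrbits t.toContactForm (P i)} {N : Finset ι}

lemma CurveSpace.isPotential (u : CurveSpace t γ N) (i : ι) : IsPotential t (u.w i) (u.f i) :=
  (u.isPseudoholomorphic i).isPotential

lemma CurveSpace.isSloped (u : CurveSpace t γ N) (i : ι) : IsSloped (γ i).slope (u.f i) where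
  contMDiff := (u.f i).contMDiff
  subharm := (u.isPotential i).subharm (u.isPseudoholomorphic i).isContactCauchyRiemann
    (u.w i).contMDiff (u.f i).contMDiff
  hasSlope := fun _ hp => (u.asymptotics i).hasSlope (u.w i).contMDiff (u.f i).contMDiff
    (u.isPotential i) hp

lemma CurveSpace.continuous_w (i : ι) : Continuous fun u : CurveSpace t γ N => u.w i :=
  have h : Continuous fun u : CurveSpace t γ N => (u.w, u.f) := continuous_induced_dom
  (continuous_apply i).comp (continuous_fst.comp h)

lemma CurveSpace.continuous_f (i : ι) : Continuous fun u : CurveSpace t γ N => u.f i :=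
  have h : Continuous fun u : CurveSpace t γ N => (u.w, u.f) := continuous_induced_dom
  (continuous_apply i).comp (continuous_snd.comp h)

/-- A continuous normalization of the potential of a non-cylindrical component that is invariant
under reparametrizations. -/
lemma exists_center {i : ι} (hi : i ∈ N) : ∃ c : CurveSpace t γ N → ℝ, Continuous c ∧
    ∀ (u u' : CurveSpace t γ N) (φ : (P i).Aut) (s : ℝ),
      (∀ z, u'.f i z = u.f i (φ.restrict z) - s) → c u' = c u - s := by
  obtain ⟨x₀⟩ := nonempty_dot (P i)
  -- One harmonic potential makes all of them harmonic, since the prescribed slopes force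
  -- differences to be constant; then evaluation at a point serves. Otherwise the moment has a
  -- unique zero for every curve. The same choice is thus made for all curves, and no continuity
  -- across cases is needed.
  by_cases hH : ∃ u₀ : CurveSpace t γ N, Harm (u₀.f i)
  · obtain ⟨u₀, h0⟩ := hH
    refine ⟨fun u => u.f i x₀, continuous_eval (CurveSpace.continuous_f i) x₀, ?_⟩
    have hsub : ∀ u : CurveSpace t γ N, ∃ k, ∀ z, u.f i z = u₀.f i z + k := fun u =>
      ⟨u.f i x₀ - u₀.f i x₀, fun z => by
        have := (u.isSloped i).subharm.sub_harm_const (u.f i).contMDiff (u₀.f i).contMDiff h0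
          (u.isSloped i).hasSlope (u₀.isSloped i).hasSlope z x₀
        linarith⟩
    intro u u' φ s h
    obtain ⟨k, hk⟩ := hsub u
    obtain ⟨k', hk'⟩ := hsub u'
    have hu : Harm (u.f i) := Harm.of_sub_const (b := k) <| by
      have : (fun x => u.f i x - k) = u₀.f i := funext fun x => by rw [hk]; ring
      rwa [this]
    -- With `u.f i = u₀.f i + k` and `u'.f i = u₀.f i + k'`, the automorphism shifts `u.f i` by `k'
    -- - k + s`. This vanishes because the component is not cylindrical.
    have h1 := eq_zero_of_harm_symmetry (u.w i).contMDiff (u.f i).contMDiff (u.isPotential i)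
      (u.isPseudoholomorphic i).isContactCauchyRiemann hu
      (fun p hp => ⟨_, (γ i).slope_ne_zero hp, (u.isSloped i).hasSlope p hp⟩)
      ((u.mem_iff i).1 hi) φ (s := k' - k + s) fun z => by
        have h2 := h z
        rw [hk'] at h2
        linarith [hk z]
    change u'.f i x₀ = u.f i x₀ - s
    rw [hk, hk']
    linarith
  · push Not at hH
    obtain ⟨n, c, hc, hce⟩ := exists_decomposition (P i) x₀
    refine ⟨fun u => momentCenter c (u.f i),
      (isContFamily_of_continuous (CurveSpace.continuous_f i)).continuous_center
        (fun u => u.isSloped i) hc hce hH, fun u u' φ s h => ?_⟩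
    change momentCenter c (u'.f i) = momentCenter c (u.f i) - s
    rw [center_comp_restrict ((u.isSloped i).sub_const s) (u'.isSloped i) hc hce φ h,
      center_sub_const (u.isSloped i) hc hce (hH u)]

/-- Translations act continuously. -/
lemma CurveSpace.continuous_translate :
    Continuous fun q : (ι → ℝ) × CurveSpace t γ N => q.2.translate q.1 := by
  refine continuous_induced_rng.2 (Continuous.prodMk (continuous_pi fun i => ?_)
    (continuous_pi fun i => ?_))
  · have h : Continuous fun q : (ι → ℝ) × CurveSpace t γ N => q.2.w i :=
      (CurveSpace.continuous_w i).comp continuous_snd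
    exact h
  exact continuous_translateFun ((CurveSpace.continuous_f i).comp continuous_snd)
    ((continuous_apply i).comp continuous_fst)

/-- A contact instanton has a potential that is normalized at a point. -/
lemma InstantonSpace.exists_potential (w : InstantonSpace t γ N) (x : ∀ i, (P i).dot) :
    ∃ u : CurveSpace t γ N, u.w = w.w ∧ ∀ i, u.f i (x i) = 0 := by
  choose F hF hE using w.exact_energy_lt_top
  have hps : ∀ i, IsPseudoholomorphic t (w.w i) (F i) := fun i =>
    isPseudoholomorphic_of_potential (w.isContactCauchyRiemann i) (hF i)
  exact ⟨CurveSpace.translate (fun i => F i (x i)) ⟨w.w, F, hps, hE, w.asymptotics, w.mem_iff⟩, rfl,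
    fun i => sub_self _⟩

/-- Potentials are normalized to vanish at a base point of each component. This choice is continuous
but not invariant under automorphisms, which is why centres are needed afterwards. -/
lemma exists_continuous_lift : ∃ σ : InstantonSpace t γ N → CurveSpace t γ N, Continuous σ ∧
    ∀ w, (σ w).w = w.w := by
  let x : ∀ i, (P i).dot := fun i => (nonempty_dot (P i)).some
  choose σ hσ hσ0 using fun w : InstantonSpace t γ N => w.exists_potential x
  refine ⟨σ, continuous_induced_rng.2 ?_, hσ⟩
  have hw : Continuous fun w : InstantonSpace t γ N => w.w := continuous_induced_dom
  refine Continuous.prodMk (by simpa only [hσ] using hw) (continuous_pi fun i => ?_)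
  have := preconnectedSpace_dot (P := P i)
  refine continuous_potential (t := t) ((continuous_apply i).comp hw) (fun w => ?_) (x i) ?_
  · have := (σ w).isPotential i
    rwa [hσ] at this
  · simp only [hσ0]
    exact continuous_const

/-- A continuous choice of potentials whose non-cylindrical components have center zero. -/
lemma exists_centered_lift {c : ι → CurveSpace t γ N → ℝ} (hc : ∀ i ∈ N, Continuous (c i))
    (hcs : ∀ i ∈ N, ∀ (u u' : CurveSpace t γ N) (φ : (P i).Aut) (s : ℝ),
      (∀ z, u'.f i z = u.f i (φ.restrict z) - s) → c i u' = c i u - s) :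
    ∃ σ : InstantonSpace t γ N → CurveSpace t γ N, Continuous σ ∧ (∀ w, (σ w).w = w.w) ∧
      ∀ w, ∀ i ∈ N, c i (σ w) = 0 := by
  classical
  obtain ⟨σ, hσ, hσw⟩ := exists_continuous_lift (t := t) (γ := γ) (N := N)
  refine ⟨fun w => (σ w).translate fun i => if i ∈ N then c i (σ w) else 0,
    CurveSpace.continuous_translate.comp (Continuous.prodMk (continuous_pi fun i => ?_) hσ),
    hσw, fun w i hi => ?_⟩
  · by_cases hi : i ∈ N
    · exact ((hc i hi).comp hσ).congr fun w => (if_pos hi).symm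
    · exact continuous_const.congr fun w => (if_neg hi).symm
  · rw [hcs i hi (σ w) _ (.refl _) (c i (σ w)) fun z => ?_, sub_self]
    change (σ w).f i z - (if i ∈ N then c i (σ w) else 0) = _
    rw [if_pos hi]
    rfl

end Centers

/-! ### The principal bundle -/

section ZeroSum

variable {ι : Type*}

/-- Vectors with zero sum, as a kernel. -/
def zeroSumEquiv (N : Finset ι) :
    zeroSum N ≃ₗ[ℝ] LinearMap.ker (∑ j : N, LinearMap.proj (R := ℝ) (φ := fun _ : N => ℝ) j) := by
  classical
  refine
    { toFun := fun s => ⟨fun j => s.1 j, ?_⟩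
      map_add' := fun _ _ => rfl
      map_smul' := fun _ _ => rfl
      invFun := fun v => ⟨fun i => if h : i ∈ N then v.1 ⟨i, h⟩ else 0, fun i hi => dif_neg hi, ?_⟩
      left_inv := fun s => ?_
      right_inv := fun v => ?_ }
  · rw [LinearMap.mem_ker, LinearMap.sum_apply]
    exact (Finset.sum_coe_sort N s.1).trans s.2.2
  · have h := v.2
    rw [LinearMap.mem_ker, LinearMap.sum_apply] at h
    rw [← Finset.sum_coe_sort]
    refine (Finset.sum_congr rfl fun j _ => ?_).trans h
    exact dif_pos j.2
  · refine Subtype.ext (funext fun i => ?_)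
    by_cases hi : i ∈ N
    · exact dif_pos hi
    · exact (dif_neg hi).trans (s.2.1 i hi).symm
  · exact Subtype.ext (funext fun j => dif_pos j.2)

lemma finrank_zeroSum {N : Finset ι} (hN : N.Nonempty) :
    Module.finrank ℝ (zeroSum N) = N.card - 1 := by
  set L := ∑ j : N, LinearMap.proj (R := ℝ) (φ := fun _ : N => ℝ) j with hL
  have hsurj : Function.Surjective L := by
    classical
    obtain ⟨j, hj⟩ := hN
    intro r
    refine ⟨Pi.single ⟨j, hj⟩ r, ?_⟩
    simp [hL]
  have h1 := L.finrank_range_add_finrank_ker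
  rw [LinearMap.range_eq_top.2 hsurj, finrank_top, Module.finrank_self, Module.finrank_pi,
    Fintype.card_coe] at h1
  rw [(zeroSumEquiv N).finrank_eq, ← hL]
  omega

end ZeroSum

/-! ### The action on the moduli space and the global trivialization -/

section Bundle

variable {E : Type*} [NormedAddCommGroup E] [NormedSpace ℝ E] [FiniteDimensional ℝ E]
  {Q : Type*} [TopologicalSpace Q] [T2Space Q] [ChartedSpace E Q] [IsManifold 𝓘(ℝ, E) ∞ Q]
  {ι : Type*} {S : ι → Type*} [∀ i, TopologicalSpace (S i)] [∀ i, T2Space (S i)]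
  [∀ i, CompactSpace (S i)] [∀ i, ConnectedSpace (S i)]
  [∀ i, ChartedSpace ℂ (S i)] [∀ i, IsManifold 𝓘(ℂ, ℂ) ω (S i)]
  {t : ContactTriad E Q} {P : ∀ i, Punctures (S i)}
  {γ : ∀ i, AsymptoticOrbits t.toContactForm (P i)} {N : Finset ι}

/-- The group is locally compact, so its product with the quotient map is again a quotient map, and
continuity can be checked on parametrized curves. -/
lemma continuous_vadd_curveModuli [Finite ι] :
    Continuous fun q : zeroSum N × CurveModuli t γ N => q.1 +ᵥ q.2 := by
  have := Fintype.ofFinite ι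
  have : ProperSpace (zeroSum N) := FiniteDimensional.proper_real (zeroSum N)
  have hq : Topology.IsQuotientMap (Quotient.mk (curveSetoid t γ N)) := isQuotientMap_quot_mk
  refine hq.continuous_lift_prod_right (Y := zeroSum N)
    (g := fun q : zeroSum N × CurveModuli t γ N => q.1 +ᵥ q.2) ?_
  have h : Continuous fun q : zeroSum N × CurveSpace t γ N => q.2.translate q.1.1 :=
    CurveSpace.continuous_translate.comp
      ((continuous_subtype_val.comp continuous_fst).prodMk continuous_snd)
  exact hq.continuous.comp h

lemma forgetCurve_vadd (s : zeroSum N) (m : CurveModuli t γ N) :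
    forgetCurve t γ N (s +ᵥ m) = forgetCurve t γ N m := by
  induction m using Quotient.inductionOn'
  rfl

/-- Curves whose potentials agree with those of a reparametrization, up to a common constant on the
non-cylindrical components and up to constants on the others, are equivalent. -/
lemma curve_equiv_of_forall {u u' : CurveSpace t γ N} (φ : ∀ i, (P i).Aut)
    (hw : ∀ i z, u'.w i z = u.w i ((φ i).restrict z)) {k : ι → ℝ} {s₀ : ℝ}
    (hk : ∀ i z, u'.f i z = u.f i ((φ i).restrict z) - k i) (hN : ∀ i ∈ N, k i = s₀) :
    (curveSetoid t γ N).r u u' := by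
  have h : ∀ i, ∃ ψ : (P i).Aut, ∀ z, u'.w i z = u.w i (ψ.restrict z) ∧
      u'.f i z = u.f i (ψ.restrict z) - s₀ := by
    intro i
    by_cases hi : i ∈ N
    · exact ⟨φ i, fun z => ⟨hw i z, by rw [hk, hN i hi]⟩⟩
    · have htriv : IsTrivialCylinder t.toContactForm (u.w i) := by
        by_contra h
        exact hi ((u.mem_iff i).2 h)
      -- On a cylindrical component the discrepancy between the constant `k i` and the common one is
      -- absorbed by a translation of the cylinder.
      obtain ⟨ψ, hψ⟩ := htriv.exists_shift (u.w i).contMDiff (u.f i).contMDiff (u.isPotential i)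
        (s₀ - k i)
      refine ⟨(φ i).trans ψ, fun z => ?_⟩
      have h1 : ((φ i).trans ψ).restrict z = ψ.restrict ((φ i).restrict z) := rfl
      rw [h1, (hψ _).1, (hψ _).2, hw, hk]
      exact ⟨rfl, by ring⟩
  choose ψ hψ using h
  exact ⟨ψ, s₀, hψ⟩

lemma CurveSpace.exists_sub_comp_restrict {u u' : CurveSpace t γ N} (i : ι) (φ : (P i).Aut)
    (hw : ∀ z, u'.w i z = u.w i (φ.restrict z)) : ∃ k, ∀ z, u'.f i z = u.f i (φ.restrict z) - k :=
  (u.isPotential i).sub_comp_restrict (u.w i).contMDiff (u.f i).contMDiff (u'.w i).contMDiff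
    (u'.f i).contMDiff (u'.isPotential i) φ hw

/-- The components of the deviation of the centers from their mean. -/
def deviation (N : Finset ι) (c : ι → ℝ) : zeroSum N := by
  classical
  -- The sign makes the map equivariant: passing from `f` to `f - s` lowers the centre by `s`,
  -- leaves the mean unchanged because `s` has zero sum, and so adds `s` to the deviation.
  refine ⟨fun i => if i ∈ N then (∑ j ∈ N, c j) / N.card - c i else 0, fun i hi => if_neg hi, ?_⟩
  rcases N.eq_empty_or_nonempty with rfl | hN
  · simp
  have h0 : (N.card : ℝ) ≠ 0 := Nat.cast_ne_zero.2 hN.card_ne_zero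
  rw [Finset.sum_congr rfl fun i hi => if_pos hi, Finset.sum_sub_distrib, Finset.sum_const,
    nsmul_eq_mul, mul_div_cancel₀ _ h0, sub_self]

lemma deviation_apply {c : ι → ℝ} {i : ι} (hi : i ∈ N) :
    (deviation N c).1 i = (∑ j ∈ N, c j) / N.card - c i := if_pos hi

lemma zeroSum_ext {s s' : zeroSum N} (h : ∀ i ∈ N, s.1 i = s'.1 i) : s = s' := by
  refine Subtype.ext (funext fun i => ?_)
  by_cases hi : i ∈ N
  · exact h i hi
  · rw [s.2.1 i hi, s'.2.1 i hi]

lemma deviation_sub_const (hN : N.Nonempty) {c c' : ι → ℝ} {r : ℝ} (h : ∀ i ∈ N, c' i = c i - r) :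
    deviation N c' = deviation N c := by
  have h0 : (N.card : ℝ) ≠ 0 := Nat.cast_ne_zero.2 hN.card_ne_zero
  refine zeroSum_ext fun i hi => ?_
  rw [deviation_apply hi, deviation_apply hi, h i hi, Finset.sum_congr rfl h,
    Finset.sum_sub_distrib, Finset.sum_const, nsmul_eq_mul]
  field_simp
  ring

lemma deviation_sub {c c' : ι → ℝ} (s : zeroSum N) (h : ∀ i ∈ N, c' i = c i - s.1 i) :
    deviation N c' = s + deviation N c := by
  refine zeroSum_ext fun i hi => ?_
  change _ = s.1 i + (deviation N c).1 i
  rw [deviation_apply hi, deviation_apply hi, h i hi, Finset.sum_congr rfl h,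
    Finset.sum_sub_distrib, s.2.2]
  ring

lemma deviation_eq_zero {c : ι → ℝ} (h : ∀ i ∈ N, c i = 0) : deviation N c = 0 := by
  refine zeroSum_ext fun i hi => ?_
  rw [deviation_apply hi, h i hi, Finset.sum_congr rfl h]
  simp

lemma Continuous.deviation {Z : Type*} [TopologicalSpace Z] {c : ι → Z → ℝ}
    (hc : ∀ i ∈ N, Continuous (c i)) : Continuous fun z => deviation N fun i => c i z := by
  refine Continuous.subtype_mk (continuous_pi fun i => ?_) _
  by_cases hi : i ∈ N
  · exact (((continuous_finsetSum N hc).div_const _).sub (hc i hi)).congr fun z => (if_pos hi).symm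
  · exact continuous_const.congr fun z => (if_neg hi).symm

/-- The forgetful map is a trivial principal bundle. -/
lemma exists_equivariant_homeomorph (hN : N.Nonempty) [Finite ι] :
    ∃ e : CurveModuli t γ N ≃ₜ InstantonModuli t γ N × zeroSum N,
      (∀ m, (e m).1 = forgetCurve t γ N m) ∧ ∀ (s : zeroSum N) m, (e (s +ᵥ m)).2 = s + (e m).2 := by
  have hex : ∀ i, ∃ c : CurveSpace t γ N → ℝ, i ∈ N → Continuous c ∧
      ∀ (u u' : CurveSpace t γ N) (φ : (P i).Aut) (s : ℝ),
        (∀ z, u'.f i z = u.f i (φ.restrict z) - s) → c u' = c u - s := by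
    intro i
    by_cases hi : i ∈ N
    · obtain ⟨c, hc⟩ := exists_center (t := t) (γ := γ) hi
      exact ⟨c, fun _ => hc⟩
    · exact ⟨0, fun h => (hi h).elim⟩
  choose c hc using hex
  have hcc : ∀ i ∈ N, Continuous (c i) := fun i hi => (hc i hi).1
  have hcs := fun i hi => (hc i hi).2
  obtain ⟨σ, hσ, hσw, hσc⟩ := exists_centered_lift hcc hcs
  let hfun : CurveModuli t γ N → zeroSum N :=
    Quotient.lift (s := curveSetoid t γ N) (fun u => deviation N fun i => c i u) fun u u' h => by
      obtain ⟨φ, s, h⟩ := h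
      exact (deviation_sub_const hN fun i hi => hcs i hi u u' (φ i) s fun z => (h i z).2).symm
  have hhc : Continuous hfun := continuous_quot_lift _ (Continuous.deviation hcc)
  have hhv : ∀ (s : zeroSum N) m, hfun (s +ᵥ m) = s + hfun m := by
    intro s m
    induction m using Quotient.inductionOn' with | _ u
    exact deviation_sub (N := N) s fun i hi => hcs i hi u (u.translate s.1) (.refl _) (s.1 i)
      fun z => rfl
  -- A reparametrization of `w` changes the chosen potentials by constants. On non-cylindrical
  -- components both potentials have centre zero, so these constants vanish; on the others they are
  -- absorbed by automorphisms.
  let τ : InstantonModuli t γ N → CurveModuli t γ N :=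
    Quotient.lift (s := instantonSetoid t γ N) (fun w => Quotient.mk (curveSetoid t γ N) (σ w))
      fun w w' h => by
        obtain ⟨φ, h⟩ := h
        have hw : ∀ i z, (σ w').w i z = (σ w).w i ((φ i).restrict z) := fun i z => by
          rw [hσw, hσw, h]
        choose k hk using fun i => CurveSpace.exists_sub_comp_restrict i (φ i) (hw i)
        refine Quotient.sound (s := curveSetoid t γ N)
          (curve_equiv_of_forall φ hw (s₀ := 0) hk fun i hi => ?_)
        have := hcs i hi _ _ (φ i) (k i) (hk i)
        rw [hσc w' i hi, hσc w i hi] at this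
        linarith
  have hτ : Continuous τ := continuous_quot_lift _ (continuous_quot_mk.comp hσ)
  have hτf : ∀ b, forgetCurve t γ N (τ b) = b := by
    intro b
    induction b using Quotient.inductionOn' with | _ w
    exact congrArg (Quotient.mk (instantonSetoid t γ N)) (InstantonSpace.ext (hσw w))
  have hτh : ∀ b, hfun (τ b) = 0 := by
    intro b
    induction b using Quotient.inductionOn' with | _ w
    exact deviation_eq_zero (N := N) (hσc w)
  have hinv : ∀ m, hfun m +ᵥ τ (forgetCurve t γ N m) = m := by
    intro m
    induction m using Quotient.inductionOn' with | _ u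
    have hw : ∀ i z, u.w i z = (σ u.forget).w i ((Punctures.Aut.refl (P i)).restrict z) :=
      fun i z => by
        rw [hσw]
        rfl
    choose k hk using fun i => CurveSpace.exists_sub_comp_restrict i (.refl (P i)) (hw i)
    have hck : ∀ i ∈ N, c i u = -k i := fun i hi => by
      rw [hcs i hi _ _ _ (k i) (hk i), hσc _ i hi, zero_sub]
    -- The potential of `u` exceeds the centred one by its centre. After translating the centred
    -- curve by the deviation, only the mean of the centres remains, the same constant on all
    -- components of `N`.
    refine Quotient.sound (s := curveSetoid t γ N) (a := (σ u.forget).translate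
      (deviation N fun i => c i u).1) (curve_equiv_of_forall (fun i => .refl (P i)) hw
        (k := fun i => k i - (deviation N fun i => c i u).1 i)
        (s₀ := -((∑ j ∈ N, c j u) / N.card)) (fun i z => ?_) fun i hi => ?_)
    · rw [hk i z]
      change _ = (σ u.forget).f i _ - _ - _
      ring
    · rw [deviation_apply hi, hck i hi]
      ring
  have hfc : Continuous (forgetCurve t γ N) := by
    refine continuous_quot_lift _ (continuous_quot_mk.comp ?_)
    refine continuous_induced_rng.2 ?_
    have h : Continuous fun u : CurveSpace t γ N => (u.w, u.f) := continuous_induced_dom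
    exact continuous_fst.comp h
  refine ⟨⟨⟨fun m => (forgetCurve t γ N m, hfun m), fun q => q.2 +ᵥ τ q.1, hinv, fun q => ?_⟩,
    hfc.prodMk hhc, ?_⟩, fun _ => rfl, hhv⟩
  · refine Prod.ext ?_ ?_
    · change forgetCurve t γ N (q.2 +ᵥ τ q.1) = q.1
      rw [forgetCurve_vadd, hτf]
    · change hfun (q.2 +ᵥ τ q.1) = q.2
      rw [hhv, hτh, add_zero]
  · exact continuous_vadd_curveModuli.comp (continuous_snd.prodMk (hτ.comp continuous_fst))

end Bundle

end

theorem mainTheorem7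
    {E : Type*} [NormedAddCommGroup E] [NormedSpace ℝ E] [FiniteDimensional ℝ E]
    {Q : Type*} [TopologicalSpace Q] [T2Space Q] [SecondCountableTopology Q] [ChartedSpace E Q]
    [IsManifold 𝓘(ℝ, E) ∞ Q] (t : ContactTriad E Q)
    {ι : Type*} [Finite ι] {S : ι → Type*} [∀ i, TopologicalSpace (S i)] [∀ i, T2Space (S i)]
    [∀ i, CompactSpace (S i)] [∀ i, ConnectedSpace (S i)] [∀ i, ChartedSpace ℂ (S i)]
    [∀ i, IsManifold 𝓘(ℂ, ℂ) ω (S i)] (P : ∀ i, Punctures (S i))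
    (γ : ∀ i, AsymptoticOrbits t.toContactForm (P i))
    (N : Finset ι) (ℓ : ℕ) (hℓ : 1 ≤ ℓ) (hN : N.card = ℓ) :
    Module.finrank ℝ (zeroSum N) = ℓ - 1 ∧
      IsPrincipalBundle (zeroSum N) (forgetCurve t γ N) := by
  have hne : N.Nonempty := Finset.card_pos.1 (by omega)
  refine ⟨by rw [finrank_zeroSum hne, hN], continuous_vadd_curveModuli, forgetCurve_vadd,
    fun b => ?_⟩
  obtain ⟨e, he, hev⟩ := exists_equivariant_homeomorph (t := t) (γ := γ) hne
  refine ⟨{ e.toOpenPartialHomeomorph with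
    baseSet := Set.univ
    open_baseSet := isOpen_univ
    source_eq := rfl
    target_eq := Set.univ_prod_univ.symm
    proj_toFun := fun m _ => he m }, Set.mem_univ b, fun m _ s => hev s m⟩
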